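/- **Setting.** Let $K$ be a field of characteristic $0$, let $A=\bigoplus_{i\in\mathbb Z}A_i$ be an associative unital graded commutative $K$-algebra, and let $L=\bigoplus_i L_i$ and $Q=\bigoplus_i Q_i$ be graded $A$-modules. In formulas all elements and maps are homogeneous, and $\bar x$ denotes the degree of $x$. "Graded symmetric" always includes Koszul signs. $S_{p,q}$ is the set of $(p,q)$-unshuffles, i.e. permutations $\sigma$ of $\{1,\dots,p+q\}$ with $\sigma(1)<\dots<\sigma(p)$ and $\sigma(p+1)<\dots<\sigma(p+q)$ ($S_{p,q}$ is empty if $p<0$ or $q<0$). For $\boldsymbol\xi=(\xi_1,\dots,\xi_n)$ in $L$, $\alpha(\sigma,\boldsymbol\xi)$ is the sign with $\xi_{\sigma(1)}\cdots\xi_{\sigma(n)}=\alpha(\sigma,\boldsymbol\xi)\,\xi_1\cdots\xi_n$ in the graded symmetric algebra of $L$. **Forms and tensors.** $\mathrm{Sym}_A(L,A)=\bigoplus_n\mathrm{Sym}^n_A(L,A)$ is the space of graded symmetric, graded $A$-multilinear maps (finite sums of maps homogeneous in the degree and in the number $n$ of entries). It is a graded commutative algebra under $$(\omega\omega')(\xi_1,\dots,\xi_{p+q})=\sum_{\sigma\in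 S_{p,q}}(-1)^{\bar\omega'(\bar\xi_{\sigma(1)}+\cdots+\bar\xi_{\sigma(p)})}\alpha(\sigma,\boldsymbol\xi)\,\omega(\xi_{\sigma(1)},\dots,\xi_{\sigma(p)})\,\omega'(\xi_{\sigma(p+1)},\dots,\xi_{\sigma(p+q)}).$$ It acts on $S^\bullet_AL\otimes_AQ=\bigoplus_n S^n_AL\otimes_AQ$ (graded symmetric tensors) by operators $\omega\mapsto i_\omega$; for a $k$-form $\omega$, $$i_\omega(\xi_1\cdots\xi_n\otimes q)=\sum_{\sigma\in S_{n-k,k}}(-1)^{\bar\omega(\bar\xi_{\sigma(1)}+\cdots+\bar\xi_{\sigma(n-k)})}\alpha(\sigma,\boldsymbol\xi)\,\xi_{\sigma(1)}\cdots\xi_{\sigma(n-k)}\otimes\omega(\xi_{\sigma(n-k+1)},\dots,\xi_{\sigma(n)})\,q .$$ **Module derivations.** A derivation of degree $d$ of the $\mathrm{Sym}_A(L,A)$-module $S^\bullet_AL\otimes_AQ$ is a pair $(D,s)$: $s$ (the symbol) is a degree $d$ graded derivation of the algebra $\mathrm{Sym}_A(L,A)$, and $D$ is a degree $d$ $K$-linear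 operator on $S^\bullet_AL\otimes_AQ$ with $$D(i_\omega U)=i_{s(\omega)}U+(-1)^{d\bar\omega}i_\omega(DU).$$ It is homogeneous of weight $w\in\mathbb Z$ if $D$ maps $S^n_AL\otimes_AQ$ to $S^{n-w}_AL\otimes_AQ$ and $s$ maps $n$-forms to $(n+w)$-forms for all $n$ (spaces with a negative index being $0$). Let $\mathcal D_d$ be the space of finite sums of degree $d$ derivations that are homogeneous in weight, and $\mathcal D=\bigoplus_d\mathcal D_d$, with the componentwise graded commutator. **The space $\mathcal R(Q)$.** For $k\ge1$, a multiderivation $\mathbb X=(X,\sigma)$ of $L$ with $k$ entries and degree $\bar{\mathbb X}$ consists of * a graded symmetric $K$-multilinear map $X:L^k\to L$ of degree $\bar{\mathbb X}$; * a graded symmetric, graded $A$-multilinear map $\sigma$ of degree $\bar{\mathbb X}$ from $L^{k-1}$ to the graded derivations of $A$, such that $$X(\xi_1,\dots,\xi_{k-1},a\zeta)=\sigma(\xi_1,\dots,\xi_{k-1})(a)\,\zeta+(-1)^{\bar a(\bar{\mathbb X}+\bar\xi_1+\cdots+\bar\xi_{k-1})}a\,X(\xi_1,\dots,\xi_{k-1},\zeta).$$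 A multiderivation with $0$ entries is an element $X\in L$ (with no symbol). For $k\ge1$, $\mathcal R^k(Q)$ is the space of pairs $(\mathbb X,\Delta)$ where $\mathbb X=(X,\sigma)$ has $k$ entries and $\Delta$ is a graded symmetric map of degree $\bar{\mathbb X}$, with $k-1$ entries in $L$ and values in $\mathrm{End}_K(Q)$, such that $$\Delta(\xi_1,\dots,a\xi_i,\dots,\xi_{k-1})=(-1)^{\bar a(\bar\xi_i+\cdots+\bar\xi_{k-1})}\Delta(\xi_1,\dots,\xi_{k-1})\circ a,$$ $$\Delta(\xi_1,\dots,\xi_{k-1})(aq)=(-1)^{\bar a(\bar{\mathbb X}+\bar\xi_1+\cdots+\bar\xi_{k-1})}a\,\Delta(\xi_1,\dots,\xi_{k-1})(q)-\sigma(\xi_1,\dots,\xi_{k-1})(a)\,q .$$ In other words, $\Delta$ is an $A$-multilinear form with values in the right derivations $\mathrm{Der}^RQ$ and with symbol $-\sigma$. Put $\mathcal R^0(Q)=L$ and $\mathcal R(Q)=\bigoplus_k\mathcal R^k(Q)$. If $F$ has $m+1$ entries and $Y$ has $l$ entries, put $$(F\circ Y)(\xi_1,\dots,\xi_{l+m})=\sum_{\sigma\in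 S_{l,m}}\alpha(\sigma,\boldsymbol\xi)\,F\bigl(Y(\xi_{\sigma(1)},\dots,\xi_{\sigma(l)}),\xi_{\sigma(l+1)},\dots,\xi_{\sigma(l+m)}\bigr),$$ and $F\circ Y=0$ if $F$ has no entries. If $f,g$ are operator valued with $p$ and $q$ entries, put $$[f,g](\xi_1,\dots,\xi_{p+q})=\sum_{\sigma\in S_{p,q}}(-1)^{\bar g(\bar\xi_{\sigma(1)}+\cdots+\bar\xi_{\sigma(p)})}\alpha(\sigma,\boldsymbol\xi)\,\bigl[f(\xi_{\sigma(1)},\dots,\xi_{\sigma(p)}),g(\xi_{\sigma(p+1)},\dots,\xi_{\sigma(p+q)})\bigr]$$ with the graded commutator on the right. The bracket on $\mathcal R(Q)$ is $$[((X,\sigma),\Delta),((X',\sigma'),\Delta')]=((X'',\sigma''),\Delta''),$$ where, with $\epsilon=(-1)^{\bar{\mathbb X}\bar{\mathbb X}'}$, $$X''=X\circ X'-\epsilon X'\circ X,\quad \sigma''=\sigma\circ X'-\epsilon\sigma'\circ X+[\sigma,\sigma'],\quad \Delta''=\Delta\circ X'-\epsilon\Delta'\circ X-[\Delta,\Delta'].$$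 For a multiderivation $\mathbb X=(X,\sigma)$ and an $\ell$-form $\omega$ put $\eta(\mathbb X)\omega=\sigma\circ\omega-(-1)^{\bar{\mathbb X}\bar\omega}\omega\circ X$. Here, if $\mathbb X$ has $k\ge1$ entries, $$(\sigma\circ\omega)(\xi_1,\dots,\xi_{k+\ell-1})=\sum_{\tau\in S_{k-1,\ell}}(-1)^{\bar\omega(\bar\xi_{\tau(1)}+\cdots+\bar\xi_{\tau(k-1)})}\alpha(\tau,\boldsymbol\xi)\,\sigma(\xi_{\tau(1)},\dots,\xi_{\tau(k-1)})\bigl(\omega(\xi_{\tau(k)},\dots,\xi_{\tau(k+\ell-1)})\bigr),$$ and $\sigma\circ\omega=0$ if $k=0$. Extend $\eta$ linearly to sums. **Proposition.** $\mathcal R(Q)$ and $\mathcal D$, with the brackets above, are graded Lie algebras over $K$. For $(\mathbb X,\Delta)\in\mathcal R^k(Q)$, the formula $$\begin{aligned}D(\xi_1\cdots\xi_\ell\otimes q)={}&\sum_{\tau\in S_{k,\ell-k}}\alpha(\tau,\boldsymbol\xi)\,X(\xi_{\tau(1)},\dots,\xi_{\tau(k)})\,\xi_{\tau(k+1)}\cdots\xi_{\tau(\ell)}\otimes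 q\\&-\sum_{\tau\in S_{\ell-k+1,k-1}}(-1)^{\bar{\mathbb X}(\bar\xi_{\tau(1)}+\cdots+\bar\xi_{\tau(\ell-k+1)})}\alpha(\tau,\boldsymbol\xi)\,\xi_{\tau(1)}\cdots\xi_{\tau(\ell-k+1)}\otimes\Delta(\xi_{\tau(\ell-k+2)},\dots,\xi_{\tau(\ell)})(q)\end{aligned}$$ (without the second sum if $k=0$) gives a well defined operator on $S^\bullet_AL\otimes_AQ$, and $$\eta^R(\mathbb X,\Delta):=(D,\eta(\mathbb X))$$ defines, extending linearly over sums, a degree preserving morphism of graded Lie algebras $\eta^R:\mathcal R(Q)\to\mathcal D$. In particular the symbol of $\eta^R(\mathbb X,\Delta)$ is $\eta(\mathbb X)$. For $(\mathbb X,\Delta)\in\mathcal R^k(Q)$, $\eta^R(\mathbb X,\Delta)$ has weight $k-1$; in particular it takes $S^\ell_AL\otimes_AQ$ to $S^{\ell-k+1}_AL\otimes_AQ$. If $L$ is projective and finitely generated over $A$, then $\eta^R$ is an isomorphism. -/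

import Mathlib

noncomputable section

namespace RightRep

open scoped DirectSum TensorProduct

/-! ### Signs, gradings, unshuffles -/

/-- The sign `(-1)^n`, as an element of the ground field. -/
def sg (K : Type*) [Field K] (n : ℤ) : K := if Even n then 1 else -1

/-- Graded commutativity: `a b = (-1)^{|a||b|} b a` for homogeneous `a`, `b`. -/
class IsGradedComm {K A : Type*} [Field K] [Ring A] [Algebra K A] (𝒜 : ℤ → Submodule K A) :
    Prop where
  comm : ∀ i j : ℤ, ∀ a ∈ 𝒜 i, ∀ b ∈ 𝒜 j, a * b = sg K (i * j) • (b * a)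

section Signs

variable {K : Type*} [Field K]

theorem sg_add (m n : ℤ) : sg K (m + n) = sg K m * sg K n := by
  unfold sg
  by_cases hm : Even m <;> by_cases hn : Even n <;> simp [hm, hn, Int.even_add]

theorem sg_congr {m n : ℤ} (h : Even (m - n)) : sg K m = sg K n := by
  unfold sg
  have : Even m ↔ Even n := by
    rw [Int.even_sub] at h; exact h
  simp [this]

end Signs

section Multilinear

variable {K L : Type*} [Field K] [AddCommGroup L] [Module K L]

/-- The tuple `ξ` consists of homogeneous elements, `ξ i` being of degree `e i`. -/
def IsHom (ℒ : ℤ → Submodule K L) {n : ℕ} (e : Fin n → ℤ) (ξ : Fin n → L) : Prop :=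
  ∀ i, ξ i ∈ ℒ (e i)

/-- Projection of `L` onto its even part (`r = 0`) or its odd part (`r = 1`). -/
def parityProj (ℒ : ℤ → Submodule K L) [DirectSum.Decomposition ℒ] (r : Fin 2) : L →ₗ[K] L :=
  (DirectSum.toModule K ℤ L fun i => if i % 2 = (r : ℕ) then (ℒ i).subtype else 0) ∘ₗ
    (DirectSum.decomposeLinearEquiv ℒ).toLinearMap

theorem parityProj_apply (ℒ : ℤ → Submodule K L) [DirectSum.Decomposition ℒ] (r : Fin 2) {i : ℤ}
    {x : L} (hx : x ∈ ℒ i) : parityProj ℒ r x = if i % 2 = (r : ℕ) then x else 0 := by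
  lift x to ℒ i using hx
  simp only [parityProj, LinearMap.comp_apply, LinearEquiv.coe_coe,
    DirectSum.decomposeLinearEquiv_apply_coe, DirectSum.toModule_lof]
  split_ifs <;> simp

/-- The `(p,q)`-unshuffles of `{1, …, N}` (there are none unless `p + q = N`). The first block is
the image of `Sum.inl`, the second one is the image of `Sum.inr`. -/
def unshuffles (p q N : ℕ) : Finset (Fin p ⊕ Fin q ≃ Fin N) := by
  classical
  exact Finset.univ.filter fun σ =>
    StrictMono (fun i => σ (Sum.inl i)) ∧ StrictMono (fun j => σ (Sum.inr j))

/-- The exponent of the Koszul sign `α(σ, ξ)` of an unshuffle, the entries of `ξ` having degrees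
`e`: the sum of the products of the degrees of all pairs of entries whose order is reversed. -/
def koszul {p q N : ℕ} (σ : Fin p ⊕ Fin q ≃ Fin N) (e : Fin N → ℤ) : ℤ :=
  ∑ i : Fin p, ∑ j : Fin q,
    if σ (Sum.inr j) < σ (Sum.inl i) then e (σ (Sum.inl i)) * e (σ (Sum.inr j)) else 0

variable {W : Type*} [AddCommGroup W] [Module K W]

/-- The `K`-multilinear map whose value at homogeneous `ξ₁, …, ξ_N` is
`∑_{σ ∈ S_{p,q}} α(σ, ξ) h(ξ_{σ(1)}, …, ξ_{σ(p)}, ξ_{σ(p+1)}, …, ξ_{σ(N)})`.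
The map `h` is allowed to depend on the parities `u` of `|ξ_{σ(1)}| + ⋯ + |ξ_{σ(p)}|` and `v` of
`|ξ_{σ(p+1)}| + ⋯ + |ξ_{σ(N)}|`. Arbitrary entries are decomposed into even and odd parts. -/
def shuffle (ℒ : ℤ → Submodule K L) [DirectSum.Decomposition ℒ] {p q : ℕ}
    (h : ℤ → ℤ → MultilinearMap K (fun _ : Fin p ⊕ Fin q => L) W) (N : ℕ) :
    MultilinearMap K (fun _ : Fin N => L) W :=
  ∑ ε : Fin N → Fin 2, ∑ σ ∈ unshuffles p q N,
    sg K (koszul σ fun i => ((ε i : ℕ) : ℤ)) •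
      ((h (∑ i, ((ε (σ (Sum.inl i)) : ℕ) : ℤ)) (∑ j, ((ε (σ (Sum.inr j)) : ℕ) : ℤ))).domDomCongr
        σ).compLinearMap fun i => parityProj ℒ (ε i)

theorem even_sum_sub {ι : Type*} (s : Finset ι) (f g : ι → ℤ) (h : ∀ i ∈ s, Even (f i - g i)) :
    Even (∑ i ∈ s, f i - ∑ i ∈ s, g i) := by
  rw [← Finset.sum_sub_distrib]
  exact even_iff_two_dvd.2 (Finset.dvd_sum fun i hi => even_iff_two_dvd.1 (h i hi))

theorem even_mul_sub {a b c d : ℤ} (h : Even (a - c)) (h' : Even (b - d)) :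
    Even (a * b - c * d) := by
  have : a * b - c * d = (a - c) * b + c * (b - d) := by ring
  rw [this]
  exact (h.mul_right b).add (h'.mul_left c)

theorem even_koszul_sub {p q N : ℕ} (σ : Fin p ⊕ Fin q ≃ Fin N) {e e' : Fin N → ℤ}
    (h : ∀ i, Even (e i - e' i)) : Even (koszul σ e - koszul σ e') := by
  refine even_sum_sub _ _ _ fun i _ => even_sum_sub _ _ _ fun j _ => ?_
  split_ifs
  · exact even_mul_sub (h _) (h _)
  · simp

/-- `shuffle` is given by the expected formula on homogeneous elements. -/
theorem shuffle_apply (ℒ : ℤ → Submodule K L) [DirectSum.Decomposition ℒ] {p q : ℕ}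
    (h : ℤ → ℤ → MultilinearMap K (fun _ : Fin p ⊕ Fin q => L) W)
    (hh : ∀ u v u' v', Even (u - u') → Even (v - v') → h u v = h u' v') {N : ℕ}
    {e : Fin N → ℤ} {ξ : Fin N → L} (hξ : IsHom ℒ e ξ) :
    shuffle ℒ h N ξ = ∑ σ ∈ unshuffles p q N, sg K (koszul σ e) •
      h (∑ i, e (σ (Sum.inl i))) (∑ j, e (σ (Sum.inr j))) (fun s => ξ (σ s)) := by
  classical
  let ε₀ : Fin N → Fin 2 := fun i =>
    ⟨(e i % 2).toNat, by have := Int.emod_lt_of_pos (e i) (b := 2) (by norm_num); omega⟩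
  have hε₀ : ∀ i, e i % 2 = ((ε₀ i : ℕ) : ℤ) := fun i => by
    have := Int.emod_nonneg (e i) (b := 2) (by norm_num)
    simp [ε₀, this]
  have hev : ∀ i, Even (((ε₀ i : ℕ) : ℤ) - e i) := fun i => by
    rw [← hε₀, Int.even_iff]; omega
  simp only [shuffle, sum_apply, smul_apply,
    MultilinearMap.compLinearMap_apply, MultilinearMap.domDomCongr_apply]
  rw [Finset.sum_eq_single ε₀]
  · refine Finset.sum_congr rfl fun σ _ => ?_
    rw [sg_congr (even_koszul_sub σ hev), hh _ _ _ _ (even_sum_sub _ _ _ fun i _ => hev _)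
      (even_sum_sub _ _ _ fun i _ => hev _)]
    congr 2
    funext s
    rw [parityProj_apply ℒ _ (hξ _), if_pos (hε₀ _)]
  · intro ε _ hε
    obtain ⟨i, hi⟩ : ∃ i, ε i ≠ ε₀ i := by
      by_contra! hc
      exact hε (funext hc)
    refine Finset.sum_eq_zero fun σ _ => ?_
    rw [MultilinearMap.map_coord_zero _ (σ.symm i), smul_zero]
    rw [Equiv.apply_symm_apply, parityProj_apply ℒ _ (hξ _), if_neg]
    rw [hε₀]
    intro hc
    exact hi (Fin.ext (by exact_mod_cast hc.symm))
  · simp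

/-- The insertion `∑_{σ ∈ S_{l,n}} α(σ, ξ) F(Y(ξ_{σ(1)}, …, ξ_{σ(l)}), ξ_{σ(l+1)}, …, ξ_{σ(N)})`. -/
def insertion (ℒ : ℤ → Submodule K L) [DirectSum.Decomposition ℒ] {l n : ℕ}
    (F : MultilinearMap K (fun _ : Fin (n + 1) => L) W)
    (Y : MultilinearMap K (fun _ : Fin l => L) L) (N : ℕ) :
    MultilinearMap K (fun _ : Fin N => L) W :=
  shuffle ℒ (fun _ _ => MultilinearMap.uncurrySum (F.curryLeft.compMultilinearMap Y)) N

variable {U V : Type*} [AddCommGroup U] [Module K U] [AddCommGroup V] [Module K V]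

/-- The product
`∑_{σ ∈ S_{p,q}} α(σ, ξ) (-1)^χ B(f(ξ_{σ(1)}, …, ξ_{σ(p)}), g(ξ_{σ(p+1)}, …, ξ_{σ(N)}))`
with `χ = c (|ξ_{σ(1)}| + ⋯ + |ξ_{σ(p)}|)`, where `B` is a bilinear map and `c` is the degree
of `g`. -/
def star (ℒ : ℤ → Submodule K L) [DirectSum.Decomposition ℒ] (c : ℤ) (B : U →ₗ[K] V →ₗ[K] W)
    {p q : ℕ} (f : MultilinearMap K (fun _ : Fin p => L) U)
    (g : MultilinearMap K (fun _ : Fin q => L) V) (N : ℕ) :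
    MultilinearMap K (fun _ : Fin N => L) W :=
  shuffle ℒ (fun u _ => sg K (c * u) • (TensorProduct.lift B).compMultilinearMap (f.domCoprod g)) N

theorem star_apply (ℒ : ℤ → Submodule K L) [DirectSum.Decomposition ℒ] (c : ℤ)
    (B : U →ₗ[K] V →ₗ[K] W) {p q : ℕ} (f : MultilinearMap K (fun _ : Fin p => L) U)
    (g : MultilinearMap K (fun _ : Fin q => L) V) {N : ℕ}
    {e : Fin N → ℤ} {ξ : Fin N → L} (hξ : IsHom ℒ e ξ) :
    star ℒ c B f g N ξ = ∑ σ ∈ unshuffles p q N,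
      sg K (koszul σ e + c * ∑ i, e (σ (Sum.inl i))) •
        B (f fun i => ξ (σ (Sum.inl i))) (g fun j => ξ (σ (Sum.inr j))) := by
  rw [star, shuffle_apply ℒ _ _ hξ]
  · refine Finset.sum_congr rfl fun σ _ => ?_
    simp [sg_add, mul_smul]
  · intro u v u' v' hu _
    rw [sg_congr (even_mul_sub (a := c) (c := c) (by simp) hu)]

/-- Graded symmetry: exchanging two adjacent homogeneous arguments produces the Koszul sign. -/
def GrSymm (ℒ : ℤ → Submodule K L) {n : ℕ} (F : MultilinearMap K (fun _ : Fin n => L) W) : Prop :=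
  ∀ (e : Fin n → ℤ) (ξ : Fin n → L), IsHom ℒ e ξ → ∀ i j : Fin n, (j : ℕ) = i + 1 →
    F (ξ ∘ Equiv.swap i j) = sg K (e i * e j) • F ξ

theorem swap_lt {N : ℕ} {i j x y : Fin N} (hij : (j : ℕ) = i + 1) (_ : x ≠ y)
    (h : ¬ (x = i ∧ y = j)) (h' : ¬ (x = j ∧ y = i)) :
    Equiv.swap i j x < Equiv.swap i j y ↔ x < y := by
  simp only [Equiv.swap_apply_def, Fin.ext_iff, Fin.lt_def] at *
  split_ifs <;> simp_all <;> omega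

theorem koszul_swap_left {p q N : ℕ} {σ : Fin p ⊕ Fin q ≃ Fin N} {i j : Fin N}
    (hij : (j : ℕ) = i + 1) {a a' : Fin p} (ha : σ (Sum.inl a) = i) (ha' : σ (Sum.inl a') = j)
    (e : Fin N → ℤ) : koszul σ (e ∘ Equiv.swap i j) = koszul σ e := by
  have hinj : Function.Injective fun x => σ (Sum.inl x) := σ.injective.comp Sum.inl_injective
  have hs : ∀ x, Equiv.swap i j (σ (Sum.inl x)) = σ (Sum.inl (Equiv.swap a a' x)) := fun x => by
    rw [← ha, ← ha']; exact (hinj.map_swap a a' x).symm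
  have hr : ∀ y, Equiv.swap i j (σ (Sum.inr y)) = σ (Sum.inr y) := fun y => by
    apply Equiv.swap_apply_of_ne_of_ne
    · rw [← ha]; simp
    · rw [← ha']; simp
  unfold koszul
  rw [← Equiv.sum_comp (Equiv.swap a a')
    (fun x => ∑ y, if σ (Sum.inr y) < σ (Sum.inl x) then e (σ (Sum.inl x)) * e (σ (Sum.inr y)) else 0)]
  refine Finset.sum_congr rfl fun x _ => Finset.sum_congr rfl fun y _ => ?_
  have : σ (Sum.inr y) < σ (Sum.inl (Equiv.swap a a' x)) ↔ σ (Sum.inr y) < σ (Sum.inl x) := by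
    rw [← hs, ← hr y]
    nth_rewrite 2 [hr y]
    apply swap_lt hij
    · simp
    · rintro ⟨h, -⟩; rw [← ha] at h; simp at h
    · rintro ⟨h, -⟩; rw [← ha'] at h; simp at h
  simp only [Function.comp_apply, hs, hr, this]

theorem koszul_swap_right {p q N : ℕ} {σ : Fin p ⊕ Fin q ≃ Fin N} {i j : Fin N}
    (hij : (j : ℕ) = i + 1) {b b' : Fin q} (hb : σ (Sum.inr b) = i) (hb' : σ (Sum.inr b') = j)
    (e : Fin N → ℤ) : koszul σ (e ∘ Equiv.swap i j) = koszul σ e := by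
  have hinj : Function.Injective fun x => σ (Sum.inr x) := σ.injective.comp Sum.inr_injective
  have hs : ∀ x, Equiv.swap i j (σ (Sum.inr x)) = σ (Sum.inr (Equiv.swap b b' x)) := fun x => by
    rw [← hb, ← hb']; exact (hinj.map_swap b b' x).symm
  have hr : ∀ y, Equiv.swap i j (σ (Sum.inl y)) = σ (Sum.inl y) := fun y => by
    apply Equiv.swap_apply_of_ne_of_ne
    · rw [← hb]; simp
    · rw [← hb']; simp
  unfold koszul
  refine Finset.sum_congr rfl fun y _ => ?_
  rw [← Equiv.sum_comp (Equiv.swap b b')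
    (fun x => if σ (Sum.inr x) < σ (Sum.inl y) then e (σ (Sum.inl y)) * e (σ (Sum.inr x)) else 0)]
  refine Finset.sum_congr rfl fun x _ => ?_
  have : σ (Sum.inr (Equiv.swap b b' x)) < σ (Sum.inl y) ↔ σ (Sum.inr x) < σ (Sum.inl y) := by
    rw [← hs, ← hr y]
    nth_rewrite 2 [hr y]
    apply swap_lt hij
    · simp
    · rintro ⟨-, h⟩; rw [← hb'] at h; simp at h
    · rintro ⟨-, h⟩; rw [← hb] at h; simp at h
  simp only [Function.comp_apply, hs, hr, this]

theorem koszul_trans_swap {p q N : ℕ} {σ : Fin p ⊕ Fin q ≃ Fin N} {i j : Fin N}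
    (hij : (j : ℕ) = i + 1) {a : Fin p} {b : Fin q}
    (h : σ (Sum.inl a) = i ∧ σ (Sum.inr b) = j ∨ σ (Sum.inl a) = j ∧ σ (Sum.inr b) = i)
    (e : Fin N → ℤ) :
    Even (koszul σ (e ∘ Equiv.swap i j) - (e i * e j + koszul (σ.trans (Equiv.swap i j)) e)) := by
  have hlt : i < j := by rw [Fin.lt_def]; omega
  have key : ∀ x y, Even
      ((if σ (Sum.inr y) < σ (Sum.inl x) then
          (e ∘ Equiv.swap i j) (σ (Sum.inl x)) * (e ∘ Equiv.swap i j) (σ (Sum.inr y)) else 0) -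
        ((if x = a then if y = b then e i * e j else 0 else 0) +
        (if (σ.trans (Equiv.swap i j)) (Sum.inr y) < (σ.trans (Equiv.swap i j)) (Sum.inl x) then
          e ((σ.trans (Equiv.swap i j)) (Sum.inl x)) * e ((σ.trans (Equiv.swap i j)) (Sum.inr y))
          else 0))) := by
    intro x y
    by_cases hxy : x = a ∧ y = b
    · obtain ⟨rfl, rfl⟩ := hxy
      rcases h with ⟨h1, h2⟩ | ⟨h1, h2⟩
      · simp only [h1, h2, Equiv.trans_apply, Function.comp_apply, Equiv.swap_apply_left,
          Equiv.swap_apply_right, hlt, hlt.not_gt, if_true, if_false]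
        exact ⟨-(e i * e j), by ring⟩
      · simp only [h1, h2, Equiv.trans_apply, Function.comp_apply, Equiv.swap_apply_left,
          Equiv.swap_apply_right, hlt, hlt.not_gt, if_true, if_false]
        exact ⟨0, by ring⟩
    · have h0 : (if x = a then if y = b then e i * e j else 0 else 0) = 0 := by
        split_ifs <;> simp_all
      have hc : Equiv.swap i j (σ (Sum.inr y)) < Equiv.swap i j (σ (Sum.inl x)) ↔
          σ (Sum.inr y) < σ (Sum.inl x) := by
        apply swap_lt hij
        · simp
        · rintro ⟨h1, h2⟩
          rcases h with ⟨h3, h4⟩ | ⟨h3, h4⟩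
          · have := σ.injective (h1.trans h3.symm); simp at this
          · have h5 := σ.injective (h1.trans h4.symm)
            have h6 := σ.injective (h2.trans h3.symm)
            simp at h5 h6
            exact hxy ⟨h6, h5⟩
        · rintro ⟨h1, h2⟩
          rcases h with ⟨h3, h4⟩ | ⟨h3, h4⟩
          · have h5 := σ.injective (h1.trans h4.symm)
            have h6 := σ.injective (h2.trans h3.symm)
            simp at h5 h6
            exact hxy ⟨h6, h5⟩
          · have := σ.injective (h1.trans h3.symm); simp at this
      rw [h0]
      simp [hc]
  have hs : e i * e j = ∑ x : Fin p, ∑ y : Fin q,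
      (if x = a then if y = b then e i * e j else 0 else 0) := by
    rw [Finset.sum_eq_single a (by intro x _ hx; simp [hx]) (by simp)]
    simp
  rw [hs]
  unfold koszul
  rw [← Finset.sum_add_distrib]
  simp only [← Finset.sum_add_distrib]
  exact even_sum_sub _ _ _ fun x _ => even_sum_sub _ _ _ fun y _ => key x y

theorem succ_of_strictMono {p N : ℕ} {f : Fin p → Fin N} (hf : StrictMono f) {i j : Fin N}
    (hij : (j : ℕ) = i + 1) {a a' : Fin p} (ha : f a = i) (ha' : f a' = j) :
    (a' : ℕ) = a + 1 := by
  have h1 : a < a' := hf.lt_iff_lt.1 (by rw [ha, ha', Fin.lt_def]; omega)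
  rw [Fin.lt_def] at h1
  by_contra hne
  have h2 : (a : ℕ) + 1 < a' := by omega
  have h3 := hf (a := a) (b := ⟨a + 1, by omega⟩) (by rw [Fin.lt_def]; simp)
  have h4 := hf (a := ⟨a + 1, by omega⟩) (b := a') (by rw [Fin.lt_def]; exact h2)
  rw [ha, Fin.lt_def] at h3
  rw [ha', Fin.lt_def] at h4
  omega

theorem trans_swap_mem_unshuffles {p q N : ℕ} {σ : Fin p ⊕ Fin q ≃ Fin N}
    (hσ : σ ∈ unshuffles p q N) {i j : Fin N} (hij : (j : ℕ) = i + 1) {a : Fin p} {b : Fin q}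
    (h : σ (Sum.inl a) = i ∧ σ (Sum.inr b) = j ∨ σ (Sum.inl a) = j ∧ σ (Sum.inr b) = i) :
    σ.trans (Equiv.swap i j) ∈ unshuffles p q N := by
  simp only [unshuffles, Finset.mem_filter, Finset.mem_univ, true_and] at hσ ⊢
  have aux : ∀ x y : Fin p ⊕ Fin q, σ x = i → σ y = j → ¬ (x.isLeft = y.isLeft) := by
    intro x y hx hy hxy
    rcases h with ⟨h3, h4⟩ | ⟨h3, h4⟩
    · have h5 := σ.injective (hx.trans h3.symm)
      have h6 := σ.injective (hy.trans h4.symm)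
      simp [h5, h6] at hxy
    · have h5 := σ.injective (hx.trans h4.symm)
      have h6 := σ.injective (hy.trans h3.symm)
      simp [h5, h6] at hxy
  constructor
  · intro x y hxy
    refine (swap_lt hij (hσ.1 hxy).ne ?_ ?_).2 (hσ.1 hxy)
    · rintro ⟨h1, h2⟩; exact aux _ _ h1 h2 rfl
    · rintro ⟨h1, h2⟩; exact aux _ _ h2 h1 rfl
  · intro x y hxy
    refine (swap_lt hij (hσ.2 hxy).ne ?_ ?_).2 (hσ.2 hxy)
    · rintro ⟨h1, h2⟩; exact aux _ _ h1 h2 rfl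
    · rintro ⟨h1, h2⟩; exact aux _ _ h2 h1 rfl

/-- The product of graded symmetric maps is graded symmetric. -/
theorem star_grSymm (ℒ : ℤ → Submodule K L) [DirectSum.Decomposition ℒ] (c : ℤ)
    (B : U →ₗ[K] V →ₗ[K] W) {p q : ℕ} {f : MultilinearMap K (fun _ : Fin p => L) U}
    {g : MultilinearMap K (fun _ : Fin q => L) V} (hf : GrSymm ℒ f) (hg : GrSymm ℒ g) (N : ℕ) :
    GrSymm ℒ (star ℒ c B f g N) := by
  intro e ξ hξ i j hij
  have hξ' : IsHom ℒ (e ∘ Equiv.swap i j) (ξ ∘ Equiv.swap i j) := fun k => hξ _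
  rw [star_apply ℒ c B f g hξ, star_apply ℒ c B f g hξ', Finset.smul_sum]
  let φ : (Fin p ⊕ Fin q ≃ Fin N) → (Fin p ⊕ Fin q ≃ Fin N) := fun σ =>
    if (σ.symm i).isLeft = (σ.symm j).isLeft then σ else σ.trans (Equiv.swap i j)
  have hφφ : ∀ σ, φ (φ σ) = σ := by
    intro σ
    by_cases h : (σ.symm i).isLeft = (σ.symm j).isLeft
    · simp [φ, h]
    · have h' : ¬ (σ.symm j).isLeft = (σ.symm i).isLeft := fun h1 => h h1.symm
      ext x
      simp [φ, h, h']
  have cases : ∀ σ : Fin p ⊕ Fin q ≃ Fin N, ¬ (σ.symm i).isLeft = (σ.symm j).isLeft →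
      ∃ a b, (σ (Sum.inl a) = i ∧ σ (Sum.inr b) = j ∨ σ (Sum.inl a) = j ∧ σ (Sum.inr b) = i) := by
    intro σ h
    rcases hi : σ.symm i with a | a <;> rcases hj : σ.symm j with b | b
    · simp [hi, hj] at h
    · exact ⟨a, b, Or.inl ⟨by rw [← hi]; simp, by rw [← hj]; simp⟩⟩
    · exact ⟨b, a, Or.inr ⟨by rw [← hj]; simp, by rw [← hi]; simp⟩⟩
    · simp [hi, hj] at h
  have hφ : ∀ σ ∈ unshuffles p q N, φ σ ∈ unshuffles p q N := by
    intro σ hσ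
    by_cases h : (σ.symm i).isLeft = (σ.symm j).isLeft
    · simpa [φ, h] using hσ
    · obtain ⟨a, b, hab⟩ := cases σ h
      simp only [φ, h, if_false]
      exact trans_swap_mem_unshuffles hσ hij hab
  refine Finset.sum_nbij' φ φ hφ hφ (fun σ _ => hφφ σ) (fun σ _ => hφφ σ) fun σ hσ => ?_
  by_cases h : (σ.symm i).isLeft = (σ.symm j).isLeft
  · have hφσ : φ σ = σ := by simp [φ, h]
    rw [hφσ]
    have hσ' := hσ
    simp only [unshuffles, Finset.mem_filter, Finset.mem_univ, true_and] at hσ'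
    rcases hi : σ.symm i with a | a <;> rcases hj : σ.symm j with b | b
    · have ha : σ (Sum.inl a) = i := by rw [← hi]; simp
      have hb : σ (Sum.inl b) = j := by rw [← hj]; simp
      have hab := succ_of_strictMono hσ'.1 hij ha hb
      have hinj : Function.Injective fun x => σ (Sum.inl x) := σ.injective.comp Sum.inl_injective
      have hs : ∀ x, Equiv.swap i j (σ (Sum.inl x)) = σ (Sum.inl (Equiv.swap a b x)) := fun x => by
        rw [← ha, ← hb]; exact (hinj.map_swap a b x).symm
      have hr : ∀ y, Equiv.swap i j (σ (Sum.inr y)) = σ (Sum.inr y) := fun y => by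
        apply Equiv.swap_apply_of_ne_of_ne
        · rw [← ha]; simp
        · rw [← hb]; simp
      rw [koszul_swap_left hij ha hb]
      simp only [Function.comp_apply, hs, hr]
      rw [Equiv.sum_comp (Equiv.swap a b) (fun x => e (σ (Sum.inl x)))]
      have := hf (fun x => e (σ (Sum.inl x))) (fun x => ξ (σ (Sum.inl x))) (fun x => hξ _) a b hab
      simp only [Function.comp_def, ha, hb] at this
      rw [this]
      simp only [map_smul, LinearMap.smul_apply]
      rw [smul_comm]
    · simp [hi, hj] at h
    · simp [hi, hj] at h
    · have ha : σ (Sum.inr a) = i := by rw [← hi]; simp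
      have hb : σ (Sum.inr b) = j := by rw [← hj]; simp
      have hab := succ_of_strictMono hσ'.2 hij ha hb
      have hinj : Function.Injective fun x => σ (Sum.inr x) := σ.injective.comp Sum.inr_injective
      have hs : ∀ x, Equiv.swap i j (σ (Sum.inr x)) = σ (Sum.inr (Equiv.swap a b x)) := fun x => by
        rw [← ha, ← hb]; exact (hinj.map_swap a b x).symm
      have hr : ∀ y, Equiv.swap i j (σ (Sum.inl y)) = σ (Sum.inl y) := fun y => by
        apply Equiv.swap_apply_of_ne_of_ne
        · rw [← ha]; simp
        · rw [← hb]; simp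
      rw [koszul_swap_right hij ha hb]
      simp only [Function.comp_apply, hs, hr]
      have := hg (fun x => e (σ (Sum.inr x))) (fun x => ξ (σ (Sum.inr x))) (fun x => hξ _) a b hab
      simp only [Function.comp_def, ha, hb] at this
      rw [this]
      simp only [map_smul]
      rw [smul_comm]
  · obtain ⟨a, b, hab⟩ := cases σ h
    have hφσ : φ σ = σ.trans (Equiv.swap i j) := by simp [φ, h]
    rw [hφσ, smul_smul, ← sg_add]
    have hk := koszul_trans_swap hij hab e
    rw [sg_congr (m := koszul σ (e ∘ Equiv.swap i j) + _)
      (n := e i * e j + (koszul (σ.trans (Equiv.swap i j)) e +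
        c * ∑ x, e ((σ.trans (Equiv.swap i j)) (Sum.inl x))))]
    · rfl
    · have h1 : ∀ x, (e ∘ Equiv.swap i j) (σ (Sum.inl x)) =
          e ((σ.trans (Equiv.swap i j)) (Sum.inl x)) := fun x => rfl
      simp only [h1]
      convert hk using 1
      ring

/-- Homogeneity of degree `d`: `|F(ξ₁, …, ξ_n)| = d + |ξ₁| + ⋯ + |ξ_n|`. -/
def HasDeg (ℒ : ℤ → Submodule K L) (𝒲 : ℤ → Submodule K W) (d : ℤ) {n : ℕ}
    (F : MultilinearMap K (fun _ : Fin n => L) W) : Prop :=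
  ∀ (e : Fin n → ℤ) (ξ : Fin n → L), IsHom ℒ e ξ → F ξ ∈ 𝒲 (d + ∑ i, e i)

theorem sum_eq_blocks {p q N : ℕ} (σ : Fin p ⊕ Fin q ≃ Fin N) (e : Fin N → ℤ) :
    ∑ i, e i = ∑ x, e (σ (Sum.inl x)) + ∑ y, e (σ (Sum.inr y)) := by
  rw [← Equiv.sum_comp σ, Fintype.sum_sum_type]

theorem koszul_update_inl {p q N : ℕ} (σ : Fin p ⊕ Fin q ≃ Fin N) (e : Fin N → ℤ) (x₀ : Fin p)
    (b : ℤ) : koszul σ (Function.update e (σ (Sum.inl x₀)) (b + e (σ (Sum.inl x₀)))) =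
      koszul σ e +
        b * ∑ y, if σ (Sum.inr y) < σ (Sum.inl x₀) then e (σ (Sum.inr y)) else 0 := by
  have hs : (b * ∑ y, if σ (Sum.inr y) < σ (Sum.inl x₀) then e (σ (Sum.inr y)) else 0) =
      ∑ x : Fin p, ∑ y : Fin q, if x = x₀ then
        (if σ (Sum.inr y) < σ (Sum.inl x₀) then b * e (σ (Sum.inr y)) else 0) else 0 := by
    rw [Finset.sum_eq_single x₀ (by intro x _ hx; simp [hx]) (by simp), Finset.mul_sum]
    simp
  rw [hs]
  unfold koszul
  rw [← Finset.sum_add_distrib]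
  simp only [← Finset.sum_add_distrib]
  refine Finset.sum_congr rfl fun x _ => Finset.sum_congr rfl fun y _ => ?_
  by_cases hx : x = x₀
  · subst hx
    split_ifs <;> simp_all; ring
  · simp [hx]

theorem koszul_update_inr {p q N : ℕ} (σ : Fin p ⊕ Fin q ≃ Fin N) (e : Fin N → ℤ) (y₀ : Fin q)
    (b : ℤ) : koszul σ (Function.update e (σ (Sum.inr y₀)) (b + e (σ (Sum.inr y₀)))) =
      koszul σ e +
        b * ∑ x, if σ (Sum.inr y₀) < σ (Sum.inl x) then e (σ (Sum.inl x)) else 0 := by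
  have hs : (b * ∑ x, if σ (Sum.inr y₀) < σ (Sum.inl x) then e (σ (Sum.inl x)) else 0) =
      ∑ x : Fin p, ∑ y : Fin q, if y = y₀ then
        (if σ (Sum.inr y₀) < σ (Sum.inl x) then b * e (σ (Sum.inl x)) else 0) else 0 := by
    rw [Finset.mul_sum]
    refine Finset.sum_congr rfl fun x _ => ?_
    rw [Finset.sum_ite_eq' Finset.univ y₀]
    simp
  rw [hs]
  unfold koszul
  rw [← Finset.sum_add_distrib]
  simp only [← Finset.sum_add_distrib]
  refine Finset.sum_congr rfl fun x _ => Finset.sum_congr rfl fun y _ => ?_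
  by_cases hy : y = y₀
  · subst hy
    split_ifs <;> simp_all; ring
  · simp [hy]

theorem sum_Iio_eq {N : ℕ} (e : Fin N → ℤ) (i : Fin N) :
    ∑ j ∈ Finset.Iio i, e j = ∑ j, if j < i then e j else 0 := by
  rw [← Finset.sum_filter]; congr 1; ext; simp

theorem sum_Ici_eq {N : ℕ} (e : Fin N → ℤ) (i : Fin N) :
    ∑ j ∈ Finset.Ici i, e j = ∑ j, e j - ∑ j ∈ Finset.Iio i, e j := by
  rw [sum_Iio_eq, ← Finset.sum_sub_distrib]
  rw [show Finset.Ici i = Finset.univ.filter (fun j => i ≤ j) by ext; simp, Finset.sum_filter]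
  refine Finset.sum_congr rfl fun j _ => ?_
  by_cases h : j < i
  · simp [h, not_le.2 h]
  · simp [h, not_lt.1 h]

theorem sum_lt_add_sum_gt {ι : Type*} [Fintype ι] {N : ℕ} (s : ι → Fin N) (f : ι → ℤ) (i : Fin N)
    (h : ∀ x, s x ≠ i) :
    (∑ x, if s x < i then f x else 0) + (∑ x, if i < s x then f x else 0) = ∑ x, f x := by
  rw [← Finset.sum_add_distrib]
  refine Finset.sum_congr rfl fun x _ => ?_
  rcases lt_or_gt_of_ne (h x) with h1 | h1
  · simp [h1, h1.not_gt]
  · simp [h1, h1.not_gt]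

section Linear

variable {A : Type*} [Ring A] [Algebra K A] (𝒜 : ℤ → Submodule K A)
theorem star_hasDeg (ℒ : ℤ → Submodule K L) [DirectSum.Decomposition ℒ] [GradedAlgebra 𝒜] (d c : ℤ)
    {p q : ℕ} {f : MultilinearMap K (fun _ : Fin p => L) A}
    {g : MultilinearMap K (fun _ : Fin q => L) A} (hf : HasDeg ℒ 𝒜 d f) (hg : HasDeg ℒ 𝒜 c g)
    (N : ℕ) : HasDeg ℒ 𝒜 (d + c) (star ℒ c (LinearMap.mul K A) f g N) := by
  intro e ξ hξ
  rw [star_apply ℒ c _ f g hξ]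
  refine Submodule.sum_mem _ fun σ _ => Submodule.smul_mem _ _ ?_
  have := SetLike.mul_mem_graded
    (hf (fun y => e (σ (Sum.inl y))) (fun y => ξ (σ (Sum.inl y))) fun y => hξ _)
    (hg (fun y => e (σ (Sum.inr y))) (fun y => ξ (σ (Sum.inr y))) fun y => hξ _)
  rw [sum_eq_blocks σ, add_add_add_comm]
  exact this

variable [Module A L]

/-- Graded `A`-multilinearity of a map of degree `d` with values in a left `A`-module:
`F(ξ₁, …, a ξ_i, …, ξ_n) = (-1)^χ a F(ξ₁, …, ξ_n)`, `χ = |a| (d + |ξ₁| + ⋯ + |ξ_{i-1}|)`. -/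
def LeftLin (ℒ : ℤ → Submodule K L) [Module A W] (d : ℤ) {n : ℕ}
    (F : MultilinearMap K (fun _ : Fin n => L) W) : Prop :=
  ∀ (e : Fin n → ℤ) (ξ : Fin n → L), IsHom ℒ e ξ → ∀ (i : Fin n) (b : ℤ), ∀ a ∈ 𝒜 b,
    F (Function.update ξ i (a • ξ i)) = sg K (b * (d + ∑ j ∈ Finset.Iio i, e j)) • a • F ξ

/-- Graded `A`-multilinearity of a map of some degree `d` with values in `Hom_K(Q, W)`, `A` acting
on a homogeneous map `φ` of degree `m` by `a φ := (-1)^{|a| m} φ ∘ a`. Here this reads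
`F(ξ₁, …, a ξ_i, …, ξ_n) = (-1)^χ F(ξ₁, …, ξ_n) ∘ a`, where
`χ = |a| (d + |ξ₁| + ⋯ + |ξ_{i-1}|) + |a| (d + |ξ₁| + ⋯ + |ξ_n|) ≡ |a| (|ξ_i| + ⋯ + |ξ_n|)`. -/
def RightLin (ℒ : ℤ → Submodule K L) {Q : Type*} [AddCommGroup Q] [Module K Q] [Module A Q]
    [IsScalarTower K A Q] {n : ℕ} (F : MultilinearMap K (fun _ : Fin n => L) (Q →ₗ[K] W)) : Prop :=
  ∀ (e : Fin n → ℤ) (ξ : Fin n → L), IsHom ℒ e ξ → ∀ (i : Fin n) (b : ℤ), ∀ a ∈ 𝒜 b,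
    F (Function.update ξ i (a • ξ i)) =
      sg K (b * ∑ j ∈ Finset.Ici i, e j) • (F ξ ∘ₗ Algebra.lsmul K K Q a)

variable {𝒜}

theorem isHom_update {ℒ : ℤ → Submodule K L} [SetLike.GradedSMul 𝒜 ℒ] {n : ℕ} {e : Fin n → ℤ}
    {ξ : Fin n → L} (hξ : IsHom ℒ e ξ) (i : Fin n) {b : ℤ} {a : A} (ha : a ∈ 𝒜 b) :
    IsHom ℒ (Function.update e i (b + e i)) (Function.update ξ i (a • ξ i)) := by
  intro j
  by_cases h : j = i
  · subst h; simpa using SetLike.GradedSMul.smul_mem ha (hξ j)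
  · simpa [h] using hξ j

theorem update_inl {ι : Type*} {p q N : ℕ} (σ : Fin p ⊕ Fin q ≃ Fin N) (f : Fin N → ι) (x₀ : Fin p)
    (v : ι) : (fun x => Function.update f (σ (Sum.inl x₀)) v (σ (Sum.inl x))) =
      Function.update (fun x => f (σ (Sum.inl x))) x₀ v := by
  funext x; simp [Function.update_apply]

theorem update_inl' {ι : Type*} {p q N : ℕ} (σ : Fin p ⊕ Fin q ≃ Fin N) (f : Fin N → ι) (x₀ : Fin p)
    (v : ι) : (fun y => Function.update f (σ (Sum.inl x₀)) v (σ (Sum.inr y))) =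
      fun y => f (σ (Sum.inr y)) := by
  funext x; simp

theorem update_inr {ι : Type*} {p q N : ℕ} (σ : Fin p ⊕ Fin q ≃ Fin N) (f : Fin N → ι) (y₀ : Fin q)
    (v : ι) : (fun y => Function.update f (σ (Sum.inr y₀)) v (σ (Sum.inr y))) =
      Function.update (fun y => f (σ (Sum.inr y))) y₀ v := by
  funext x; simp [Function.update_apply]

theorem update_inr' {ι : Type*} {p q N : ℕ} (σ : Fin p ⊕ Fin q ≃ Fin N) (f : Fin N → ι) (y₀ : Fin q)
    (v : ι) : (fun x => Function.update f (σ (Sum.inr y₀)) v (σ (Sum.inl x))) =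
      fun x => f (σ (Sum.inl x)) := by
  funext x; simp

theorem sum_update {n : ℕ} (e : Fin n → ℤ) (i : Fin n) (b : ℤ) :
    ∑ j, Function.update e i (b + e i) j = b + ∑ j, e j := by
  rw [Finset.sum_update_of_mem (Finset.mem_univ i), add_assoc,
    ← Finset.add_sum_erase _ _ (Finset.mem_univ i), Finset.sdiff_singleton_eq_erase]

theorem sum_Iio_blocks_inl {p q N : ℕ} {σ : Fin p ⊕ Fin q ≃ Fin N} (hσ : σ ∈ unshuffles p q N)
    (e : Fin N → ℤ) (x₀ : Fin p) :
    ∑ j ∈ Finset.Iio (σ (Sum.inl x₀)), e j = ∑ x ∈ Finset.Iio x₀, e (σ (Sum.inl x)) +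
      ∑ y, if σ (Sum.inr y) < σ (Sum.inl x₀) then e (σ (Sum.inr y)) else 0 := by
  simp only [unshuffles, Finset.mem_filter, Finset.mem_univ, true_and] at hσ
  rw [sum_Iio_eq, sum_eq_blocks σ, sum_Iio_eq]
  congr 1
  exact Finset.sum_congr rfl fun x _ => if_congr hσ.1.lt_iff_lt rfl rfl

theorem sum_Iio_blocks_inr {p q N : ℕ} {σ : Fin p ⊕ Fin q ≃ Fin N} (hσ : σ ∈ unshuffles p q N)
    (e : Fin N → ℤ) (y₀ : Fin q) :
    ∑ j ∈ Finset.Iio (σ (Sum.inr y₀)), e j = ∑ y ∈ Finset.Iio y₀, e (σ (Sum.inr y)) +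
      ∑ x, if σ (Sum.inl x) < σ (Sum.inr y₀) then e (σ (Sum.inl x)) else 0 := by
  simp only [unshuffles, Finset.mem_filter, Finset.mem_univ, true_and] at hσ
  rw [sum_Iio_eq, sum_eq_blocks σ, sum_Iio_eq, add_comm]
  congr 1
  exact Finset.sum_congr rfl fun x _ => if_congr hσ.2.lt_iff_lt rfl rfl

/-- Pairing of `Hom_K(Q, W)`-valued maps with `A`-valued maps: `(φ, a) ↦ φ ∘ a`. -/
def compSMul (K A Q W : Type*) [Field K] [Ring A] [Algebra K A] [AddCommGroup Q] [Module K Q]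
    [Module A Q] [IsScalarTower K A Q] [AddCommGroup W] [Module K W] :
    (Q →ₗ[K] W) →ₗ[K] A →ₗ[K] (Q →ₗ[K] W) :=
  (LinearMap.llcomp K Q Q W).compl₂ (Algebra.lsmul K K Q).toLinearMap

theorem compSMul_apply {Q : Type*} [AddCommGroup Q] [Module K Q] [Module A Q]
    [IsScalarTower K A Q] (φ : Q →ₗ[K] W) (a : A) (x : Q) : compSMul K A Q W φ a x = φ (a • x) :=
  rfl

theorem star_rightLin (ℒ : ℤ → Submodule K L) [DirectSum.Decomposition ℒ] [GradedAlgebra 𝒜]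
    [IsGradedComm 𝒜] [SetLike.GradedSMul 𝒜 ℒ]
    {Q : Type*} [AddCommGroup Q] [Module K Q] [Module A Q] [IsScalarTower K A Q] (c : ℤ)
    {p q : ℕ} {f : MultilinearMap K (fun _ : Fin p => L) (Q →ₗ[K] W)}
    {g : MultilinearMap K (fun _ : Fin q => L) A} (hf : RightLin 𝒜 ℒ f) (hg : HasDeg ℒ 𝒜 c g)
    (hg' : LeftLin 𝒜 ℒ c g) (N : ℕ) : RightLin 𝒜 ℒ (star ℒ c (compSMul K A Q W) f g N) := by
  intro e ξ hξ i b a ha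
  rw [star_apply ℒ c _ f g (isHom_update hξ i ha), star_apply ℒ c _ f g hξ]
  ext z
  rw [LinearMap.smul_apply, LinearMap.comp_apply, LinearMap.sum_apply, LinearMap.sum_apply,
    Finset.smul_sum]
  refine Finset.sum_congr rfl fun σ hσ => ?_
  simp only [LinearMap.smul_apply, compSMul_apply, Algebra.lsmul_coe]
  have hgm := hg (fun y => e (σ (Sum.inr y))) (fun y => ξ (σ (Sum.inr y))) fun y => hξ _
  have hcomm := IsGradedComm.comm _ _ a ha _ hgm
  obtain ⟨s, rfl⟩ := σ.surjective i
  have hI := sum_Ici_eq e (σ s)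
  rw [sum_eq_blocks σ e] at hI
  rcases s with x₀ | y₀
  · rw [koszul_update_inl, update_inl, update_inl, update_inl']
    rw [sum_update (fun x => e (σ (Sum.inl x)))]
    rw [hf (fun x => e (σ (Sum.inl x))) (fun x => ξ (σ (Sum.inl x))) (fun x => hξ _) x₀ b a ha]
    rw [sum_Iio_blocks_inl hσ] at hI
    rw [hI, LinearMap.smul_apply, LinearMap.comp_apply, Algebra.lsmul_coe]
    beta_reduce
    rw [smul_smul a, smul_smul,
      hcomm, smul_assoc, map_smul, smul_smul, smul_smul, ← mul_smul (_ : A) a z]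
    congr 1
    rw [← sg_add, ← sg_add, ← sg_add]
    apply sg_congr
    rw [sum_Ici_eq]
    generalize (∑ y, if σ (Sum.inr y) < σ (Sum.inl x₀) then e (σ (Sum.inr y)) else 0) = s1
    exact ⟨b * c + b * s1, by ring⟩
  · rw [koszul_update_inr, update_inr', update_inr', update_inr]
    rw [hg' (fun x => e (σ (Sum.inr x))) (fun x => ξ (σ (Sum.inr x))) (fun x => hξ _) y₀ b a ha]
    rw [sum_Iio_blocks_inr hσ] at hI
    rw [hI, smul_eq_mul, hcomm, smul_smul, smul_assoc, map_smul, smul_smul, smul_smul,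
      mul_smul (_ : A) a z]
    congr 1
    rw [← sg_add, ← sg_add, ← sg_add]
    apply sg_congr
    have := sum_lt_add_sum_gt (fun x => σ (Sum.inl x)) (fun x => e (σ (Sum.inl x)))
      (σ (Sum.inr y₀)) (by simp)
    rw [← this]
    generalize (∑ x, if σ (Sum.inl x) < σ (Sum.inr y₀) then e (σ (Sum.inl x)) else 0) = s1
    exact ⟨b * c + b * ∑ y ∈ Finset.Iio y₀, e (σ (Sum.inr y)), by ring⟩

theorem star_leftLin (ℒ : ℤ → Submodule K L) [DirectSum.Decomposition ℒ] [GradedAlgebra 𝒜]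
    [IsGradedComm 𝒜] [SetLike.GradedSMul 𝒜 ℒ] (d c : ℤ)
    {p q : ℕ} {f : MultilinearMap K (fun _ : Fin p => L) A}
    {g : MultilinearMap K (fun _ : Fin q => L) A} (hf : HasDeg ℒ 𝒜 d f) (hf' : LeftLin 𝒜 ℒ d f)
    (hg' : LeftLin 𝒜 ℒ c g) (N : ℕ) :
    LeftLin 𝒜 ℒ (d + c) (star ℒ c (LinearMap.mul K A) f g N) := by
  intro e ξ hξ i b a ha
  rw [star_apply ℒ c _ f g (isHom_update hξ i ha), star_apply ℒ c _ f g hξ, Finset.smul_sum,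
    Finset.smul_sum]
  refine Finset.sum_congr rfl fun σ hσ => ?_
  simp only [LinearMap.mul_apply']
  have hfm := hf (fun y => e (σ (Sum.inl y))) (fun y => ξ (σ (Sum.inl y))) fun y => hξ _
  have hcomm := IsGradedComm.comm _ _ _ hfm a ha
  obtain ⟨s, rfl⟩ := σ.surjective i
  rcases s with x₀ | y₀
  · rw [koszul_update_inl, update_inl, update_inl, update_inl']
    rw [sum_update (fun x => e (σ (Sum.inl x)))]
    rw [hf' (fun x => e (σ (Sum.inl x))) (fun x => ξ (σ (Sum.inl x))) (fun x => hξ _) x₀ b a ha]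
    rw [sum_Iio_blocks_inl hσ, smul_mul_assoc, smul_eq_mul, smul_eq_mul, mul_assoc, mul_smul_comm,
      smul_smul, smul_smul]
    congr 1
    rw [← sg_add, ← sg_add]
    apply sg_congr
    exact ⟨0, by ring⟩
  · rw [koszul_update_inr, update_inr', update_inr', update_inr]
    rw [hg' (fun x => e (σ (Sum.inr x))) (fun x => ξ (σ (Sum.inr x))) (fun x => hξ _) y₀ b a ha]
    rw [sum_Iio_blocks_inr hσ, mul_smul_comm, smul_eq_mul, ← mul_assoc, hcomm, smul_mul_assoc,
      smul_eq_mul, mul_smul_comm, mul_assoc, smul_smul, smul_smul, smul_smul]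
    congr 1
    rw [← sg_add, ← sg_add, ← sg_add]
    apply sg_congr
    have := sum_lt_add_sum_gt (fun x => σ (Sum.inl x)) (fun x => e (σ (Sum.inl x)))
      (σ (Sum.inr y₀)) (by simp)
    rw [← this]
    generalize (∑ x, if σ (Sum.inl x) < σ (Sum.inr y₀) then e (σ (Sum.inl x)) else 0) = s1
    generalize (∑ x, if σ (Sum.inr y₀) < σ (Sum.inl x) then e (σ (Sum.inl x)) else 0) = s2
    exact ⟨b * s2, by ring⟩

theorem star_zero_left (ℒ : ℤ → Submodule K L) [DirectSum.Decomposition ℒ] (c : ℤ)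
    (B : U →ₗ[K] V →ₗ[K] W) {p q : ℕ} (g : MultilinearMap K (fun _ : Fin q => L) V) (N : ℕ) :
    star ℒ c B (0 : MultilinearMap K (fun _ : Fin p => L) U) g N = 0 := by
  ext ξ
  simp [star, shuffle]

theorem star_zero_right (ℒ : ℤ → Submodule K L) [DirectSum.Decomposition ℒ] (c : ℤ)
    (B : U →ₗ[K] V →ₗ[K] W) {p q : ℕ} (f : MultilinearMap K (fun _ : Fin p => L) U) (N : ℕ) :
    star ℒ c B f (0 : MultilinearMap K (fun _ : Fin q => L) V) N = 0 := by
  ext ξ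
  simp [star, shuffle]

theorem GrSymm.zero (ℒ : ℤ → Submodule K L) {n : ℕ} :
    GrSymm ℒ (0 : MultilinearMap K (fun _ : Fin n => L) W) := fun e ξ hξ i j hij => by simp

theorem GrSymm.add {ℒ : ℤ → Submodule K L} {n : ℕ} {F G : MultilinearMap K (fun _ : Fin n => L) W}
    (hF : GrSymm ℒ F) (hG : GrSymm ℒ G) : GrSymm ℒ (F + G) := fun e ξ hξ i j hij => by
  rw [add_apply, add_apply, hF e ξ hξ i j hij, hG e ξ hξ i j hij,
    smul_add]

theorem GrSymm.smul {ℒ : ℤ → Submodule K L} {n : ℕ} {F : MultilinearMap K (fun _ : Fin n => L) W}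
    (r : K) (hF : GrSymm ℒ F) : GrSymm ℒ (r • F) := fun e ξ hξ i j hij => by
  rw [smul_apply, smul_apply, hF e ξ hξ i j hij, smul_comm]

theorem HasDeg.zero (ℒ : ℤ → Submodule K L) (𝒲 : ℤ → Submodule K W) (d : ℤ) {n : ℕ} :
    HasDeg ℒ 𝒲 d (0 : MultilinearMap K (fun _ : Fin n => L) W) := fun e ξ hξ => by simp

theorem HasDeg.add {ℒ : ℤ → Submodule K L} {𝒲 : ℤ → Submodule K W} {d : ℤ} {n : ℕ}
    {F G : MultilinearMap K (fun _ : Fin n => L) W}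
    (hF : HasDeg ℒ 𝒲 d F) (hG : HasDeg ℒ 𝒲 d G) : HasDeg ℒ 𝒲 d (F + G) := fun e ξ hξ =>
  Submodule.add_mem _ (hF e ξ hξ) (hG e ξ hξ)

theorem HasDeg.smul {ℒ : ℤ → Submodule K L} {𝒲 : ℤ → Submodule K W} {d : ℤ} {n : ℕ}
    {F : MultilinearMap K (fun _ : Fin n => L) W} (r : K)
    (hF : HasDeg ℒ 𝒲 d F) : HasDeg ℒ 𝒲 d (r • F) := fun e ξ hξ =>
  Submodule.smul_mem _ _ (hF e ξ hξ)

theorem LeftLin.zero [Module A W] (ℒ : ℤ → Submodule K L) (d : ℤ) {n : ℕ} :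
    LeftLin 𝒜 ℒ d (0 : MultilinearMap K (fun _ : Fin n => L) W) := fun e ξ hξ i b a ha => by simp

theorem LeftLin.add [Module A W] {ℒ : ℤ → Submodule K L} {d : ℤ} {n : ℕ}
    {F G : MultilinearMap K (fun _ : Fin n => L) W}
    (hF : LeftLin 𝒜 ℒ d F) (hG : LeftLin 𝒜 ℒ d G) : LeftLin 𝒜 ℒ d (F + G) :=
  fun e ξ hξ i b a ha => by
    rw [add_apply, add_apply, hF e ξ hξ i b a ha,
      hG e ξ hξ i b a ha, smul_add, smul_add]

theorem LeftLin.smul [Module A W] [IsScalarTower K A W] {ℒ : ℤ → Submodule K L} {d : ℤ} {n : ℕ}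
    {F : MultilinearMap K (fun _ : Fin n => L) W} (r : K)
    (hF : LeftLin 𝒜 ℒ d F) : LeftLin 𝒜 ℒ d (r • F) :=
  fun e ξ hξ i b a ha => by
    rw [smul_apply, smul_apply, hF e ξ hξ i b a ha,
      smul_comm a r, smul_comm r]

section Right

variable {Q : Type*} [AddCommGroup Q] [Module K Q] [Module A Q] [IsScalarTower K A Q]

theorem RightLin.zero (ℒ : ℤ → Submodule K L) {n : ℕ} :
    RightLin 𝒜 ℒ (0 : MultilinearMap K (fun _ : Fin n => L) (Q →ₗ[K] W)) :=
  fun e ξ hξ i b a ha => by simp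

theorem RightLin.add {ℒ : ℤ → Submodule K L} {n : ℕ}
    {F G : MultilinearMap K (fun _ : Fin n => L) (Q →ₗ[K] W)}
    (hF : RightLin 𝒜 ℒ F) (hG : RightLin 𝒜 ℒ G) : RightLin 𝒜 ℒ (F + G) :=
  fun e ξ hξ i b a ha => by
    rw [add_apply, add_apply, hF e ξ hξ i b a ha,
      hG e ξ hξ i b a ha, LinearMap.add_comp, smul_add]

theorem RightLin.smul {ℒ : ℤ → Submodule K L} {n : ℕ}
    {F : MultilinearMap K (fun _ : Fin n => L) (Q →ₗ[K] W)} (r : K)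
    (hF : RightLin 𝒜 ℒ F) : RightLin 𝒜 ℒ (r • F) :=
  fun e ξ hξ i b a ha => by
    rw [smul_apply, smul_apply, hF e ξ hξ i b a ha,
      LinearMap.smul_comp, smul_comm r]

end Right

end Linear

end Multilinear

/-! ### The symmetric tensors with coefficients, and the symmetric forms -/

section Spaces

variable {K A L Q : Type*} [Field K] [Ring A] [Algebra K A] [AddCommGroup L] [Module K L]
  [Module A L] [AddCommGroup Q] [Module K Q] [Module A Q]

/-- The relations defining `S_A^n L ⊗_A Q` as a quotient of `L ⊗_K ⋯ ⊗_K L ⊗_K Q`: graded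
symmetry, and `ξ₁ ⊗ ⋯ ⊗ a ξ_i ⊗ ⋯ ⊗ ξ_n ⊗ q = (-1)^χ ξ₁ ⊗ ⋯ ⊗ ξ_n ⊗ a q` with
`χ = |a| (|ξ_i| + ⋯ + |ξ_n|)`. -/
def tensorRel (𝒜 : ℤ → Submodule K A) (ℒ : ℤ → Submodule K L) (Q : Type*) [AddCommGroup Q]
    [Module K Q] [Module A Q] (n : ℕ) : Submodule K ((⨂[K] _ : Fin n, L) ⊗[K] Q) :=
  Submodule.span K
    ({z | ∃ (e : Fin n → ℤ) (ξ : Fin n → L) (i j : Fin n) (q : Q), IsHom ℒ e ξ ∧ (j : ℕ) = i + 1 ∧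
        z = PiTensorProduct.tprod K (ξ ∘ Equiv.swap i j) ⊗ₜ[K] q -
          sg K (e i * e j) • (PiTensorProduct.tprod K ξ ⊗ₜ[K] q)} ∪
      {z | ∃ (e : Fin n → ℤ) (ξ : Fin n → L) (i : Fin n) (b : ℤ) (a : A) (q : Q),
        IsHom ℒ e ξ ∧ a ∈ 𝒜 b ∧
        z = PiTensorProduct.tprod K (Function.update ξ i (a • ξ i)) ⊗ₜ[K] q -
          sg K (b * ∑ j ∈ Finset.Ici i, e j) • (PiTensorProduct.tprod K ξ ⊗ₜ[K] (a • q))})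

/-- The weight `n` component `S_A^n L ⊗_A Q`. -/
def SymTensorPow (𝒜 : ℤ → Submodule K A) (ℒ : ℤ → Submodule K L) (Q : Type*) [AddCommGroup Q]
    [Module K Q] [Module A Q] (n : ℕ) : Type _ :=
  ((⨂[K] _ : Fin n, L) ⊗[K] Q) ⧸ tensorRel 𝒜 ℒ Q n

instance (𝒜 : ℤ → Submodule K A) (ℒ : ℤ → Submodule K L) (n : ℕ) :
    AddCommGroup (SymTensorPow 𝒜 ℒ Q n) :=
  inferInstanceAs (AddCommGroup (((⨂[K] _ : Fin n, L) ⊗[K] Q) ⧸ tensorRel 𝒜 ℒ Q n))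

instance (𝒜 : ℤ → Submodule K A) (ℒ : ℤ → Submodule K L) (n : ℕ) :
    Module K (SymTensorPow 𝒜 ℒ Q n) :=
  inferInstanceAs (Module K (((⨂[K] _ : Fin n, L) ⊗[K] Q) ⧸ tensorRel 𝒜 ℒ Q n))

/-- The quotient map onto `S_A^n L ⊗_A Q`. -/
def toSymTensorPow (𝒜 : ℤ → Submodule K A) (ℒ : ℤ → Submodule K L) (Q : Type*) [AddCommGroup Q]
    [Module K Q] [Module A Q] (n : ℕ) :
    ((⨂[K] _ : Fin n, L) ⊗[K] Q) →ₗ[K] SymTensorPow 𝒜 ℒ Q n :=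
  (tensorRel 𝒜 ℒ Q n).mkQ

/-- The graded space `S_A^• L ⊗_A Q`. -/
abbrev SymTensor (𝒜 : ℤ → Submodule K A) (ℒ : ℤ → Submodule K L) (Q : Type*) [AddCommGroup Q]
    [Module K Q] [Module A Q] : Type _ :=
  ⨁ n : ℕ, SymTensorPow 𝒜 ℒ Q n

/-- The generators `(ξ₁, …, ξ_n), q ↦ ξ₁ ⋯ ξ_n ⊗ q` of `S_A^• L ⊗_A Q`. -/
def tens (𝒜 : ℤ → Submodule K A) (ℒ : ℤ → Submodule K L) (Q : Type*) [AddCommGroup Q]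
    [Module K Q] [Module A Q] (n : ℕ) :
    MultilinearMap K (fun _ : Fin n => L) (Q →ₗ[K] SymTensor 𝒜 ℒ Q) :=
  ((TensorProduct.mk K (⨂[K] _ : Fin n, L) Q).compr₂
    (DirectSum.lof K ℕ (SymTensorPow 𝒜 ℒ Q) n ∘ₗ
      toSymTensorPow 𝒜 ℒ Q n)).compMultilinearMap (PiTensorProduct.tprod K)

theorem tens_apply (𝒜 : ℤ → Submodule K A) (ℒ : ℤ → Submodule K L) (n : ℕ) (ξ : Fin n → L)
    (q : Q) : tens 𝒜 ℒ Q n ξ q = DirectSum.lof K ℕ (SymTensorPow 𝒜 ℒ Q) n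
      (toSymTensorPow 𝒜 ℒ Q n (PiTensorProduct.tprod K ξ ⊗ₜ[K] q)) := rfl

theorem tens_grSymm (𝒜 : ℤ → Submodule K A) (ℒ : ℤ → Submodule K L) (n : ℕ) :
    GrSymm ℒ (tens 𝒜 ℒ Q n) := by
  intro e ξ hξ i j hij
  refine LinearMap.ext fun q => ?_
  rw [LinearMap.smul_apply, tens_apply, tens_apply, ← map_smul, ← map_smul]
  refine congrArg (DirectSum.lof K ℕ (SymTensorPow 𝒜 ℒ Q) n) ?_
  refine (Submodule.Quotient.eq (tensorRel 𝒜 ℒ Q n)).2 ?_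
  exact Submodule.subset_span (Or.inl ⟨e, ξ, i, j, q, hξ, hij, rfl⟩)

theorem tens_rightLin [IsScalarTower K A Q] (𝒜 : ℤ → Submodule K A) (ℒ : ℤ → Submodule K L)
    (n : ℕ) : RightLin 𝒜 ℒ (tens 𝒜 ℒ Q n) := by
  intro e ξ hξ i b a ha
  refine LinearMap.ext fun q => ?_
  rw [LinearMap.smul_apply, LinearMap.comp_apply, tens_apply, tens_apply, ← map_smul,
    ← map_smul]
  refine congrArg (DirectSum.lof K ℕ (SymTensorPow 𝒜 ℒ Q) n) ?_
  refine (Submodule.Quotient.eq (tensorRel 𝒜 ℒ Q n)).2 ?_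
  exact Submodule.subset_span (Or.inr ⟨e, ξ, i, b, a, q, hξ, ha, rfl⟩)

/-- The universal property of `S_A^n L ⊗_A Q`. -/
def tensLift [IsScalarTower K A Q] {𝒜 : ℤ → Submodule K A} {ℒ : ℤ → Submodule K L}
    {W : Type*} [AddCommGroup W]
    [Module K W] {n : ℕ} (F : MultilinearMap K (fun _ : Fin n => L) (Q →ₗ[K] W))
    (hs : GrSymm ℒ F) (hr : RightLin 𝒜 ℒ F) : SymTensorPow 𝒜 ℒ Q n →ₗ[K] W :=
  (tensorRel 𝒜 ℒ Q n).liftQ (TensorProduct.lift (PiTensorProduct.lift F)) <| by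
    refine Submodule.span_le.2 ?_
    rintro z (⟨e, ξ, i, j, q, hξ, hij, rfl⟩ | ⟨e, ξ, i, b, a, q, hξ, ha, rfl⟩)
    · simp [hs e ξ hξ i j hij]
    · simp [hr e ξ hξ i b a ha]

/-- Elements of bidegree: internal degree `m` in `S_A^• L ⊗_A Q`, spanned by the
`ξ₁ ⋯ ξ_n ⊗ q` with `|ξ₁| + ⋯ + |ξ_n| + |q| = m`. -/
def tensorDeg (𝒜 : ℤ → Submodule K A) (ℒ : ℤ → Submodule K L) (𝒬 : ℤ → Submodule K Q) (m : ℤ) :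
    Submodule K (SymTensor 𝒜 ℒ Q) :=
  Submodule.span K {z | ∃ (n : ℕ) (e : Fin n → ℤ) (ξ : Fin n → L) (f : ℤ) (q : Q),
    IsHom ℒ e ξ ∧ q ∈ 𝒬 f ∧ ∑ i, e i + f = m ∧ z = tens 𝒜 ℒ Q n ξ q}

/-- Families `(F_n)_{n ≥ 0}` of `K`-multilinear maps `L × ⋯ × L → W` with `n` entries. -/
abbrev Cochain (K L W : Type*) [Field K] [AddCommGroup L] [Module K L] [AddCommGroup W]
    [Module K W] : Type _ :=
  (n : ℕ) → MultilinearMap K (fun _ : Fin n => L) W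

/-- `F ∘ Y` for families: the sum over `l`, `n` of the insertions
`∑_{σ ∈ S_{l,n}} α(σ, ξ) F_{n+1}(Y_l(ξ_{σ(1)}, …, ξ_{σ(l)}), ξ_{σ(l+1)}, …, ξ_{σ(l+n)})`. -/
def circ {W : Type*} [AddCommGroup W] [Module K W] (ℒ : ℤ → Submodule K L)
    [DirectSum.Decomposition ℒ] (F : Cochain K L W) (Y : Cochain K L L) : Cochain K L W := fun N =>
  ∑ ln ∈ Finset.HasAntidiagonal.antidiagonal N, insertion ℒ (F (ln.2 + 1)) (Y ln.1) N

/-- The product of families with respect to a bilinear map `B`, `g` being of degree `c`: the sum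
over `p`, `q` of
`∑_{σ ∈ S_{p,q}} α(σ, ξ) (-1)^χ B(f_p(ξ_{σ(1)}, …, ξ_{σ(p)}), g_q(ξ_{σ(p+1)}, …, ξ_{σ(p+q)}))`,
`χ = c (|ξ_{σ(1)}| + ⋯ + |ξ_{σ(p)}|)`. -/
def cstar {U V W : Type*} [AddCommGroup U] [Module K U] [AddCommGroup V] [Module K V]
    [AddCommGroup W] [Module K W] (ℒ : ℤ → Submodule K L) [DirectSum.Decomposition ℒ] (c : ℤ)
    (B : U →ₗ[K] V →ₗ[K] W) (f : Cochain K L U) (g : Cochain K L V) : Cochain K L W := fun N =>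
  ∑ pq ∈ Finset.HasAntidiagonal.antidiagonal N, star ℒ c B (f pq.1) (g pq.2) N

/-- The symmetric forms of degree `d`, i.e. the degree `d` part of
`Sym_A(L, A) = ⨁_n Sym_A^n(L, A)`. -/
def forms (𝒜 : ℤ → Submodule K A) (ℒ : ℤ → Submodule K L) (d : ℤ) :
    Submodule K (Cochain K L A) where
  carrier := {ω | (∃ N, ∀ n ≥ N, ω n = 0) ∧
    ∀ n, GrSymm ℒ (ω n) ∧ HasDeg ℒ 𝒜 d (ω n) ∧ LeftLin 𝒜 ℒ d (ω n)}
  zero_mem' := ⟨⟨0, fun _ _ => rfl⟩, fun _ => ⟨GrSymm.zero _, HasDeg.zero _ _ _, LeftLin.zero _ _⟩⟩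
  add_mem' := by
    rintro ω ω' ⟨⟨N, hN⟩, h⟩ ⟨⟨N', hN'⟩, h'⟩
    refine ⟨⟨max N N', fun n hn => ?_⟩, fun n => ⟨(h n).1.add (h' n).1, (h n).2.1.add (h' n).2.1,
      (h n).2.2.add (h' n).2.2⟩⟩
    rw [Pi.add_apply, hN n (le_trans (le_max_left _ _) hn), hN' n (le_trans (le_max_right _ _) hn),
      add_zero]
  smul_mem' := by
    rintro r ω ⟨⟨N, hN⟩, h⟩
    refine ⟨⟨N, fun n hn => ?_⟩, fun n => ⟨(h n).1.smul r, (h n).2.1.smul r, (h n).2.2.smul r⟩⟩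
    rw [Pi.smul_apply, hN n hn, smul_zero]

/-- The space `Sym_A(L, A)` of symmetric forms: finite sums of homogeneous forms. -/
def allForms (𝒜 : ℤ → Submodule K A) (ℒ : ℤ → Submodule K L) : Submodule K (Cochain K L A) :=
  ⨆ d : ℤ, forms 𝒜 ℒ d

theorem forms_le_allForms (𝒜 : ℤ → Submodule K A) (ℒ : ℤ → Submodule K L) (d : ℤ) :
    forms 𝒜 ℒ d ≤ allForms 𝒜 ℒ := le_iSup (forms 𝒜 ℒ) d

/-- The product `ω ω'` of forms, `ω'` being of degree `c`. -/
def formMul (ℒ : ℤ → Submodule K L) [DirectSum.Decomposition ℒ] (c : ℤ)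
    (ω ω' : Cochain K L A) : Cochain K L A :=
  cstar ℒ c (LinearMap.mul K A) ω ω'

theorem formMul_mem {𝒜 : ℤ → Submodule K A} [GradedAlgebra 𝒜] [IsGradedComm 𝒜]
    {ℒ : ℤ → Submodule K L} [DirectSum.Decomposition ℒ] [SetLike.GradedSMul 𝒜 ℒ] {d c : ℤ}
    {ω ω' : Cochain K L A} (hω : ω ∈ forms 𝒜 ℒ d) (hω' : ω' ∈ forms 𝒜 ℒ c) :
    formMul ℒ c ω ω' ∈ forms 𝒜 ℒ (d + c) := by
  obtain ⟨⟨N, hN⟩, h⟩ := hω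
  obtain ⟨⟨N', hN'⟩, h'⟩ := hω'
  refine ⟨⟨N + N', fun n hn => ?_⟩, fun n => ⟨?_, ?_, ?_⟩⟩
  · change ∑ pq ∈ Finset.HasAntidiagonal.antidiagonal n,
      star ℒ c (LinearMap.mul K A) (ω pq.1) (ω' pq.2) n = 0
    refine Finset.sum_eq_zero (fun pq hpq => ?_)
    rw [Finset.HasAntidiagonal.mem_antidiagonal] at hpq
    by_cases hp : N ≤ pq.1
    · rw [hN _ hp, star_zero_left]
    · rw [hN' pq.2 (by omega), star_zero_right]
  · exact Finset.sum_induction _ (GrSymm ℒ) (fun _ _ => GrSymm.add) (GrSymm.zero _)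
      fun pq _ => star_grSymm ℒ c _ (h _).1 (h' _).1 n
  · exact Finset.sum_induction _ (HasDeg ℒ 𝒜 (d + c)) (fun _ _ => HasDeg.add) (HasDeg.zero _ _ _)
      fun pq _ => star_hasDeg 𝒜 ℒ d c (h _).2.1 (h' _).2.1 n
  · exact Finset.sum_induction _ (LeftLin 𝒜 ℒ (d + c)) (fun _ _ => LeftLin.add) (LeftLin.zero _ _)
      fun pq _ => star_leftLin ℒ d c (h _).2.1 (h _).2.2 (h' _).2.2 n

/-- The action `i_ω` of a form `ω` of degree `c` on `S_A^• L ⊗_A Q`: for a `k`-form `ω`,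
`i_ω (ξ₁ ⋯ ξ_n ⊗ q) = ∑_{σ ∈ S_{n-k,k}} α(σ, ξ) (-1)^χ ξ_{σ(1)} ⋯ ξ_{σ(n-k)} ⊗
  ω(ξ_{σ(n-k+1)}, …, ξ_{σ(n)}) q`, with `χ = c (|ξ_{σ(1)}| + ⋯ + |ξ_{σ(n-k)}|)`. -/
def contract (𝒜 : ℤ → Submodule K A) [GradedAlgebra 𝒜] [IsGradedComm 𝒜]
    (ℒ : ℤ → Submodule K L) [DirectSum.Decomposition ℒ] [SetLike.GradedSMul 𝒜 ℒ]
    (Q : Type*) [AddCommGroup Q] [Module K Q] [Module A Q] [IsScalarTower K A Q] (c : ℤ)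
    (ω : Cochain K L A) (hω : ω ∈ forms 𝒜 ℒ c) : Module.End K (SymTensor 𝒜 ℒ Q) :=
  DirectSum.toModule K ℕ _ fun N =>
    tensLift
      (cstar ℒ c (compSMul K A Q (SymTensor 𝒜 ℒ Q)) (tens 𝒜 ℒ Q) ω N)
      (Finset.sum_induction _ (GrSymm ℒ) (fun _ _ => GrSymm.add) (GrSymm.zero _)
        fun _ _ => star_grSymm ℒ c _ (tens_grSymm 𝒜 ℒ _) (hω.2 _).1 N)
      (Finset.sum_induction _ (RightLin 𝒜 ℒ) (fun _ _ => RightLin.add) (RightLin.zero _)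
        fun _ _ => star_rightLin ℒ c (tens_rightLin 𝒜 ℒ _) (hω.2 _).2.1 (hω.2 _).2.2 N)

/-! ### Derivations of the module of symmetric tensors -/

/-- The `K`-linear endomorphisms of degree `m` of a graded space. -/
def endDeg {V : Type*} [AddCommGroup V] [Module K V] (𝒱 : ℤ → Submodule K V) (m : ℤ) :
    Submodule K (Module.End K V) where
  carrier := {f | ∀ i, ∀ x ∈ 𝒱 i, f x ∈ 𝒱 (m + i)}
  zero_mem' := fun _ _ _ => Submodule.zero_mem _
  add_mem' := fun hf hg i x hx => Submodule.add_mem _ (hf i x hx) (hg i x hx)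
  smul_mem' := fun r _ hf i x hx => Submodule.smul_mem _ r (hf i x hx)

/-- A derivation of degree `d` of the `Sym_A(L, A)`-module `S_A^• L ⊗_A Q`: a pair `(D, s)`, where
`s` (the symbol) is a derivation of degree `d` of the graded algebra `Sym_A(L, A)`, and `D` is an
operator of degree `d` with `D (i_ω U) = i_{s ω} U + (-1)^{d |ω|} i_ω (D U)`. -/
structure IsModuleDerivation (𝒜 : ℤ → Submodule K A) [GradedAlgebra 𝒜] [IsGradedComm 𝒜]
    (ℒ : ℤ → Submodule K L) [DirectSum.Decomposition ℒ] [SetLike.GradedSMul 𝒜 ℒ]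
    [IsScalarTower K A Q] (𝒬 : ℤ → Submodule K Q) (d : ℤ)
    (D : Module.End K (SymTensor 𝒜 ℒ Q)) (s : Module.End K (allForms 𝒜 ℒ)) : Prop where
  symbol_deg : ∀ (c : ℤ) (ω : allForms 𝒜 ℒ), (ω : Cochain K L A) ∈ forms 𝒜 ℒ c →
    (s ω : Cochain K L A) ∈ forms 𝒜 ℒ (d + c)
  symbol_leibniz : ∀ (c c' : ℤ) (ω ω' : allForms 𝒜 ℒ) (hω : (ω : Cochain K L A) ∈ forms 𝒜 ℒ c)
    (hω' : (ω' : Cochain K L A) ∈ forms 𝒜 ℒ c'),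
    (s ⟨formMul ℒ c' ω ω', forms_le_allForms 𝒜 ℒ (c + c') (formMul_mem hω hω')⟩ : Cochain K L A) =
      formMul ℒ c' (s ω) ω' + sg K (d * c) • formMul ℒ (d + c') ω (s ω')
  deg : D ∈ endDeg (tensorDeg 𝒜 ℒ 𝒬) d
  leibniz : ∀ (c : ℤ) (ω : allForms 𝒜 ℒ) (hω : (ω : Cochain K L A) ∈ forms 𝒜 ℒ c)
    (u : SymTensor 𝒜 ℒ Q), D (contract 𝒜 ℒ Q c ω hω u) =
      contract 𝒜 ℒ Q (d + c) (s ω) (symbol_deg c ω hω) u +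
        sg K (d * c) • contract 𝒜 ℒ Q c ω hω (D u)

/-- `D` maps `S_A^n L ⊗_A Q` to `S_A^{n-w} L ⊗_A Q`, and `s` maps `n`-forms to `(n+w)`-forms
(components of negative weight being zero). -/
def HasWeight {𝒜 : ℤ → Submodule K A} {ℒ : ℤ → Submodule K L} (w : ℤ)
    (D : Module.End K (SymTensor 𝒜 ℒ Q)) (s : Module.End K (allForms 𝒜 ℒ)) : Prop :=
  (∀ (n : ℕ) (u : SymTensorPow 𝒜 ℒ Q n) (m : ℕ), (m : ℤ) ≠ n - w →
    D (DirectSum.lof K ℕ (SymTensorPow 𝒜 ℒ Q) n u) m = 0) ∧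
  (∀ (n : ℕ) (ω : allForms 𝒜 ℒ), (∀ j ≠ n, (ω : Cochain K L A) j = 0) →
    ∀ m : ℕ, (m : ℤ) ≠ n + w → (s ω : Cochain K L A) m = 0)

/-- The derivations of degree `d` of the `Sym_A(L, A)`-module `S_A^• L ⊗_A Q`: finite sums of
derivations of degree `d` which are also homogeneous with respect to the weight. -/
def moduleDerivations (𝒜 : ℤ → Submodule K A) [GradedAlgebra 𝒜] [IsGradedComm 𝒜]
    (ℒ : ℤ → Submodule K L) [DirectSum.Decomposition ℒ] [SetLike.GradedSMul 𝒜 ℒ]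
    [IsScalarTower K A Q] (𝒬 : ℤ → Submodule K Q) (d : ℤ) :
    Submodule K (Module.End K (SymTensor 𝒜 ℒ Q) × Module.End K (allForms 𝒜 ℒ)) :=
  Submodule.span K {p | IsModuleDerivation 𝒜 ℒ 𝒬 d p.1 p.2 ∧ ∃ w : ℤ, HasWeight w p.1 p.2}

/-- The graded commutator of pairs of operators of degrees `d` and `e`. -/
def pairCommutator {M N : Type*} [AddCommGroup M] [Module K M] [AddCommGroup N] [Module K N]
    (d e : ℤ) (p p' : Module.End K M × Module.End K N) : Module.End K M × Module.End K N :=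
  (p.1 * p'.1 - sg K (d * e) • (p'.1 * p.1), p.2 * p'.2 - sg K (d * e) • (p'.2 * p.2))

/-! ### Multiderivations and right derivation valued forms -/

/-- `D` is a derivation of degree `m` of the graded algebra `A`. -/
def IsDerivation (𝒜 : ℤ → Submodule K A) (m : ℤ) (D : Module.End K A) : Prop :=
  D ∈ endDeg 𝒜 m ∧ ∀ i, ∀ a ∈ 𝒜 i, ∀ b, D (a * b) = D a * b + sg K (m * i) • (a * D b)

/-- `(X, σ)` is a (finite sum of) multiderivation(s) of degree `d` of the `A`-module `L`. Here
`X k` is the part with `k` entries, and `σ n` is the symbol of `X (n + 1)`; the part `X 0`, with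
no entries, is an element of `L` and has no symbol. -/
structure IsMultiderivation (𝒜 : ℤ → Submodule K A) (ℒ : ℤ → Submodule K L) (d : ℤ)
    (X : Cochain K L L) (σ : Cochain K L (Module.End K A)) : Prop where
  finite : ∃ N, ∀ n ≥ N, X n = 0 ∧ σ n = 0
  symm : ∀ k, GrSymm ℒ (X k)
  deg : ∀ k, HasDeg ℒ ℒ d (X k)
  symbol_symm : ∀ n, GrSymm ℒ (σ n)
  symbol_der : ∀ (n : ℕ) (e : Fin n → ℤ) (ξ : Fin n → L), IsHom ℒ e ξ →
    IsDerivation 𝒜 (d + ∑ i, e i) (σ n ξ)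
  symbol_lin : ∀ n, LeftLin 𝒜 ℒ d (σ n)
  leibniz : ∀ (n : ℕ) (e : Fin n → ℤ) (ξ : Fin n → L), IsHom ℒ e ξ → ∀ b, ∀ a ∈ 𝒜 b, ∀ ζ : L,
    X (n + 1) (Fin.snoc (α := fun _ => L) ξ (a • ζ)) = σ n ξ a • ζ +
      sg K ((d + ∑ i, e i) * b) • a • X (n + 1) (Fin.snoc (α := fun _ => L) ξ ζ)

/-- `Δ` is a (finite sum of) form(s) of degree `d` with values in `Der^R Q`, whose symbol is
`-σ`. -/
structure IsRightForm [IsScalarTower K A Q] (𝒜 : ℤ → Submodule K A) (ℒ : ℤ → Submodule K L)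
    (𝒬 : ℤ → Submodule K Q) (d : ℤ) (σ : Cochain K L (Module.End K A))
    (Δ : Cochain K L (Module.End K Q)) : Prop where
  finite : ∃ N, ∀ n ≥ N, Δ n = 0
  symm : ∀ n, GrSymm ℒ (Δ n)
  deg : ∀ n, HasDeg ℒ (endDeg 𝒬) d (Δ n)
  lin : ∀ n, RightLin 𝒜 ℒ (Δ n)
  leibniz : ∀ (n : ℕ) (e : Fin n → ℤ) (ξ : Fin n → L), IsHom ℒ e ξ → ∀ b, ∀ a ∈ 𝒜 b, ∀ q : Q,
    Δ n ξ (a • q) = sg K ((d + ∑ i, e i) * b) • a • Δ n ξ q - σ n ξ a • q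

/-- The degree `d` part of `ℛ(Q) = ⨁_k ℛ^k(Q)`: triples `(X, σ, Δ)`, where `(X, σ)` is a
multiderivation of `L` and `Δ` is a `Der^R Q`-valued form with symbol `-σ`. The component in
`ℛ^k(Q)` consists of `X k` and, if `k = n + 1`, of `σ n` and `Δ n`. -/
def rightPairs [IsScalarTower K A L] [IsScalarTower K A Q] (𝒜 : ℤ → Submodule K A)
    (ℒ : ℤ → Submodule K L) (𝒬 : ℤ → Submodule K Q) (d : ℤ) :
    Submodule K (Cochain K L L × Cochain K L (Module.End K A) × Cochain K L (Module.End K Q)) where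
  carrier := {x | IsMultiderivation 𝒜 ℒ d x.1 x.2.1 ∧ IsRightForm 𝒜 ℒ 𝒬 d x.2.1 x.2.2}
  zero_mem' := by
    refine ⟨⟨⟨0, fun _ _ => ⟨rfl, rfl⟩⟩, fun _ => GrSymm.zero _, fun _ => HasDeg.zero _ _ _,
      fun _ => GrSymm.zero _, fun n e ξ _ => ⟨Submodule.zero_mem _, fun i a _ b => by simp⟩,
      fun _ => LeftLin.zero _ _, fun n e ξ _ b a _ ζ => by simp⟩,
      ⟨⟨0, fun _ _ => rfl⟩, fun _ => GrSymm.zero _, fun _ => HasDeg.zero _ _ _,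
      fun _ => RightLin.zero _, fun n e ξ _ b a _ q => by simp⟩⟩
  add_mem' := by
    rintro x y ⟨hx, hx'⟩ ⟨hy, hy'⟩
    obtain ⟨N₁, h₁⟩ := hx.finite
    obtain ⟨N₂, h₂⟩ := hy.finite
    obtain ⟨N₃, h₃⟩ := hx'.finite
    obtain ⟨N₄, h₄⟩ := hy'.finite
    refine ⟨⟨⟨max N₁ N₂, fun n hn => ?_⟩, fun k => (hx.symm k).add (hy.symm k),
      fun k => (hx.deg k).add (hy.deg k), fun n => (hx.symbol_symm n).add (hy.symbol_symm n),
      fun n e ξ hξ => ⟨Submodule.add_mem _ (hx.symbol_der n e ξ hξ).1 (hy.symbol_der n e ξ hξ).1,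
        fun i a ha b => ?_⟩,
      fun n => (hx.symbol_lin n).add (hy.symbol_lin n), fun n e ξ hξ b a ha ζ => ?_⟩,
      ⟨⟨max N₃ N₄, fun n hn => ?_⟩, fun n => (hx'.symm n).add (hy'.symm n),
        fun n => (hx'.deg n).add (hy'.deg n), fun n => (hx'.lin n).add (hy'.lin n),
        fun n e ξ hξ b a ha q => ?_⟩⟩
    · have e₁ := h₁ n (le_trans (le_max_left _ _) hn)
      have e₂ := h₂ n (le_trans (le_max_right _ _) hn)
      simp [e₁, e₂]
    · have e₁ := (hx.symbol_der n e ξ hξ).2 i a ha b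
      have e₂ := (hy.symbol_der n e ξ hξ).2 i a ha b
      simp only [Prod.fst_add, Prod.snd_add, Pi.add_apply, add_apply, LinearMap.add_apply, e₁, e₂, add_mul, mul_add,
        smul_add]
      abel
    · have e₁ := hx.leibniz n e ξ hξ b a ha ζ
      have e₂ := hy.leibniz n e ξ hξ b a ha ζ
      simp only [Prod.fst_add, Prod.snd_add, Pi.add_apply, add_apply, LinearMap.add_apply, e₁, e₂, add_smul, smul_add]
      abel
    · have e₁ := h₃ n (le_trans (le_max_left _ _) hn)
      have e₂ := h₄ n (le_trans (le_max_right _ _) hn)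
      simp [e₁, e₂]
    · have e₁ := hx'.leibniz n e ξ hξ b a ha q
      have e₂ := hy'.leibniz n e ξ hξ b a ha q
      simp only [Prod.fst_add, Prod.snd_add, Pi.add_apply, add_apply, LinearMap.add_apply, e₁, e₂, add_smul, smul_add]
      abel
  smul_mem' := by
    rintro r x ⟨hx, hx'⟩
    obtain ⟨N₁, h₁⟩ := hx.finite
    obtain ⟨N₃, h₃⟩ := hx'.finite
    refine ⟨⟨⟨N₁, fun n hn => ?_⟩, fun k => (hx.symm k).smul r,
      fun k => (hx.deg k).smul r, fun n => (hx.symbol_symm n).smul r,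
      fun n e ξ hξ => ⟨Submodule.smul_mem _ _ (hx.symbol_der n e ξ hξ).1, fun i a ha b => ?_⟩,
      fun n => (hx.symbol_lin n).smul r, fun n e ξ hξ b a ha ζ => ?_⟩,
      ⟨⟨N₃, fun n hn => ?_⟩, fun n => (hx'.symm n).smul r,
        fun n => (hx'.deg n).smul r, fun n => (hx'.lin n).smul r,
        fun n e ξ hξ b a ha q => ?_⟩⟩
    · simp [h₁ n hn]
    · have e₁ := (hx.symbol_der n e ξ hξ).2 i a ha b
      simp only [Prod.smul_fst, Prod.smul_snd, Pi.smul_apply, smul_apply, LinearMap.smul_apply, e₁, smul_add,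
        smul_mul_assoc, mul_smul_comm, smul_comm r]
    · have e₁ := hx.leibniz n e ξ hξ b a ha ζ
      simp only [Prod.smul_fst, Prod.smul_snd, Pi.smul_apply, smul_apply, LinearMap.smul_apply, e₁, smul_add,
        smul_assoc, smul_comm _ r]
    · simp [h₃ n hn]
    · have e₁ := hx'.leibniz n e ξ hξ b a ha q
      simp only [Prod.smul_fst, Prod.smul_snd, Pi.smul_apply, smul_apply, LinearMap.smul_apply, e₁, smul_sub,
        smul_assoc, smul_comm _ r]

/-- The element `x` of `ℛ(Q)` belongs to `ℛ^k(Q)`. -/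
def HasEntries (k : ℕ)
    (x : Cochain K L L × Cochain K L (Module.End K A) × Cochain K L (Module.End K Q)) : Prop :=
  (∀ j, j ≠ k → x.1 j = 0) ∧ ∀ n, n + 1 ≠ k → x.2.1 n = 0 ∧ x.2.2 n = 0

/-- The bracket of operator valued families `f`, `g` of degrees `d`, `e`: the sum over `p`, `q` of
`∑_{σ ∈ S_{p,q}} (-1)^χ α(σ, ξ) [f_p(ξ_{σ(1)}, …, ξ_{σ(p)}), g_q(ξ_{σ(p+1)}, …, ξ_{σ(p+q)})]`,
`χ = e (|ξ_{σ(1)}| + ⋯ + |ξ_{σ(p)}|)`, where `[-, -]` is the graded commutator. -/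
def opBracket {V : Type*} [AddCommGroup V] [Module K V] (ℒ : ℤ → Submodule K L)
    [DirectSum.Decomposition ℒ] (d e : ℤ) (f g : Cochain K L (Module.End K V)) :
    Cochain K L (Module.End K V) := fun N =>
  ∑ pq ∈ Finset.HasAntidiagonal.antidiagonal N,
    shuffle ℒ (fun u v => sg K (e * u) •
      (TensorProduct.lift (LinearMap.mul K (Module.End K V) -
        sg K ((d + u) * (e + v)) • (LinearMap.mul K (Module.End K V)).flip)).compMultilinearMap
          ((f pq.1).domCoprod (g pq.2))) N

/-- The Lie bracket of `ℛ(Q)`, for elements of degrees `d` and `e`: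
`[X, Y] = X ∘ Y - (-1)^{de} Y ∘ X`,
`σ_{[X, Y]} = σ_X ∘ Y - (-1)^{de} σ_Y ∘ X + [σ_X, σ_Y]`,
`Δ'' = Δ ∘ Y - (-1)^{de} Δ' ∘ X - [Δ, Δ']`. -/
def rightBracket (ℒ : ℤ → Submodule K L) [DirectSum.Decomposition ℒ] (d e : ℤ)
    (x y : Cochain K L L × Cochain K L (Module.End K A) × Cochain K L (Module.End K Q)) :
    Cochain K L L × Cochain K L (Module.End K A) × Cochain K L (Module.End K Q) :=
  (circ ℒ x.1 y.1 - sg K (d * e) • circ ℒ y.1 x.1,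
    circ ℒ x.2.1 y.1 - sg K (d * e) • circ ℒ y.2.1 x.1 + opBracket ℒ d e x.2.1 y.2.1,
    circ ℒ x.2.2 y.1 - sg K (d * e) • circ ℒ y.2.2 x.1 - opBracket ℒ d e x.2.2 y.2.2)

/-- The derivation `η(𝕏)` of `Sym_A(L, A)` associated with a multiderivation `𝕏 = (X, σ)` of degree
`d`, applied to a form `ω` of degree `c`: `η(𝕏) ω = σ ∘ ω - (-1)^{dc} ω ∘ X`, where
`σ ∘ ω = ∑ α(τ, ξ) (-1)^χ σ(ξ_{τ(1)}, …)(ω(…, ξ_{τ(N)}))`. -/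
def eta (ℒ : ℤ → Submodule K L) [DirectSum.Decomposition ℒ] (d : ℤ) (X : Cochain K L L)
    (σ : Cochain K L (Module.End K A)) (c : ℤ) (ω : Cochain K L A) : Cochain K L A :=
  cstar ℒ c (LinearMap.id : Module.End K A →ₗ[K] (A →ₗ[K] A)) σ ω - sg K (d * c) • circ ℒ ω X

/-- The values on the generators `ξ₁ ⋯ ξ_N ⊗ q` of the operator associated with `(X, Δ)`, of degree
`d`: for elements with `k` entries,
`∑_{τ ∈ S_{k,N-k}} α(τ, ξ) X(ξ_{τ(1)}, …, ξ_{τ(k)}) ξ_{τ(k+1)} ⋯ ξ_{τ(N)} ⊗ q`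
`- ∑_{τ ∈ S_{N-k+1,k-1}} (-1)^χ α(τ, ξ) ξ_{τ(1)} ⋯ ξ_{τ(N-k+1)} ⊗ Δ(ξ_{τ(N-k+2)}, …, ξ_{τ(N)})(q)`,
with `χ = d (|ξ_{τ(1)}| + ⋯ + |ξ_{τ(N-k+1)}|)`. -/
def etaRight (𝒜 : ℤ → Submodule K A) (ℒ : ℤ → Submodule K L) [DirectSum.Decomposition ℒ] (d : ℤ)
    (X : Cochain K L L) (Δ : Cochain K L (Module.End K Q)) :
    Cochain K L (Q →ₗ[K] SymTensor 𝒜 ℒ Q) :=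
  circ ℒ (tens 𝒜 ℒ Q) X - cstar ℒ d (LinearMap.llcomp K Q Q (SymTensor 𝒜 ℒ Q)) (tens 𝒜 ℒ Q) Δ

end Spaces

/-- The components `V d` (inside some ambient space) form a graded Lie algebra with respect to a
bracket, `br d e` being the bracket of elements of degrees `d` and `e`. -/
structure IsGradedLieAlgebra {K E : Type*} [Field K] [AddCommGroup E] [Module K E]
    (V : ℤ → Submodule K E) (br : ℤ → ℤ → E → E → E) : Prop where
  mem : ∀ d e, ∀ x ∈ V d, ∀ y ∈ V e, br d e x y ∈ V (d + e)
  add_left : ∀ d e, ∀ x ∈ V d, ∀ x' ∈ V d, ∀ y ∈ V e, br d e (x + x') y = br d e x y + br d e x' y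
  smul_left : ∀ d e, ∀ r : K, ∀ x ∈ V d, ∀ y ∈ V e, br d e (r • x) y = r • br d e x y
  add_right : ∀ d e, ∀ x ∈ V d, ∀ y ∈ V e, ∀ y' ∈ V e,
    br d e x (y + y') = br d e x y + br d e x y'
  smul_right : ∀ d e, ∀ r : K, ∀ x ∈ V d, ∀ y ∈ V e, br d e x (r • y) = r • br d e x y
  skew : ∀ d e, ∀ x ∈ V d, ∀ y ∈ V e, br d e x y = -(sg K (d * e) • br e d y x)
  jacobi : ∀ d e f, ∀ x ∈ V d, ∀ y ∈ V e, ∀ z ∈ V f,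
    br d (e + f) x (br e f y z) =
      br (d + e) f (br d e x y) z + sg K (d * e) • br e (d + f) y (br d f x z)

end RightRep

end

set_option linter.unusedSectionVars false

namespace RightRep

open scoped DirectSum TensorProduct

/-! ### Unshuffles and the position of the first entry -/

section Unshuffles

/-! Maps with any number of entries are handled together as one family, a `Cochain`, and all
products involved (`cstar`, `circ`, `opBracket`) are signed sums over unshuffles. The first entry of
an unshuffle lies in one of its two blocks. Hence fixing a homogeneous first argument `a`, the
operation `ins a`, acts on each product by a graded Leibniz rule (`ins_cstar`, `ins_circ`,
`ins_opBracket`). Identities between families are then proved by induction on the number of entries: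
they are checked without entries, and in the inductive step the insertion rules reduce them to a
comparison of signs. This yields associativity of products (`cstar_assoc`), the fact that insertion
of `X` is a derivation of products (`circ_cstar`), and the graded symmetry of the associator of
`circ` in its last two arguments (`circ_preLie`).

For the Lie algebra of right pairs put `φ = -Δ`. Then `φ` takes values in ordinary derivations with
symbol `σ`, and the components `σ` and `φ` of a bracket obey one and the same formula,
`twistedBracket`. A pair `(X, φ)` acts on families by `F ↦ F ∘ X + F φ` (`rightOp`). The three
identities above show that brackets go to commutators in the opposite order (`rightOp_bracket`).
Evaluation at the constant `1` recovers `φ`, so the bracket is expressed through the action, and the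
Jacobi identity becomes formal (`twistedBracket_jacobi`). The linearity and Leibniz conditions
survive because the terms in which a coefficient is differentiated cancel or match
(`FirstLeft.operator`, `FirstRight.operator`, `FirstLeibniz.bracket`).

The generators `ξ₁ ⋯ ξ_n ⊗ q` form the universal symmetric right linear family `tens`. The operator
`D` of `(X, φ)` is defined by sending `tens` to `rightOp` of `tens`, which is again symmetric and
right linear. Composing with an operator on the outside commutes with `rightOp`, so the reversed
order of the action turns into the correct order for operators, and brackets are preserved
(`etaPair_bracket`). In the module Leibniz rule, moving `φ` past a form `ω` produces `σ ∘ ω`, and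
the derivation `∘ X` produces `ω ∘ X`. Together these are `η(𝕏) ω`
(`IsRightPair.isModuleDerivation`).

If `L` is projective and finitely generated, it has a homogeneous dual frame, `id_L = ∑ f_i b_i`
(`exists_isDualFrame`). Inserting `id_L` into all slots multiplies by the number of entries
(`circ_idC_right`). Expanding `id_L` in the frame and using characteristic zero, a derivation of
forms is determined by its values on `A` and on the `f_i` (`IsFormDerivation.eq_zero`), and a tensor
by its weight zero part and its contractions with the `f_i` (`eq_zero_of_contract`). For
injectivity, `σ` is read off on `A`, `X` on the `f_i`, and `φ` from the weight zero part of `D`. For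
surjectivity the same recipes define `σ`, `X` and `φ` from a given derivation
(`isRightPair_of_derivation`), and the determination statements show that the derivation obtained
from them is the given one (`mem_range_etaPair`). -/

/-- Removing the first element of the left block. -/
def splitLeft (p q : ℕ) : Fin (p + 1) ⊕ Fin q ≃ Option (Fin p ⊕ Fin q) where
  toFun := Sum.elim (Fin.cases none fun i => some (Sum.inl i)) fun j => some (Sum.inr j)
  invFun := fun o => o.elim (Sum.inl 0) (Sum.elim (fun i => Sum.inl i.succ) Sum.inr)
  left_inv := by
    rintro (i | j)
    · refine Fin.cases ?_ (fun i => ?_) i <;> simp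
    · simp
  right_inv := by rintro (_ | _ | _) <;> simp

/-- Removing the first element of the right block. -/
def splitRight (p q : ℕ) : Fin p ⊕ Fin (q + 1) ≃ Option (Fin p ⊕ Fin q) where
  toFun := Sum.elim (fun i => some (Sum.inl i)) (Fin.cases none fun j => some (Sum.inr j))
  invFun := fun o => o.elim (Sum.inr 0) (Sum.elim Sum.inl fun j => Sum.inr j.succ)
  left_inv := by
    rintro (i | j)
    · simp
    · refine Fin.cases ?_ (fun i => ?_) j <;> simp
  right_inv := by rintro (_ | _ | _) <;> simp

/-- Extension of a bijection onto `Fin N` by a new element mapped to `0`. -/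
def consEquiv {S S' : Type*} {N : ℕ} (o : S' ≃ Option S) (σ : S ≃ Fin N) : S' ≃ Fin (N + 1) :=
  (o.trans σ.optionCongr).trans (finSuccEquiv N).symm

variable {N : ℕ}

theorem consEquiv_surj {S S' : Type*} (o : S' ≃ Option S) (τ : S' ≃ Fin (N + 1))
    (h : τ (o.symm none) = 0) : ∃ σ, consEquiv o σ = τ := by
  have h0 : ((o.symm.trans τ).trans (finSuccEquiv N)) none = none := by simp [h]
  refine ⟨Equiv.removeNone ((o.symm.trans τ).trans (finSuccEquiv N)), ?_⟩
  ext x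
  obtain ⟨y, rfl⟩ := o.symm.surjective x
  rcases y with _ | y
  · simp [consEquiv, h]
  -- Only `none` is mapped to `none`, so on the remaining elements `removeNone` is the honest
  -- restriction and not a default value.
  · have : ∃ z, ((o.symm.trans τ).trans (finSuccEquiv N)) (some y) = some z := by
      rw [← Option.ne_none_iff_exists']
      intro h1
      have := (Equiv.injective _) (h1.trans h0.symm)
      simp at this
    have h2 := Equiv.removeNone_some _ this
    simp only [consEquiv, Equiv.trans_apply, Equiv.apply_symm_apply, Equiv.optionCongr_apply,
      Option.map_some, h2]
    simp

theorem consEquiv_injective {S S' : Type*} (o : S' ≃ Option S) :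
    Function.Injective (consEquiv (N := N) o) := by
  intro σ τ h
  apply Equiv.optionCongr_injective
  ext x
  have := congrArg (fun e => (finSuccEquiv N) (e (o.symm x))) h
  simp only [consEquiv, Equiv.trans_apply, Equiv.apply_symm_apply] at this
  rw [this]

variable {p q : ℕ}

theorem consLeft_inl (σ : Fin p ⊕ Fin q ≃ Fin N) :
    (fun i => consEquiv (splitLeft p q) σ (Sum.inl i)) =
      Fin.cons 0 fun i => (σ (Sum.inl i)).succ := by
  funext i
  refine Fin.cases ?_ (fun i => ?_) i <;> simp [consEquiv, splitLeft]

theorem consLeft_inr (σ : Fin p ⊕ Fin q ≃ Fin N) (j : Fin q) :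
    consEquiv (splitLeft p q) σ (Sum.inr j) = (σ (Sum.inr j)).succ := by
  simp [consEquiv, splitLeft]

theorem consRight_inr (σ : Fin p ⊕ Fin q ≃ Fin N) :
    (fun i => consEquiv (splitRight p q) σ (Sum.inr i)) =
      Fin.cons 0 fun i => (σ (Sum.inr i)).succ := by
  funext i
  refine Fin.cases ?_ (fun i => ?_) i <;> simp [consEquiv, splitRight]

theorem consRight_inl (σ : Fin p ⊕ Fin q ≃ Fin N) (j : Fin p) :
    consEquiv (splitRight p q) σ (Sum.inl j) = (σ (Sum.inl j)).succ := by
  simp [consEquiv, splitRight]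

theorem strictMono_cons_zero_iff {n : ℕ} (f : Fin n → Fin N) :
    StrictMono (Fin.cons 0 fun i => (f i).succ : Fin (n + 1) → Fin (N + 1)) ↔ StrictMono f := by
  constructor
  · intro h i j hij
    have := h (Fin.succ_lt_succ_iff.2 hij)
    simpa using this
  · intro h i j
    refine Fin.cases (fun hij => ?_) (fun i => ?_) i
    · refine Fin.cases (fun hij => absurd hij (lt_irrefl _)) (fun j _ => ?_) j hij
      simp
    · refine Fin.cases (fun hij => absurd hij (by simp)) (fun j hij => ?_) j
      simpa using h (Fin.succ_lt_succ_iff.1 hij)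

theorem mem_unshuffles {σ : Fin p ⊕ Fin q ≃ Fin N} : σ ∈ unshuffles p q N ↔
    StrictMono (fun i => σ (Sum.inl i)) ∧ StrictMono (fun j => σ (Sum.inr j)) := by
  simp [unshuffles]

theorem consLeft_mem {σ : Fin p ⊕ Fin q ≃ Fin N} :
    consEquiv (splitLeft p q) σ ∈ unshuffles (p + 1) q (N + 1) ↔ σ ∈ unshuffles p q N := by
  rw [mem_unshuffles, mem_unshuffles, consLeft_inl, strictMono_cons_zero_iff]
  simp only [consLeft_inr]
  refine and_congr_right fun _ => ?_
  simp [StrictMono]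

theorem consRight_mem {σ : Fin p ⊕ Fin q ≃ Fin N} :
    consEquiv (splitRight p q) σ ∈ unshuffles p (q + 1) (N + 1) ↔ σ ∈ unshuffles p q N := by
  rw [mem_unshuffles, mem_unshuffles, consRight_inr, strictMono_cons_zero_iff]
  simp only [consRight_inl]
  refine and_congr_left fun _ => ?_
  simp [StrictMono]

theorem strictMono_apply_zero {n : ℕ} {f : Fin (n + 1) → Fin (N + 1)} (hf : StrictMono f)
    (i : Fin (n + 1)) (h : f i = 0) : f 0 = 0 :=
  le_antisymm (h ▸ hf.monotone (Fin.zero_le i)) (Fin.zero_le _)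

variable {W : Type*} [AddCommGroup W]

/-- A block is increasing, so if it contains `0` then `0` is its first entry. Deleting that entry
leaves an arbitrary unshuffle of one element less. -/
theorem sum_unshuffles_left (G : (Fin (p + 1) ⊕ Fin q ≃ Fin (N + 1)) → W) :
    ∑ σ ∈ unshuffles (p + 1) q (N + 1) with (σ.symm 0).isLeft, G σ =
      ∑ σ ∈ unshuffles p q N, G (consEquiv (splitLeft p q) σ) := by
  symm
  refine Finset.sum_bij (fun σ _ => consEquiv (splitLeft p q) σ) ?_ ?_ ?_ fun _ _ => rfl
  · intro σ hσ
    rw [Finset.mem_filter]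
    refine ⟨consLeft_mem.2 hσ, ?_⟩
    have : consEquiv (splitLeft p q) σ (Sum.inl 0) = 0 := congrFun (consLeft_inl σ) 0
    rw [← this]; simp
  · intro σ _ τ _ h
    exact consEquiv_injective _ h
  · intro τ hτ
    rw [Finset.mem_filter] at hτ
    obtain ⟨i, hi⟩ := Sum.isLeft_iff.1 hτ.2
    have h0 := strictMono_apply_zero (mem_unshuffles.1 hτ.1).1 i (by rw [← hi]; simp)
    obtain ⟨σ, rfl⟩ := consEquiv_surj (splitLeft p q) τ h0
    exact ⟨σ, consLeft_mem.1 hτ.1, rfl⟩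

theorem sum_unshuffles_right (G : (Fin p ⊕ Fin (q + 1) ≃ Fin (N + 1)) → W) :
    ∑ σ ∈ unshuffles p (q + 1) (N + 1) with ¬ (σ.symm 0).isLeft, G σ =
      ∑ σ ∈ unshuffles p q N, G (consEquiv (splitRight p q) σ) := by
  symm
  refine Finset.sum_bij (fun σ _ => consEquiv (splitRight p q) σ) ?_ ?_ ?_ fun _ _ => rfl
  · intro σ hσ
    rw [Finset.mem_filter]
    refine ⟨consRight_mem.2 hσ, ?_⟩
    have : consEquiv (splitRight p q) σ (Sum.inr 0) = 0 := congrFun (consRight_inr σ) 0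
    rw [← this]; simp
  · intro σ _ τ _ h
    exact consEquiv_injective _ h
  · intro τ hτ
    rw [Finset.mem_filter, Sum.not_isLeft] at hτ
    obtain ⟨i, hi⟩ := Sum.isRight_iff.1 hτ.2
    have h0 := strictMono_apply_zero (mem_unshuffles.1 hτ.1).2 i (by rw [← hi]; simp)
    obtain ⟨σ, rfl⟩ := consEquiv_surj (splitRight p q) τ h0
    exact ⟨σ, consRight_mem.1 hτ.1, rfl⟩

/-- The smallest element belongs to exactly one of the two blocks. This dichotomy is the origin of
all Leibniz rules for `ins`. -/
theorem sum_unshuffles_succ (G : ∀ p q : ℕ, (Fin p ⊕ Fin q ≃ Fin (N + 1)) → W) :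
    ∑ pq ∈ Finset.HasAntidiagonal.antidiagonal (N + 1),
        ∑ σ ∈ unshuffles pq.1 pq.2 (N + 1), G pq.1 pq.2 σ =
      ∑ pq ∈ Finset.HasAntidiagonal.antidiagonal N, ∑ σ ∈ unshuffles pq.1 pq.2 N,
        G (pq.1 + 1) pq.2 (consEquiv (splitLeft pq.1 pq.2) σ) +
      ∑ pq ∈ Finset.HasAntidiagonal.antidiagonal N, ∑ σ ∈ unshuffles pq.1 pq.2 N,
        G pq.1 (pq.2 + 1) (consEquiv (splitRight pq.1 pq.2) σ) := by
  simp_rw [← fun pq : ℕ × ℕ => Finset.sum_filter_add_sum_filter_not (unshuffles pq.1 pq.2 (N + 1))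
    (fun σ => (σ.symm 0).isLeft) (G pq.1 pq.2)]
  rw [Finset.sum_add_distrib]
  congr 1
  · rw [Finset.Nat.sum_antidiagonal_succ]
    simp only [sum_unshuffles_left]
    -- The leftover summand has an empty left block, which cannot contain `0`.
    rw [add_eq_right]
    refine Finset.sum_eq_zero fun σ hσ => ?_
    obtain ⟨i, -⟩ := Sum.isLeft_iff.1 (Finset.mem_filter.1 hσ).2
    exact i.elim0
  · rw [Finset.Nat.sum_antidiagonal_succ']
    simp only [sum_unshuffles_right]
    rw [add_eq_right]
    refine Finset.sum_eq_zero fun σ hσ => ?_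
    obtain ⟨i, -⟩ := Sum.isRight_iff.1 (Sum.not_isLeft.1 (Finset.mem_filter.1 hσ).2)
    exact i.elim0

theorem koszul_consLeft (σ : Fin p ⊕ Fin q ≃ Fin N) (i : ℤ) (e : Fin N → ℤ) :
    koszul (consEquiv (splitLeft p q) σ) (Fin.cons i e : Fin (N + 1) → ℤ) = koszul σ e := by
  have h := fun x => congrFun (consLeft_inl σ) x
  simp [koszul, h, consLeft_inr, Fin.sum_univ_succ]

/-- An entry that comes first but is sent to the right block is carried past the whole left block.
-/
theorem koszul_consRight (σ : Fin p ⊕ Fin q ≃ Fin N) (i : ℤ) (e : Fin N → ℤ) :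
    koszul (consEquiv (splitRight p q) σ) (Fin.cons i e : Fin (N + 1) → ℤ) =
      koszul σ e + i * ∑ x, e (σ (Sum.inl x)) := by
  have h := fun x => congrFun (consRight_inr σ) x
  simp [koszul, h, consRight_inl, Fin.sum_univ_succ, Finset.sum_add_distrib, Finset.mul_sum,
    mul_comm, add_comm]

end Unshuffles

theorem sg_zero {K : Type*} [Field K] : sg K 0 = 1 := by simp [sg]

theorem sg_mul_self {K : Type*} [Field K] (n : ℤ) : sg K n * sg K n = 1 := by
  unfold sg; split_ifs <;> simp

/-! ### Signed sums over unshuffles with blocks of all sizes. -/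

section ShuffleSum

variable {K L W : Type*} [Field K] [AddCommGroup W] [Module K W]

/-- The signed sum over all unshuffles, with blocks of any size, of a function of the sizes, of the
degrees and of the entries of the blocks. -/
def shuffleSum (K : Type*) [Field K] {L W : Type*} [AddCommGroup W] [Module K W]
    (h : ∀ p q : ℕ, ℤ → ℤ → (Fin p → L) → (Fin q → L) → W) {N : ℕ} (e : Fin N → ℤ)
    (ξ : Fin N → L) : W :=
  ∑ pq ∈ Finset.HasAntidiagonal.antidiagonal N, ∑ σ ∈ unshuffles pq.1 pq.2 N,
    sg K (koszul σ e) • h pq.1 pq.2 (∑ i, e (σ (Sum.inl i))) (∑ j, e (σ (Sum.inr j)))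
      (fun i => ξ (σ (Sum.inl i))) (fun j => ξ (σ (Sum.inr j)))

/-- The recursion behind every insertion rule. The summand `h` sees the integer degrees of both
blocks, so the degree `i` of the new entry must be added on the side that receives it. -/
theorem shuffleSum_cons (h : ∀ p q : ℕ, ℤ → ℤ → (Fin p → L) → (Fin q → L) → W) {N : ℕ}
    (i : ℤ) (a : L) (e : Fin N → ℤ) (ξ : Fin N → L) :
    shuffleSum K h (Fin.cons i e : Fin (N + 1) → ℤ) (Fin.cons a ξ : Fin (N + 1) → L) =
      shuffleSum K (fun p q u v x y => h (p + 1) q (i + u) v (Fin.cons a x : Fin (p + 1) → L) y)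
        e ξ +
      shuffleSum K (fun p q u v x y =>
        sg K (i * u) • h p (q + 1) u (i + v) x (Fin.cons a y : Fin (q + 1) → L)) e ξ := by
  rw [shuffleSum, sum_unshuffles_succ (fun p q σ => sg K (koszul σ (Fin.cons i e : Fin (N + 1) → ℤ)) •
    h p q (∑ x, (Fin.cons i e : Fin (N + 1) → ℤ) (σ (Sum.inl x)))
      (∑ j, (Fin.cons i e : Fin (N + 1) → ℤ) (σ (Sum.inr j)))
      (fun x => (Fin.cons a ξ : Fin (N + 1) → L) (σ (Sum.inl x)))
      (fun j => (Fin.cons a ξ : Fin (N + 1) → L) (σ (Sum.inr j))))]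
  congr 1
  · refine Finset.sum_congr rfl fun pq _ => Finset.sum_congr rfl fun σ _ => ?_
    have hl := fun x => congrFun (consLeft_inl σ) x
    rw [koszul_consLeft]
    simp only [hl, consLeft_inr, Fin.cons_succ]
    congr 2
    · simp [Fin.sum_univ_succ]
    · funext x; refine Fin.cases ?_ (fun x => ?_) x <;> simp
  · refine Finset.sum_congr rfl fun pq _ => Finset.sum_congr rfl fun σ _ => ?_
    have hl := fun x => congrFun (consRight_inr σ) x
    rw [koszul_consRight, sg_add, mul_smul]
    simp only [hl, consRight_inl, Fin.cons_succ]
    congr 3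
    · simp [Fin.sum_univ_succ]
    · funext x; refine Fin.cases ?_ (fun x => ?_) x <;> simp

theorem shuffleSum_zero (h : ∀ p q : ℕ, ℤ → ℤ → (Fin p → L) → (Fin q → L) → W)
    (e : Fin 0 → ℤ) (ξ : Fin 0 → L) : shuffleSum K h e ξ = h 0 0 0 0 ξ ξ := by
  have hu : unshuffles 0 0 0 = {Equiv.equivOfIsEmpty _ _} := by
    ext σ
    rw [mem_unshuffles, Finset.mem_singleton]
    exact iff_of_true ⟨fun i => i.elim0, fun i => i.elim0⟩ (Subsingleton.elim _ _)
  simp only [shuffleSum, Finset.HasAntidiagonal.antidiagonal_zero, Finset.sum_singleton, hu, koszul,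
    Finset.univ_eq_empty, Finset.sum_empty, sg_zero, one_smul]
  congr 1 <;> exact Subsingleton.elim _ _

theorem shuffleSum_add (h h' : ∀ p q : ℕ, ℤ → ℤ → (Fin p → L) → (Fin q → L) → W) {N : ℕ}
    (e : Fin N → ℤ) (ξ : Fin N → L) :
    shuffleSum K (fun p q u v x y => h p q u v x y + h' p q u v x y) e ξ =
      shuffleSum K h e ξ + shuffleSum K h' e ξ := by
  simp [shuffleSum, Finset.sum_add_distrib]

theorem shuffleSum_smul (r : K) (h : ∀ p q : ℕ, ℤ → ℤ → (Fin p → L) → (Fin q → L) → W) {N : ℕ}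
    (e : Fin N → ℤ) (ξ : Fin N → L) :
    shuffleSum K (fun p q u v x y => r • h p q u v x y) e ξ = r • shuffleSum K h e ξ := by
  simp [shuffleSum, Finset.smul_sum, smul_comm _ r]

theorem map_shuffleSum {W' : Type*} [AddCommGroup W'] [Module K W'] (f : W →ₗ[K] W')
    (h : ∀ p q : ℕ, ℤ → ℤ → (Fin p → L) → (Fin q → L) → W) {N : ℕ}
    (e : Fin N → ℤ) (ξ : Fin N → L) :
    f (shuffleSum K h e ξ) = shuffleSum K (fun p q u v x y => f (h p q u v x y)) e ξ := by
  simp [shuffleSum]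

end ShuffleSum

end RightRep

namespace RightRep

open scoped DirectSum TensorProduct

/-! ### Calculus of families of multilinear maps -/

section Calculus

variable {K L : Type*} [Field K] [AddCommGroup L] [Module K L]
variable {U V W W' : Type*} [AddCommGroup U] [Module K U] [AddCommGroup V] [Module K V]
  [AddCommGroup W] [Module K W] [AddCommGroup W'] [Module K W']

/-- Insertion of `a` as the first argument. -/
def ins (a : L) (F : Cochain K L W) : Cochain K L W := fun n => (F (n + 1)).curryLeft a

theorem ins_apply (a : L) (F : Cochain K L W) (n : ℕ) (ξ : Fin n → L) :
    ins a F n ξ = F (n + 1) (Fin.cons a ξ : Fin (n + 1) → L) := rfl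

theorem ins_add (a : L) (F G : Cochain K L W) : ins a (F + G) = ins a F + ins a G := rfl

theorem ins_sub (a : L) (F G : Cochain K L W) : ins a (F - G) = ins a F - ins a G := rfl

theorem ins_smul (a : L) (r : K) (F : Cochain K L W) : ins a (r • F) = r • ins a F := rfl

/-- Postcomposition with a linear map. -/
def mapC (ℓ : W →ₗ[K] W') (F : Cochain K L W) : Cochain K L W' := fun n =>
  ℓ.compMultilinearMap (F n)

theorem mapC_apply (ℓ : W →ₗ[K] W') (F : Cochain K L W) (n : ℕ) (ξ : Fin n → L) :
    mapC ℓ F n ξ = ℓ (F n ξ) := rfl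

theorem ins_mapC (a : L) (ℓ : W →ₗ[K] W') (F : Cochain K L W) :
    ins a (mapC ℓ F) = mapC ℓ (ins a F) := rfl

/-- A constant, as a family concentrated in arity `0`. -/
def cst (K L : Type*) [Field K] [AddCommGroup L] [Module K L] {W : Type*} [AddCommGroup W]
    [Module K W] (w : W) : Cochain K L W
  | 0 => MultilinearMap.constOfIsEmpty K _ w
  | _ + 1 => 0

theorem ins_cst (a : L) (w : W) : ins a (cst K L w) = 0 := rfl

theorem cst_zero_apply (w : W) (ξ : Fin 0 → L) : cst K L w 0 ξ = w := rfl

theorem cst_succ (w : W) (n : ℕ) : cst K L w (n + 1) = 0 := rfl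

/-- The identity of `L`, as a family concentrated in arity `1`. -/
def idC (K L : Type*) [Field K] [AddCommGroup L] [Module K L] : Cochain K L L
  | 1 => MultilinearMap.ofSubsingleton K L L (0 : Fin 1) LinearMap.id
  | 0 => 0
  | _ + 2 => 0

theorem idC_one_apply (ξ : Fin 1 → L) : idC K L 1 ξ = ξ 0 := rfl

theorem ins_idC (a : L) : ins a (idC K L) = cst K L a := by
  funext n
  ext ξ
  rcases n with _ | n <;> rfl

variable (ℒ : ℤ → Submodule K L)

/-- A family consisting of graded symmetric maps. -/
def SymmC (F : Cochain K L W) : Prop := ∀ n, GrSymm ℒ (F n)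

/-- A family consisting of maps of degree `d`. -/
def DegC (𝒲 : ℤ → Submodule K W) (d : ℤ) (F : Cochain K L W) : Prop := ∀ n, HasDeg ℒ 𝒲 d (F n)

variable {ℒ}

theorem isHom_cons {n : ℕ} {i : ℤ} {a : L} (ha : a ∈ ℒ i) {e : Fin n → ℤ} {ξ : Fin n → L}
    (hξ : IsHom ℒ e ξ) :
    IsHom ℒ (Fin.cons i e : Fin (n + 1) → ℤ) (Fin.cons a ξ : Fin (n + 1) → L) := by
  intro x
  refine Fin.cases ?_ (fun x => ?_) x
  · simpa using ha
  · simpa using hξ x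

theorem IsHom.tail {n : ℕ} {e : Fin (n + 1) → ℤ} {ξ : Fin (n + 1) → L} (hξ : IsHom ℒ e ξ) :
    IsHom ℒ (Fin.tail e) (Fin.tail ξ) := fun i => hξ i.succ

theorem DegC.ins {𝒲 : ℤ → Submodule K W} {d : ℤ} {F : Cochain K L W} (hF : DegC ℒ 𝒲 d F) {i : ℤ}
    {a : L} (ha : a ∈ ℒ i) : DegC ℒ 𝒲 (d + i) (ins a F) := by
  intro n e ξ hξ
  have := hF (n + 1) _ _ (isHom_cons ha hξ)
  rw [Fin.sum_univ_succ, ← add_assoc] at this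
  simpa [ins_apply] using this

theorem DegC.zero_apply {𝒲 : ℤ → Submodule K W} {d : ℤ} {F : Cochain K L W} (hF : DegC ℒ 𝒲 d F)
    (ξ : Fin 0 → L) : F 0 ξ ∈ 𝒲 d := by
  have := hF 0 (fun _ => 0) ξ (fun i => i.elim0)
  simpa using this

theorem DegC.add {𝒲 : ℤ → Submodule K W} {d : ℤ} {F G : Cochain K L W} (hF : DegC ℒ 𝒲 d F)
    (hG : DegC ℒ 𝒲 d G) : DegC ℒ 𝒲 d (F + G) := fun n => (hF n).add (hG n)

theorem DegC.smul {𝒲 : ℤ → Submodule K W} {d : ℤ} {F : Cochain K L W} (r : K)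
    (hF : DegC ℒ 𝒲 d F) : DegC ℒ 𝒲 d (r • F) := fun n => (hF n).smul r

theorem DegC.neg {𝒲 : ℤ → Submodule K W} {d : ℤ} {F : Cochain K L W}
    (hF : DegC ℒ 𝒲 d F) : DegC ℒ 𝒲 d (-F) := by
  rw [← neg_one_smul K F]; exact hF.smul _

theorem DegC.sub {𝒲 : ℤ → Submodule K W} {d : ℤ} {F G : Cochain K L W} (hF : DegC ℒ 𝒲 d F)
    (hG : DegC ℒ 𝒲 d G) : DegC ℒ 𝒲 d (F - G) := by
  rw [sub_eq_add_neg]; exact hF.add hG.neg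

theorem DegC.cst {𝒲 : ℤ → Submodule K W} {d : ℤ} {w : W} (hw : w ∈ 𝒲 d) :
    DegC ℒ 𝒲 d (cst K L w)
  | 0, e, ξ, _ => by simpa [cst_zero_apply] using hw
  | _ + 1, _, _, _ => Submodule.zero_mem _

theorem SymmC.add {F G : Cochain K L W} (hF : SymmC ℒ F) (hG : SymmC ℒ G) : SymmC ℒ (F + G) :=
  fun n => (hF n).add (hG n)

theorem SymmC.smul {F : Cochain K L W} (r : K) (hF : SymmC ℒ F) : SymmC ℒ (r • F) :=
  fun n => (hF n).smul r

theorem SymmC.neg {F : Cochain K L W} (hF : SymmC ℒ F) : SymmC ℒ (-F) := by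
  rw [← neg_one_smul K F]; exact hF.smul _

theorem SymmC.sub {F G : Cochain K L W} (hF : SymmC ℒ F) (hG : SymmC ℒ G) : SymmC ℒ (F - G) := by
  rw [sub_eq_add_neg]; exact hF.add hG.neg

theorem SymmC.mapC {F : Cochain K L W} (ℓ : W →ₗ[K] W') (hF : SymmC ℒ F) : SymmC ℒ (mapC ℓ F) := by
  intro n e ξ hξ i j hij
  rw [mapC_apply, mapC_apply, hF n e ξ hξ i j hij, map_smul]

theorem SymmC.cst (w : W) : SymmC ℒ (cst K L w)
  | 0, _, _, _, i, _, _ => i.elim0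
  | _ + 1, _, _, _, _, _, _ => by simp [cst_succ]

theorem SymmC.idC : SymmC ℒ (idC K L)
  | 0, _, _, _, i, _, _ => i.elim0
  | 1, _, _, _, i, j, h => by omega
  | _ + 2, _, _, _, _, _, _ => (smul_zero _).symm

theorem DegC.idC : DegC ℒ ℒ 0 (idC K L)
  | 0, _, _, _ => Submodule.zero_mem _
  | 1, e, ξ, h => by simpa [idC_one_apply] using h 0
  | _ + 2, _, _, _ => Submodule.zero_mem _

theorem SymmC.ins {F : Cochain K L W} (hF : SymmC ℒ F) {i : ℤ} {a : L} (ha : a ∈ ℒ i) :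
    SymmC ℒ (ins a F) := by
  intro n e ξ hξ x y hxy
  have := hF (n + 1) _ _ (isHom_cons ha hξ) x.succ y.succ (by simp [hxy])
  rw [ins_apply, ins_apply]
  simp only [Fin.cons_succ] at this
  rw [← this]
  congr 1
  funext z
  refine Fin.cases ?_ (fun z => ?_) z
  · rw [Function.comp_apply, Equiv.swap_apply_of_ne_of_ne (Fin.succ_ne_zero _).symm
      (Fin.succ_ne_zero _).symm]
    rfl
  · simp [← (Fin.succ_injective n).map_swap]

theorem swap_zero_one_cons {n : ℕ} (a b : L) (ξ : Fin n → L) :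
    (Fin.cons b (Fin.cons a ξ : Fin (n + 1) → L) : Fin (n + 2) → L) ∘ Equiv.swap 0 1 =
      Fin.cons a (Fin.cons b ξ : Fin (n + 1) → L) := by
  funext z
  refine Fin.cases ?_ (fun z => ?_) z
  · simp
  · refine Fin.cases ?_ (fun z => ?_) z
    · simp
    · rw [Function.comp_apply, Equiv.swap_apply_of_ne_of_ne (Fin.succ_ne_zero _)
        (Fin.ne_of_val_ne (by simp))]
      simp

variable [DirectSum.Decomposition ℒ]

theorem hom_induction {p : L → Prop} (h0 : p 0) (hadd : ∀ x y, p x → p y → p (x + y))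
    (hom : ∀ i, ∀ a ∈ ℒ i, p a) (x : L) : p x :=
  DirectSum.Decomposition.inductionOn ℒ h0 (fun a => hom _ a a.2) hadd x

/-- Inductive step for identities between families: since `L` is spanned by homogeneous elements, it
suffices to compare after inserting a homogeneous first argument. -/
theorem succ_ext {n : ℕ} {F G : Cochain K L W}
    (h : ∀ i, ∀ a ∈ ℒ i, ins a F n = ins a G n) : F (n + 1) = G (n + 1) := by
  have : (F (n + 1)).curryLeft = (G (n + 1)).curryLeft := by
    ext1 a
    induction a using hom_induction (ℒ := ℒ) with
    | h0 => simp
    | hadd x y hx hy => rw [map_add, map_add, hx, hy]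
    | hom i a ha => exact h i a ha
  rw [← (F (n + 1)).uncurry_curryLeft, this, (G (n + 1)).uncurry_curryLeft]

theorem zero_ext {F G : Cochain K L W} (h : ∀ ξ, F 0 ξ = G 0 ξ) : F 0 = G 0 := by
  ext ξ; exact h ξ

theorem arity_ext (ℒ : ℤ → Submodule K L) [DirectSum.Decomposition ℒ] {n : ℕ} {F G : Cochain K L W}
    (h : ∀ e ξ, IsHom ℒ e ξ → F n ξ = G n ξ) : F n = G n := by
  induction n generalizing F G with
  | zero => exact zero_ext fun ξ => h (fun _ => 0) ξ fun i => i.elim0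
  | succ n ih =>
    refine succ_ext (ℒ := ℒ) fun i a ha => ih fun e ξ hξ => ?_
    exact h _ _ (isHom_cons ha hξ)

theorem cochain_ext (ℒ : ℤ → Submodule K L) [DirectSum.Decomposition ℒ] {F G : Cochain K L W}
    (h : ∀ n e ξ, IsHom ℒ e ξ → F n ξ = G n ξ) : F = G :=
  funext fun n => arity_ext ℒ (h n)

theorem ins_comm {F : Cochain K L W} (hF : SymmC ℒ F) {i j : ℤ} {a b : L} (ha : a ∈ ℒ i)
    (hb : b ∈ ℒ j) : ins b (ins a F) = sg K (i * j) • ins a (ins b F) := by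
  refine cochain_ext ℒ fun n e ξ hξ => ?_
  have := hF (n + 2) _ _ (isHom_cons hb (isHom_cons ha hξ)) 0 1 (by simp)
  rw [swap_zero_one_cons] at this
  simpa [ins_apply, mul_comm] using this

/-- An adjacent transposition either moves only the arguments after the first, or exchanges the
first two. The two hypotheses treat these two cases. -/
theorem grSymm_succ {n : ℕ} {F : Cochain K L W} (h : ∀ i, ∀ a ∈ ℒ i, GrSymm ℒ (ins a F n))
    (h' : ∀ i, ∀ a ∈ ℒ i, ∀ j, ∀ b ∈ ℒ j,
      ins b (ins a F) = sg K (i * j) • ins a (ins b F)) :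
    GrSymm ℒ (F (n + 1)) := by
  intro e ξ hξ x y hxy
  obtain ⟨y, rfl⟩ : ∃ y', y = Fin.succ y' := ⟨y.pred (by rintro rfl; simp at hxy), by simp⟩
  induction x using Fin.cases with
  | zero =>
    rcases n with _ | n
    · exact y.elim0
    have hy : y = 0 := by ext; simpa using hxy
    subst hy
    -- The order of the two inserted arguments is reversed here because `swap_zero_one_cons` puts
    -- the second one in front.
    have := congrFun (h' _ _ (hξ 1) _ _ (hξ 0)) n
    have := congrArg (fun f => f (Fin.tail (Fin.tail ξ))) this
    simp only [ins_apply, smul_apply, Pi.smul_apply] at this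
    rw [← swap_zero_one_cons] at this
    have hc : (Fin.cons (ξ 0) (Fin.cons (ξ 1) (Fin.tail (Fin.tail ξ)) : Fin (n + 1) → L) :
        Fin (n + 2) → L) = ξ := by
      funext z
      refine Fin.cases rfl (fun z => ?_) z
      refine Fin.cases rfl (fun z => ?_) z
      simp [Fin.tail]
    rw [hc] at this
    rw [mul_comm]
    exact this
  | succ x =>
    have := h _ _ (hξ 0) _ _ hξ.tail x y (by simpa using hxy)
    rw [ins_apply, ins_apply] at this
    have hc : (Fin.cons (ξ 0) (Fin.tail ξ) : Fin (n + 1) → L) = ξ := Fin.cons_self_tail ξ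
    rw [hc] at this
    refine Eq.trans ?_ this
    congr 1
    funext z
    refine Fin.cases ?_ (fun z => ?_) z
    · rw [Function.comp_apply, Equiv.swap_apply_of_ne_of_ne (Fin.succ_ne_zero _).symm
        (Fin.succ_ne_zero _).symm]
      rfl
    · simp [← (Fin.succ_injective n).map_swap, Fin.tail]

/-! Values on homogeneous arguments -/

theorem cstar_apply (c : ℤ) (B : U →ₗ[K] V →ₗ[K] W) (f : Cochain K L U) (g : Cochain K L V) {N : ℕ}
    {e : Fin N → ℤ} {ξ : Fin N → L} (hξ : IsHom ℒ e ξ) : cstar ℒ c B f g N ξ =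
      shuffleSum K (fun p q u _ x y => sg K (c * u) • B (f p x) (g q y)) e ξ := by
  simp only [cstar, sum_apply, star_apply ℒ c B _ _ hξ, shuffleSum, sg_add, mul_smul]

theorem circ_apply (F : Cochain K L W) (X : Cochain K L L) {N : ℕ}
    {e : Fin N → ℤ} {ξ : Fin N → L} (hξ : IsHom ℒ e ξ) : circ ℒ F X N ξ =
      shuffleSum K (fun p q _ _ x y => F (q + 1) (Fin.cons (X p x) y : Fin (q + 1) → L)) e ξ := by
  simp only [circ, sum_apply, insertion, shuffleSum]
  refine Finset.sum_congr rfl fun pq _ => ?_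
  rw [shuffle_apply ℒ _ (fun _ _ _ _ _ _ => rfl) hξ]
  rfl

theorem opBracket_apply (d c : ℤ) (f g : Cochain K L (Module.End K V)) {N : ℕ}
    {e : Fin N → ℤ} {ξ : Fin N → L} (hξ : IsHom ℒ e ξ) : opBracket ℒ d c f g N ξ =
      shuffleSum K (fun p q u v x y => sg K (c * u) • (f p x * g q y -
        sg K ((d + u) * (c + v)) • (g q y * f p x))) e ξ := by
  simp only [opBracket, sum_apply, shuffleSum]
  refine Finset.sum_congr rfl fun pq _ => ?_
  rw [shuffle_apply ℒ _ _ hξ]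
  · rfl
  · intro u v u' v' hu hv
    rw [sg_congr (even_mul_sub (a := c) (c := c) (by simp) hu),
      sg_congr (even_mul_sub (a := d + u) (c := d + u') (b := c + v) (d := c + v')
        (by simpa using hu) (by simpa using hv))]

end Calculus

end RightRep

namespace RightRep

open scoped DirectSum TensorProduct

theorem sg_ext {K : Type*} [Field K] {m n : ℤ} (h : Even m ↔ Even n) : sg K m = sg K n := by
  simp [sg, h]

/-! ### Bilinearity, insertion rules, associativity and the derivation property of insertions. -/

section Calculus

variable {K L : Type*} [Field K] [AddCommGroup L] [Module K L]
variable {U V W W' : Type*} [AddCommGroup U] [Module K U] [AddCommGroup V] [Module K V]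
  [AddCommGroup W] [Module K W] [AddCommGroup W'] [Module K W']
variable (ℒ : ℤ → Submodule K L) [DirectSum.Decomposition ℒ]

/-- `cstar` as a bilinear map. -/
def cstarHom (c : ℤ) (B : U →ₗ[K] V →ₗ[K] W) :
    Cochain K L U →ₗ[K] Cochain K L V →ₗ[K] Cochain K L W :=
  LinearMap.mk₂ K (cstar ℒ c B)
    (fun f f' g => cochain_ext ℒ fun n e ξ hξ => by
      simp only [Pi.add_apply, add_apply, cstar_apply _ _ _ _ hξ, map_add, LinearMap.add_apply,
        smul_add, shuffleSum_add])
    (fun r f g => cochain_ext ℒ fun n e ξ hξ => by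
      simp only [Pi.smul_apply, smul_apply, cstar_apply _ _ _ _ hξ, map_smul, LinearMap.smul_apply,
        ← shuffleSum_smul, smul_comm r])
    (fun f g g' => cochain_ext ℒ fun n e ξ hξ => by
      simp only [Pi.add_apply, add_apply, cstar_apply _ _ _ _ hξ, map_add,
        smul_add, shuffleSum_add])
    (fun r f g => cochain_ext ℒ fun n e ξ hξ => by
      simp only [Pi.smul_apply, smul_apply, cstar_apply _ _ _ _ hξ, map_smul,
        ← shuffleSum_smul, smul_comm r])

/-- `circ` as a bilinear map. -/
def circHom : Cochain K L W →ₗ[K] Cochain K L L →ₗ[K] Cochain K L W :=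
  LinearMap.mk₂ K (circ ℒ)
    (fun f f' g => cochain_ext ℒ fun n e ξ hξ => by
      simp only [Pi.add_apply, add_apply, circ_apply _ _ hξ, shuffleSum_add])
    (fun r f g => cochain_ext ℒ fun n e ξ hξ => by
      simp only [Pi.smul_apply, smul_apply, circ_apply _ _ hξ, ← shuffleSum_smul])
    (fun f g g' => cochain_ext ℒ fun n e ξ hξ => by
      simp only [Pi.add_apply, add_apply, circ_apply _ _ hξ, MultilinearMap.cons_add,
        shuffleSum_add])
    (fun r f g => cochain_ext ℒ fun n e ξ hξ => by
      simp only [Pi.smul_apply, smul_apply, circ_apply _ _ hξ, MultilinearMap.cons_smul,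
        ← shuffleSum_smul])

variable {ℒ} {c : ℤ} {B : U →ₗ[K] V →ₗ[K] W}

theorem cstar_add_left (f f' : Cochain K L U) (g : Cochain K L V) :
    cstar ℒ c B (f + f') g = cstar ℒ c B f g + cstar ℒ c B f' g :=
  (cstarHom ℒ c B).map_add₂ f f' g

theorem cstar_add_right (f : Cochain K L U) (g g' : Cochain K L V) :
    cstar ℒ c B f (g + g') = cstar ℒ c B f g + cstar ℒ c B f g' :=
  (cstarHom ℒ c B f).map_add g g'

theorem cstar_sub_left (f f' : Cochain K L U) (g : Cochain K L V) :
    cstar ℒ c B (f - f') g = cstar ℒ c B f g - cstar ℒ c B f' g :=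
  (cstarHom ℒ c B).map_sub₂ f f' g

theorem cstar_sub_right (f : Cochain K L U) (g g' : Cochain K L V) :
    cstar ℒ c B f (g - g') = cstar ℒ c B f g - cstar ℒ c B f g' :=
  (cstarHom ℒ c B f).map_sub g g'

theorem cstar_neg_left (f : Cochain K L U) (g : Cochain K L V) :
    cstar ℒ c B (-f) g = -cstar ℒ c B f g :=
  (cstarHom ℒ c B).map_neg₂ f g

theorem cstar_neg_right (f : Cochain K L U) (g : Cochain K L V) :
    cstar ℒ c B f (-g) = -cstar ℒ c B f g :=
  (cstarHom ℒ c B f).map_neg g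

theorem cstar_smul_left (r : K) (f : Cochain K L U) (g : Cochain K L V) :
    cstar ℒ c B (r • f) g = r • cstar ℒ c B f g :=
  (cstarHom ℒ c B).map_smul₂ r f g

theorem cstar_smul_right (r : K) (f : Cochain K L U) (g : Cochain K L V) :
    cstar ℒ c B f (r • g) = r • cstar ℒ c B f g :=
  (cstarHom ℒ c B f).map_smul r g

theorem cstar_zero_left (g : Cochain K L V) : cstar ℒ c B 0 g = 0 :=
  (cstarHom ℒ c B).map_zero₂ g

theorem cstar_zero_right (f : Cochain K L U) : cstar ℒ c B f 0 = 0 :=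
  (cstarHom ℒ c B f).map_zero

theorem circ_add_left (f f' : Cochain K L W) (g : Cochain K L L) :
    circ ℒ (f + f') g = circ ℒ f g + circ ℒ f' g :=
  (circHom ℒ).map_add₂ f f' g

theorem circ_add_right (f : Cochain K L W) (g g' : Cochain K L L) :
    circ ℒ f (g + g') = circ ℒ f g + circ ℒ f g' :=
  (circHom ℒ f).map_add g g'

theorem circ_sub_left (f f' : Cochain K L W) (g : Cochain K L L) :
    circ ℒ (f - f') g = circ ℒ f g - circ ℒ f' g :=
  (circHom ℒ).map_sub₂ f f' g

theorem circ_sub_right (f : Cochain K L W) (g g' : Cochain K L L) :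
    circ ℒ f (g - g') = circ ℒ f g - circ ℒ f g' :=
  (circHom ℒ f).map_sub g g'

theorem circ_neg_left (f : Cochain K L W) (g : Cochain K L L) :
    circ ℒ (-f) g = -circ ℒ f g :=
  (circHom ℒ).map_neg₂ f g

theorem circ_smul_left (r : K) (f : Cochain K L W) (g : Cochain K L L) :
    circ ℒ (r • f) g = r • circ ℒ f g :=
  (circHom ℒ).map_smul₂ r f g

theorem circ_smul_right (r : K) (f : Cochain K L W) (g : Cochain K L L) :
    circ ℒ f (r • g) = r • circ ℒ f g :=
  (circHom ℒ f).map_smul r g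

theorem circ_zero_right (f : Cochain K L W) : circ ℒ f 0 = 0 :=
  (circHom ℒ f).map_zero

/-! The values without arguments -/

theorem cstar_zero_apply (f : Cochain K L U) (g : Cochain K L V) (ξ : Fin 0 → L) :
    cstar ℒ c B f g 0 ξ = B (f 0 ξ) (g 0 ξ) := by
  rw [cstar_apply (e := fun _ => 0) _ _ _ _ (fun i => i.elim0), shuffleSum_zero]
  simp [sg_zero]

theorem circ_zero_apply (F : Cochain K L W) (X : Cochain K L L) (ξ : Fin 0 → L) :
    circ ℒ F X 0 ξ = ins (X 0 ξ) F 0 ξ := by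
  rw [circ_apply (e := fun _ => 0) _ _ (fun i => i.elim0), shuffleSum_zero]
  rfl

theorem opBracket_zero_apply (d : ℤ) (f g : Cochain K L (Module.End K V)) (ξ : Fin 0 → L) :
    opBracket ℒ d c f g 0 ξ = f 0 ξ * g 0 ξ - sg K (d * c) • (g 0 ξ * f 0 ξ) := by
  rw [opBracket_apply (e := fun _ => 0) _ _ _ _ (fun i => i.elim0), shuffleSum_zero]
  simp [sg_zero]

/-! Insertion of an argument into products -/

/-- If `a` joins the left block, the built-in twist by the degree of `g` contributes the sign. If it
joins the right block, the sign of passing the left block is absorbed by recording the degree `c +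
i` of `ins a g`. -/
theorem ins_cstar {i : ℤ} {a : L} (ha : a ∈ ℒ i) (f : Cochain K L U) (g : Cochain K L V) :
    ins a (cstar ℒ c B f g) =
      sg K (c * i) • cstar ℒ c B (ins a f) g + cstar ℒ (c + i) B f (ins a g) := by
  refine cochain_ext ℒ fun n e ξ hξ => ?_
  rw [ins_apply, cstar_apply _ _ _ _ (isHom_cons ha hξ), shuffleSum_cons, Pi.add_apply, add_apply,
    Pi.smul_apply, smul_apply, cstar_apply _ _ _ _ hξ, cstar_apply _ _ _ _ hξ, ← shuffleSum_smul]
  simp only [mul_add, add_mul, sg_add, mul_smul, ins_apply, smul_comm (sg K (c * _)) (sg K (i * _))]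

theorem ins_opBracket {d i : ℤ} {a : L} (ha : a ∈ ℒ i) (f g : Cochain K L (Module.End K V)) :
    ins a (opBracket ℒ d c f g) =
      sg K (c * i) • opBracket ℒ (d + i) c (ins a f) g + opBracket ℒ d (c + i) f (ins a g) := by
  refine cochain_ext ℒ fun n e ξ hξ => ?_
  rw [ins_apply, opBracket_apply _ _ _ _ (isHom_cons ha hξ), shuffleSum_cons, Pi.add_apply,
    add_apply, Pi.smul_apply, smul_apply, opBracket_apply _ _ _ _ hξ, opBracket_apply _ _ _ _ hξ,
    ← shuffleSum_smul]
  simp only [mul_add, add_mul, sg_add, mul_smul, ins_apply, smul_comm (sg K (c * _)) (sg K (i * _)),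
    add_assoc]

/-- If `a` is not swallowed by `X`, it ends up behind the value of `X` and must be moved to the
front. This is where the symmetry of `F` and the degree of `X` enter. -/
theorem ins_circ {d i : ℤ} {a : L} (ha : a ∈ ℒ i) {F : Cochain K L W} (hF : SymmC ℒ F)
    {X : Cochain K L L} (hX : DegC ℒ ℒ d X) :
    ins a (circ ℒ F X) = circ ℒ F (ins a X) + sg K (i * d) • circ ℒ (ins a F) X := by
  refine cochain_ext ℒ fun n e ξ hξ => ?_
  rw [ins_apply, circ_apply _ _ (isHom_cons ha hξ), shuffleSum_cons, Pi.add_apply, add_apply,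
    Pi.smul_apply, smul_apply, circ_apply _ _ hξ, circ_apply _ _ hξ, ← shuffleSum_smul]
  congr 1
  simp only [shuffleSum]
  refine Finset.sum_congr rfl fun pq _ => Finset.sum_congr rfl fun σ _ => ?_
  congr 1
  -- With `u` the total degree of the left block, `a` passes that block with exponent `i u` and the
  -- value of `X` with exponent `i (d + u)`. The sum is `i d` modulo `2`.
  have h1 := ins_comm hF ha
    (hX pq.1 (fun i => e (σ (Sum.inl i))) (fun i => ξ (σ (Sum.inl i))) fun i => hξ _)
  have h2 := congrArg (fun G => G pq.2 fun i => ξ (σ (Sum.inr i))) h1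
  simp only [ins_apply, Pi.smul_apply, smul_apply] at h2
  rw [ins_apply, h2, smul_smul, ← sg_add]
  congr 1
  exact sg_ext (by simp only [Int.even_add, Int.even_mul]; tauto)

/-- Exchanging the blocks of an unshuffle turns the flipped half of the commutator into the opposite
product. The induction on entries sees this through the equal insertion rules, and from here on
brackets are handled by the identities for `cstar`. -/
theorem opBracket_eq (d c : ℤ) (f g : Cochain K L (Module.End K V)) :
    opBracket ℒ d c f g = cstar ℒ c (LinearMap.mul K (Module.End K V)) f g -
      sg K (d * c) • cstar ℒ d (LinearMap.mul K (Module.End K V)) g f := by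
  funext n
  induction n generalizing d c f g with
  | zero =>
    refine zero_ext fun ξ => ?_
    simp [opBracket_zero_apply, cstar_zero_apply]
  | succ n ih =>
    refine succ_ext (ℒ := ℒ) fun i a ha => ?_
    rw [ins_sub, ins_smul, ins_opBracket ha, ins_cstar ha, ins_cstar ha]
    simp only [Pi.add_apply, Pi.sub_apply, Pi.smul_apply, ih, mul_add, add_mul, sg_add]
    -- Both sides are combinations of the same families. The coefficients are products of signs, and
    -- they agree because every sign squares to one.
    match_scalars <;> grind [sg_mul_self]

/-- Stated for four compatible pairings, so that composition of operators, evaluation,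
multiplication in `A` and module actions are all covered by one proof. -/
theorem cstar_assoc {V' W₁ W₂ : Type*} [AddCommGroup V'] [Module K V'] [AddCommGroup W₁]
    [Module K W₁] [AddCommGroup W₂] [Module K W₂] {c₁ c₂ : ℤ}
    {B₁ : W₁ →ₗ[K] V' →ₗ[K] W} {B₂ : U →ₗ[K] V →ₗ[K] W₁} {B₃ : U →ₗ[K] W₂ →ₗ[K] W}
    {B₄ : V →ₗ[K] V' →ₗ[K] W₂} (h : ∀ x y z, B₁ (B₂ x y) z = B₃ x (B₄ y z))
    (f : Cochain K L U) (g : Cochain K L V) (k : Cochain K L V') :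
    cstar ℒ c₂ B₁ (cstar ℒ c₁ B₂ f g) k = cstar ℒ (c₁ + c₂) B₃ f (cstar ℒ c₂ B₄ g k) := by
  funext n
  induction n generalizing f g k c₁ c₂ with
  | zero =>
    refine zero_ext fun ξ => ?_
    simp [cstar_zero_apply, h]
  | succ n ih =>
    refine succ_ext (ℒ := ℒ) fun i a ha => ?_
    simp only [ins_cstar ha, cstar_add_left, cstar_add_right, cstar_smul_left, cstar_smul_right,
      Pi.add_apply, Pi.smul_apply, ih, add_mul, sg_add]
    rw [show c₁ + i + c₂ = c₁ + c₂ + i by ring, ← add_assoc]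
    module

theorem cstar_symm {f : Cochain K L U} (hf : SymmC ℒ f) {g : Cochain K L V}
    (hg : SymmC ℒ g) : SymmC ℒ (cstar ℒ c B f g) := fun n =>
  Finset.sum_induction _ (GrSymm ℒ) (fun _ _ => GrSymm.add) (GrSymm.zero _)
    fun _ _ => star_grSymm ℒ c _ (hf _) (hg _) n

/-- The value of `X` occupies one argument of the product, hence one argument of either `f` or `g`.
Entering `f`, it leaves `g` behind it, which accounts for the sign. -/
theorem circ_cstar {d : ℤ} {f : Cochain K L U} (hf : SymmC ℒ f) {g : Cochain K L V}
    (hg : SymmC ℒ g) {X : Cochain K L L} (hX : DegC ℒ ℒ d X) :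
    circ ℒ (cstar ℒ c B f g) X = cstar ℒ (c + d) B f (circ ℒ g X) +
      sg K (d * c) • cstar ℒ c B (circ ℒ f X) g := by
  funext n
  induction n generalizing f g X c d with
  | zero =>
    refine zero_ext fun ξ => ?_
    simp only [circ_zero_apply, ins_cstar (hX.zero_apply ξ), Pi.add_apply, Pi.smul_apply, add_apply,
      smul_apply, cstar_zero_apply]
    rw [add_comm, mul_comm]
  | succ n ih =>
    refine succ_ext (ℒ := ℒ) fun i a ha => ?_
    simp only [ins_cstar ha, ins_circ ha (cstar_symm hf hg) hX, ins_circ ha hf hX, ins_circ ha hg hX,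
      ins_smul, ins_add, circ_add_left, circ_smul_left, cstar_add_left, cstar_smul_left,
      cstar_add_right, cstar_smul_right, Pi.add_apply, Pi.smul_apply, ih hf hg (hX.ins ha),
      ih (hf.ins ha) hg hX, ih hf (hg.ins ha) hX, add_mul, mul_add, sg_add]
    rw [show c + i + d = c + (d + i) by ring, show c + d + i = c + (d + i) by ring]
    match_scalars <;> grind [sg_mul_self]

end Calculus

end RightRep

namespace RightRep

open scoped DirectSum TensorProduct

/-! ### Degrees, symmetry, the pre-Lie identity, naturality and units. -/

section Calculus

variable {K L : Type*} [Field K] [AddCommGroup L] [Module K L]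
variable {U V W W' : Type*} [AddCommGroup U] [Module K U] [AddCommGroup V] [Module K V]
  [AddCommGroup W] [Module K W] [AddCommGroup W'] [Module K W']
variable {ℒ : ℤ → Submodule K L} [DirectSum.Decomposition ℒ] {c d : ℤ} {B : U →ₗ[K] V →ₗ[K] W}

theorem shuffleSum_mem {𝒲 : ℤ → Submodule K W} {m : ℤ}
    {h : ∀ p q : ℕ, ℤ → ℤ → (Fin p → L) → (Fin q → L) → W}
    (hh : ∀ p q (e : Fin p → ℤ) (e' : Fin q → ℤ) x y, IsHom ℒ e x → IsHom ℒ e' y →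
      h p q (∑ i, e i) (∑ i, e' i) x y ∈ 𝒲 (m + (∑ i, e i + ∑ i, e' i)))
    {N : ℕ} {e : Fin N → ℤ} {ξ : Fin N → L} (hξ : IsHom ℒ e ξ) :
    shuffleSum K h e ξ ∈ 𝒲 (m + ∑ i, e i) := by
  refine Submodule.sum_mem _ fun pq _ => Submodule.sum_mem _ fun σ _ => Submodule.smul_mem _ _ ?_
  rw [sum_eq_blocks σ]
  exact hh _ _ _ _ _ _ (fun _ => hξ _) fun _ => hξ _

theorem DegC.cstar {𝒰 : ℤ → Submodule K U} {𝒱 : ℤ → Submodule K V} {𝒲 : ℤ → Submodule K W}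
    (hB : ∀ i j, ∀ x ∈ 𝒰 i, ∀ y ∈ 𝒱 j, B x y ∈ 𝒲 (i + j)) {f : Cochain K L U}
    (hf : DegC ℒ 𝒰 d f) {g : Cochain K L V} (hg : DegC ℒ 𝒱 c g) (c' : ℤ) :
    DegC ℒ 𝒲 (d + c) (cstar ℒ c' B f g) := by
  intro N e ξ hξ
  rw [cstar_apply _ _ _ _ hξ]
  refine shuffleSum_mem (fun p q e e' x y hx hy => Submodule.smul_mem _ _ ?_) hξ
  rw [add_add_add_comm]
  exact hB _ _ _ (hf _ _ _ hx) _ (hg _ _ _ hy)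

theorem DegC.circ {𝒲 : ℤ → Submodule K W} {F : Cochain K L W} (hF : DegC ℒ 𝒲 c F)
    {X : Cochain K L L} (hX : DegC ℒ ℒ d X) : DegC ℒ 𝒲 (c + d) (circ ℒ F X) := by
  intro N e ξ hξ
  rw [circ_apply _ _ hξ]
  refine shuffleSum_mem (fun p q e e' x y hx hy => ?_) hξ
  have := hF _ _ _ (isHom_cons (hX _ _ _ hx) hy)
  rw [Fin.sum_univ_succ] at this
  simp only [Fin.cons_zero, Fin.cons_succ] at this
  rw [← add_assoc] at this ⊢
  rwa [← add_assoc] at this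

theorem circ_symm {F : Cochain K L W} (hF : SymmC ℒ F) {X : Cochain K L L} (hX : SymmC ℒ X)
    (hX' : DegC ℒ ℒ d X) : SymmC ℒ (circ ℒ F X) := by
  intro n
  induction n generalizing F X d with
  | zero => exact fun _ _ _ i => i.elim0
  | succ n ih =>
    refine grSymm_succ (fun i a ha => ?_) fun i a ha j b hb => ?_
    · rw [ins_circ ha hF hX']
      exact (ih hF (hX.ins ha) (hX'.ins ha)).add ((ih (hF.ins ha) hX hX').smul _)
    · simp only [ins_circ ha hF hX', ins_circ hb hF hX', ins_add, ins_smul,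
        ins_circ ha hF (hX'.ins hb), ins_circ hb hF (hX'.ins ha), ins_circ ha (hF.ins hb) hX',
        ins_circ hb (hF.ins ha) hX', ins_comm hF ha hb, ins_comm hX ha hb, circ_smul_left,
        circ_smul_right, mul_add, sg_add]
      match_scalars <;> grind [sg_mul_self]

/-- In `(F ∘ X) ∘ Y - F ∘ (X ∘ Y)` the terms with `Y` nested in `X` drop out. What remains has `X`
and `Y` in two different slots of `F` and is symmetric up to the Koszul sign. -/
theorem circ_preLie {F : Cochain K L W} (hF : SymmC ℒ F) {X Y : Cochain K L L}
    (hX : SymmC ℒ X) (hX' : DegC ℒ ℒ d X) (hY : SymmC ℒ Y) (hY' : DegC ℒ ℒ c Y) :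
    circ ℒ (circ ℒ F X) Y - circ ℒ F (circ ℒ X Y) =
      sg K (d * c) • (circ ℒ (circ ℒ F Y) X - circ ℒ F (circ ℒ Y X)) := by
  funext n
  induction n generalizing F X Y d c with
  | zero =>
    refine zero_ext fun ξ => ?_
    -- Without entries `X` and `Y` are homogeneous elements of `L`, and the identity is the symmetry
    -- of `F` in its first two arguments.
    have h := congrArg (fun G => G 0 ξ) (ins_comm hF (hX'.zero_apply ξ) (hY'.zero_apply ξ))
    simp only [Pi.smul_apply, smul_apply] at h
    simp only [Pi.sub_apply, Pi.smul_apply, sub_apply, smul_apply, circ_zero_apply,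
      ins_circ (hX'.zero_apply ξ) hF hY', ins_circ (hY'.zero_apply ξ) hF hX', Pi.add_apply,
      add_apply, h]
    match_scalars <;> grind [sg_mul_self]
  | succ n ih =>
    refine succ_ext (ℒ := ℒ) fun i a ha => ?_
    have h1 := ih hF (hX.ins ha) (hX'.ins ha) hY hY'
    have h2 := ih hF hX hX' (hY.ins ha) (hY'.ins ha)
    have h3 := ih (hF.ins ha) hX hX' hY hY'
    simp only [Pi.sub_apply, Pi.smul_apply] at h1 h2 h3
    rw [sub_eq_iff_eq_add] at h1 h2 h3
    simp only [ins_sub, ins_smul, ins_circ ha (circ_symm hF hX hX') hY',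
      ins_circ ha (circ_symm hF hY hY') hX', ins_circ ha hF hX', ins_circ ha hF hY',
      ins_circ ha hF (hX'.circ hY'), ins_circ ha hF (hY'.circ hX'), ins_circ ha hX hY',
      ins_circ ha hY hX', circ_add_left, circ_add_right, circ_smul_left, circ_smul_right,
      Pi.add_apply, Pi.sub_apply, Pi.smul_apply, h1, h2, h3, mul_add, add_mul, sg_add]
    match_scalars <;> grind [sg_mul_self]

/-! Naturality -/

theorem mapC_cstar_left {U' : Type*} [AddCommGroup U'] [Module K U'] {ℓ : W →ₗ[K] W'}
    {ℓ' : U →ₗ[K] U'} {B' : U' →ₗ[K] V →ₗ[K] W'} (h : ∀ x y, ℓ (B x y) = B' (ℓ' x) y)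
    (f : Cochain K L U) (g : Cochain K L V) :
    mapC ℓ (cstar ℒ c B f g) = cstar ℒ c B' (mapC ℓ' f) g :=
  cochain_ext ℒ fun n e ξ hξ => by
    simp only [mapC_apply, cstar_apply _ _ _ _ hξ, map_shuffleSum, map_smul, h]

theorem mapC_circ (ℓ : W →ₗ[K] W') (F : Cochain K L W) (X : Cochain K L L) :
    mapC ℓ (circ ℒ F X) = circ ℒ (mapC ℓ F) X :=
  cochain_ext ℒ fun n e ξ hξ => by
    simp only [mapC_apply, circ_apply _ _ hξ, map_shuffleSum]

theorem mapC_add (ℓ : W →ₗ[K] W') (F G : Cochain K L W) :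
    mapC ℓ (F + G) = mapC ℓ F + mapC ℓ G := by
  funext n; ext ξ; simp [mapC_apply]

theorem mapC_sub (ℓ : W →ₗ[K] W') (F G : Cochain K L W) :
    mapC ℓ (F - G) = mapC ℓ F - mapC ℓ G := by
  funext n; ext ξ; simp [mapC_apply]

theorem mapC_smul (ℓ : W →ₗ[K] W') (r : K) (F : Cochain K L W) :
    mapC ℓ (r • F) = r • mapC ℓ F := by
  funext n; ext ξ; simp [mapC_apply]

theorem mapC_cst (ℓ : W →ₗ[K] W') (w : W) : mapC ℓ (cst K L w) = cst K L (ℓ w) := by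
  funext n; ext ξ
  rcases n with _ | n
  · rfl
  · simp [mapC_apply, cst_succ]

/-! Products and insertions of constants -/

theorem cstar_cst_left (u : U) (g : Cochain K L V) : cstar ℒ c B (cst K L u) g = mapC (B u) g := by
  funext n
  induction n generalizing g c with
  | zero => exact zero_ext fun ξ => cstar_zero_apply _ _ _
  | succ n ih =>
    refine succ_ext (ℒ := ℒ) fun i a ha => ?_
    rw [ins_cstar ha, ins_cst, cstar_zero_left, smul_zero, zero_add, ih, ins_mapC]

/-- All entries lie in the left block, so the only sign is the twist by the degree `c` of the
constant. -/
theorem cstar_cst_right_apply (f : Cochain K L U) (v : V) {n : ℕ} {e : Fin n → ℤ} {ξ : Fin n → L}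
    (hξ : IsHom ℒ e ξ) :
    cstar ℒ c B f (cst K L v) n ξ = sg K (c * ∑ i, e i) • B (f n ξ) v := by
  induction n generalizing f with
  | zero => simp [cstar_zero_apply, cst_zero_apply, sg_zero]
  | succ n ih =>
    have := congrArg (fun G => G n (Fin.tail ξ)) (ins_cstar (c := c) (B := B) (hξ 0) f (cst K L v))
    simp only [ins_apply, ins_cst, cstar_zero_right, add_zero, Pi.smul_apply, smul_apply,
      ih _ hξ.tail, Fin.cons_self_tail] at this
    rw [this, smul_smul, Fin.sum_univ_succ, mul_add, sg_add]
    rfl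

theorem circ_cst_left (w : W) (X : Cochain K L L) : circ ℒ (cst K L w) X = 0 :=
  cochain_ext ℒ fun n e ξ hξ => by
    simp only [circ_apply _ _ hξ, cst_succ]
    simp [shuffleSum]

theorem circ_cst_right {F : Cochain K L W} (hF : SymmC ℒ F) {z : L} (hz : z ∈ ℒ d) :
    circ ℒ F (cst K L z) = ins z F := by
  funext n
  induction n generalizing F with
  | zero => exact zero_ext fun ξ => circ_zero_apply _ _ _
  | succ n ih =>
    refine succ_ext (ℒ := ℒ) fun i a ha => ?_
    rw [ins_circ ha hF (DegC.cst hz), ins_cst, circ_zero_right, zero_add, Pi.smul_apply,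
      ih (hF.ins ha), ins_comm hF hz ha, Pi.smul_apply, mul_comm]

theorem circ_idC_left {X : Cochain K L L} (hX : DegC ℒ ℒ d X) : circ ℒ (idC K L) X = X := by
  funext n
  induction n generalizing X d with
  | zero => exact zero_ext fun ξ => circ_zero_apply _ _ _
  | succ n ih =>
    refine succ_ext (ℒ := ℒ) fun i a ha => ?_
    rw [ins_circ ha SymmC.idC hX, ins_idC, circ_cst_left, smul_zero, add_zero, ih (hX.ins ha)]

/-- The Euler operator: substituting the identity into each of the `n` slots returns the map `n`
times. Division by `n` is what characteristic zero is needed for later. -/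
theorem circ_idC_right {F : Cochain K L W} (hF : SymmC ℒ F) (n : ℕ) :
    circ ℒ F (idC K L) n = (n : K) • F n := by
  induction n generalizing F with
  | zero =>
    refine zero_ext (G := ((0 : ℕ) : K) • F) fun ξ => ?_
    rw [circ_zero_apply, Pi.smul_apply, Nat.cast_zero, zero_smul]
    exact (F 1).map_coord_zero 0 rfl
  | succ n ih =>
    refine succ_ext (G := ((n + 1 : ℕ) : K) • F) (ℒ := ℒ) fun i a ha => ?_
    rw [ins_circ ha hF DegC.idC, ins_idC, circ_cst_right hF ha, mul_zero, sg_zero, one_smul,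
      Pi.add_apply, ih (hF.ins ha), ins_smul, Pi.smul_apply]
    push_cast
    module

end Calculus

end RightRep

namespace RightRep

open scoped DirectSum TensorProduct

/-! ### Linearity over the graded algebra -/

section Linearity

variable {K A L : Type*} [Field K] [Ring A] [Algebra K A] [AddCommGroup L] [Module K L]
  [Module A L]
variable {W Q : Type*} [AddCommGroup W] [Module K W] [AddCommGroup Q] [Module K Q] [Module A Q]
  [IsScalarTower K A Q]

/-- The action of `A` on an `A`-module, as a bilinear map. -/
def smulB (K A W : Type*) [Field K] [Ring A] [Algebra K A] [AddCommGroup W] [Module K W]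
    [Module A W] [IsScalarTower K A W] : A →ₗ[K] W →ₗ[K] W := (Algebra.lsmul K K W).toLinearMap

theorem smulB_apply [Module A W] [IsScalarTower K A W] (a : A) (w : W) : smulB K A W a w = a • w :=
  rfl

/-- The evaluation pairing. -/
abbrev evB (K A : Type*) [Field K] [Ring A] [Algebra K A] : Module.End K A →ₗ[K] (A →ₗ[K] A) :=
  LinearMap.id

/-- Multiplication of a family by an element of `A`, on the left. -/
def lact [Module A W] [IsScalarTower K A W] (a : A) (F : Cochain K L W) : Cochain K L W :=
  mapC (smulB K A W a) F

section Lact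

variable [Module A W] [IsScalarTower K A W]

theorem lact_apply (a : A) (F : Cochain K L W) (n : ℕ) (ξ : Fin n → L) :
    lact a F n ξ = a • F n ξ := rfl

theorem ins_lact (x : L) (a : A) (F : Cochain K L W) : ins x (lact a F) = lact a (ins x F) := rfl

theorem lact_add (a : A) (F G : Cochain K L W) : lact a (F + G) = lact a F + lact a G :=
  mapC_add _ _ _

theorem lact_sub (a : A) (F G : Cochain K L W) : lact a (F - G) = lact a F - lact a G :=
  mapC_sub _ _ _

theorem lact_smul (a : A) (r : K) (F : Cochain K L W) : lact a (r • F) = r • lact a F :=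
  mapC_smul _ _ _

end Lact

variable (𝒜 : ℤ → Submodule K A) (ℒ : ℤ → Submodule K L)

/-- Left linearity with respect to the first argument. -/
def FirstLeft [Module A W] [IsScalarTower K A W] (c : ℤ) (F : Cochain K L W) : Prop :=
  ∀ i, ∀ ζ ∈ ℒ i, ∀ b, ∀ a ∈ 𝒜 b, ins (a • ζ) F = sg K (b * c) • lact a (ins ζ F)

/-- Right linearity with respect to the first argument. -/
def FirstRight [DirectSum.Decomposition ℒ] (F : Cochain K L (Q →ₗ[K] W)) : Prop :=
  ∀ i, ∀ ζ ∈ ℒ i, ∀ b, ∀ a ∈ 𝒜 b,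
    ins (a • ζ) F = sg K (b * i) • cstar ℒ b (compSMul K A Q W) (ins ζ F) (cst K L a)

/-- The Leibniz rule for a multiderivation with respect to the first argument. -/
def FirstLeibniz [IsScalarTower K A L] [DirectSum.Decomposition ℒ] (d : ℤ) (X : Cochain K L L)
    (σ : Cochain K L (Module.End K A)) : Prop :=
  ∀ i, ∀ ζ ∈ ℒ i, ∀ b, ∀ a ∈ 𝒜 b, ins (a • ζ) X = sg K (b * d) • lact a (ins ζ X) +
    cstar ℒ i (smulB K A L) (cstar ℒ b (evB K A) σ (cst K L a)) (cst K L ζ)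

/-- The values of `φ`, acting through `P`, are derivations with symbols given by `σ`. -/
def DerLike [Module A W] {Φ : Type*} [AddCommGroup Φ] [Module K Φ] (P : Φ →ₗ[K] W →ₗ[K] W) (d : ℤ)
    (φ : Cochain K L Φ) (σ : Cochain K L (Module.End K A)) : Prop :=
  ∀ n e ξ, IsHom ℒ e ξ → ∀ b, ∀ a ∈ 𝒜 b, ∀ w,
    P (φ n ξ) (a • w) = σ n ξ a • w + sg K ((d + ∑ i, e i) * b) • a • P (φ n ξ) w

variable {𝒜 ℒ} {c d p z : ℤ}

theorem DerLike.ins [Module A W] {Φ : Type*} [AddCommGroup Φ] [Module K Φ]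
    {P : Φ →ₗ[K] W →ₗ[K] W} {φ : Cochain K L Φ} {σ : Cochain K L (Module.End K A)}
    (h : DerLike 𝒜 ℒ P d φ σ) {i : ℤ} {x : L} (hx : x ∈ ℒ i) :
    DerLike 𝒜 ℒ P (d + i) (ins x φ) (ins x σ) := by
  intro n e ξ hξ b a ha w
  have := h _ _ _ (isHom_cons hx hξ) b a ha w
  rw [Fin.sum_univ_succ, ← add_assoc] at this
  simpa [ins_apply] using this

variable [DirectSum.Decomposition ℒ]

theorem circ_lact [Module A W] [IsScalarTower K A W] (a : A) (F : Cochain K L W)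
    (X : Cochain K L L) : circ ℒ (lact a F) X = lact a (circ ℒ F X) :=
  (mapC_circ _ _ _).symm

theorem cstar_lact_left [Module A W] [IsScalarTower K A W] {U V : Type*} [AddCommGroup U]
    [Module K U] [Module A U] [IsScalarTower K A U] [AddCommGroup V] [Module K V]
    {P : U →ₗ[K] V →ₗ[K] W} (hP : ∀ (a : A) x y, P (a • x) y = a • P x y) (a : A)
    (F : Cochain K L U) (G : Cochain K L V) :
    cstar ℒ c P (lact a F) G = lact a (cstar ℒ c P F G) :=
  (mapC_cstar_left (fun x y => (hP a x y).symm) F G).symm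

theorem cstar_mapC_right {U V V' : Type*} [AddCommGroup U] [Module K U] [AddCommGroup V]
    [Module K V] [AddCommGroup V'] [Module K V'] {B : U →ₗ[K] V' →ₗ[K] W} {B' : U →ₗ[K] V →ₗ[K] W}
    {ℓ : V →ₗ[K] V'} (h : ∀ x y, B x (ℓ y) = B' x y) (f : Cochain K L U) (g : Cochain K L V) :
    cstar ℒ c B f (mapC ℓ g) = cstar ℒ c B' f g :=
  cochain_ext ℒ fun n e ξ hξ => by
    simp only [mapC_apply, cstar_apply _ _ _ _ hξ, h]

/-- Symmetry brings the second argument to the front and back again. The argument `x` passed on the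
way shifts the degree by `j`. With this, linearity in the first argument can be carried through
inductions on the number of entries. -/
theorem FirstLeft.ins [Module A W] [IsScalarTower K A W] [GradedAlgebra 𝒜]
    [SetLike.GradedSMul 𝒜 ℒ] {F : Cochain K L W}
    (h : FirstLeft 𝒜 ℒ c F) (hF : SymmC ℒ F) {j : ℤ} {x : L} (hx : x ∈ ℒ j) :
    FirstLeft 𝒜 ℒ (c + j) (ins x F) := by
  intro i ζ hζ b a ha
  have haz : a • ζ ∈ ℒ (b + i) := SetLike.GradedSMul.smul_mem ha hζ
  rw [ins_comm hF hx haz, h i ζ hζ b a ha, ins_comm hF hx hζ, ins_smul, ins_lact, lact_smul]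
  simp only [mul_add, sg_add]
  match_scalars <;> grind [sg_mul_self]

theorem FirstRight.ins [GradedAlgebra 𝒜] [SetLike.GradedSMul 𝒜 ℒ] {F : Cochain K L (Q →ₗ[K] W)}
    (h : FirstRight 𝒜 ℒ F) (hF : SymmC ℒ F) {j : ℤ} {x : L} (hx : x ∈ ℒ j) :
    FirstRight 𝒜 ℒ (ins x F) := by
  intro i ζ hζ b a ha
  have haz : a • ζ ∈ ℒ (b + i) := SetLike.GradedSMul.smul_mem ha hζ
  rw [ins_comm hF hx haz, h i ζ hζ b a ha, ins_comm hF hx hζ, ins_smul, ins_cstar hx, ins_cst,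
    cstar_zero_right, add_zero, cstar_smul_left]
  simp only [mul_add, sg_add]
  match_scalars <;> grind [sg_mul_self]

theorem FirstLeibniz.ins [IsScalarTower K A L] [GradedAlgebra 𝒜] [SetLike.GradedSMul 𝒜 ℒ]
    {X : Cochain K L L} {σ : Cochain K L (Module.End K A)}
    (h : FirstLeibniz 𝒜 ℒ d X σ) (hX : SymmC ℒ X) {j : ℤ} {x : L} (hx : x ∈ ℒ j) :
    FirstLeibniz 𝒜 ℒ (d + j) (ins x X) (ins x σ) := by
  intro i ζ hζ b a ha
  have haz : a • ζ ∈ ℒ (b + i) := SetLike.GradedSMul.smul_mem ha hζ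
  rw [ins_comm hX hx haz, h i ζ hζ b a ha, ins_comm hX hx hζ, ins_add, ins_smul, ins_lact,
    lact_smul, ins_cstar hx, ins_cst, ins_cstar hx, ins_cst]
  simp only [mul_add, sg_add, cstar_zero_right, add_zero, cstar_smul_left]
  match_scalars <;> grind [sg_mul_self]

theorem smulB_deg [Module A W] [IsScalarTower K A W] {𝒲 : ℤ → Submodule K W} [GradedAlgebra 𝒜]
    [SetLike.GradedSMul 𝒜 𝒲] (i j : ℤ) (a : A) (ha : a ∈ 𝒜 i) (w : W) (hw : w ∈ 𝒲 j) :
    smulB K A W a w ∈ 𝒲 (i + j) := SetLike.GradedSMul.smul_mem ha hw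

/-- The pointwise rule `φ(f w) = σ(f) w ± f φ(w)`, with scalar and vector replaced by families. -/
theorem cstar_cstar_smul_of_derLike [Module A W] [IsScalarTower K A W]
    {Φ : Type*} [AddCommGroup Φ] [Module K Φ] {P : Φ →ₗ[K] W →ₗ[K] W} {φ : Cochain K L Φ}
    {σ : Cochain K L (Module.End K A)} (hφ : DerLike 𝒜 ℒ P d φ σ)
    {f : Cochain K L A} (hf : DegC ℒ 𝒜 p f) (G : Cochain K L W) :
    cstar ℒ (p + c) P φ (cstar ℒ c (smulB K A W) f G) =
      cstar ℒ c (smulB K A W) (cstar ℒ p (evB K A) σ f) G +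
        sg K (d * p) • cstar ℒ (d + c) (smulB K A W) f (cstar ℒ c P φ G) := by
  funext n
  induction n generalizing φ σ f G d p c with
  | zero =>
    refine zero_ext fun ξ => ?_
    have := hφ 0 (fun _ => 0) ξ (fun i => i.elim0) p _ (hf.zero_apply ξ) (G 0 ξ)
    simpa [cstar_zero_apply, smulB_apply] using this
  | succ n ih =>
    refine succ_ext (ℒ := ℒ) fun i a ha => ?_
    have h1 := ih (c := c) (hφ.ins ha) hf G
    have h2 := ih (c := c) hφ (hf.ins ha) G
    have h3 := ih (c := c + i) hφ hf (RightRep.ins a G)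
    rw [show p + i + c = p + c + i by ring] at h2
    rw [← add_assoc, ← add_assoc] at h3
    rw [show d + i + c = d + c + i by ring] at h1
    simp only [ins_cstar ha, ins_smul, ins_add, cstar_add_left, cstar_smul_left, cstar_add_right,
      cstar_smul_right, Pi.add_apply, Pi.smul_apply, h1, h2, h3, mul_add, add_mul, sg_add]
    match_scalars <;> grind [sg_mul_self]

section Substitution

variable [IsScalarTower K A L] [GradedAlgebra 𝒜] [SetLike.GradedSMul 𝒜 ℒ]

/-- A coefficient family `f` in front of an inserted `Z` can be pulled out of a linear family. Such
coefficients occur because the symbol part of a Leibniz rule has the form `σ(a) ζ`, with entries of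
its own. -/
theorem circ_cstar_smul_of_left [Module A W] [IsScalarTower K A W] {F : Cochain K L W}
    (hF : SymmC ℒ F) (hF' : FirstLeft 𝒜 ℒ c F) {f : Cochain K L A} (hf : DegC ℒ 𝒜 p f)
    {Z : Cochain K L L} (hZ : DegC ℒ ℒ z Z) :
    circ ℒ F (cstar ℒ z (smulB K A L) f Z) =
      sg K (p * c) • cstar ℒ (c + z) (smulB K A W) f (circ ℒ F Z) := by
  funext n
  induction n generalizing F f Z c p z with
  | zero =>
    refine zero_ext fun ξ => ?_
    rw [circ_zero_apply, cstar_zero_apply, smulB_apply,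
      hF' _ _ (hZ.zero_apply ξ) _ _ (hf.zero_apply ξ), Pi.smul_apply, Pi.smul_apply, smul_apply,
      smul_apply, cstar_zero_apply, circ_zero_apply]
    rfl
  | succ n ih =>
    refine succ_ext (ℒ := ℒ) fun i a ha => ?_
    simp only [ins_circ ha hF (hf.cstar smulB_deg hZ z), ins_cstar ha, ins_circ ha hF hZ, ins_smul,
      circ_add_right, circ_smul_right, cstar_add_right, cstar_smul_right, Pi.add_apply,
      Pi.smul_apply, ih hF hF' (hf.ins ha) hZ, ih hF hF' hf (hZ.ins ha),
      ih (hF.ins ha) (hF'.ins hF ha) hf hZ, mul_add, add_mul, sg_add]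
    rw [show c + i + z = c + z + i by ring, show c + (z + i) = c + z + i by ring]
    match_scalars <;> grind [sg_mul_self]

theorem circ_cstar_smul_of_right {F : Cochain K L (Q →ₗ[K] W)}
    (hF : SymmC ℒ F) (hF' : FirstRight 𝒜 ℒ F) {f : Cochain K L A} (hf : DegC ℒ 𝒜 p f)
    {Z : Cochain K L L} (hZ : DegC ℒ ℒ z Z) :
    circ ℒ F (cstar ℒ z (smulB K A L) f Z) =
      sg K (p * z) • cstar ℒ p (compSMul K A Q W) (circ ℒ F Z) f := by
  funext n
  induction n generalizing F f Z p z with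
  | zero =>
    refine zero_ext fun ξ => ?_
    rw [circ_zero_apply, cstar_zero_apply, smulB_apply,
      hF' _ _ (hZ.zero_apply ξ) _ _ (hf.zero_apply ξ), Pi.smul_apply, Pi.smul_apply, smul_apply,
      smul_apply, cstar_zero_apply, cstar_zero_apply, circ_zero_apply]
    rfl
  | succ n ih =>
    refine succ_ext (ℒ := ℒ) fun i a ha => ?_
    simp only [ins_circ ha hF (hf.cstar smulB_deg hZ z), ins_cstar ha, ins_circ ha hF hZ, ins_smul,
      circ_add_right, circ_smul_right, cstar_add_left, cstar_smul_left, Pi.add_apply,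
      Pi.smul_apply, ih hF hF' (hf.ins ha) hZ, ih hF hF' hf (hZ.ins ha),
      ih (hF.ins ha) (hF'.ins hF ha) hf hZ, mul_add, add_mul, sg_add]
    match_scalars <;> grind [sg_mul_self]

/-- As for a linear family, except that each extraction of `f` leaves behind the term in which `σ`
differentiates `f`. -/
theorem circ_cstar_smul_of_leibniz {X : Cochain K L L} {σ : Cochain K L (Module.End K A)}
    (hX : SymmC ℒ X) (hX' : FirstLeibniz 𝒜 ℒ d X σ) {f : Cochain K L A} (hf : DegC ℒ 𝒜 p f)
    {Z : Cochain K L L} (hZ : DegC ℒ ℒ z Z) :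
    circ ℒ X (cstar ℒ z (smulB K A L) f Z) =
      sg K (p * d) • cstar ℒ (d + z) (smulB K A L) f (circ ℒ X Z) +
        cstar ℒ z (smulB K A L) (cstar ℒ p (evB K A) σ f) Z := by
  funext n
  induction n generalizing X σ f Z d p z with
  | zero =>
    refine zero_ext fun ξ => ?_
    rw [circ_zero_apply, cstar_zero_apply, smulB_apply,
      hX' _ _ (hZ.zero_apply ξ) _ _ (hf.zero_apply ξ)]
    simp only [Pi.add_apply, add_apply, Pi.smul_apply, smul_apply, cstar_zero_apply,
      circ_zero_apply]
    rfl
  | succ n ih =>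
    refine succ_ext (ℒ := ℒ) fun i a ha => ?_
    simp only [ins_circ ha hX (hf.cstar smulB_deg hZ z), ins_cstar ha, ins_circ ha hX hZ, ins_smul,
      ins_add,
      circ_add_right, circ_smul_right, cstar_add_left, cstar_smul_left, cstar_add_right,
      cstar_smul_right, Pi.add_apply,
      Pi.smul_apply, ih hX hX' (hf.ins ha) hZ, ih hX hX' hf (hZ.ins ha),
      ih (hX.ins ha) (hX'.ins hX ha) hf hZ, mul_add, add_mul, sg_add]
    rw [show d + i + z = d + z + i by ring, show d + (z + i) = d + z + i by ring]
    match_scalars <;> grind [sg_mul_self]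

end Substitution

end Linearity

end RightRep

namespace RightRep

open scoped DirectSum TensorProduct

/-! ### From linearity in the first argument to linearity in all arguments. -/

section Linearity

variable {K A L : Type*} [Field K] [Ring A] [Algebra K A] [AddCommGroup L] [Module K L]
  [Module A L]
variable {W Q : Type*} [AddCommGroup W] [Module K W] [AddCommGroup Q] [Module K Q] [Module A Q]
  [IsScalarTower K A Q]
variable {𝒜 : ℤ → Submodule K A} {ℒ : ℤ → Submodule K L} [DirectSum.Decomposition ℒ]
variable {c d p z b : ℤ}

/-- A scalar acts as the product with a constant, so the rules for `cstar` apply. The recorded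
degree `c` is arbitrary because a constant leaves the left block empty. -/
theorem mapC_cst_smulB [Module A W] [IsScalarTower K A W] (a : A) (c : ℤ) (F : Cochain K L W) :
    lact a F = cstar ℒ c (smulB K A W) (cst K L a) F := (cstar_cst_left _ _).symm

theorem cstar_cst_apply {U V : Type*} [AddCommGroup U] [Module K U] [AddCommGroup V] [Module K V]
    {B : U →ₗ[K] V →ₗ[K] W} (u : U) (v : V) :
    cstar ℒ c B (cst K L u) (cst K L v) = cst K L (B u v) := by
  rw [cstar_cst_left, mapC_cst]

/-! Linearity in the first argument and linearity in all arguments -/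

theorem firstLeft_of_leftLin [Module A W] [IsScalarTower K A W] {F : Cochain K L W}
    (h : ∀ n, LeftLin 𝒜 ℒ c (F n)) : FirstLeft 𝒜 ℒ c F := by
  intro i ζ hζ b a ha
  refine cochain_ext ℒ fun n e ξ hξ => ?_
  have := h (n + 1) _ _ (isHom_cons hζ hξ) 0 b a ha
  rw [sum_Iio_eq] at this
  simpa [ins_apply, lact_apply] using this

theorem sum_Iio_succ {n : ℕ} (e : Fin (n + 1) → ℤ) (x : Fin n) :
    ∑ j ∈ Finset.Iio x.succ, e j = e 0 + ∑ j ∈ Finset.Iio x, Fin.tail e j := by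
  rw [sum_Iio_eq, sum_Iio_eq, Fin.sum_univ_succ]
  simp [Fin.tail]

/-- For a later slot, insert the first argument: the resulting family is again symmetric and linear
in its first argument, and the slot has moved one step forward. -/
theorem FirstLeft.leftLin [Module A W] [IsScalarTower K A W] [GradedAlgebra 𝒜]
    [SetLike.GradedSMul 𝒜 ℒ] {F : Cochain K L W}
    (h : FirstLeft 𝒜 ℒ c F) (hF : SymmC ℒ F) (n : ℕ) : LeftLin 𝒜 ℒ c (F n) := by
  induction n generalizing F c with
  | zero => exact fun _ _ _ i => i.elim0
  | succ n ih =>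
    intro e ξ hξ x b a ha
    induction x using Fin.cases with
    | zero =>
      have := congrArg (fun G => G n (Fin.tail ξ)) (h _ _ (hξ 0) b a ha)
      simp only [ins_apply, Pi.smul_apply, smul_apply, lact_apply, Fin.cons_self_tail] at this
      rw [sum_Iio_eq]
      simp only [Fin.not_lt_zero, if_false, Finset.sum_const_zero, add_zero, ← this]
      congr 1
      rw [← Fin.update_cons_zero (ξ 0), Fin.cons_self_tail]
    | succ x =>
      have := ih (h.ins hF (hξ 0)) (hF.ins (hξ 0)) _ _ hξ.tail x b a ha
      rw [sum_Iio_succ, ← add_assoc]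
      rw [ins_apply, ins_apply, Fin.cons_self_tail] at this
      rw [← this]
      congr 1
      rw [Fin.cons_update, Fin.cons_self_tail]
      rfl

theorem firstRight_of_rightLin {F : Cochain K L (Q →ₗ[K] W)}
    (h : ∀ n, RightLin 𝒜 ℒ (F n)) : FirstRight 𝒜 ℒ F := by
  intro i ζ hζ b a ha
  refine cochain_ext ℒ fun n e ξ hξ => ?_
  have := h (n + 1) _ _ (isHom_cons hζ hξ) 0 b a ha
  rw [sum_Ici_eq, sum_Iio_eq] at this
  rw [Pi.smul_apply, smul_apply, cstar_cst_right_apply _ _ hξ, smul_smul, ← sg_add, ← mul_add]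
  simp only [Fin.update_cons_zero, Fin.cons_zero, Fin.not_lt_zero, if_false,
    Finset.sum_const_zero, sub_zero, Fin.sum_univ_succ, Fin.cons_succ] at this
  exact this

theorem FirstRight.rightLin [GradedAlgebra 𝒜]
    [SetLike.GradedSMul 𝒜 ℒ] {F : Cochain K L (Q →ₗ[K] W)}
    (h : FirstRight 𝒜 ℒ F) (hF : SymmC ℒ F) (n : ℕ) : RightLin 𝒜 ℒ (F n) := by
  induction n generalizing F with
  | zero => exact fun _ _ _ i => i.elim0
  | succ n ih =>
    intro e ξ hξ x b a ha
    induction x using Fin.cases with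
    | zero =>
      have := congrArg (fun G => G n (Fin.tail ξ)) (h _ _ (hξ 0) b a ha)
      simp only [Pi.smul_apply, smul_apply] at this
      rw [cstar_cst_right_apply _ _ hξ.tail, smul_smul, ← sg_add, ← mul_add, ins_apply, ins_apply,
        Fin.cons_self_tail] at this
      rw [sum_Ici_eq, sum_Iio_eq]
      simp only [Fin.not_lt_zero, if_false, Finset.sum_const_zero, sub_zero, Fin.sum_univ_succ]
      refine Eq.trans ?_ this
      congr 1
      rw [← Fin.update_cons_zero (ξ 0), Fin.cons_self_tail]
    | succ x =>
      have := ih (h.ins hF (hξ 0)) (hF.ins (hξ 0)) _ _ hξ.tail x b a ha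
      rw [sum_Ici_eq, sum_Iio_succ, Fin.sum_univ_succ, add_sub_add_left_eq_sub]
      rw [sum_Ici_eq, ins_apply, ins_apply, Fin.cons_self_tail] at this
      refine Eq.trans ?_ this
      congr 1
      rw [Fin.cons_update, Fin.cons_self_tail]
      rfl

/-- Bridge between the Leibniz rule in the last argument, used in the definition of
multiderivations, and insertions at the front. -/
theorem snoc_eq_cons {n : ℕ} {F : Cochain K L W} (hF : SymmC ℒ F) {e : Fin n → ℤ} {ξ : Fin n → L}
    (hξ : IsHom ℒ e ξ) {i : ℤ} {ζ : L} (hζ : ζ ∈ ℒ i) :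
    F (n + 1) (Fin.snoc (α := fun _ => L) ξ ζ) =
      sg K (i * ∑ j, e j) • F (n + 1) (Fin.cons ζ ξ : Fin (n + 1) → L) := by
  induction n generalizing F with
  | zero =>
    have : Fin.snoc (α := fun _ => L) ξ ζ = (Fin.cons ζ ξ : Fin 1 → L) := by
      funext j
      obtain rfl : j = 0 := Fin.fin_one_eq_zero j
      rfl
    simp [this, sg_zero]
  | succ n ih =>
    have h1 := ih (hF.ins (hξ 0)) hξ.tail
    have h2 := congrArg (fun G => G n (Fin.tail ξ)) (ins_comm hF (hξ 0) hζ)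
    simp only [ins_apply, Pi.smul_apply, smul_apply, Fin.cons_self_tail] at h1 h2
    rw [h2, Fin.cons_snoc_eq_snoc_cons, Fin.cons_self_tail, smul_smul, ← sg_add] at h1
    rw [h1, Fin.sum_univ_succ]
    congr 1
    refine sg_ext ?_
    simp only [Fin.tail, mul_add, mul_comm (e 0), add_comm]

theorem firstLeibniz_iff [IsScalarTower K A L] [GradedAlgebra 𝒜] [SetLike.GradedSMul 𝒜 ℒ]
    {X : Cochain K L L} (hX : SymmC ℒ X) {σ : Cochain K L (Module.End K A)} :
    FirstLeibniz 𝒜 ℒ d X σ ↔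
      ∀ (n : ℕ) (e : Fin n → ℤ) (ξ : Fin n → L), IsHom ℒ e ξ → ∀ b, ∀ a ∈ 𝒜 b, ∀ ζ : L,
        X (n + 1) (Fin.snoc (α := fun _ => L) ξ (a • ζ)) = σ n ξ a • ζ +
          sg K ((d + ∑ i, e i) * b) • a • X (n + 1) (Fin.snoc (α := fun _ => L) ξ ζ) := by
  -- For homogeneous `ζ` the two rules differ by the sign of moving `ζ`, or `a • ζ`, past all
  -- entries. That sign is invertible, so the equivalence holds entry by entry.
  have key : ∀ (n : ℕ) (e : Fin n → ℤ) (ξ : Fin n → L), IsHom ℒ e ξ → ∀ b, ∀ a ∈ 𝒜 b, ∀ i,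
      ∀ ζ ∈ ℒ i,
      (ins (a • ζ) X n ξ = (sg K (b * d) • lact a (ins ζ X) +
        cstar ℒ i (smulB K A L) (cstar ℒ b (evB K A) σ (cst K L a)) (cst K L ζ)) n ξ ↔
      X (n + 1) (Fin.snoc (α := fun _ => L) ξ (a • ζ)) = σ n ξ a • ζ +
          sg K ((d + ∑ i, e i) * b) • a • X (n + 1) (Fin.snoc (α := fun _ => L) ξ ζ)) := by
    intro n e ξ hξ b a ha i ζ hζ
    have haz : a • ζ ∈ ℒ (b + i) := SetLike.GradedSMul.smul_mem ha hζ
    rw [snoc_eq_cons hX hξ haz, snoc_eq_cons hX hξ hζ, Pi.add_apply, add_apply,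
      cstar_cst_right_apply _ _ hξ, cstar_cst_right_apply _ _ hξ, ins_apply, Pi.smul_apply,
      smul_apply, lact_apply, ins_apply, smulB_apply, LinearMap.id_apply, smul_assoc]
    rw [smul_comm a]
    generalize X (n + 1) (Fin.cons (a • ζ) ξ) = x
    generalize a • X (n + 1) (Fin.cons ζ ξ) = y
    generalize σ n ξ a • ζ = w
    generalize ∑ j, e j = s
    have hs := sg_mul_self (K := K) ((b + i) * s)
    constructor
    · rintro rfl
      simp only [add_mul, sg_add, mul_comm b d, mul_comm b s]
      match_scalars <;> grind [sg_mul_self]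
    · intro h
      have h' := congrArg (fun y => sg K ((b + i) * s) • y) h
      simp only [smul_smul, hs, one_smul, smul_add] at h'
      rw [h']
      simp only [add_mul, sg_add, mul_comm b d, mul_comm b s]
      match_scalars <;> grind [sg_mul_self]
  constructor
  · intro h n e ξ hξ b a ha ζ
    -- The definition allows an inhomogeneous last argument; both sides are additive in it.
    induction ζ using hom_induction (ℒ := ℒ) with
    | h0 =>
      have : X (n + 1) (Fin.snoc (α := fun _ => L) ξ 0) = 0 :=
        (X (n + 1)).map_coord_zero (Fin.last n) (by simp)
      simp [this]
    | hadd x y hx hy =>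
      rw [smul_add, MultilinearMap.snoc_add, MultilinearMap.snoc_add, hx, hy]
      simp only [smul_add]
      abel
    | hom i ζ hζ =>
      rw [← key n e ξ hξ b a ha i ζ hζ, h i ζ hζ b a ha]
  · intro h i ζ hζ b a ha
    exact cochain_ext ℒ fun n e ξ hξ => (key n e ξ hξ b a ha i ζ hζ).2 (h n e ξ hξ b a ha ζ)

end Linearity

end RightRep

namespace RightRep

open scoped DirectSum TensorProduct

/-! ### Stability of the linearity and Leibniz conditions under operators and brackets. -/

section Closure

variable {K A L : Type*} [Field K] [Ring A] [Algebra K A] [AddCommGroup L] [Module K L]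
  [Module A L] [IsScalarTower K A L]
variable {W Q : Type*} [AddCommGroup W] [Module K W] [AddCommGroup Q] [Module K Q] [Module A Q]
  [IsScalarTower K A Q]
variable {𝒜 : ℤ → Submodule K A} {ℒ : ℤ → Submodule K L} [DirectSum.Decomposition ℒ]
  [GradedAlgebra 𝒜] [SetLike.GradedSMul 𝒜 ℒ]
variable {c d p z b e i : ℤ}

theorem circ_lact_of_left [Module A W] [IsScalarTower K A W] {F : Cochain K L W}
    (hF : SymmC ℒ F) (hF' : FirstLeft 𝒜 ℒ c F) {a : A} (ha : a ∈ 𝒜 b)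
    {Z : Cochain K L L} (hZ : DegC ℒ ℒ z Z) :
    circ ℒ F (lact a Z) = sg K (b * c) • lact a (circ ℒ F Z) := by
  rw [mapC_cst_smulB (ℒ := ℒ) a z, circ_cstar_smul_of_left hF hF' (DegC.cst ha) hZ, ← mapC_cst_smulB]

theorem circ_lact_of_right {F : Cochain K L (Q →ₗ[K] W)}
    (hF : SymmC ℒ F) (hF' : FirstRight 𝒜 ℒ F) {a : A} (ha : a ∈ 𝒜 b)
    {Z : Cochain K L L} (hZ : DegC ℒ ℒ z Z) :
    circ ℒ F (lact a Z) =
      sg K (b * z) • cstar ℒ b (compSMul K A Q W) (circ ℒ F Z) (cst K L a) := by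
  rw [mapC_cst_smulB (ℒ := ℒ) a z, circ_cstar_smul_of_right hF hF' (DegC.cst ha) hZ]

theorem circ_lact_of_leibniz {X : Cochain K L L} {σ : Cochain K L (Module.End K A)}
    (hX : SymmC ℒ X) (hX' : FirstLeibniz 𝒜 ℒ d X σ) {a : A} (ha : a ∈ 𝒜 b)
    {Z : Cochain K L L} (hZ : DegC ℒ ℒ z Z) :
    circ ℒ X (lact a Z) = sg K (b * d) • lact a (circ ℒ X Z) +
        cstar ℒ z (smulB K A L) (cstar ℒ b (evB K A) σ (cst K L a)) Z := by
  rw [mapC_cst_smulB (ℒ := ℒ) a z, circ_cstar_smul_of_leibniz hX hX' (DegC.cst ha) hZ, ← mapC_cst_smulB]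

theorem cstar_lact_of_derLike [Module A W] [IsScalarTower K A W]
    {Φ : Type*} [AddCommGroup Φ] [Module K Φ] {P : Φ →ₗ[K] W →ₗ[K] W} {φ : Cochain K L Φ}
    {σ : Cochain K L (Module.End K A)} (hφ : DerLike 𝒜 ℒ P d φ σ)
    {a : A} (ha : a ∈ 𝒜 b) (G : Cochain K L W) :
    cstar ℒ (b + c) P φ (lact a G) =
      cstar ℒ c (smulB K A W) (cstar ℒ b (evB K A) σ (cst K L a)) G +
        sg K (d * b) • lact a (cstar ℒ c P φ G) := by
  rw [mapC_cst_smulB (ℒ := ℒ) a c, cstar_cstar_smul_of_derLike hφ (DegC.cst ha) G, ← mapC_cst_smulB]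

/-- The degree `m` derivations of `A`. -/
def derSub (𝒜 : ℤ → Submodule K A) (m : ℤ) : Submodule K (Module.End K A) where
  carrier := {D | IsDerivation 𝒜 m D}
  zero_mem' := ⟨Submodule.zero_mem _, by simp⟩
  add_mem' := fun {D D'} h h' => ⟨Submodule.add_mem _ h.1 h'.1, fun i a ha b => by
    simp only [LinearMap.add_apply, h.2 i a ha b, h'.2 i a ha b, add_mul, mul_add, smul_add]
    abel⟩
  smul_mem' := fun r D h => ⟨Submodule.smul_mem _ r h.1, fun i a ha b => by
    simp only [LinearMap.smul_apply, h.2 i a ha b, smul_add, smul_mul_assoc, mul_smul_comm,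
      smul_comm r]⟩

theorem mem_derSub {m : ℤ} {D : Module.End K A} : D ∈ derSub 𝒜 m ↔ IsDerivation 𝒜 m D := Iff.rfl

theorem commutator_mem_endDeg {V : Type*} [AddCommGroup V] [Module K V] {𝒱 : ℤ → Submodule K V}
    (i j : ℤ) (x : Module.End K V) (hx : x ∈ endDeg 𝒱 i) (y : Module.End K V)
    (hy : y ∈ endDeg 𝒱 j) : x * y - sg K (i * j) • (y * x) ∈ endDeg 𝒱 (i + j) := by
  refine Submodule.sub_mem _ (fun k v hv => ?_) (Submodule.smul_mem _ _ fun k v hv => ?_)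
  · rw [add_assoc]; exact hx _ _ (hy _ _ hv)
  · rw [add_comm i, add_assoc]; exact hy _ _ (hx _ _ hv)

theorem commutator_mem_derSub (i j : ℤ) (x : Module.End K A) (hx : x ∈ derSub 𝒜 i)
    (y : Module.End K A) (hy : y ∈ derSub 𝒜 j) :
    x * y - sg K (i * j) • (y * x) ∈ derSub 𝒜 (i + j) := by
  refine ⟨commutator_mem_endDeg i j x hx.1 y hy.1, fun k a ha b => ?_⟩
  simp only [LinearMap.sub_apply, LinearMap.smul_apply, Module.End.mul_apply, hx.2 k a ha b,
    hy.2 k a ha b, map_add, map_smul, hx.2 _ _ (hy.1 _ _ ha) b, hy.2 _ _ (hx.1 _ _ ha) b,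
    hx.2 k a ha, hy.2 k a ha, add_mul, mul_add, sg_add, sub_mul, mul_sub, smul_mul_assoc,
    mul_smul_comm]
  match_scalars <;> grind [sg_mul_self]

theorem opBracket_deg {V : Type*} [AddCommGroup V] [Module K V] {𝒱 : ℤ → Submodule K (Module.End K V)}
    (h : ∀ i j, ∀ x ∈ 𝒱 i, ∀ y ∈ 𝒱 j, x * y - sg K (i * j) • (y * x) ∈ 𝒱 (i + j))
    {f g : Cochain K L (Module.End K V)} (hf : DegC ℒ 𝒱 d f) (hg : DegC ℒ 𝒱 e g) :
    DegC ℒ 𝒱 (d + e) (opBracket ℒ d e f g) := by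
  intro N u ξ hξ
  rw [opBracket_apply _ _ _ _ hξ]
  refine shuffleSum_mem (fun p q u u' x y hx hy => Submodule.smul_mem _ _ ?_) hξ
  rw [add_add_add_comm]
  exact h _ _ _ (hf _ _ _ hx) _ (hg _ _ _ hy)

theorem opBracket_symm {V : Type*} [AddCommGroup V] [Module K V]
    {f g : Cochain K L (Module.End K V)} (hf : SymmC ℒ f) (hg : SymmC ℒ g) :
    SymmC ℒ (opBracket ℒ d e f g) := by
  rw [opBracket_eq]
  exact (cstar_symm hf hg).sub ((cstar_symm hg hf).smul _)

/-- The left linear families are preserved by the operators associated with multiderivations. -/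
theorem FirstLeft.operator [Module A W] [IsScalarTower K A W]
    {P : Module.End K A →ₗ[K] W →ₗ[K] W} (hP : ∀ (a : A) x y, P (a • x) y = a • P x y)
    {X : Cochain K L L} (hX' : DegC ℒ ℒ d X)
    {σ : Cochain K L (Module.End K A)} (hσ : FirstLeft 𝒜 ℒ d σ) (hσ' : DerLike 𝒜 ℒ P d σ σ)
    (hσ'' : DegC ℒ (derSub 𝒜) d σ)
    (hXσ : FirstLeibniz 𝒜 ℒ d X σ) {F : Cochain K L W} (hF : SymmC ℒ F)
    (hF' : FirstLeft 𝒜 ℒ c F) :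
    FirstLeft 𝒜 ℒ (d + c) (cstar ℒ c P σ F - sg K (d * c) • circ ℒ F X) := by
  intro i ζ hζ b a ha
  have haz : a • ζ ∈ ℒ (b + i) := SetLike.GradedSMul.smul_mem ha hζ
  have hev : ∀ i j, ∀ x ∈ derSub 𝒜 i, ∀ y ∈ 𝒜 j, evB K A x y ∈ 𝒜 (i + j) :=
    fun i j x hx y hy => hx.1 j y hy
  have hσa : DegC ℒ 𝒜 (d + b) (cstar ℒ b (evB K A) σ (cst K L a)) :=
    DegC.cstar hev hσ'' (DegC.cst ha) b
  rw [ins_sub, ins_smul, ins_sub, ins_smul, ins_cstar haz, ins_cstar hζ, ins_circ haz hF hX',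
    ins_circ hζ hF hX', hσ i ζ hζ b a ha, hF' i ζ hζ b a ha, hXσ i ζ hζ b a ha, circ_add_right,
    circ_smul_right, cstar_smul_left, cstar_smul_right, circ_smul_left, cstar_lact_left hP,
    circ_lact, circ_lact_of_left hF hF' ha (hX'.ins hζ),
    circ_cstar_smul_of_left hF hF' hσa (DegC.cst hζ), circ_cst_right hF hζ,
    show c + (b + i) = b + (c + i) by ring, cstar_lact_of_derLike hσ' ha]
  -- Here `a` is differentiated twice: by `σ` acting on the value of `F` at `a • ζ`, and through the
  -- Leibniz rule of `X` inside `F`. The two terms cancel.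
  simp only [lact_sub, lact_add, lact_smul, mul_add, add_mul, sg_add]
  match_scalars <;> grind [sg_mul_self]

/-- The commutation rule of a derivation with multiplication by `a`, as an identity of operators: `φ
∘ a = ± a φ + σ(a)`. -/
theorem compSMul_of_derLike {φ : Cochain K L (Module.End K Q)} {σ : Cochain K L (Module.End K A)}
    (hφ : DerLike 𝒜 ℒ (LinearMap.id : Module.End K Q →ₗ[K] Q →ₗ[K] Q) d φ σ) {a : A}
    (ha : a ∈ 𝒜 b) :
    cstar ℒ b (compSMul K A Q Q) φ (cst K L a) =
      sg K (d * b) • lact a φ + mapC (smulB K A Q) (cstar ℒ b (evB K A) σ (cst K L a)) := by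
  refine cochain_ext ℒ fun n e ξ hξ => LinearMap.ext fun q => ?_
  have := hφ n e ξ hξ b a ha q
  rw [LinearMap.id_apply] at this
  simp only [cstar_cst_right_apply _ _ hξ, LinearMap.smul_apply, compSMul_apply, this,
    Pi.add_apply, Pi.smul_apply, smul_apply, add_apply, LinearMap.add_apply, mapC_apply, map_smul,
    smulB_apply, lact_apply, LinearMap.id_apply, add_mul, sg_add]
  generalize a • φ n ξ q = x
  generalize σ n ξ a • q = y
  rw [mul_comm _ b]
  match_scalars <;> grind [sg_mul_self]

/-- The right linear families are preserved by the operators associated with right derivations. -/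
theorem FirstRight.operator {X : Cochain K L L} (hX' : DegC ℒ ℒ d X)
    {σ : Cochain K L (Module.End K A)} (hσ'' : DegC ℒ (derSub 𝒜) d σ)
    (hXσ : FirstLeibniz 𝒜 ℒ d X σ) {φ : Cochain K L (Module.End K Q)}
    (hφ : DerLike 𝒜 ℒ (LinearMap.id : Module.End K Q →ₗ[K] Q →ₗ[K] Q) d φ σ)
    (hφ' : FirstRight 𝒜 ℒ φ)
    {F : Cochain K L (Q →ₗ[K] W)} (hF : SymmC ℒ F) (hF' : FirstRight 𝒜 ℒ F) :
    FirstRight 𝒜 ℒ (circ ℒ F X + cstar ℒ d (LinearMap.llcomp K Q Q W) F φ) := by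
  intro i ζ hζ b a ha
  have haz : a • ζ ∈ ℒ (b + i) := SetLike.GradedSMul.smul_mem ha hζ
  have hev : ∀ i j, ∀ x ∈ derSub 𝒜 i, ∀ y ∈ 𝒜 j, evB K A x y ∈ 𝒜 (i + j) :=
    fun i j x hx y hy => hx.1 j y hy
  have hσa : DegC ℒ 𝒜 (d + b) (cstar ℒ b (evB K A) σ (cst K L a)) :=
    DegC.cstar hev hσ'' (DegC.cst ha) b
  -- Composition is associative: a scalar released by `F` can be regarded as acting on the values of
  -- `φ`.
  have h1 : cstar ℒ d (LinearMap.llcomp K Q Q W)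
      (cstar ℒ b (compSMul K A Q W) (RightRep.ins ζ F) (cst K L a)) φ =
      cstar ℒ (b + d) (LinearMap.llcomp K Q Q W) (RightRep.ins ζ F) (lact a φ) := by
    rw [cstar_assoc (B₃ := LinearMap.llcomp K Q Q W) (B₄ := smulB K A (Module.End K Q))
      (fun _ _ _ => rfl), ← mapC_cst_smulB]
  have h2 : cstar ℒ (d + (b + i)) (LinearMap.llcomp K Q Q W) F
      (cstar ℒ b (compSMul K A Q Q) (RightRep.ins ζ φ) (cst K L a)) =
      cstar ℒ b (compSMul K A Q W) (cstar ℒ (d + i) (LinearMap.llcomp K Q Q W) F (RightRep.ins ζ φ))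
        (cst K L a) := by
    rw [show d + (b + i) = d + i + b by ring, cstar_assoc (B₃ := LinearMap.llcomp K Q Q W)
      (B₄ := compSMul K A Q Q) (fun _ _ _ => rfl)]
  -- Moving `a` from the right of `φ` to its left leaves a term with `σ(a)`. It matches the term
  -- that comes from the Leibniz rule of `X` inside `F`.
  have h3 : cstar ℒ b (compSMul K A Q W) (cstar ℒ d (LinearMap.llcomp K Q Q W) (RightRep.ins ζ F) φ)
      (cst K L a) = sg K (d * b) • cstar ℒ (b + d) (LinearMap.llcomp K Q Q W) (RightRep.ins ζ F) (lact a φ) +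
        cstar ℒ (d + b) (compSMul K A Q W) (RightRep.ins ζ F) (cstar ℒ b (evB K A) σ (cst K L a)) := by
    rw [cstar_assoc (B₃ := LinearMap.llcomp K Q Q W) (B₄ := compSMul K A Q Q) (fun _ _ _ => rfl),
      compSMul_of_derLike hφ ha, cstar_add_right, cstar_smul_right, add_comm b d,
      cstar_mapC_right (B' := compSMul K A Q W) (fun _ _ => rfl)]
  rw [ins_add, ins_add, ins_cstar haz, ins_cstar hζ, ins_circ haz hF hX',
    ins_circ hζ hF hX', hF' i ζ hζ b a ha, hφ' i ζ hζ b a ha, hXσ i ζ hζ b a ha, circ_add_right,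
    circ_smul_right, cstar_smul_left, cstar_smul_right, circ_smul_left,
    circ_lact_of_right hF hF' ha (hX'.ins hζ),
    circ_cstar_smul_of_right hF hF' hσa (DegC.cst hζ), circ_cst_right hF hζ,
    circ_cstar (hF.ins hζ) (SymmC.cst a) hX', circ_cst_left, cstar_zero_right, h1, h2]
  simp only [cstar_add_left, cstar_smul_left, h3, mul_add, add_mul, sg_add]
  match_scalars <;> grind [sg_mul_self]

/-- A composite of two multiderivations violates the Leibniz rule by the two cross terms at the end,
each differentiating `a` by one symbol while the other map takes `ζ`. The second summand displays
the contribution to the symbol of the bracket. -/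
theorem ins_smul_circ {X Y : Cochain K L L} (hX : SymmC ℒ X) (hY' : DegC ℒ ℒ e Y)
    {σ τ : Cochain K L (Module.End K A)} (hσ : SymmC ℒ σ)
    (hτ : DegC ℒ (derSub 𝒜) e τ) (hXσ : FirstLeibniz 𝒜 ℒ d X σ)
    (hYτ : FirstLeibniz 𝒜 ℒ e Y τ) {ζ : L} (hζ : ζ ∈ ℒ i) {a : A} (ha : a ∈ 𝒜 b) :
    ins (a • ζ) (circ ℒ X Y) = sg K (b * (d + e)) • lact a (ins ζ (circ ℒ X Y)) +
      cstar ℒ i (smulB K A L) (cstar ℒ b (evB K A)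
        (circ ℒ σ Y + cstar ℒ e (LinearMap.mul K (Module.End K A)) σ τ) (cst K L a)) (cst K L ζ) +
      sg K (b * e) • cstar ℒ (e + i) (smulB K A L) (cstar ℒ b (evB K A) σ (cst K L a)) (ins ζ Y) +
      sg K ((b + e) * d) •
        cstar ℒ (d + i) (smulB K A L) (cstar ℒ b (evB K A) τ (cst K L a)) (ins ζ X) := by
  have haz : a • ζ ∈ ℒ (b + i) := SetLike.GradedSMul.smul_mem ha hζ
  have hev : ∀ i j, ∀ x ∈ derSub 𝒜 i, ∀ y ∈ 𝒜 j, evB K A x y ∈ 𝒜 (i + j) :=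
    fun i j x hx y hy => hx.1 j y hy
  have hτa : DegC ℒ 𝒜 (e + b) (cstar ℒ b (evB K A) τ (cst K L a)) :=
    DegC.cstar hev hτ (DegC.cst ha) b
  have h : cstar ℒ b (evB K A) (cstar ℒ e (LinearMap.mul K (Module.End K A)) σ τ) (cst K L a) =
      cstar ℒ (e + b) (evB K A) σ (cstar ℒ b (evB K A) τ (cst K L a)) :=
    cstar_assoc (fun _ _ _ => rfl) _ _ _
  rw [ins_circ haz hX hY', ins_circ hζ hX hY', hXσ i ζ hζ b a ha, hYτ i ζ hζ b a ha,
    circ_add_right, circ_smul_right, circ_add_left, circ_smul_left, circ_lact,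
    circ_lact_of_leibniz hX hXσ ha (hY'.ins hζ),
    circ_cstar_smul_of_leibniz hX hXσ hτa (DegC.cst hζ), circ_cst_right hX hζ,
    circ_cstar (cstar_symm hσ (SymmC.cst a)) (SymmC.cst ζ) hY', circ_cst_left, cstar_zero_right,
    circ_cstar hσ (SymmC.cst a) hY', circ_cst_left, cstar_zero_right]
  simp only [lact_add, lact_smul, cstar_add_left, cstar_smul_left, h, zero_add, mul_add, add_mul,
    sg_add]
  match_scalars <;> grind [sg_mul_self]

/-- The cross terms of `X ∘ Y` and `Y ∘ X` are the same two families up to sign, so they disappear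
in the graded commutator. -/
theorem FirstLeibniz.bracket {X Y : Cochain K L L} (hX : SymmC ℒ X) (hY : SymmC ℒ Y)
    (hX' : DegC ℒ ℒ d X) (hY' : DegC ℒ ℒ e Y)
    {σ τ : Cochain K L (Module.End K A)} (hσ : SymmC ℒ σ) (hτ : SymmC ℒ τ)
    (hσ' : DegC ℒ (derSub 𝒜) d σ)
    (hτ' : DegC ℒ (derSub 𝒜) e τ) (hXσ : FirstLeibniz 𝒜 ℒ d X σ)
    (hYτ : FirstLeibniz 𝒜 ℒ e Y τ) :
    FirstLeibniz 𝒜 ℒ (d + e) (circ ℒ X Y - sg K (d * e) • circ ℒ Y X)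
      (circ ℒ σ Y - sg K (d * e) • circ ℒ τ X + opBracket ℒ d e σ τ) := by
  intro i ζ hζ b a ha
  rw [ins_sub, ins_smul, ins_smul_circ hX hY' hσ hτ' hXσ hYτ hζ ha,
    ins_smul_circ hY hX' hτ hσ' hYτ hXσ hζ ha, opBracket_eq]
  simp only [ins_sub, ins_smul, lact_sub, lact_smul, cstar_add_left, cstar_sub_left,
    cstar_smul_left, mul_add, add_mul, sg_add]
  match_scalars <;> grind [sg_mul_self]

end Closure

end RightRep

namespace RightRep

open scoped DirectSum TensorProduct

/-! ### Families with finitely many nonzero members. -/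

section FiniteFamilies

variable {K L : Type*} [Field K] [AddCommGroup L] [Module K L]
variable {U V W : Type*} [AddCommGroup U] [Module K U] [AddCommGroup V] [Module K V]
  [AddCommGroup W] [Module K W]
variable {ℒ : ℤ → Submodule K L} [DirectSum.Decomposition ℒ] {c d : ℤ} {B : U →ₗ[K] V →ₗ[K] W}

/-- A family with finitely many nonzero members. -/
def FinC (F : Cochain K L W) : Prop := ∃ N, ∀ n ≥ N, F n = 0

theorem FinC.add {F G : Cochain K L W} (hF : FinC F) (hG : FinC G) : FinC (F + G) := by
  obtain ⟨N, hN⟩ := hF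
  obtain ⟨M, hM⟩ := hG
  refine ⟨max N M, fun n hn => ?_⟩
  rw [Pi.add_apply, hN n (le_trans (le_max_left _ _) hn), hM n (le_trans (le_max_right _ _) hn),
    add_zero]

theorem FinC.smul {F : Cochain K L W} (r : K) (hF : FinC F) : FinC (r • F) := by
  obtain ⟨N, hN⟩ := hF
  exact ⟨N, fun n hn => by rw [Pi.smul_apply, hN n hn, smul_zero]⟩

theorem FinC.neg {F : Cochain K L W} (hF : FinC F) : FinC (-F) := by
  simpa using hF.smul (-1)

theorem FinC.sub {F G : Cochain K L W} (hF : FinC F) (hG : FinC G) : FinC (F - G) := by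
  rw [sub_eq_add_neg]; exact hF.add hG.neg

theorem FinC.cstar {f : Cochain K L U} {g : Cochain K L V} (hf : FinC f) (hg : FinC g) :
    FinC (cstar ℒ c B f g) := by
  obtain ⟨N, hN⟩ := hf
  obtain ⟨M, hM⟩ := hg
  refine ⟨N + M, fun n hn => Finset.sum_eq_zero fun pq hpq => ?_⟩
  rw [Finset.HasAntidiagonal.mem_antidiagonal] at hpq
  by_cases hp : N ≤ pq.1
  · rw [hN _ hp, star_zero_left]
  · rw [hM pq.2 (by omega), star_zero_right]

theorem insertion_zero_left {l n : ℕ} (Y : MultilinearMap K (fun _ : Fin l => L) L) (N : ℕ) :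
    insertion ℒ (0 : MultilinearMap K (fun _ : Fin (n + 1) => L) W) Y N = 0 := by
  ext ξ
  simp [insertion, shuffle]

theorem insertion_zero_right {l n : ℕ} (F : MultilinearMap K (fun _ : Fin (n + 1) => L) W) (N : ℕ) :
    insertion ℒ F (0 : MultilinearMap K (fun _ : Fin l => L) L) N = 0 := by
  ext ξ
  simp [insertion, shuffle]

theorem FinC.circ {F : Cochain K L W} {Y : Cochain K L L} (hF : FinC F) (hY : FinC Y) :
    FinC (circ ℒ F Y) := by
  obtain ⟨N, hN⟩ := hF
  obtain ⟨M, hM⟩ := hY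
  refine ⟨N + M, fun n hn => Finset.sum_eq_zero fun pq hpq => ?_⟩
  rw [Finset.HasAntidiagonal.mem_antidiagonal] at hpq
  by_cases hp : M ≤ pq.1
  · rw [hM _ hp, insertion_zero_right]
  · rw [hN (pq.2 + 1) (by omega), insertion_zero_left]

theorem FinC.opBracket {e : ℤ} {f g : Cochain K L (Module.End K V)} (hf : FinC f) (hg : FinC g) :
    FinC (opBracket ℒ d e f g) := by
  rw [opBracket_eq]
  exact (hf.cstar hg).sub ((hg.cstar hf).smul _)

end FiniteFamilies

/-! ### The right action of pairs, and the Jacobi identities derived from it. -/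

section BracketFormulas

variable {K L : Type*} [Field K] [AddCommGroup L] [Module K L]
variable {U V : Type*} [AddCommGroup U] [Module K U] [AddCommGroup V] [Module K V]
variable (ℒ : ℤ → Submodule K L) [DirectSum.Decomposition ℒ] (d e f : ℤ)

/-- The commutator of insertions. -/
def circBracket (X Y : Cochain K L L) : Cochain K L L :=
  circ ℒ X Y - sg K (d * e) • circ ℒ Y X

/-- The bracket of operator valued families, twisted by insertions. -/
def twistedBracket (X : Cochain K L L) (φ : Cochain K L (Module.End K V)) (Y : Cochain K L L)
    (ψ : Cochain K L (Module.End K V)) : Cochain K L (Module.End K V) :=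
  circ ℒ φ Y - sg K (d * e) • circ ℒ ψ X + opBracket ℒ d e φ ψ

/-- The right action of `(X, φ)` on families with values in a right `End V`-module. -/
def rightOp (B : U →ₗ[K] Module.End K V →ₗ[K] U) (X : Cochain K L L)
    (φ : Cochain K L (Module.End K V)) (F : Cochain K L U) : Cochain K L U :=
  circ ℒ F X + cstar ℒ d B F φ

variable {ℒ d e f}

theorem circBracket_skew (X Y : Cochain K L L) :
    circBracket ℒ d e X Y = -(sg K (d * e) • circBracket ℒ e d Y X) := by
  simp only [circBracket, mul_comm e d]
  match_scalars <;> grind [sg_mul_self]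

theorem twistedBracket_skew (X : Cochain K L L) (φ : Cochain K L (Module.End K V))
    (Y : Cochain K L L) (ψ : Cochain K L (Module.End K V)) :
    twistedBracket ℒ d e X φ Y ψ = -(sg K (d * e) • twistedBracket ℒ e d Y ψ X φ) := by
  simp only [twistedBracket, opBracket_eq, mul_comm e d]
  match_scalars <;> grind [sg_mul_self]

theorem rightOp_sub (B : U →ₗ[K] Module.End K V →ₗ[K] U) (X : Cochain K L L)
    (φ : Cochain K L (Module.End K V)) (F G : Cochain K L U) :
    rightOp ℒ d B X φ (F - G) = rightOp ℒ d B X φ F - rightOp ℒ d B X φ G := by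
  simp only [rightOp, circ_sub_left, cstar_sub_left]; abel

theorem rightOp_smul (B : U →ₗ[K] Module.End K V →ₗ[K] U) (X : Cochain K L L)
    (φ : Cochain K L (Module.End K V)) (r : K) (F : Cochain K L U) :
    rightOp ℒ d B X φ (r • F) = r • rightOp ℒ d B X φ F := by
  simp only [rightOp, circ_smul_left, cstar_smul_left, smul_add]

theorem rightOp_symm {B : U →ₗ[K] Module.End K V →ₗ[K] U} {X : Cochain K L L} (hX : SymmC ℒ X)
    (hX' : DegC ℒ ℒ d X) {φ : Cochain K L (Module.End K V)} (hφ : SymmC ℒ φ) {F : Cochain K L U}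
    (hF : SymmC ℒ F) : SymmC ℒ (rightOp ℒ d B X φ F) :=
  (circ_symm hF hX hX').add (cstar_symm hF hφ)

/-- The pre-Lie identity turns `F ∘ X ∘ Y` into the bracket of insertions, `circ_cstar` produces the
mixed terms, and associativity composes the operators. Operators multiply from the right, so the
order of composition is reversed. -/
theorem rightOp_bracket {B : U →ₗ[K] Module.End K V →ₗ[K] U}
    (hB : ∀ u f g, B (B u f) g = B u (f * g)) {X Y : Cochain K L L} (hX : SymmC ℒ X)
    (hX' : DegC ℒ ℒ d X) (hY : SymmC ℒ Y) (hY' : DegC ℒ ℒ e Y)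
    {φ ψ : Cochain K L (Module.End K V)} (hφ : SymmC ℒ φ) (hψ : SymmC ℒ ψ) {F : Cochain K L U}
    (hF : SymmC ℒ F) :
    rightOp ℒ (d + e) B (circBracket ℒ d e X Y) (twistedBracket ℒ d e X φ Y ψ) F =
      rightOp ℒ e B Y ψ (rightOp ℒ d B X φ F) -
        sg K (d * e) • rightOp ℒ d B X φ (rightOp ℒ e B Y ψ F) := by
  have hp := circ_preLie hF hX hX' hY hY'
  rw [sub_eq_iff_eq_add] at hp
  simp only [rightOp, circBracket, twistedBracket, opBracket_eq, circ_add_left, cstar_add_left,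
    circ_cstar hF hφ hY', circ_cstar hF hψ hX', circ_sub_right, circ_smul_right, cstar_add_right,
    cstar_sub_right, cstar_smul_right, hp,
    cstar_assoc (B₃ := B) (B₄ := LinearMap.mul K (Module.End K V)) hB, add_comm e d]
  rw [mul_comm e d]
  match_scalars <;> grind [sg_mul_self]

/-- The constant `1` has no slot for `X`, so acting on it isolates `φ`. This makes every identity
for the action an identity for `φ`. -/
theorem rightOp_cst_one {X : Cochain K L L} {φ : Cochain K L (Module.End K V)} :
    rightOp ℒ d (LinearMap.mul K (Module.End K V)) X φ (cst K L 1) = φ := by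
  rw [rightOp, circ_cst_left, cstar_cst_left, zero_add]
  funext n; ext ξ : 1
  exact one_mul _

theorem circBracket_symm {X Y : Cochain K L L} (hX : SymmC ℒ X)
    (hX' : DegC ℒ ℒ d X) (hY : SymmC ℒ Y) (hY' : DegC ℒ ℒ e Y) :
    SymmC ℒ (circBracket ℒ d e X Y) :=
  (circ_symm hX hY hY').sub ((circ_symm hY hX hX').smul _)

theorem circBracket_deg {X Y : Cochain K L L}
    (hX' : DegC ℒ ℒ d X) (hY' : DegC ℒ ℒ e Y) : DegC ℒ ℒ (d + e) (circBracket ℒ d e X Y) :=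
  (hX'.circ hY').sub (by rw [add_comm]; exact (hY'.circ hX').smul _)

theorem twistedBracket_symm {X Y : Cochain K L L} (hX : SymmC ℒ X)
    (hX' : DegC ℒ ℒ d X) (hY : SymmC ℒ Y) (hY' : DegC ℒ ℒ e Y)
    {φ ψ : Cochain K L (Module.End K V)} (hφ : SymmC ℒ φ) (hψ : SymmC ℒ ψ) :
    SymmC ℒ (twistedBracket ℒ d e X φ Y ψ) :=
  ((circ_symm hφ hY hY').sub ((circ_symm hψ hX hX').smul _)).add (opBracket_symm hφ hψ)

theorem twistedBracket_eq_rightOp {X Y : Cochain K L L} (hX : SymmC ℒ X)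
    (hX' : DegC ℒ ℒ d X) (hY : SymmC ℒ Y) (hY' : DegC ℒ ℒ e Y)
    {φ ψ : Cochain K L (Module.End K V)} (hφ : SymmC ℒ φ) (hψ : SymmC ℒ ψ) :
    twistedBracket ℒ d e X φ Y ψ = rightOp ℒ e (LinearMap.mul K (Module.End K V)) Y ψ φ -
      sg K (d * e) • rightOp ℒ d (LinearMap.mul K (Module.End K V)) X φ ψ := by
  have := rightOp_bracket (B := LinearMap.mul K (Module.End K V)) mul_assoc hX hX' hY hY' hφ hψ
    (SymmC.cst 1)
  rwa [rightOp_cst_one, rightOp_cst_one, rightOp_cst_one] at this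

theorem twistedBracket_twistedBracket {X Y Z : Cochain K L L} (hX : SymmC ℒ X)
    (hX' : DegC ℒ ℒ d X) (hY : SymmC ℒ Y) (hY' : DegC ℒ ℒ e Y) (hZ : SymmC ℒ Z)
    (hZ' : DegC ℒ ℒ f Z) {φ ψ χ : Cochain K L (Module.End K V)} (hφ : SymmC ℒ φ) (hψ : SymmC ℒ ψ)
    (hχ : SymmC ℒ χ) :
    twistedBracket ℒ d (e + f) X φ (circBracket ℒ e f Y Z) (twistedBracket ℒ e f Y ψ Z χ) =
      rightOp ℒ f (LinearMap.mul K (Module.End K V)) Z χ (rightOp ℒ e (LinearMap.mul K (Module.End K V)) Y ψ φ) -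
        sg K (e * f) • rightOp ℒ e (LinearMap.mul K (Module.End K V)) Y ψ (rightOp ℒ f (LinearMap.mul K (Module.End K V)) Z χ φ) -
        sg K (d * (e + f)) • (rightOp ℒ d (LinearMap.mul K (Module.End K V)) X φ
          (rightOp ℒ f (LinearMap.mul K (Module.End K V)) Z χ ψ) - sg K (e * f) •
          rightOp ℒ d (LinearMap.mul K (Module.End K V)) X φ (rightOp ℒ e (LinearMap.mul K (Module.End K V)) Y ψ χ)) := by
  rw [twistedBracket_eq_rightOp hX hX' (circBracket_symm hY hY' hZ hZ') (circBracket_deg hY' hZ') hφ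
      (twistedBracket_symm hY hY' hZ hZ' hψ hχ),
    rightOp_bracket (B := LinearMap.mul K (Module.End K V)) mul_assoc hY hY' hZ hZ' hψ hχ hφ,
    twistedBracket_eq_rightOp hY hY' hZ hZ' hψ hχ, rightOp_sub, rightOp_smul]

theorem twistedBracket_jacobi {X Y Z : Cochain K L L} (hX : SymmC ℒ X)
    (hX' : DegC ℒ ℒ d X) (hY : SymmC ℒ Y) (hY' : DegC ℒ ℒ e Y) (hZ : SymmC ℒ Z)
    (hZ' : DegC ℒ ℒ f Z) {φ ψ χ : Cochain K L (Module.End K V)} (hφ : SymmC ℒ φ) (hψ : SymmC ℒ ψ)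
    (hχ : SymmC ℒ χ) :
    twistedBracket ℒ d (e + f) X φ (circBracket ℒ e f Y Z) (twistedBracket ℒ e f Y ψ Z χ) =
      twistedBracket ℒ (d + e) f (circBracket ℒ d e X Y) (twistedBracket ℒ d e X φ Y ψ) Z χ +
        sg K (d * e) • twistedBracket ℒ e (d + f) Y ψ (circBracket ℒ d f X Z)
          (twistedBracket ℒ d f X φ Z χ) := by
  rw [twistedBracket_twistedBracket hX hX' hY hY' hZ hZ' hφ hψ hχ,
    twistedBracket_twistedBracket hY hY' hX hX' hZ hZ' hψ hφ hχ,
    twistedBracket_skew (d := d + e) (circBracket ℒ d e X Y) (twistedBracket ℒ d e X φ Y ψ) Z χ,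
    twistedBracket_twistedBracket hZ hZ' hX hX' hY hY' hχ hφ hψ, mul_add, mul_add, mul_add, add_mul,
    sg_add, sg_add, sg_add, sg_add]
  simp only [mul_comm e d, mul_comm f d, mul_comm f e]
  -- After the nested brackets are expanded, only six iterated actions occur. Treated as unknowns,
  -- they cancel by signs alone, as in the Jacobi identity for commutators.
  generalize LinearMap.mul K (Module.End K V) = m
  generalize rightOp ℒ f m Z χ (rightOp ℒ e m Y ψ φ) = t₁
  generalize rightOp ℒ e m Y ψ (rightOp ℒ f m Z χ φ) = t₂
  generalize rightOp ℒ d m X φ (rightOp ℒ f m Z χ ψ) = t₃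
  generalize rightOp ℒ d m X φ (rightOp ℒ e m Y ψ χ) = t₄
  generalize rightOp ℒ f m Z χ (rightOp ℒ d m X φ ψ) = t₅
  generalize rightOp ℒ e m Y ψ (rightOp ℒ d m X φ χ) = t₆
  match_scalars <;> grind [sg_mul_self]

/-- The usual passage from a pre-Lie product to a Lie bracket: each of the three associators is
replaced by its mirror image. -/
theorem circBracket_jacobi {X Y Z : Cochain K L L} (hX : SymmC ℒ X)
    (hX' : DegC ℒ ℒ d X) (hY : SymmC ℒ Y) (hY' : DegC ℒ ℒ e Y) (hZ : SymmC ℒ Z)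
    (hZ' : DegC ℒ ℒ f Z) :
    circBracket ℒ d (e + f) X (circBracket ℒ e f Y Z) =
      circBracket ℒ (d + e) f (circBracket ℒ d e X Y) Z +
        sg K (d * e) • circBracket ℒ e (d + f) Y (circBracket ℒ d f X Z) := by
  have h1 := circ_preLie hX hY hY' hZ hZ'
  have h2 := circ_preLie hY hX hX' hZ hZ'
  have h3 := circ_preLie hZ hX hX' hY hY'
  rw [sub_eq_iff_eq_add] at h1 h2 h3
  simp only [circBracket, circ_sub_left, circ_sub_right, circ_smul_left, circ_smul_right, h1, h2,
    h3, mul_add, add_mul, sg_add, mul_comm e d]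
  match_scalars <;> grind [sg_mul_self]

end BracketFormulas

end RightRep

namespace RightRep

open scoped DirectSum TensorProduct

/-! ### The graded Lie algebra of right pairs. -/

section RightPairs

variable {K A L Q : Type*} [Field K] [Ring A] [Algebra K A] [AddCommGroup L] [Module K L]
  [Module A L] [IsScalarTower K A L] [AddCommGroup Q] [Module K Q] [Module A Q]
  [IsScalarTower K A Q]

/-- The elements `((X, σ), -φ)` of `ℛ(Q)` of degree `d`, described by conditions on families. -/
structure IsRightPair (𝒜 : ℤ → Submodule K A) (ℒ : ℤ → Submodule K L) [DirectSum.Decomposition ℒ]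
    (𝒬 : ℤ → Submodule K Q) (d : ℤ)
    (X : Cochain K L L) (σ : Cochain K L (Module.End K A)) (φ : Cochain K L (Module.End K Q)) :
    Prop where
  fin : FinC X
  symbol_fin : FinC σ
  form_fin : FinC φ
  symm : SymmC ℒ X
  symbol_symm : SymmC ℒ σ
  form_symm : SymmC ℒ φ
  deg : DegC ℒ ℒ d X
  symbol_deg : DegC ℒ (derSub 𝒜) d σ
  form_deg : DegC ℒ (endDeg 𝒬) d φ
  leibniz : FirstLeibniz 𝒜 ℒ d X σ
  symbol_lin : FirstLeft 𝒜 ℒ d σ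
  form_lin : FirstRight 𝒜 ℒ φ
  form_leibniz : DerLike 𝒜 ℒ (LinearMap.id : Module.End K Q →ₗ[K] Q →ₗ[K] Q) d φ σ

variable {𝒜 : ℤ → Submodule K A} [GradedAlgebra 𝒜]
  {ℒ : ℤ → Submodule K L} [DirectSum.Decomposition ℒ] [SetLike.GradedSMul 𝒜 ℒ]
  {𝒬 : ℤ → Submodule K Q} {d e : ℤ}

theorem RightLin.neg {W : Type*} [AddCommGroup W] [Module K W] {n : ℕ}
    {F : MultilinearMap K (fun _ : Fin n => L) (Q →ₗ[K] W)}
    (hF : RightLin 𝒜 ℒ F) : RightLin 𝒜 ℒ (-F) := by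
  rw [← neg_one_smul K]; exact hF.smul (-1)

/-- The sign change `φ = -Δ` replaces right derivations with symbol `-σ` by ordinary derivations
with symbol `σ`. The linearity in the entries of `L` is unaffected. -/
theorem mem_rightPairs_iff
    {x : Cochain K L L × Cochain K L (Module.End K A) × Cochain K L (Module.End K Q)} :
    x ∈ rightPairs 𝒜 ℒ 𝒬 d ↔ IsRightPair 𝒜 ℒ 𝒬 d x.1 x.2.1 (-x.2.2) := by
  obtain ⟨X, σ, Δ⟩ := x
  constructor
  · rintro ⟨h, h'⟩
    obtain ⟨N, hN⟩ := h.finite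
    exact
    { fin := ⟨N, fun n hn => (hN n hn).1⟩
      symbol_fin := ⟨N, fun n hn => (hN n hn).2⟩
      form_fin := FinC.neg h'.finite
      symm := h.symm
      symbol_symm := h.symbol_symm
      form_symm := SymmC.neg h'.symm
      deg := h.deg
      symbol_deg := h.symbol_der
      form_deg := DegC.neg h'.deg
      leibniz := (firstLeibniz_iff h.symm).2 h.leibniz
      symbol_lin := firstLeft_of_leftLin h.symbol_lin
      form_lin := firstRight_of_rightLin fun n => (h'.lin n).neg
      form_leibniz := fun n u ξ hξ b a ha q => by
        have := h'.leibniz n u ξ hξ b a ha q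
        simp only at this
        simp only [LinearMap.id_apply, Pi.neg_apply, neg_apply, LinearMap.neg_apply, this, smul_neg]
        abel }
  · intro h
    obtain ⟨N, hN⟩ := h.fin
    obtain ⟨M, hM⟩ := h.symbol_fin
    have hs := h.form_symm.neg
    have hd := h.form_deg.neg
    have hf := h.form_fin.neg
    have hl : ∀ n, RightLin 𝒜 ℒ (- -Δ n) := fun n => (h.form_lin.rightLin h.form_symm n).neg
    simp only [neg_neg] at hs hd hf hl
    refine ⟨⟨⟨max N M, fun n hn => ⟨hN n (le_trans (le_max_left _ _) hn),
      hM n (le_trans (le_max_right _ _) hn)⟩⟩, h.symm, h.deg, h.symbol_symm, h.symbol_deg,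
      h.symbol_lin.leftLin h.symbol_symm, (firstLeibniz_iff h.symm).1 h.leibniz⟩,
      ⟨hf, hs, hd, hl, fun n u ξ hξ b a ha q => ?_⟩⟩
    have := h.form_leibniz n u ξ hξ b a ha q
    simp only [LinearMap.id_apply, Pi.neg_apply, neg_apply, LinearMap.neg_apply, smul_neg] at this ⊢
    rw [neg_eq_iff_eq_neg] at this
    rw [this]
    abel

section DerLike

variable {W : Type*} [AddCommGroup W] [Module K W] [Module A W] [IsScalarTower K A W]

theorem DerLike.circ {Φ : Type*} [AddCommGroup Φ] [Module K Φ] {P : Φ →ₗ[K] W →ₗ[K] W}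
    {φ : Cochain K L Φ} {σ : Cochain K L (Module.End K A)} (h : DerLike 𝒜 ℒ P d φ σ)
    (hφ : SymmC ℒ φ) (hσ : SymmC ℒ σ) {Y : Cochain K L L} (hY : DegC ℒ ℒ e Y) :
    DerLike 𝒜 ℒ P (d + e) (circ ℒ φ Y) (circ ℒ σ Y) := by
  intro n
  induction n generalizing φ σ Y d e with
  | zero =>
    intro u ξ hξ b a ha w
    rw [circ_zero_apply, circ_zero_apply]
    exact h.ins (hY.zero_apply ξ) 0 u ξ hξ b a ha w
  | succ n ih =>
    intro u ξ hξ b a ha w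
    have h1 := ih h hφ hσ (hY.ins (hξ 0)) (Fin.tail u) (Fin.tail ξ) hξ.tail b a ha w
    have h2 := ih (h.ins (hξ 0)) (hφ.ins (hξ 0)) (hσ.ins (hξ 0)) hY (Fin.tail u) (Fin.tail ξ)
      hξ.tail b a ha w
    have e1 := congrArg (fun F => F n (Fin.tail ξ)) (ins_circ (hξ 0) hφ hY)
    have e2 := congrArg (fun F => F n (Fin.tail ξ)) (ins_circ (hξ 0) hσ hY)
    simp only [ins_apply, Fin.cons_self_tail] at e1 e2
    rw [e1, e2, Fin.sum_univ_succ]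
    simp only [Fin.tail] at h1 h2
    simp only [Pi.add_apply, Pi.smul_apply, add_apply, smul_apply, map_add, map_smul,
      LinearMap.add_apply, LinearMap.smul_apply] at h1 h2 ⊢
    rw [h1, h2, add_smul, smul_add, smul_add, smul_add, smul_assoc, smul_comm a,
      show d + e + (u 0 + ∑ i : Fin n, u i.succ) = d + (e + u 0) + ∑ i : Fin n, u i.succ by ring,
      show d + u 0 + e + ∑ i : Fin n, u i.succ = d + (e + u 0) + ∑ i : Fin n, u i.succ by ring,
      smul_comm (sg K ((d + (e + u 0) + ∑ i : Fin n, u i.succ) * b)) (sg K (u 0 * e))]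
    abel

/-- Without entries this is the commutator of two derivations, whose second order terms cancel. The
insertion rule carries the property to all arities. -/
theorem DerLike.opBracket {φ ψ : Cochain K L (Module.End K W)}
    {σ τ : Cochain K L (Module.End K A)}
    (h : DerLike 𝒜 ℒ (LinearMap.id : Module.End K W →ₗ[K] W →ₗ[K] W) d φ σ)
    (hσ : DegC ℒ (derSub 𝒜) d σ)
    (h' : DerLike 𝒜 ℒ (LinearMap.id : Module.End K W →ₗ[K] W →ₗ[K] W) e ψ τ)
    (hτ : DegC ℒ (derSub 𝒜) e τ) :
    DerLike 𝒜 ℒ (LinearMap.id : Module.End K W →ₗ[K] W →ₗ[K] W) (d + e) (opBracket ℒ d e φ ψ)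
      (opBracket ℒ d e σ τ) := by
  intro n
  induction n generalizing φ σ ψ τ d e with
  | zero =>
    intro u ξ hξ b a ha w
    have k1 := h 0 u ξ hξ
    have k2 := h' 0 u ξ hξ
    have k3 := (hσ.zero_apply ξ).1 b a ha
    have k4 := (hτ.zero_apply ξ).1 b a ha
    simp only [LinearMap.id_apply, Fin.sum_univ_zero, add_zero] at k1 k2 ⊢
    simp only [opBracket_zero_apply, LinearMap.sub_apply, LinearMap.smul_apply,
      Module.End.mul_apply, k1 b a ha, k2 b a ha, map_add, map_smul, k1 _ _ k4, k2 _ _ k3, sub_smul,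
      smul_assoc, smul_sub, smul_comm a, mul_add, add_mul, sg_add, smul_add]
    generalize a • φ 0 ξ (ψ 0 ξ w) = t₁
    generalize a • ψ 0 ξ (φ 0 ξ w) = t₂
    generalize σ 0 ξ a • ψ 0 ξ w = t₃
    generalize τ 0 ξ a • φ 0 ξ w = t₄
    generalize σ 0 ξ (τ 0 ξ a) • w = t₅
    generalize τ 0 ξ (σ 0 ξ a) • w = t₆
    match_scalars <;> grind [sg_mul_self]
  | succ n ih =>
    intro u ξ hξ b a ha w
    have h1 := ih (h.ins (hξ 0)) (hσ.ins (hξ 0)) h' hτ (Fin.tail u) (Fin.tail ξ) hξ.tail b a ha w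
    have h2 := ih h hσ (h'.ins (hξ 0)) (hτ.ins (hξ 0)) (Fin.tail u) (Fin.tail ξ)
      hξ.tail b a ha w
    have e1 := congrArg (fun F => F n (Fin.tail ξ)) (ins_opBracket (ℒ := ℒ) (hξ 0) (d := d) (c := e) φ ψ)
    have e2 := congrArg (fun F => F n (Fin.tail ξ)) (ins_opBracket (ℒ := ℒ) (hξ 0) (d := d) (c := e) σ τ)
    simp only [ins_apply, Fin.cons_self_tail] at e1 e2
    have hu : ∑ i : Fin n, u i.succ = ∑ i, Fin.tail u i := rfl
    rw [e1, e2, Fin.sum_univ_succ, hu]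
    simp only [Pi.add_apply, Pi.smul_apply, add_apply, smul_apply, map_add, map_smul,
      LinearMap.add_apply, LinearMap.smul_apply] at h1 h2 ⊢
    rw [h1, h2, add_smul, smul_add, smul_add, smul_add, smul_assoc, smul_comm a,
      show d + e + (u 0 + ∑ i, Fin.tail u i) = d + (e + u 0) + ∑ i, Fin.tail u i by ring,
      show d + u 0 + e + ∑ i, Fin.tail u i = d + (e + u 0) + ∑ i, Fin.tail u i by ring,
      smul_comm (sg K ((d + (e + u 0) + ∑ i, Fin.tail u i) * b)) (sg K (e * u 0))]
    abel

theorem DerLike.add {Φ : Type*} [AddCommGroup Φ] [Module K Φ] {P : Φ →ₗ[K] W →ₗ[K] W}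
    {φ φ' : Cochain K L Φ} {σ σ' : Cochain K L (Module.End K A)} (h : DerLike 𝒜 ℒ P d φ σ)
    (h' : DerLike 𝒜 ℒ P d φ' σ') : DerLike 𝒜 ℒ P d (φ + φ') (σ + σ') := by
  intro n u ξ hξ b a ha w
  simp only [Pi.add_apply, add_apply, map_add, LinearMap.add_apply, h n u ξ hξ b a ha w,
    h' n u ξ hξ b a ha w, add_smul, smul_add]
  abel

theorem DerLike.smul {Φ : Type*} [AddCommGroup Φ] [Module K Φ] {P : Φ →ₗ[K] W →ₗ[K] W}
    {φ : Cochain K L Φ} {σ : Cochain K L (Module.End K A)} (r : K) (h : DerLike 𝒜 ℒ P d φ σ) :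
    DerLike 𝒜 ℒ P d (r • φ) (r • σ) := by
  intro n u ξ hξ b a ha w
  simp only [Pi.smul_apply, smul_apply, map_smul, LinearMap.smul_apply, h n u ξ hξ b a ha w,
    smul_add, smul_assoc, smul_comm a, smul_comm _ r]

theorem DerLike.sub {Φ : Type*} [AddCommGroup Φ] [Module K Φ] {P : Φ →ₗ[K] W →ₗ[K] W}
    {φ φ' : Cochain K L Φ} {σ σ' : Cochain K L (Module.End K A)} (h : DerLike 𝒜 ℒ P d φ σ)
    (h' : DerLike 𝒜 ℒ P d φ' σ') : DerLike 𝒜 ℒ P d (φ - φ') (σ - σ') := by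
  simpa [sub_eq_add_neg] using h.add (h'.smul (-1))

end DerLike

theorem symbol_derLike {σ : Cochain K L (Module.End K A)} (h : DegC ℒ (derSub 𝒜) d σ) :
    DerLike 𝒜 ℒ (evB K A) d σ σ := fun n u ξ hξ b a ha w => (h n u ξ hξ).2 b a ha w

theorem symbol_derLike_mul {σ : Cochain K L (Module.End K A)} (h : DegC ℒ (derSub 𝒜) d σ) :
    DerLike 𝒜 ℒ (LinearMap.mul K (Module.End K A)) d σ σ := fun n u ξ hξ b a ha w =>
  LinearMap.ext fun x => (h n u ξ hξ).2 b a ha (w x)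

theorem FirstLeft.add {W : Type*} [AddCommGroup W] [Module K W] [Module A W] [IsScalarTower K A W]
    {c : ℤ} {F G : Cochain K L W} (hF : FirstLeft 𝒜 ℒ c F) (hG : FirstLeft 𝒜 ℒ c G) :
    FirstLeft 𝒜 ℒ c (F + G) := fun i ζ hζ b a ha => by
  rw [ins_add, ins_add, hF i ζ hζ b a ha, hG i ζ hζ b a ha, lact_add, smul_add]

theorem FirstLeft.smul {W : Type*} [AddCommGroup W] [Module K W] [Module A W] [IsScalarTower K A W]
    {c : ℤ} {F : Cochain K L W} (r : K) (hF : FirstLeft 𝒜 ℒ c F) :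
    FirstLeft 𝒜 ℒ c (r • F) := fun i ζ hζ b a ha => by
  rw [ins_smul, ins_smul, hF i ζ hζ b a ha, lact_smul, smul_comm]

theorem FirstLeft.sub {W : Type*} [AddCommGroup W] [Module K W] [Module A W] [IsScalarTower K A W]
    {c : ℤ} {F G : Cochain K L W} (hF : FirstLeft 𝒜 ℒ c F) (hG : FirstLeft 𝒜 ℒ c G) :
    FirstLeft 𝒜 ℒ c (F - G) := by
  simpa [sub_eq_add_neg] using hF.add (hG.smul (-1))

theorem FirstRight.add {W : Type*} [AddCommGroup W] [Module K W]
    {F G : Cochain K L (Q →ₗ[K] W)} (hF : FirstRight 𝒜 ℒ F) (hG : FirstRight 𝒜 ℒ G) :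
    FirstRight 𝒜 ℒ (F + G) := fun i ζ hζ b a ha => by
  rw [ins_add, ins_add, hF i ζ hζ b a ha, hG i ζ hζ b a ha, cstar_add_left, smul_add]

theorem FirstRight.smul {W : Type*} [AddCommGroup W] [Module K W]
    {F : Cochain K L (Q →ₗ[K] W)} (r : K) (hF : FirstRight 𝒜 ℒ F) :
    FirstRight 𝒜 ℒ (r • F) := fun i ζ hζ b a ha => by
  rw [ins_smul, ins_smul, hF i ζ hζ b a ha, cstar_smul_left, smul_comm]

theorem FirstRight.sub {W : Type*} [AddCommGroup W] [Module K W]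
    {F G : Cochain K L (Q →ₗ[K] W)} (hF : FirstRight 𝒜 ℒ F) (hG : FirstRight 𝒜 ℒ G) :
    FirstRight 𝒜 ℒ (F - G) := by
  simpa [sub_eq_add_neg] using hF.add (hG.smul (-1))

theorem IsRightPair.bracket {X Y : Cochain K L L} {σ τ : Cochain K L (Module.End K A)}
    {φ ψ : Cochain K L (Module.End K Q)} (hx : IsRightPair 𝒜 ℒ 𝒬 d X σ φ)
    (hy : IsRightPair 𝒜 ℒ 𝒬 e Y τ ψ) :
    IsRightPair 𝒜 ℒ 𝒬 (d + e) (circBracket ℒ d e X Y) (twistedBracket ℒ d e X σ Y τ)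
      (twistedBracket ℒ d e X φ Y ψ) where
  fin := (hx.fin.circ hy.fin).sub ((hy.fin.circ hx.fin).smul _)
  symbol_fin := ((hx.symbol_fin.circ hy.fin).sub ((hy.symbol_fin.circ hx.fin).smul _)).add
    (hx.symbol_fin.opBracket hy.symbol_fin)
  form_fin := ((hx.form_fin.circ hy.fin).sub ((hy.form_fin.circ hx.fin).smul _)).add
    (hx.form_fin.opBracket hy.form_fin)
  symm := circBracket_symm hx.symm hx.deg hy.symm hy.deg
  symbol_symm := twistedBracket_symm hx.symm hx.deg hy.symm hy.deg hx.symbol_symm hy.symbol_symm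
  form_symm := twistedBracket_symm hx.symm hx.deg hy.symm hy.deg hx.form_symm hy.form_symm
  deg := circBracket_deg hx.deg hy.deg
  symbol_deg := ((hx.symbol_deg.circ hy.deg).sub
    (by rw [add_comm]; exact (hy.symbol_deg.circ hx.deg).smul _)).add
      (opBracket_deg commutator_mem_derSub hx.symbol_deg hy.symbol_deg)
  form_deg := ((hx.form_deg.circ hy.deg).sub
    (by rw [add_comm]; exact (hy.form_deg.circ hx.deg).smul _)).add
      (opBracket_deg commutator_mem_endDeg hx.form_deg hy.form_deg)
  leibniz := hx.leibniz.bracket hx.symm hy.symm hx.deg hy.deg hx.symbol_symm hy.symbol_symm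
    hx.symbol_deg hy.symbol_deg hy.leibniz
  symbol_lin := by
    -- With composition as pairing, `FirstLeft.operator` applies to `τ` itself as the transformed
    -- family. The symbol of the bracket is the signed difference of this and the version with the
    -- roles exchanged.
    have h1 := FirstLeft.operator (P := LinearMap.mul K (Module.End K A)) (fun _ _ _ => rfl) hx.deg
      hx.symbol_lin (symbol_derLike_mul hx.symbol_deg) hx.symbol_deg hx.leibniz hy.symbol_symm
      hy.symbol_lin
    have h2 := FirstLeft.operator (P := LinearMap.mul K (Module.End K A)) (fun _ _ _ => rfl) hy.deg
      hy.symbol_lin (symbol_derLike_mul hy.symbol_deg) hy.symbol_deg hy.leibniz hx.symbol_symm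
      hx.symbol_lin
    rw [add_comm e d, mul_comm e d] at h2
    convert h1.sub (h2.smul (sg K (d * e))) using 1
    rw [twistedBracket, opBracket_eq]
    match_scalars <;> grind [sg_mul_self]
  form_lin := by
    have h1 := FirstRight.operator hy.deg hy.symbol_deg hy.leibniz hy.form_leibniz hy.form_lin
      hx.form_symm hx.form_lin
    have h2 := FirstRight.operator hx.deg hx.symbol_deg hx.leibniz hx.form_leibniz hx.form_lin
      hy.form_symm hy.form_lin
    convert h1.sub (h2.smul (sg K (d * e))) using 1
    rw [twistedBracket, opBracket_eq]
    -- For operators on `Q`, composition and multiplication in `End Q` coincide, so the linear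
    -- family produced by `FirstRight.operator` has the form needed for the bracket.
    change _ = circ ℒ φ Y + cstar ℒ e (LinearMap.mul K (Module.End K Q)) φ ψ -
      sg K (d * e) • (circ ℒ ψ X + cstar ℒ d (LinearMap.mul K (Module.End K Q)) ψ φ)
    rw [smul_add]
    abel
  form_leibniz := ((hx.form_leibniz.circ hx.form_symm hx.symbol_symm hy.deg).sub
    (by rw [add_comm]
        exact (hy.form_leibniz.circ hy.form_symm hy.symbol_symm hx.deg).smul _)).add
      (hx.form_leibniz.opBracket hx.symbol_deg hy.form_leibniz hy.symbol_deg)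

/-- The commutator enters the third component with a minus sign. After passing to `-Δ` it has the
same sign as in the symbol component, so a single Jacobi identity serves both. -/
theorem rightBracket_eq
    (x y : Cochain K L L × Cochain K L (Module.End K A) × Cochain K L (Module.End K Q)) :
    rightBracket ℒ d e x y = (circBracket ℒ d e x.1 y.1, twistedBracket ℒ d e x.1 x.2.1 y.1 y.2.1,
      -twistedBracket ℒ d e x.1 (-x.2.2) y.1 (-y.2.2)) := by
  refine Prod.ext rfl (Prod.ext rfl ?_)
  simp only [rightBracket, twistedBracket, opBracket_eq, circ_neg_left, cstar_neg_left,
    cstar_neg_right]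
  match_scalars <;> simp

theorem rightPairs_isGradedLieAlgebra :
    IsGradedLieAlgebra (rightPairs 𝒜 ℒ 𝒬) (rightBracket ℒ) where
  mem d e x hx y hy := by
    rw [mem_rightPairs_iff] at hx hy ⊢
    rw [rightBracket_eq, neg_neg]
    exact hx.bracket hy
  add_left d e x _ x' _ y _ := by
    refine Prod.ext ?_ (Prod.ext ?_ ?_) <;>
    · simp only [rightBracket, opBracket_eq, circ_add_left, circ_add_right, cstar_add_left,
        cstar_add_right, Prod.fst_add, Prod.snd_add, smul_add]
      abel
  smul_left d e r x _ y _ := by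
    refine Prod.ext ?_ (Prod.ext ?_ ?_) <;>
    · simp only [rightBracket, opBracket_eq, circ_smul_left, circ_smul_right, cstar_smul_left,
        cstar_smul_right, Prod.smul_fst, Prod.smul_snd, smul_add, smul_sub, smul_comm _ r]
  add_right d e x _ y _ y' _ := by
    refine Prod.ext ?_ (Prod.ext ?_ ?_) <;>
    · simp only [rightBracket, opBracket_eq, circ_add_left, circ_add_right, cstar_add_left,
        cstar_add_right, Prod.fst_add, Prod.snd_add, smul_add]
      abel
  smul_right d e r x _ y _ := by
    refine Prod.ext ?_ (Prod.ext ?_ ?_) <;>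
    · simp only [rightBracket, opBracket_eq, circ_smul_left, circ_smul_right, cstar_smul_left,
        cstar_smul_right, Prod.smul_fst, Prod.smul_snd, smul_add, smul_sub, smul_comm _ r]
  skew d e x _ y _ := by
    rw [rightBracket_eq, rightBracket_eq]
    refine Prod.ext (circBracket_skew _ _) (Prod.ext (twistedBracket_skew _ _ _ _) ?_)
    change -twistedBracket _ _ _ _ _ _ _ = -(_ • -_)
    rw [twistedBracket_skew, smul_neg]
  jacobi d e f x hx y hy z hz := by
    rw [mem_rightPairs_iff] at hx hy hz
    simp only [rightBracket_eq, neg_neg]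
    refine Prod.ext (circBracket_jacobi hx.symm hx.deg hy.symm hy.deg hz.symm hz.deg) (Prod.ext
      (twistedBracket_jacobi hx.symm hx.deg hy.symm hy.deg hz.symm hz.deg hx.symbol_symm
        hy.symbol_symm hz.symbol_symm) ?_)
    change -twistedBracket _ _ _ _ _ _ _ = -_ + _ • -_
    rw [twistedBracket_jacobi hx.symm hx.deg hy.symm hy.deg hz.symm hz.deg hx.form_symm
        hy.form_symm hz.form_symm, smul_neg, neg_add]

end RightPairs

end RightRep

namespace RightRep

open scoped DirectSum TensorProduct

/-! ### Maps out of the symmetric tensors, and contraction with forms. -/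

section Contraction

variable {K A L Q : Type*} [Field K] [Ring A] [Algebra K A] [AddCommGroup L] [Module K L]
  [Module A L] [AddCommGroup Q] [Module K Q] [Module A Q] [IsScalarTower K A Q]
variable {𝒜 : ℤ → Submodule K A} {ℒ : ℤ → Submodule K L}

theorem toModule_lof' {M : ℕ → Type*} [∀ n, AddCommGroup (M n)] [∀ n, Module K (M n)] {N : Type*}
    [AddCommGroup N] [Module K N] (f : ∀ n, M n →ₗ[K] N) (n : ℕ) (x : M n) :
    DirectSum.toModule K ℕ N f (DirectSum.lof K ℕ M n x) = f n x := DirectSum.toModule_lof K n x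

theorem tensLift_toSymTensorPow {W : Type*} [AddCommGroup W]
    [Module K W] {n : ℕ} (F : MultilinearMap K (fun _ : Fin n => L) (Q →ₗ[K] W))
    (hs : GrSymm ℒ F) (hr : RightLin 𝒜 ℒ F) (ξ : Fin n → L) (q : Q) :
    tensLift F hs hr (toSymTensorPow 𝒜 ℒ Q n (PiTensorProduct.tprod K ξ ⊗ₜ[K] q)) = F ξ q := by
  unfold tensLift toSymTensorPow
  erw [Submodule.liftQ_apply]
  simp

/-- Linear maps on `S_A^n L ⊗_A Q` are determined by their values on generators. -/
theorem symTensorPow_ext {W : Type*} [AddCommGroup W] [Module K W] {n : ℕ}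
    {f g : SymTensorPow 𝒜 ℒ Q n →ₗ[K] W}
    (h : ∀ (ξ : Fin n → L) (q : Q),
      f (toSymTensorPow 𝒜 ℒ Q n (PiTensorProduct.tprod K ξ ⊗ₜ[K] q)) =
        g (toSymTensorPow 𝒜 ℒ Q n (PiTensorProduct.tprod K ξ ⊗ₜ[K] q))) : f = g := by
  have : f ∘ₗ toSymTensorPow 𝒜 ℒ Q n = g ∘ₗ toSymTensorPow 𝒜 ℒ Q n := by
    refine TensorProduct.ext (PiTensorProduct.ext ?_)
    ext ξ q
    exact h ξ q
  refine LinearMap.ext fun x => ?_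
  obtain ⟨y, rfl⟩ := Submodule.mkQ_surjective (tensorRel 𝒜 ℒ Q n) x
  exact congrArg (fun l => l y) this

theorem symTensor_ext {W : Type*} [AddCommGroup W] [Module K W] {f g : SymTensor 𝒜 ℒ Q →ₗ[K] W}
    (h : ∀ n ξ q, f (tens 𝒜 ℒ Q n ξ q) = g (tens 𝒜 ℒ Q n ξ q)) : f = g := by
  refine DirectSum.linearMap_ext K fun n => symTensorPow_ext fun ξ q => h n ξ q

/-- The extension of a family of values on the generators `ξ₁ ⋯ ξ_n ⊗ q`. -/
def ofTens {W : Type*} [AddCommGroup W] [Module K W] (F : Cochain K L (Q →ₗ[K] W))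
    (hs : ∀ n, GrSymm ℒ (F n)) (hr : ∀ n, RightLin 𝒜 ℒ (F n)) : SymTensor 𝒜 ℒ Q →ₗ[K] W :=
  DirectSum.toModule K ℕ _ fun n => tensLift (F n) (hs n) (hr n)

theorem ofTens_tens {W : Type*} [AddCommGroup W] [Module K W] (F : Cochain K L (Q →ₗ[K] W))
    (hs : ∀ n, GrSymm ℒ (F n)) (hr : ∀ n, RightLin 𝒜 ℒ (F n)) (n : ℕ) (ξ : Fin n → L) (q : Q) :
    ofTens F hs hr (tens 𝒜 ℒ Q n ξ q) = F n ξ q := by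
  rw [tens_apply, ofTens, toModule_lof', tensLift_toSymTensorPow]

variable [GradedAlgebra 𝒜] [IsGradedComm 𝒜] [DirectSum.Decomposition ℒ] [SetLike.GradedSMul 𝒜 ℒ]

theorem contract_tens {c : ℤ} {ω : Cochain K L A} (hω : ω ∈ forms 𝒜 ℒ c) (n : ℕ) (ξ : Fin n → L)
    (q : Q) : contract 𝒜 ℒ Q c ω hω (tens 𝒜 ℒ Q n ξ q) =
      cstar ℒ c (compSMul K A Q (SymTensor 𝒜 ℒ Q)) (tens 𝒜 ℒ Q) ω n ξ q := by
  rw [tens_apply, contract, toModule_lof']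
  exact tensLift_toSymTensorPow _ _ _ _ _

/-- The degree is an argument of `contract`, so equal forms whose degrees are written differently
must be compared explicitly. -/
theorem contract_congr {c c' : ℤ} {ω ω' : Cochain K L A} (hω : ω ∈ forms 𝒜 ℒ c)
    (hω' : ω' ∈ forms 𝒜 ℒ c') (h : c = c') (h' : ω = ω') :
    contract 𝒜 ℒ Q c ω hω = contract 𝒜 ℒ Q c' ω' hω' := by
  subst h h'; rfl

theorem contract_smul {c : ℤ} {ω : Cochain K L A} (hω : ω ∈ forms 𝒜 ℒ c) (r : K)
    (h : r • ω ∈ forms 𝒜 ℒ c) :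
    contract 𝒜 ℒ Q c (r • ω) h = r • contract 𝒜 ℒ Q c ω hω :=
  symTensor_ext fun n ξ q => by
    rw [LinearMap.smul_apply, contract_tens, contract_tens, cstar_smul_right]; rfl

theorem contract_sub {c : ℤ} {ω ω' : Cochain K L A} (hω : ω ∈ forms 𝒜 ℒ c)
    (hω' : ω' ∈ forms 𝒜 ℒ c) (h : ω - ω' ∈ forms 𝒜 ℒ c) :
    contract 𝒜 ℒ Q c (ω - ω') h = contract 𝒜 ℒ Q c ω hω - contract 𝒜 ℒ Q c ω' hω' :=
  symTensor_ext fun n ξ q => by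
    rw [LinearMap.sub_apply, contract_tens, contract_tens, contract_tens, cstar_sub_right]; rfl

end Contraction

/-! ### The graded Lie algebra of module derivations. -/

section Commutator

variable {K A L Q : Type*} [Field K] [Ring A] [Algebra K A] [AddCommGroup L] [Module K L]
  [Module A L] [AddCommGroup Q] [Module K Q] [Module A Q] [IsScalarTower K A Q]
variable {𝒜 : ℤ → Submodule K A} [GradedAlgebra 𝒜] [IsGradedComm 𝒜]
  {ℒ : ℤ → Submodule K L} [DirectSum.Decomposition ℒ] [SetLike.GradedSMul 𝒜 ℒ]
  {𝒬 : ℤ → Submodule K Q} {d e : ℤ}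

theorem IsModuleDerivation.commutator {D D' : Module.End K (SymTensor 𝒜 ℒ Q)}
    {s s' : Module.End K (allForms 𝒜 ℒ)} (h : IsModuleDerivation 𝒜 ℒ 𝒬 d D s)
    (h' : IsModuleDerivation 𝒜 ℒ 𝒬 e D' s') :
    IsModuleDerivation 𝒜 ℒ 𝒬 (d + e) (D * D' - sg K (d * e) • (D' * D))
      (s * s' - sg K (d * e) • (s' * s)) where
  symbol_deg c ω hω := by
    have h1 := h.symbol_deg _ _ (h'.symbol_deg _ _ hω)
    have h2 := h'.symbol_deg _ _ (h.symbol_deg _ _ hω)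
    rw [← add_assoc] at h1 h2
    rw [add_comm e d] at h2
    exact Submodule.sub_mem _ h1 (Submodule.smul_mem _ _ h2)
  symbol_leibniz c c' ω ω' hω hω' := by
    -- One composite of the two symbols, expanded by both Leibniz rules; the opposite composite
    -- follows by exchanging the roles.
    have key : ∀ {d e : ℤ} {s s' : Module.End K (allForms 𝒜 ℒ)}
        {D D' : Module.End K (SymTensor 𝒜 ℒ Q)} (_ : IsModuleDerivation 𝒜 ℒ 𝒬 d D s)
        (_ : IsModuleDerivation 𝒜 ℒ 𝒬 e D' s'), (s (s' ⟨formMul ℒ c' ω ω',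
          forms_le_allForms 𝒜 ℒ (c + c') (formMul_mem hω hω')⟩) : Cochain K L A) =
        formMul ℒ c' (s (s' ω)) ω' + sg K (d * (e + c)) • formMul ℒ (d + c') (s' ω) (s ω') +
        sg K (e * c) • (formMul ℒ (e + c') (s ω) (s' ω') +
          sg K (d * c) • formMul ℒ (d + (e + c')) ω (s (s' ω'))) := by
      intro d e s s' D D' h h'
      have h1 := h'.symbol_deg c ω hω
      have h2 := h'.symbol_deg c' ω' hω'
      have e1 : s' ⟨formMul ℒ c' ω ω', forms_le_allForms 𝒜 ℒ (c + c') (formMul_mem hω hω')⟩ =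
          ⟨formMul ℒ c' (s' ω) ω', forms_le_allForms 𝒜 ℒ _ (formMul_mem h1 hω')⟩ +
          sg K (e * c) • ⟨formMul ℒ (e + c') ω (s' ω'),
            forms_le_allForms 𝒜 ℒ _ (formMul_mem hω h2)⟩ :=
        Subtype.ext (h'.symbol_leibniz c c' ω ω' hω hω')
      rw [e1, map_add, map_smul]
      simp only [Submodule.coe_add, Submodule.coe_smul]
      rw [h.symbol_leibniz _ _ _ _ h1 hω', h.symbol_leibniz _ _ _ _ hω h2]
    simp only [LinearMap.sub_apply, LinearMap.smul_apply, Module.End.mul_apply,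
      Submodule.coe_sub, Submodule.coe_smul, key h h', key h' h]
    simp only [formMul, cstar_sub_left, cstar_sub_right, cstar_smul_left, cstar_smul_right,
      ← add_assoc, add_comm e d, mul_add, add_mul, sg_add, mul_comm e d]
    match_scalars <;> grind [sg_mul_self]
  deg := commutator_mem_endDeg d e D h.deg D' h'.deg
  leibniz c ω hω u := by
    have h1 := h.symbol_deg _ _ (h'.symbol_deg _ _ hω)
    have h2 := h'.symbol_deg _ _ (h.symbol_deg _ _ hω)
    have h3 : d + (e + c) = d + e + c := by ring
    have h4 : e + (d + c) = d + e + c := by ring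
    have e1 := h3 ▸ h1
    have e2 := h4 ▸ h2
    have hs := Submodule.smul_mem _ (sg K (d * e)) e2
    have e3 : contract 𝒜 ℒ Q (d + e + c) ((s (s' ω) : Cochain K L A) - sg K (d * e) • (s' (s ω)))
        (Submodule.sub_mem _ e1 hs) = contract 𝒜 ℒ Q (d + (e + c)) (s (s' ω)) h1 -
          sg K (d * e) • contract 𝒜 ℒ Q (e + (d + c)) (s' (s ω)) h2 := by
      rw [contract_sub e1 hs, contract_smul e2, contract_congr e1 h1 h3.symm rfl,
        contract_congr e2 h2 h4.symm rfl]
    have e4 := congrArg (fun l => l u) e3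
    refine Eq.trans ?_ (congrArg (fun z => z + _) e4.symm)
    simp only [LinearMap.sub_apply, LinearMap.smul_apply, Module.End.mul_apply, h.leibniz c ω hω,
      h'.leibniz c ω hω, map_add, map_smul, h.leibniz _ _ (h'.symbol_deg _ _ hω),
      h'.leibniz _ _ (h.symbol_deg _ _ hω), map_sub, mul_add, add_mul, sg_add, mul_comm e d]
    match_scalars <;> grind [sg_mul_self]

/-- Weights are integers while tensor powers are indexed by natural numbers, so a negative target
weight has to be separated as the zero case. -/
theorem eq_zero_or_eq_lof {n : ℤ} {z : SymTensor 𝒜 ℒ Q} (h : ∀ m : ℕ, (m : ℤ) ≠ n → z m = 0) :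
    z = 0 ∨ ∃ k : ℕ, (k : ℤ) = n ∧ z = DirectSum.lof K ℕ (SymTensorPow 𝒜 ℒ Q) k (z k) := by
  by_cases hn : 0 ≤ n
  · lift n to ℕ using hn
    refine Or.inr ⟨n, rfl, DFinsupp.ext fun m => ?_⟩
    by_cases hm : m = n
    · subst hm
      exact (DirectSum.of_eq_same (β := SymTensorPow 𝒜 ℒ Q) m (z m)).symm
    · rw [h m (by exact_mod_cast hm)]
      exact (DirectSum.of_eq_of_ne (β := SymTensorPow 𝒜 ℒ Q) n m (z n) hm).symm
  · exact Or.inl (DFinsupp.ext fun m => h m (by omega))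

theorem HasWeight.mul {w w' : ℤ} {D D' : Module.End K (SymTensor 𝒜 ℒ Q)}
    {s s' : Module.End K (allForms 𝒜 ℒ)} (h : HasWeight w D s) (h' : HasWeight w' D' s') :
    HasWeight (w + w') (D * D') (s * s') := by
  refine ⟨fun n u m hm => ?_, fun n ω hω m hm => ?_⟩
  · rw [Module.End.mul_apply]
    obtain h0 | ⟨k, hk, hk'⟩ := eq_zero_or_eq_lof (h'.1 n u)
    · rw [h0, map_zero]; rfl
    · rw [hk']
      exact h.1 k _ m (by omega)
  · rw [Module.End.mul_apply]
    have h1 := h'.2 n ω hω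
    by_cases hn : 0 ≤ n + w'
    · refine h.2 (n + w').toNat (s' ω) (fun j hj => h1 j (by omega)) m (by omega)
    · have : s' ω = 0 := Subtype.ext (funext fun j => h1 j (by omega))
      rw [this, map_zero]; rfl

theorem HasWeight.sub {w : ℤ} {D D' : Module.End K (SymTensor 𝒜 ℒ Q)}
    {s s' : Module.End K (allForms 𝒜 ℒ)} (h : HasWeight w D s) (h' : HasWeight w D' s') :
    HasWeight w (D - D') (s - s') := by
  refine ⟨fun n u m hm => ?_, fun n ω hω m hm => ?_⟩
  · rw [LinearMap.sub_apply, DirectSum.sub_apply, h.1 n u m hm, h'.1 n u m hm, sub_zero]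
  · rw [LinearMap.sub_apply, Submodule.coe_sub, Pi.sub_apply, h.2 n ω hω m hm, h'.2 n ω hω m hm,
      sub_zero]

theorem HasWeight.smul {w : ℤ} {D : Module.End K (SymTensor 𝒜 ℒ Q)}
    {s : Module.End K (allForms 𝒜 ℒ)} (r : K) (h : HasWeight w D s) :
    HasWeight w (r • D) (r • s) := by
  refine ⟨fun n u m hm => ?_, fun n ω hω m hm => ?_⟩
  · rw [LinearMap.smul_apply, DirectSum.smul_apply, h.1 n u m hm, smul_zero]
  · rw [LinearMap.smul_apply, Submodule.coe_smul, Pi.smul_apply, h.2 n ω hω m hm, smul_zero]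

/-- The graded commutator of pairs of operators, as a bilinear map. -/
def pairCommutatorHom {M N : Type*} [AddCommGroup M] [Module K M] [AddCommGroup N] [Module K N]
    (d e : ℤ) : Module.End K M × Module.End K N →ₗ[K] Module.End K M × Module.End K N →ₗ[K]
      Module.End K M × Module.End K N :=
  LinearMap.mk₂ K (pairCommutator d e)
    (fun x x' y => by
      refine Prod.ext ?_ ?_ <;>
      · simp only [pairCommutator, Prod.fst_add, Prod.snd_add, add_mul, mul_add, smul_add]; abel)
    (fun r x y => by
      refine Prod.ext ?_ ?_ <;>
      · simp only [pairCommutator, Prod.smul_fst, Prod.smul_snd, smul_mul_assoc, mul_smul_comm,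
          smul_sub, smul_comm _ r])
    (fun x y y' => by
      refine Prod.ext ?_ ?_ <;>
      · simp only [pairCommutator, Prod.fst_add, Prod.snd_add, add_mul, mul_add, smul_add]; abel)
    (fun r x y => by
      refine Prod.ext ?_ ?_ <;>
      · simp only [pairCommutator, Prod.smul_fst, Prod.smul_snd, smul_mul_assoc, mul_smul_comm,
          smul_sub, smul_comm _ r])

theorem commutator_jacobi {R : Type*} [Ring R] [Algebra K R] (d e f : ℤ) (x y z : R) :
    x * (y * z - sg K (e * f) • (z * y)) -
      sg K (d * (e + f)) • ((y * z - sg K (e * f) • (z * y)) * x) =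
    ((x * y - sg K (d * e) • (y * x)) * z -
      sg K ((d + e) * f) • (z * (x * y - sg K (d * e) • (y * x)))) +
    sg K (d * e) • (y * (x * z - sg K (d * f) • (z * x)) -
      sg K (e * (d + f)) • ((x * z - sg K (d * f) • (z * x)) * y)) := by
  simp only [mul_sub, sub_mul, mul_smul_comm, smul_mul_assoc, ← mul_assoc, mul_add, add_mul, sg_add,
    mul_comm e d]
  generalize x * y * z = t₁
  generalize x * z * y = t₂
  generalize y * z * x = t₃
  generalize y * x * z = t₄
  generalize z * x * y = t₅
  generalize z * y * x = t₆
  match_scalars <;> grind [sg_mul_self]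

theorem moduleDerivations_isGradedLieAlgebra :
    IsGradedLieAlgebra (moduleDerivations 𝒜 ℒ 𝒬) pairCommutator where
  mem d e x hx y hy := by
    -- By bilinearity, closure is checked on generators, which are homogeneous in weight; there the
    -- weights add.
    refine LinearMap.BilinMap.apply_apply_mem_of_mem_span (moduleDerivations 𝒜 ℒ 𝒬 (d + e)) _ _
      (pairCommutatorHom d e) ?_ x y hx hy
    rintro ⟨D, s⟩ ⟨h, w, hw⟩ ⟨D', s'⟩ ⟨h', w', hw'⟩
    refine Submodule.subset_span ⟨h.commutator h', w + w', ?_⟩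
    exact (hw.mul hw').sub ((add_comm w w' ▸ hw'.mul hw).smul (sg K (d * e)))
  add_left d e x _ x' _ y _ := (pairCommutatorHom d e).map_add₂ x x' y
  smul_left d e r x _ y _ := (pairCommutatorHom d e).map_smul₂ r x y
  add_right d e x _ y _ y' _ := (pairCommutatorHom d e x).map_add y y'
  smul_right d e r x _ y _ := (pairCommutatorHom d e x).map_smul r y
  skew d e x _ y _ := by
    refine Prod.ext ?_ ?_ <;>
    · simp only [pairCommutator, Prod.fst_neg, Prod.snd_neg, Prod.smul_fst, Prod.smul_snd,
        mul_comm e d]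
      match_scalars <;> grind [sg_mul_self]
  jacobi d e f x _ y _ z _ :=
    Prod.ext (commutator_jacobi d e f x.1 y.1 z.1) (commutator_jacobi d e f x.2 y.2 z.2)

end Commutator

end RightRep

namespace RightRep

open scoped DirectSum TensorProduct

/-! ### Families concentrated in one arity. -/

section Support

variable {K L : Type*} [Field K] [AddCommGroup L] [Module K L]
variable {U V W : Type*} [AddCommGroup U] [Module K U] [AddCommGroup V] [Module K V]
  [AddCommGroup W] [Module K W]
variable {ℒ : ℤ → Submodule K L} [DirectSum.Decomposition ℒ] {c j k : ℤ} {B : U →ₗ[K] V →ₗ[K] W}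

/-- The family `F` is concentrated in arity `k`. -/
def SuppC (k : ℤ) (F : Cochain K L W) : Prop := ∀ n : ℕ, (n : ℤ) ≠ k → F n = 0

theorem SuppC.add {F G : Cochain K L W} (hF : SuppC k F) (hG : SuppC k G) : SuppC k (F + G) :=
  fun n hn => by rw [Pi.add_apply, hF n hn, hG n hn, add_zero]

theorem SuppC.smul {F : Cochain K L W} (r : K) (hF : SuppC k F) : SuppC k (r • F) :=
  fun n hn => by rw [Pi.smul_apply, hF n hn, smul_zero]

theorem SuppC.sub {F G : Cochain K L W} (hF : SuppC k F) (hG : SuppC k G) : SuppC k (F - G) :=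
  fun n hn => by rw [Pi.sub_apply, hF n hn, hG n hn, sub_zero]

theorem SuppC.cstar {f : Cochain K L U} {g : Cochain K L V} (hf : SuppC j f) (hg : SuppC k g) :
    SuppC (j + k) (cstar ℒ c B f g) := by
  refine fun n hn => Finset.sum_eq_zero fun pq hpq => ?_
  rw [Finset.HasAntidiagonal.mem_antidiagonal] at hpq
  by_cases hp : (pq.1 : ℤ) = j
  · rw [hg pq.2 (by omega), star_zero_right]
  · rw [hf _ hp, star_zero_left]

theorem SuppC.circ {F : Cochain K L W} {Y : Cochain K L L} (hF : SuppC j F) (hY : SuppC k Y) :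
    SuppC (j + (k - 1)) (circ ℒ F Y) := by
  refine fun n hn => Finset.sum_eq_zero fun pq hpq => ?_
  rw [Finset.HasAntidiagonal.mem_antidiagonal] at hpq
  by_cases hp : (pq.1 : ℤ) = k
  · rw [hF (pq.2 + 1) (by push_cast; omega), insertion_zero_left]
  · rw [hY _ hp, insertion_zero_right]

end Support

/-! ### Decomposition of forms into homogeneous components. -/

section Forms

variable {K A L : Type*} [Field K] [Ring A] [Algebra K A] [AddCommGroup L] [Module K L]
  [Module A L]
variable {𝒜 : ℤ → Submodule K A} [GradedAlgebra 𝒜]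
  {ℒ : ℤ → Submodule K L} [DirectSum.Decomposition ℒ]

/-- On arguments of total degree `s`, a form of degree `c` has values of degree `c + s`. Hence the
components of a sum can be read off its values, and the sum of the spaces of forms is direct. -/
theorem forms_component (x : ⨁ c, forms 𝒜 ℒ c) (c : ℤ) {n : ℕ} {e : Fin n → ℤ} {ξ : Fin n → L}
    (hξ : IsHom ℒ e ξ) : (x c : Cochain K L A) n ξ =
      GradedRing.proj 𝒜 (c + ∑ i, e i) ((DirectSum.coeLinearMap (forms 𝒜 ℒ) x) n ξ) := by
  induction x using DirectSum.induction_on with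
  | zero => simp
  | of c' y =>
    rw [DirectSum.coeLinearMap_of, GradedRing.proj_apply]
    have hy := (y.2.2 n).2.1 e ξ hξ
    by_cases h : c' = c
    · subst h
      rw [DirectSum.of_eq_same, DirectSum.decompose_of_mem_same _ hy]
    · rw [DirectSum.of_eq_of_ne _ _ _ (Ne.symm h), DirectSum.decompose_of_mem_ne _ hy (by omega)]
      rfl
  | add x y hx hy =>
    rw [map_add, DirectSum.add_apply, Submodule.coe_add, Pi.add_apply, Pi.add_apply, add_apply,
      add_apply, map_add, hx, hy]

theorem forms_coe_injective :
    Function.Injective (DirectSum.coeLinearMap (forms 𝒜 ℒ)) := by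
  intro x y hxy
  refine DFinsupp.ext fun c => Subtype.ext (cochain_ext ℒ fun n e ξ hξ => ?_)
  rw [forms_component x c hξ, forms_component y c hξ, hxy]

/-- The decomposition of `Sym_A(L, A)` into its homogeneous components. -/
noncomputable def formsEquiv (𝒜 : ℤ → Submodule K A) [GradedAlgebra 𝒜] (ℒ : ℤ → Submodule K L)
    [DirectSum.Decomposition ℒ] : (⨁ c, forms 𝒜 ℒ c) ≃ₗ[K] allForms 𝒜 ℒ :=
  (LinearEquiv.ofInjective _ (forms_coe_injective (𝒜 := 𝒜) (ℒ := ℒ))).trans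
    (LinearEquiv.ofEq _ _ DirectSum.range_coeLinearMap)

theorem coe_formsEquiv (x : ⨁ c, forms 𝒜 ℒ c) :
    (formsEquiv 𝒜 ℒ x : Cochain K L A) = DirectSum.coeLinearMap (forms 𝒜 ℒ) x := rfl

theorem formsEquiv_symm_of_mem {c : ℤ} {ω : allForms 𝒜 ℒ} (hω : (ω : Cochain K L A) ∈ forms 𝒜 ℒ c) :
    (formsEquiv 𝒜 ℒ).symm ω = DirectSum.lof K ℤ (fun c => forms 𝒜 ℒ c) c ⟨ω, hω⟩ := by
  rw [LinearEquiv.symm_apply_eq]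
  refine Subtype.ext ?_
  rw [coe_formsEquiv]
  exact (DirectSum.coeLinearMap_lof (forms 𝒜 ℒ) c ⟨ω, hω⟩).symm

theorem formsEquiv_symm_supp {k : ℤ} {ω : allForms 𝒜 ℒ} (hω : SuppC k (ω : Cochain K L A)) (c : ℤ) :
    SuppC k ((formsEquiv 𝒜 ℒ).symm ω c : Cochain K L A) := by
  intro n hn
  refine arity_ext ℒ (G := 0) fun e ξ hξ => ?_
  rw [forms_component _ c hξ, ← coe_formsEquiv, LinearEquiv.apply_symm_apply, hω n hn]
  exact map_zero _

/-- Linear maps on `Sym_A(L, A)` are determined by their values on homogeneous forms. -/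
theorem allForms_ext {M : Type*} [AddCommGroup M] [Module K M] {f g : allForms 𝒜 ℒ →ₗ[K] M}
    (h : ∀ c, ∀ ω : allForms 𝒜 ℒ, (ω : Cochain K L A) ∈ forms 𝒜 ℒ c → f ω = g ω) : f = g := by
  have : f ∘ₗ (formsEquiv 𝒜 ℒ).toLinearMap = g ∘ₗ (formsEquiv 𝒜 ℒ).toLinearMap := by
    refine DirectSum.linearMap_ext K fun c => LinearMap.ext fun ω => h c _ ?_
    rw [LinearEquiv.coe_coe, coe_formsEquiv, DirectSum.coeLinearMap_lof]
    exact ω.2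
  refine LinearMap.ext fun ω => ?_
  obtain ⟨x, rfl⟩ := (formsEquiv 𝒜 ℒ).surjective ω
  exact congrArg (fun l => l x) this

theorem mem_forms_iff [SetLike.GradedSMul 𝒜 ℒ] {c : ℤ} {ω : Cochain K L A} :
    ω ∈ forms 𝒜 ℒ c ↔ FinC ω ∧ SymmC ℒ ω ∧ DegC ℒ 𝒜 c ω ∧ FirstLeft 𝒜 ℒ c ω :=
  ⟨fun h => ⟨h.1, fun n => (h.2 n).1, fun n => (h.2 n).2.1,
    firstLeft_of_leftLin fun n => (h.2 n).2.2⟩,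
   fun h => ⟨h.1, fun n => ⟨h.2.1 n, h.2.2.1 n, h.2.2.2.leftLin h.2.1 n⟩⟩⟩

end Forms

/-! ### The derivation attached to a right pair. -/

section Operators

variable {K A L Q : Type*} [Field K] [Ring A] [Algebra K A] [AddCommGroup L] [Module K L]
  [Module A L] [IsScalarTower K A L] [AddCommGroup Q] [Module K Q] [Module A Q]
  [IsScalarTower K A Q]
variable {𝒜 : ℤ → Submodule K A} [GradedAlgebra 𝒜]
  {ℒ : ℤ → Submodule K L} [DirectSum.Decomposition ℒ] [SetLike.GradedSMul 𝒜 ℒ]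
  {𝒬 : ℤ → Submodule K Q} {c d e : ℤ}

theorem eta_add (X : Cochain K L L) (σ : Cochain K L (Module.End K A)) (ω ω' : Cochain K L A) :
    eta ℒ d X σ c (ω + ω') = eta ℒ d X σ c ω + eta ℒ d X σ c ω' := by
  simp only [eta, cstar_add_right, circ_add_left, smul_add]; abel

theorem eta_smul (X : Cochain K L L) (σ : Cochain K L (Module.End K A)) (r : K)
    (ω : Cochain K L A) : eta ℒ d X σ c (r • ω) = r • eta ℒ d X σ c ω := by
  simp only [eta, cstar_smul_right, circ_smul_left, smul_sub, smul_comm r]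

theorem smulB_self : smulB K A A = LinearMap.mul K A := rfl

/-- Both halves of `eta` satisfy the same Leibniz rule: the symbol half because its values are
derivations of `A`, the insertion half by `circ_cstar`. -/
theorem eta_formMul {X : Cochain K L L} (hX : DegC ℒ ℒ d X) {σ : Cochain K L (Module.End K A)}
    (hσ : DegC ℒ (derSub 𝒜) d σ) {c' : ℤ} {ω ω' : Cochain K L A} (hω : SymmC ℒ ω)
    (hωc : DegC ℒ 𝒜 c ω) (hω' : SymmC ℒ ω') :
    eta ℒ d X σ (c + c') (formMul ℒ c' ω ω') = formMul ℒ c' (eta ℒ d X σ c ω) ω' +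
      sg K (d * c) • formMul ℒ (d + c') ω (eta ℒ d X σ c' ω') := by
  have h := cstar_cstar_smul_of_derLike (c := c') (symbol_derLike hσ) hωc ω'
  rw [smulB_self] at h
  simp only [eta, formMul, h, circ_cstar hω hω' hX, cstar_sub_left, cstar_sub_right,
    cstar_smul_left, cstar_smul_right, add_comm c' d, mul_add, sg_add]
  match_scalars <;> grind [sg_mul_self]

/-- Mixed terms, where one map is inserted and the other differentiates, cancel by `circ_cstar`. The
purely inserted terms combine by the pre-Lie identity, and the purely differentiating ones by
associativity. -/
theorem eta_bracket {X Y : Cochain K L L} (hX : SymmC ℒ X)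
    (hX' : DegC ℒ ℒ d X) (hY : SymmC ℒ Y) (hY' : DegC ℒ ℒ e Y)
    {σ τ : Cochain K L (Module.End K A)} (hσ : SymmC ℒ σ) (hτ : SymmC ℒ τ) {ω : Cochain K L A}
    (hω : SymmC ℒ ω) :
    eta ℒ (d + e) (circBracket ℒ d e X Y) (twistedBracket ℒ d e X σ Y τ) c ω =
      eta ℒ d X σ (e + c) (eta ℒ e Y τ c ω) -
        sg K (d * e) • eta ℒ e Y τ (d + c) (eta ℒ d X σ c ω) := by
  have hp := circ_preLie hω hX hX' hY hY'
  rw [sub_eq_iff_eq_add] at hp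
  have h1 : cstar ℒ c (evB K A) (cstar ℒ e (LinearMap.mul K (Module.End K A)) σ τ) ω =
    cstar ℒ (e + c) (evB K A) σ (cstar ℒ c (evB K A) τ ω) :=
    cstar_assoc (fun _ _ _ => rfl) _ _ _
  have h2 : cstar ℒ c (evB K A) (cstar ℒ d (LinearMap.mul K (Module.End K A)) τ σ) ω =
    cstar ℒ (d + c) (evB K A) τ (cstar ℒ c (evB K A) σ ω) :=
    cstar_assoc (fun _ _ _ => rfl) _ _ _
  simp only [eta, circBracket, twistedBracket, opBracket_eq, circ_sub_left, circ_sub_right,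
    circ_smul_left, circ_smul_right, cstar_add_left, cstar_sub_left, cstar_sub_right,
    cstar_smul_left, cstar_smul_right, h1, h2, hp, circ_cstar hσ hω hY', circ_cstar hτ hω hX',
    mul_add, add_mul, sg_add, mul_comm e d, add_comm c d, add_comm c e]
  match_scalars <;> grind [sg_mul_self]

/-- The commutation rule `φ ω = ± ω φ + σ(ω)` for a form in place of a scalar. It is the source of
the symbol half of `eta` in the module Leibniz rule. -/
theorem compSMul_cstar_of_derLike {φ : Cochain K L (Module.End K Q)}
    {σ : Cochain K L (Module.End K A)}
    (hφ : DerLike 𝒜 ℒ (LinearMap.id : Module.End K Q →ₗ[K] Q →ₗ[K] Q) d φ σ) {f : Cochain K L A}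
    (hf : DegC ℒ 𝒜 c f) :
    cstar ℒ c (compSMul K A Q Q) φ f = sg K (d * c) • cstar ℒ d (smulB K A (Module.End K Q)) f φ +
      mapC (smulB K A Q) (cstar ℒ c (evB K A) σ f) := by
  funext n
  induction n generalizing φ σ f c d with
  | zero =>
    refine zero_ext fun ξ => LinearMap.ext fun q => ?_
    have := hφ 0 (fun _ => 0) ξ (fun i => i.elim0) _ _ (hf.zero_apply ξ) q
    simp only [Finset.univ_eq_empty, Finset.sum_empty, add_zero, LinearMap.id_apply] at this
    simp only [Pi.add_apply, Pi.smul_apply, add_apply, smul_apply, cstar_zero_apply, mapC_apply,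
      LinearMap.add_apply, LinearMap.smul_apply, compSMul_apply, this, smulB_apply,
      LinearMap.id_apply]
    rw [add_comm]
  | succ n ih =>
    refine succ_ext (ℒ := ℒ) fun i a ha => ?_
    have h1 := ih (hφ.ins ha) hf
    have h2 := ih hφ (hf.ins ha)
    simp only [ins_add, ins_smul, ins_mapC, ins_cstar ha, mapC_add, mapC_smul, Pi.add_apply,
      Pi.smul_apply] at h1 h2 ⊢
    rw [h1, h2]
    simp only [mul_add, add_mul, sg_add]
    match_scalars <;> grind [sg_mul_self]

section RightPairOperators

variable {X : Cochain K L L} {σ : Cochain K L (Module.End K A)} {φ : Cochain K L (Module.End K Q)}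

theorem IsRightPair.eta_mem (h : IsRightPair 𝒜 ℒ 𝒬 d X σ φ) {ω : Cochain K L A}
    (hω : ω ∈ forms 𝒜 ℒ c) : eta ℒ d X σ c ω ∈ forms 𝒜 ℒ (d + c) := by
  rw [mem_forms_iff] at hω ⊢
  obtain ⟨h1, h2, h3, h4⟩ := hω
  refine ⟨(h.symbol_fin.cstar h1).sub ((h1.circ h.fin).smul _),
    (cstar_symm h.symbol_symm h2).sub ((circ_symm h2 h.symm h.deg).smul _),
    (DegC.cstar (fun i j x (hx : IsDerivation 𝒜 i x) y hy => hx.1 j y hy) h.symbol_deg h3 c).sub ?_,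
    FirstLeft.operator (P := evB K A) (fun _ _ _ => rfl) h.deg h.symbol_lin
      (symbol_derLike h.symbol_deg) h.symbol_deg h.leibniz h2 h4⟩
  rw [add_comm]
  exact (h3.circ h.deg).smul _

theorem IsRightPair.rightOp_tens_lin (h : IsRightPair 𝒜 ℒ 𝒬 d X σ φ) :
    FirstRight 𝒜 ℒ (rightOp ℒ d (LinearMap.llcomp K Q Q (SymTensor 𝒜 ℒ Q)) X φ (tens 𝒜 ℒ Q)) :=
  FirstRight.operator h.deg h.symbol_deg h.leibniz h.form_leibniz h.form_lin (tens_grSymm 𝒜 ℒ)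
    (firstRight_of_rightLin (tens_rightLin 𝒜 ℒ))

/-- The operator on `S_A^• L ⊗_A Q` associated with an element of `ℛ(Q)`. -/
def IsRightPair.operator (h : IsRightPair 𝒜 ℒ 𝒬 d X σ φ) : Module.End K (SymTensor 𝒜 ℒ Q) :=
  ofTens (rightOp ℒ d (LinearMap.llcomp K Q Q (SymTensor 𝒜 ℒ Q)) X φ (tens 𝒜 ℒ Q))
    (rightOp_symm h.symm h.deg h.form_symm (tens_grSymm 𝒜 ℒ))
    (h.rightOp_tens_lin.rightLin (rightOp_symm h.symm h.deg h.form_symm (tens_grSymm 𝒜 ℒ)))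

theorem IsRightPair.operator_tens (h : IsRightPair 𝒜 ℒ 𝒬 d X σ φ) (n : ℕ) (ξ : Fin n → L) (q : Q) :
    h.operator (tens 𝒜 ℒ Q n ξ q) =
      rightOp ℒ d (LinearMap.llcomp K Q Q (SymTensor 𝒜 ℒ Q)) X φ (tens 𝒜 ℒ Q) n ξ q :=
  ofTens_tens _ _ _ n ξ q

/-- The operator on forms associated with an element of `ℛ(Q)`. -/
noncomputable def IsRightPair.symbol (h : IsRightPair 𝒜 ℒ 𝒬 d X σ φ) : Module.End K (allForms 𝒜 ℒ) :=
  (DirectSum.toModule K ℤ (allForms 𝒜 ℒ) fun c =>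
    { toFun := fun (ω : forms 𝒜 ℒ c) => ⟨eta ℒ d X σ c ω, forms_le_allForms 𝒜 ℒ _ (h.eta_mem ω.2)⟩
      map_add' := fun ω ω' => Subtype.ext (eta_add X σ (ω : Cochain K L A) ω')
      map_smul' := fun r ω => Subtype.ext (eta_smul X σ r (ω : Cochain K L A)) }) ∘ₗ
    (formsEquiv 𝒜 ℒ).symm.toLinearMap

theorem IsRightPair.symbol_apply (h : IsRightPair 𝒜 ℒ 𝒬 d X σ φ) {ω : allForms 𝒜 ℒ}
    (hω : (ω : Cochain K L A) ∈ forms 𝒜 ℒ c) :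
    (h.symbol ω : Cochain K L A) = eta ℒ d X σ c (ω : Cochain K L A) := by
  rw [IsRightPair.symbol, LinearMap.comp_apply, LinearEquiv.coe_coe, formsEquiv_symm_of_mem hω,
    DirectSum.toModule_lof]
  rfl

/-- Postcomposition with a linear map, on families with values in `Hom(Q, W)`. -/
def postC {W W' : Type*} [AddCommGroup W] [Module K W] [AddCommGroup W'] [Module K W']
    (D : W →ₗ[K] W') (F : Cochain K L (Q →ₗ[K] W)) : Cochain K L (Q →ₗ[K] W') :=
  mapC (LinearMap.llcomp K Q W W' D) F

theorem postC_apply {W W' : Type*} [AddCommGroup W] [Module K W] [AddCommGroup W'] [Module K W']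
    (D : W →ₗ[K] W') (F : Cochain K L (Q →ₗ[K] W)) (n : ℕ) (ξ : Fin n → L) (q : Q) :
    postC D F n ξ q = D (F n ξ q) := rfl

theorem postC_cstar {V W W' : Type*} [AddCommGroup V] [Module K V] [AddCommGroup W] [Module K W]
    [AddCommGroup W'] [Module K W'] (D : W →ₗ[K] W') {B : (Q →ₗ[K] W) →ₗ[K] V →ₗ[K] (Q →ₗ[K] W)}
    {B' : (Q →ₗ[K] W') →ₗ[K] V →ₗ[K] (Q →ₗ[K] W')} (hB : ∀ f v, D ∘ₗ B f v = B' (D ∘ₗ f) v)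
    (F : Cochain K L (Q →ₗ[K] W)) (g : Cochain K L V) :
    postC D (cstar ℒ c B F g) = cstar ℒ c B' (postC D F) g :=
  mapC_cstar_left hB F g

theorem postC_circ {W W' : Type*} [AddCommGroup W] [Module K W] [AddCommGroup W'] [Module K W']
    (D : W →ₗ[K] W') (F : Cochain K L (Q →ₗ[K] W)) (X : Cochain K L L) :
    postC D (circ ℒ F X) = circ ℒ (postC D F) X := mapC_circ _ _ _

/-- The action changes the arguments and precomposes on `Q`, while `D` is applied to the values, so
the two commute. This is what reverses the order between the action and composition of operators. -/
theorem postC_rightOp {W W' : Type*} [AddCommGroup W] [Module K W] [AddCommGroup W'] [Module K W']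
    (D : W →ₗ[K] W') (F : Cochain K L (Q →ₗ[K] W)) :
    postC D (rightOp ℒ d (LinearMap.llcomp K Q Q W) X φ F) =
      rightOp ℒ d (LinearMap.llcomp K Q Q W') X φ (postC D F) := by
  rw [rightOp, rightOp, ← postC_circ, ← postC_cstar D (B := LinearMap.llcomp K Q Q W)
    fun _ _ => rfl]
  exact mapC_add _ _ _

theorem IsRightPair.postC_operator (h : IsRightPair 𝒜 ℒ 𝒬 d X σ φ) :
    postC h.operator (tens 𝒜 ℒ Q) =
      rightOp ℒ d (LinearMap.llcomp K Q Q (SymTensor 𝒜 ℒ Q)) X φ (tens 𝒜 ℒ Q) := by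
  funext n; ext ξ q : 2
  exact h.operator_tens n ξ q

theorem postC_contract [IsGradedComm 𝒜] {ω : Cochain K L A} (hω : ω ∈ forms 𝒜 ℒ c) :
    postC (contract 𝒜 ℒ Q c ω hω) (tens 𝒜 ℒ Q) =
      cstar ℒ c (compSMul K A Q (SymTensor 𝒜 ℒ Q)) (tens 𝒜 ℒ Q) ω := by
  funext n; ext ξ q : 2
  exact contract_tens hω n ξ q

/-- The maps of degree `m` from `Q` to the symmetric tensors. -/
def homDeg (𝒜 : ℤ → Submodule K A) (ℒ : ℤ → Submodule K L) (𝒬 : ℤ → Submodule K Q) (m : ℤ) :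
    Submodule K (Q →ₗ[K] SymTensor 𝒜 ℒ Q) where
  carrier := {f | ∀ i, ∀ x ∈ 𝒬 i, f x ∈ tensorDeg 𝒜 ℒ 𝒬 (m + i)}
  zero_mem' := fun _ _ _ => Submodule.zero_mem _
  add_mem' := fun hf hg i x hx => Submodule.add_mem _ (hf i x hx) (hg i x hx)
  smul_mem' := fun r _ hf i x hx => Submodule.smul_mem _ r (hf i x hx)

theorem tens_deg : DegC ℒ (homDeg 𝒜 ℒ 𝒬) 0 (tens 𝒜 ℒ Q) := fun n u ξ hξ i q hq =>
  Submodule.subset_span ⟨n, u, ξ, i, q, hξ, hq, by rw [zero_add], rfl⟩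

theorem mem_endDeg_of_postC {D : Module.End K (SymTensor 𝒜 ℒ Q)}
    (h : DegC ℒ (homDeg 𝒜 ℒ 𝒬) d (postC D (tens 𝒜 ℒ Q))) :
    D ∈ endDeg (tensorDeg 𝒜 ℒ 𝒬) d := by
  intro i x hx
  induction hx using Submodule.span_induction with
  | mem x hx =>
    obtain ⟨n, u, ξ, f, q, hξ, hq, rfl, rfl⟩ := hx
    rw [← add_assoc]
    exact h n u ξ hξ f q hq
  | zero => rw [map_zero]; exact Submodule.zero_mem _
  | add x y _ _ hx hy => rw [map_add]; exact Submodule.add_mem _ hx hy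
  | smul r x _ hx => rw [map_smul]; exact Submodule.smul_mem _ r hx

theorem rightOp_deg (h : IsRightPair 𝒜 ℒ 𝒬 d X σ φ) {m : ℤ}
    {F : Cochain K L (Q →ₗ[K] SymTensor 𝒜 ℒ Q)} (hF : DegC ℒ (homDeg 𝒜 ℒ 𝒬) m F) :
    DegC ℒ (homDeg 𝒜 ℒ 𝒬) (m + d)
      (rightOp ℒ d (LinearMap.llcomp K Q Q (SymTensor 𝒜 ℒ Q)) X φ F) := by
  have hB : ∀ i j, ∀ x ∈ homDeg 𝒜 ℒ 𝒬 i, ∀ y ∈ endDeg 𝒬 j,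
      LinearMap.llcomp K Q Q (SymTensor 𝒜 ℒ Q) x y ∈ homDeg 𝒜 ℒ 𝒬 (i + j) := by
    intro i j x hx y hy k q hq
    rw [add_assoc]
    exact hx _ _ (hy _ _ hq)
  exact (hF.circ h.deg).add (DegC.cstar hB hF h.form_deg d)

theorem IsRightPair.isModuleDerivation [IsGradedComm 𝒜] (h : IsRightPair 𝒜 ℒ 𝒬 d X σ φ) :
    IsModuleDerivation 𝒜 ℒ 𝒬 d h.operator h.symbol where
  symbol_deg c ω hω := by rw [h.symbol_apply hω]; exact h.eta_mem hω
  symbol_leibniz c c' ω ω' hω hω' := by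
    rw [h.symbol_apply (formMul_mem hω hω'), h.symbol_apply hω, h.symbol_apply hω']
    have h1 := mem_forms_iff.1 hω
    have h2 := mem_forms_iff.1 hω'
    exact eta_formMul h.deg h.symbol_deg h1.2.1 h1.2.2.1 h2.2.1
  deg := by
    refine mem_endDeg_of_postC ?_
    rw [h.postC_operator]
    simpa using rightOp_deg h (tens_deg (𝒜 := 𝒜) (𝒬 := 𝒬))
  leibniz c ω hω u := by
    have hsω : (h.symbol ω : Cochain K L A) ∈ forms 𝒜 ℒ (d + c) := by
      rw [h.symbol_apply hω]; exact h.eta_mem hω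
    have h1 := mem_forms_iff.1 hω
    suffices hD : h.operator ∘ₗ contract 𝒜 ℒ Q c ω hω =
        contract 𝒜 ℒ Q (d + c) (h.symbol ω) hsω +
          sg K (d * c) • (contract 𝒜 ℒ Q c ω hω ∘ₗ h.operator) from congrArg (fun l => l u) hD
    -- The Leibniz rule at the level of families: moving `φ` past `ω` yields `σ ∘ ω`, the derivation
    -- `∘ X` yields `ω ∘ X`, and the rest is the action on the contracted generators.
    have key : cstar ℒ c (compSMul K A Q (SymTensor 𝒜 ℒ Q))
        (rightOp ℒ d (LinearMap.llcomp K Q Q (SymTensor 𝒜 ℒ Q)) X φ (tens 𝒜 ℒ Q)) ω =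
        cstar ℒ (d + c) (compSMul K A Q (SymTensor 𝒜 ℒ Q)) (tens 𝒜 ℒ Q) (eta ℒ d X σ c ω) +
        sg K (d * c) • rightOp ℒ d (LinearMap.llcomp K Q Q (SymTensor 𝒜 ℒ Q)) X φ
          (cstar ℒ c (compSMul K A Q (SymTensor 𝒜 ℒ Q)) (tens 𝒜 ℒ Q) (ω : Cochain K L A)) := by
      have k1 : cstar ℒ c (compSMul K A Q (SymTensor 𝒜 ℒ Q)) (cstar ℒ d
          (LinearMap.llcomp K Q Q (SymTensor 𝒜 ℒ Q)) (tens 𝒜 ℒ Q) φ) ω =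
          cstar ℒ (d + c) (LinearMap.llcomp K Q Q (SymTensor 𝒜 ℒ Q)) (tens 𝒜 ℒ Q)
            (cstar ℒ c (compSMul K A Q Q) φ (ω : Cochain K L A)) :=
        cstar_assoc (fun _ _ _ => rfl) _ _ _
      have k2 : cstar ℒ d (LinearMap.llcomp K Q Q (SymTensor 𝒜 ℒ Q)) (cstar ℒ c
          (compSMul K A Q (SymTensor 𝒜 ℒ Q)) (tens 𝒜 ℒ Q) (ω : Cochain K L A)) φ =
          cstar ℒ (c + d) (LinearMap.llcomp K Q Q (SymTensor 𝒜 ℒ Q)) (tens 𝒜 ℒ Q)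
            (cstar ℒ d (smulB K A (Module.End K Q)) (ω : Cochain K L A) φ) :=
        cstar_assoc (fun _ _ _ => rfl) _ _ _
      have k3 : cstar ℒ (d + c) (LinearMap.llcomp K Q Q (SymTensor 𝒜 ℒ Q)) (tens 𝒜 ℒ Q)
          (mapC (smulB K A Q) (cstar ℒ c (evB K A) σ (ω : Cochain K L A))) =
          cstar ℒ (d + c) (compSMul K A Q (SymTensor 𝒜 ℒ Q)) (tens 𝒜 ℒ Q)
            (cstar ℒ c (evB K A) σ (ω : Cochain K L A)) :=
        cstar_mapC_right (fun _ _ => rfl) _ _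
      simp only [rightOp, eta, cstar_add_left, k1, k2,
        compSMul_cstar_of_derLike h.form_leibniz h1.2.2.1, cstar_add_right, cstar_sub_right,
        cstar_smul_right, k3, circ_cstar (tens_grSymm 𝒜 ℒ) h1.2.1 h.deg, add_comm c d]
      match_scalars <;> grind [sg_mul_self]
    refine symTensor_ext fun n ξ q => ?_
    have e1 : postC h.operator (postC (contract 𝒜 ℒ Q c ω hω) (tens 𝒜 ℒ Q)) =
        cstar ℒ c (compSMul K A Q (SymTensor 𝒜 ℒ Q))
        (rightOp ℒ d (LinearMap.llcomp K Q Q (SymTensor 𝒜 ℒ Q)) X φ (tens 𝒜 ℒ Q)) ω := by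
      rw [postC_contract, ← h.postC_operator]
      exact postC_cstar _ (fun _ _ => rfl) _ _
    -- Contraction after `D` becomes the action on contracted generators, since outer composition
    -- passes through `rightOp`.
    have e2 : postC (contract 𝒜 ℒ Q c ω hω) (postC h.operator (tens 𝒜 ℒ Q)) =
        rightOp ℒ d (LinearMap.llcomp K Q Q (SymTensor 𝒜 ℒ Q)) X φ
          (cstar ℒ c (compSMul K A Q (SymTensor 𝒜 ℒ Q)) (tens 𝒜 ℒ Q) (ω : Cochain K L A)) := by
      rw [h.postC_operator, postC_rightOp, postC_contract]
    rw [← e1, ← e2, ← h.symbol_apply hω, ← postC_contract hsω] at key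
    exact congrArg (fun F => F n ξ q) key

end RightPairOperators

end Operators

end RightRep

namespace RightRep

open scoped DirectSum TensorProduct

/-! ### Weights, and the morphism on all right pairs. -/

section EtaRight

variable {K A L Q : Type*} [Field K] [Ring A] [Algebra K A] [AddCommGroup L] [Module K L]
  [Module A L] [IsScalarTower K A L] [AddCommGroup Q] [Module K Q] [Module A Q]
  [IsScalarTower K A Q]
variable {𝒜 : ℤ → Submodule K A} [GradedAlgebra 𝒜]
  {ℒ : ℤ → Submodule K L} [DirectSum.Decomposition ℒ] [SetLike.GradedSMul 𝒜 ℒ]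
  {𝒬 : ℤ → Submodule K Q} {c d e : ℤ}
variable {X : Cochain K L L} {σ : Cochain K L (Module.End K A)} {φ : Cochain K L (Module.End K Q)}

/-- Lowering the weight by `w` is tested one output component at a time: component `m` of the values
on generators may only involve generators with `m + w` entries. -/
theorem component_eq_zero {D : Module.End K (SymTensor 𝒜 ℒ Q)} {w : ℤ}
    (h : ∀ m : ℕ, SuppC (m + w)
      (postC (DirectSum.component K ℕ (SymTensorPow 𝒜 ℒ Q) m) (postC D (tens 𝒜 ℒ Q))))
    (n : ℕ) (u : SymTensorPow 𝒜 ℒ Q n) (m : ℕ) (hm : (m : ℤ) ≠ n - w) :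
    D (DirectSum.lof K ℕ (SymTensorPow 𝒜 ℒ Q) n u) m = 0 := by
  have : DirectSum.component K ℕ (SymTensorPow 𝒜 ℒ Q) m ∘ₗ D ∘ₗ
      DirectSum.lof K ℕ (SymTensorPow 𝒜 ℒ Q) n = 0 := by
    refine symTensorPow_ext fun ξ q => ?_
    have := h m n (by omega)
    exact congrArg (fun F => F ξ q) this
  exact congrArg (fun l => l u) this

theorem component_tens (m : ℕ) :
    SuppC m (postC (DirectSum.component K ℕ (SymTensorPow 𝒜 ℒ Q) m) (tens 𝒜 ℒ Q)) := by
  intro n hn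
  ext ξ q
  rw [postC_apply, tens_apply, DirectSum.component.of, dif_neg (by omega)]
  rfl

theorem IsRightPair.hasWeight (h : IsRightPair 𝒜 ℒ 𝒬 d X σ φ) {k : ℤ} (hX : SuppC k X)
    (hσ : SuppC (k - 1) σ) (hφ : SuppC (k - 1) φ) : HasWeight (k - 1) h.operator h.symbol := by
  refine ⟨component_eq_zero fun m => ?_, fun n ω hω m hm => ?_⟩
  · rw [h.postC_operator, postC_rightOp]
    exact ((component_tens m).circ hX).add ((component_tens m).cstar hφ)
  · have hω' : SuppC n (ω : Cochain K L A) := fun j hj => hω j (by exact_mod_cast hj)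
    -- The form is homogeneous in its number of entries but not in degree. Since the symbol is given
    -- by `eta` only degree by degree, `ω` is first split into homogeneous components.
    have key : ∀ x : ⨁ c, forms 𝒜 ℒ c, (∀ c, SuppC n (x c : Cochain K L A)) →
        (h.symbol (formsEquiv 𝒜 ℒ x) : Cochain K L A) m = 0 := by
      intro x hx
      classical
      rw [← DirectSum.sum_support_of x, map_sum, map_sum, Submodule.coe_sum, Finset.sum_apply]
      refine Finset.sum_eq_zero fun c _ => ?_
      have e1 : (formsEquiv 𝒜 ℒ (DirectSum.of (fun c => forms 𝒜 ℒ c) c (x c)) : Cochain K L A) =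
          x c := by
        rw [coe_formsEquiv, DirectSum.coeLinearMap_of]
      have hm' : (formsEquiv 𝒜 ℒ (DirectSum.of (fun c => forms 𝒜 ℒ c) c (x c)) : Cochain K L A) ∈
          forms 𝒜 ℒ c := by rw [e1]; exact (x c).2
      rw [h.symbol_apply hm', e1]
      have h1 : SuppC (k - 1 + n) (eta ℒ d X σ c (x c : Cochain K L A)) := by
        refine (hσ.cstar (hx c)).sub (SuppC.smul _ ?_)
        rw [add_comm]
        exact (hx c).circ hX
      exact h1 m (by omega)
    have := key ((formsEquiv 𝒜 ℒ).symm ω) (formsEquiv_symm_supp hω')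
    rwa [LinearEquiv.apply_symm_apply] at this

/-- The part with `k` entries of an element of `ℛ(Q)`. -/
def truncEntries (k : ℕ)
    (x : Cochain K L L × Cochain K L (Module.End K A) × Cochain K L (Module.End K Q)) :
    Cochain K L L × Cochain K L (Module.End K A) × Cochain K L (Module.End K Q) :=
  (fun j => if j = k then x.1 j else 0, fun n => if n + 1 = k then x.2.1 n else 0,
    fun n => if n + 1 = k then x.2.2 n else 0)

theorem truncEntries_mem {x : Cochain K L L × Cochain K L (Module.End K A) ×
    Cochain K L (Module.End K Q)} (hx : x ∈ rightPairs 𝒜 ℒ 𝒬 d) (k : ℕ) :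
    truncEntries k x ∈ rightPairs 𝒜 ℒ 𝒬 d := by
  -- All conditions are imposed arity by arity, and the Leibniz rules link only `X (n + 1)`, `σ n`
  -- and `Δ n`, which are kept or dropped together. Outside the chosen arity the conditions are
  -- those for zero.
  have h0 := (rightPairs 𝒜 ℒ 𝒬 d).zero_mem
  refine ⟨⟨⟨k + 1, fun n hn => ⟨if_neg (by omega), if_neg (by omega)⟩⟩, fun j => ?_, fun j => ?_,
    fun n => ?_, fun n => ?_, fun n => ?_, fun n => ?_⟩, ⟨⟨k + 1, fun n hn => if_neg (by omega)⟩,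
    fun n => ?_, fun n => ?_, fun n => ?_, fun n => ?_⟩⟩
  · by_cases h : j = k
    · simpa only [truncEntries, if_pos h] using hx.1.symm j
    · simp only [truncEntries, if_neg h]; exact h0.1.symm j
  · by_cases h : j = k
    · simpa only [truncEntries, if_pos h] using hx.1.deg j
    · simp only [truncEntries, if_neg h]; exact h0.1.deg j
  · by_cases h : n + 1 = k
    · simpa only [truncEntries, if_pos h] using hx.1.symbol_symm n
    · simp only [truncEntries, if_neg h]; exact h0.1.symbol_symm n
  · by_cases h : n + 1 = k
    · simpa only [truncEntries, if_pos h] using hx.1.symbol_der n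
    · simp only [truncEntries, if_neg h]; exact h0.1.symbol_der n
  · by_cases h : n + 1 = k
    · simpa only [truncEntries, if_pos h] using hx.1.symbol_lin n
    · simp only [truncEntries, if_neg h]; exact h0.1.symbol_lin n
  · by_cases h : n + 1 = k
    · simpa only [truncEntries, if_pos h] using hx.1.leibniz n
    · simp only [truncEntries, if_neg h]; exact h0.1.leibniz n
  · by_cases h : n + 1 = k
    · simpa only [truncEntries, if_pos h] using hx.2.symm n
    · simp only [truncEntries, if_neg h]; exact h0.2.symm n
  · by_cases h : n + 1 = k
    · simpa only [truncEntries, if_pos h] using hx.2.deg n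
    · simp only [truncEntries, if_neg h]; exact h0.2.deg n
  · by_cases h : n + 1 = k
    · simpa only [truncEntries, if_pos h] using hx.2.lin n
    · simp only [truncEntries, if_neg h]; exact h0.2.lin n
  · by_cases h : n + 1 = k
    · simpa only [truncEntries, if_pos h] using hx.2.leibniz n
    · simp only [truncEntries, if_neg h]; exact h0.2.leibniz n

theorem truncEntries_hasEntries (k : ℕ) (x : Cochain K L L × Cochain K L (Module.End K A) ×
    Cochain K L (Module.End K Q)) : HasEntries k (truncEntries k x) :=
  ⟨fun _ hj => if_neg hj, fun _ hn => ⟨if_neg hn, if_neg hn⟩⟩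

theorem sum_truncEntries {x : Cochain K L L × Cochain K L (Module.End K A) ×
    Cochain K L (Module.End K Q)} (hx : x ∈ rightPairs 𝒜 ℒ 𝒬 d) :
    ∃ N, x = ∑ k ∈ Finset.range N, truncEntries k x := by
  obtain ⟨N, hN⟩ := hx.1.finite
  obtain ⟨M, hM⟩ := hx.2.finite
  refine ⟨max N M + 1, ?_⟩
  refine Prod.ext (funext fun n => ?_) (Prod.ext (funext fun n => ?_) (funext fun n => ?_))
  · simp only [Prod.fst_sum, Finset.sum_apply, truncEntries, Finset.sum_ite_eq, Finset.mem_range]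
    split_ifs with h
    · rfl
    · exact (hN n (by omega)).1
  · simp only [Prod.fst_sum, Prod.snd_sum, Finset.sum_apply, truncEntries, Finset.sum_ite_eq,
      Finset.mem_range]
    split_ifs with h
    · rfl
    · exact (hN n (by omega)).2
  · simp only [Prod.snd_sum, Finset.sum_apply, truncEntries, Finset.sum_ite_eq,
      Finset.mem_range]
    split_ifs with h
    · rfl
    · exact hM n (by omega)

/-- The pair of operators associated with an element of `ℛ(Q)`. -/
noncomputable def etaPair (𝒜 : ℤ → Submodule K A) [GradedAlgebra 𝒜]
    (ℒ : ℤ → Submodule K L) [DirectSum.Decomposition ℒ] [SetLike.GradedSMul 𝒜 ℒ]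
    (𝒬 : ℤ → Submodule K Q) (d : ℤ) : rightPairs 𝒜 ℒ 𝒬 d →ₗ[K]
      Module.End K (SymTensor 𝒜 ℒ Q) × Module.End K (allForms 𝒜 ℒ) where
  toFun x := ((mem_rightPairs_iff.1 x.2).operator, (mem_rightPairs_iff.1 x.2).symbol)
  map_add' x y := by
    refine Prod.ext (symTensor_ext fun n ξ q => ?_) (allForms_ext fun c ω hω => Subtype.ext ?_)
    · simp only [Prod.fst_add, LinearMap.add_apply, IsRightPair.operator_tens, rightOp,
        Submodule.coe_add, Prod.snd_add, neg_add, circ_add_right, cstar_add_right, Pi.add_apply,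
        add_apply]
      abel
    · simp only [Prod.snd_add, LinearMap.add_apply, Submodule.coe_add,
        IsRightPair.symbol_apply _ hω, eta, Prod.fst_add, cstar_add_left, circ_add_right, smul_add]
      abel
  map_smul' r x := by
    refine Prod.ext (symTensor_ext fun n ξ q => ?_) (allForms_ext fun c ω hω => Subtype.ext ?_)
    · simp only [Prod.smul_fst, LinearMap.smul_apply, IsRightPair.operator_tens, rightOp,
        Submodule.coe_smul, Prod.smul_snd, ← smul_neg, circ_smul_right, cstar_smul_right,
        ← smul_add, Pi.smul_apply, smul_apply, RingHom.id_apply]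
    · simp only [Prod.smul_snd, LinearMap.smul_apply, Submodule.coe_smul, RingHom.id_apply,
        IsRightPair.symbol_apply _ hω, eta, Prod.smul_fst, cstar_smul_left, circ_smul_right,
        smul_sub, smul_comm r]

theorem etaPair_tens (x : rightPairs 𝒜 ℒ 𝒬 d) (n : ℕ) (ξ : Fin n → L) (q : Q) :
    (etaPair 𝒜 ℒ 𝒬 d x).1 (tens 𝒜 ℒ Q n ξ q) = etaRight 𝒜 ℒ d x.1.1 x.1.2.2 n ξ q := by
  refine ((mem_rightPairs_iff.1 x.2).operator_tens n ξ q).trans ?_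
  rw [rightOp, cstar_neg_right, ← sub_eq_add_neg]
  rfl

theorem etaPair_symbol (x : rightPairs 𝒜 ℒ 𝒬 d) (ω : allForms 𝒜 ℒ)
    (hω : (ω : Cochain K L A) ∈ forms 𝒜 ℒ c) :
    ((etaPair 𝒜 ℒ 𝒬 d x).2 ω : Cochain K L A) = eta ℒ d x.1.1 x.1.2.1 c (ω : Cochain K L A) :=
  (mem_rightPairs_iff.1 x.2).symbol_apply hω

theorem etaPair_hasWeight (k : ℕ) (x : rightPairs 𝒜 ℒ 𝒬 d) (hx : HasEntries k x.1) :
    HasWeight ((k : ℤ) - 1) (etaPair 𝒜 ℒ 𝒬 d x).1 (etaPair 𝒜 ℒ 𝒬 d x).2 := by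
  refine (mem_rightPairs_iff.1 x.2).hasWeight (fun n hn => hx.1 n (by omega))
    (fun n hn => (hx.2 n (by omega)).1) fun n hn => ?_
  rw [Pi.neg_apply, (hx.2 n (by omega)).2, neg_zero]

/-- Membership requires a sum of derivations homogeneous in weight. Splitting by number of entries
provides one. -/
theorem etaPair_mem [IsGradedComm 𝒜] (x : rightPairs 𝒜 ℒ 𝒬 d) :
    etaPair 𝒜 ℒ 𝒬 d x ∈ moduleDerivations 𝒜 ℒ 𝒬 d := by
  obtain ⟨N, hN⟩ := sum_truncEntries x.2
  have : x = ∑ k ∈ Finset.range N,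
      (⟨truncEntries k x.1, truncEntries_mem x.2 k⟩ : rightPairs 𝒜 ℒ 𝒬 d) :=
    Subtype.ext (by rw [Submodule.coe_sum]; exact hN)
  rw [this, map_sum]
  refine Submodule.sum_mem _ fun k _ => Submodule.subset_span
    ⟨(mem_rightPairs_iff.1 (truncEntries_mem x.2 k)).isModuleDerivation, _,
      etaPair_hasWeight k ⟨truncEntries k x.1, truncEntries_mem x.2 k⟩
        (truncEntries_hasEntries k x.1)⟩

theorem etaPair_bracket (x : rightPairs 𝒜 ℒ 𝒬 d) (y : rightPairs 𝒜 ℒ 𝒬 e)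
    (z : rightPairs 𝒜 ℒ 𝒬 (d + e)) (hz : z.1 = rightBracket ℒ d e x.1 y.1) :
    etaPair 𝒜 ℒ 𝒬 (d + e) z =
      pairCommutator d e (etaPair 𝒜 ℒ 𝒬 d x) (etaPair 𝒜 ℒ 𝒬 e y) := by
  have hx := mem_rightPairs_iff.1 x.2
  have hy := mem_rightPairs_iff.1 y.2
  have hz' := mem_rightPairs_iff.1 z.2
  have hz1 : z.1.1 = circBracket ℒ d e x.1.1 y.1.1 := by rw [hz, rightBracket_eq]
  have hz2 : z.1.2.1 = twistedBracket ℒ d e x.1.1 x.1.2.1 y.1.1 y.1.2.1 := by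
    rw [hz, rightBracket_eq]
  have hz3 : -z.1.2.2 = twistedBracket ℒ d e x.1.1 (-x.1.2.2) y.1.1 (-y.1.2.2) := by
    rw [hz, rightBracket_eq, neg_neg]
  refine Prod.ext (symTensor_ext fun n ξ q => ?_) (allForms_ext fun c ω hω => Subtype.ext ?_)
  -- `postC_rightOp` reverses the order of the two actions, which undoes the reversal in
  -- `rightOp_bracket`.
  · have key : postC hz'.operator (tens 𝒜 ℒ Q) = postC hx.operator (postC hy.operator (tens 𝒜 ℒ Q)) -
        sg K (d * e) • postC hy.operator (postC hx.operator (tens 𝒜 ℒ Q)) := by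
      rw [hx.postC_operator, hy.postC_operator, hz'.postC_operator, postC_rightOp, postC_rightOp,
        hx.postC_operator, hy.postC_operator, hz1, hz3]
      exact rightOp_bracket (fun _ _ _ => rfl) hx.symm hx.deg hy.symm hy.deg hx.form_symm
        hy.form_symm (tens_grSymm 𝒜 ℒ)
    exact congrArg (fun F => F n ξ q) key
  · have h1 := hx.eta_mem hω
    have h2 := hy.eta_mem hω
    rw [← hx.symbol_apply hω] at h1
    rw [← hy.symbol_apply hω] at h2
    change (hz'.symbol ω : Cochain K L A) = hx.symbol (hy.symbol ω) -
      sg K (d * e) • (hy.symbol (hx.symbol ω) : Cochain K L A)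
    rw [hz'.symbol_apply hω, hx.symbol_apply h2, hy.symbol_apply h1, hx.symbol_apply hω,
      hy.symbol_apply hω, hz1, hz2]
    exact eta_bracket hx.symm hx.deg hy.symm hy.deg hx.symbol_symm hy.symbol_symm
      fun n => (hω.2 n).1

end EtaRight

end RightRep

namespace RightRep

open scoped DirectSum TensorProduct

/-! ### Families with one entry. -/

section OneForms

variable {K L W : Type*} [Field K] [AddCommGroup L] [Module K L] [AddCommGroup W] [Module K W]
variable {ℒ : ℤ → Submodule K L} [DirectSum.Decomposition ℒ]

/-- A linear map, as a family concentrated in arity `1`. -/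
def oneC (ℓ : L →ₗ[K] W) : Cochain K L W
  | 1 => MultilinearMap.ofSubsingleton K L W (0 : Fin 1) ℓ
  | 0 => 0
  | _ + 2 => 0

theorem ins_oneC (ℓ : L →ₗ[K] W) (a : L) : ins a (oneC ℓ) = cst K L (ℓ a) := by
  funext n
  ext ξ
  rcases n with _ | n <;> rfl

theorem oneC_supp (ℓ : L →ₗ[K] W) : SuppC 1 (oneC ℓ)
  | 0, _ => rfl
  | 1, h => absurd rfl h
  | _ + 2, _ => rfl

theorem oneC_symm (ℓ : L →ₗ[K] W) : SymmC ℒ (oneC ℓ)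
  | 0, _, _, _, i, _, _ => i.elim0
  | 1, _, _, _, i, j, h => by omega
  | _ + 2, _, _, _, _, _, _ => (smul_zero _).symm

theorem oneC_deg {𝒲 : ℤ → Submodule K W} {c : ℤ} {ℓ : L →ₗ[K] W}
    (h : ∀ i, ∀ x ∈ ℒ i, ℓ x ∈ 𝒲 (c + i)) : DegC ℒ 𝒲 c (oneC ℓ)
  | 0, _, _, _ => Submodule.zero_mem _
  | 1, e, ξ, hξ => by
    rw [Fin.sum_univ_one]
    exact h _ _ (hξ 0)
  | _ + 2, _, _, _ => Submodule.zero_mem _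

theorem cochain_ext_ins {F G : Cochain K L W} (h0 : F 0 = G 0)
    (h : ∀ i, ∀ a ∈ ℒ i, ins a F = ins a G) : F = G := by
  funext n
  rcases n with _ | n
  · exact h0
  · exact succ_ext (ℒ := ℒ) fun i a ha => by rw [h i a ha]

theorem ins_sum {ι : Type*} (S : Finset ι) (F : ι → Cochain K L W) (a : L) :
    ins a (∑ i ∈ S, F i) = ∑ i ∈ S, ins a (F i) :=
  map_sum (AddMonoidHom.mk' (ins a) fun F G => ins_add a F G : Cochain K L W →+ Cochain K L W) F S

theorem cst_add (v w : W) : cst K L (v + w) = cst K L v + cst K L w := by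
  funext n; ext ξ
  rcases n with _ | n
  · rfl
  · simp [cst_succ]

theorem cst_smul (r : K) (w : W) : cst K L (r • w) = r • cst K L w := by
  funext n; ext ξ
  rcases n with _ | n
  · rfl
  · simp [cst_succ]

theorem cst_sum {ι : Type*} (S : Finset ι) (w : ι → W) :
    cst K L (∑ i ∈ S, w i) = ∑ i ∈ S, cst K L (w i) :=
  map_sum (AddMonoidHom.mk' (cst K L) cst_add : W →+ Cochain K L W) w S

theorem SuppC.finC {F : Cochain K L W} {k : ℤ} (h : SuppC k F) : FinC F :=
  ⟨k.toNat + 1, fun n hn => h n (by omega)⟩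

end OneForms

/-! ### Homogeneous dual frames of finitely generated projective modules. -/

section Frames

variable {K A L : Type*} [Field K] [Ring A] [Algebra K A] [AddCommGroup L] [Module K L]
  [Module A L] [IsScalarTower K A L]

/-- Homogeneous dual bases: forms `f i` with one entry and elements `b i` of `L` such that
`x = ∑ ± f_i(x) b_i`. -/
structure IsDualFrame (𝒜 : ℤ → Submodule K A) (ℒ : ℤ → Submodule K L) [DirectSum.Decomposition ℒ]
    {ι : Type*} [Fintype ι] (c : ι → ℤ) (f : ι → Cochain K L A) (b : ι → L) : Prop where
  form_mem : ∀ i, f i ∈ forms 𝒜 ℒ (c i)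
  form_supp : ∀ i, SuppC 1 (f i)
  vec_mem : ∀ i, b i ∈ ℒ (-c i)
  sum_eq : ∑ i, cstar ℒ (-c i) (smulB K A L) (f i) (cst K L (b i)) = idC K L

variable {𝒜 : ℤ → Submodule K A} [GradedAlgebra 𝒜]
  {ℒ : ℤ → Submodule K L} [DirectSum.Decomposition ℒ] [SetLike.GradedSMul 𝒜 ℒ]

theorem proj_smul_mem {c j : ℤ} {r : A} {b : L} (hb : b ∈ ℒ (-c)) :
    (DirectSum.decompose ℒ (r • b) j : L) = GradedAlgebra.proj 𝒜 (j + c) r • b := by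
  induction r using hom_induction (ℒ := 𝒜) with
  | h0 => simp
  | hadd x y hx hy =>
    rw [add_smul, DirectSum.decompose_add, DirectSum.add_apply, Submodule.coe_add, hx, hy, map_add,
      add_smul]
  | hom i a ha =>
    have hab : a • b ∈ ℒ (i + -c) := SetLike.GradedSMul.smul_mem ha hb
    rw [GradedAlgebra.proj_apply]
    by_cases h : j + c = i
    · subst h
      rw [DirectSum.decompose_of_mem_same _ ha]
      have hab' : a • b ∈ ℒ j := by simpa using hab
      rw [DirectSum.decompose_of_mem_same _ hab']
    · rw [DirectSum.decompose_of_mem_ne _ ha (Ne.symm h), zero_smul,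
        DirectSum.decompose_of_mem_ne _ hab (by omega)]

theorem proj_mul_of_mem {b j : ℤ} {a r : A} (ha : a ∈ 𝒜 b) :
    GradedAlgebra.proj 𝒜 (b + j) (a * r) = a * GradedAlgebra.proj 𝒜 j r := by
  rw [GradedAlgebra.proj_apply, GradedAlgebra.proj_apply, DirectSum.coe_decompose_mul_add_of_left_mem 𝒜 ha]

/-- The homogeneous component of degree `c` of an `A`-linear form, with its sign. -/
def signedComponent (𝒜 : ℤ → Submodule K A) [GradedAlgebra 𝒜] (ℒ : ℤ → Submodule K L)
    [DirectSum.Decomposition ℒ] (c : ℤ) (g : L →ₗ[A] A) : L →ₗ[K] A :=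
  (DirectSum.toModule K ℤ A fun j => sg K (c * j) • (GradedAlgebra.proj 𝒜 (j + c) ∘ₗ
    g.restrictScalars K ∘ₗ (ℒ j).subtype)) ∘ₗ (DirectSum.decomposeLinearEquiv ℒ).toLinearMap

theorem signedComponent_apply {c j : ℤ} (g : L →ₗ[A] A) {x : L} (hx : x ∈ ℒ j) :
    signedComponent 𝒜 ℒ c g x = sg K (c * j) • GradedAlgebra.proj 𝒜 (j + c) (g x) := by
  lift x to ℒ j using hx
  simp only [signedComponent, LinearMap.comp_apply, LinearEquiv.coe_coe,
    DirectSum.decomposeLinearEquiv_apply_coe, DirectSum.toModule_lof, LinearMap.smul_apply]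
  rfl

/-- The map `g` commutes with scalars without signs. The sign `(-1)^{c j}` on arguments of degree
`j` converts this into graded linearity for a form of degree `c`. -/
theorem signedComponent_mem_forms (c : ℤ) (g : L →ₗ[A] A) :
    oneC (signedComponent 𝒜 ℒ c g) ∈ forms 𝒜 ℒ c := by
  rw [mem_forms_iff]
  refine ⟨(oneC_supp _).finC, oneC_symm _, oneC_deg fun i x hx => ?_, fun i ζ hζ b a ha => ?_⟩
  · rw [signedComponent_apply g hx, add_comm]
    exact Submodule.smul_mem _ _ (SetLike.coe_mem _)
  · have haz : a • ζ ∈ ℒ (b + i) := SetLike.GradedSMul.smul_mem ha hζ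
    rw [ins_oneC, ins_oneC, signedComponent_apply g haz, signedComponent_apply g hζ, lact,
      mapC_cst, map_smul, smul_eq_mul, add_assoc, proj_mul_of_mem ha, smulB_apply, mul_add, sg_add,
      mul_comm c b]
    rw [← cst_smul, smul_eq_mul a, mul_smul_comm, mul_smul]

/-- Projectivity splits the surjection from a finite free module given by homogeneous generators.
The coordinates of the splitting need not be homogeneous, but their components of the appropriate
degree reproduce the identity just as well. -/
theorem exists_isDualFrame (hP : Module.Projective A L) (hF : Module.Finite A L) :
    ∃ (T : Finset (L × ℤ)) (c : T → ℤ) (f : T → Cochain K L A) (b : T → L),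
      IsDualFrame 𝒜 ℒ c f b := by
  classical
  obtain ⟨S, hS⟩ := hF.fg_top
  -- The index set consists of the nonzero homogeneous components of a finite generating set.
  let T : Finset (L × ℤ) := S.biUnion fun s => (DFinsupp.support (DirectSum.decompose ℒ s)).image fun m => (s, m)
  let b : T → L := fun t => DirectSum.decompose ℒ t.1.1 t.1.2
  let c : T → ℤ := fun t => -t.1.2
  have hb : ∀ t, b t ∈ ℒ (-c t) := fun t => by
    simp only [b, c, neg_neg]; exact SetLike.coe_mem _
  have hsurj : Function.Surjective (Fintype.linearCombination A b) := by
    rw [← LinearMap.range_eq_top, Fintype.range_linearCombination, ← top_le_iff, ← hS,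
      Submodule.span_le]
    intro s hs
    rw [SetLike.mem_coe, ← DirectSum.sum_support_decompose ℒ s]
    refine Submodule.sum_mem _ fun m hm => Submodule.subset_span ⟨⟨(s, m), ?_⟩, rfl⟩
    exact Finset.mem_biUnion.2 ⟨s, hs, Finset.mem_image.2 ⟨m, hm, rfl⟩⟩
  obtain ⟨g, hg⟩ := Module.projective_lifting_property _ (LinearMap.id : L →ₗ[A] L) hsurj
  refine ⟨T, c, fun t => oneC (signedComponent 𝒜 ℒ (c t) (LinearMap.proj t ∘ₗ g)), b,
    fun t => signedComponent_mem_forms _ _, fun t => oneC_supp _, hb, ?_⟩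
  refine cochain_ext_ins (ℒ := ℒ) (zero_ext fun ξ => ?_) fun j x hx => ?_
  · rw [Finset.sum_apply, sum_apply]
    exact Finset.sum_eq_zero fun t _ => by
      rw [cstar_zero_apply, cst_zero_apply, smulB_apply]; exact zero_smul A _
  · have h1 : ∑ t, g x t • b t = x := by
      have := congrArg (fun l => l x) hg
      simpa [Fintype.linearCombination_apply] using this
    -- Project `x = ∑ g_t(x) b_t` to degree `j`, the degree of `x`: since `b_t` is homogeneous of
    -- degree `-c t`, only the part of `g_t(x)` of degree `j + c t` contributes.
    have h2 : ∑ t, GradedAlgebra.proj 𝒜 (j + c t) (g x t) • b t = x := by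
      let p : L →ₗ[K] L := (ℒ j).subtype ∘ₗ DirectSum.component K ℤ (fun j => ℒ j) j ∘ₗ
        (DirectSum.decomposeLinearEquiv ℒ).toLinearMap
      have hp : ∀ y, p y = (DirectSum.decompose ℒ y j : L) := fun y => rfl
      have := congrArg p h1
      rw [map_sum, hp x, DirectSum.decompose_of_mem_same _ hx] at this
      refine Eq.trans (Finset.sum_congr rfl fun t _ => ?_) this
      rw [hp, proj_smul_mem (𝒜 := 𝒜) (hb t)]
    rw [ins_sum, ins_idC]
    simp only [ins_cstar hx, ins_cst, cstar_zero_right, add_zero, ins_oneC, cstar_cst_apply,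
      signedComponent_apply _ hx, smulB_apply]
    rw [← h2, cst_sum, h2]
    refine Finset.sum_congr rfl fun t _ => ?_
    -- The sign in `signedComponent` cancels the sign produced by carrying `x` past the constant
    -- `b_t` of degree `-c t`.
    rw [smul_assoc, cst_smul, smul_smul, ← sg_add, show -c t * j + c t * j = 0 by ring, sg_zero,
      one_smul]
    rfl

end Frames

end RightRep

namespace RightRep

open scoped DirectSum TensorProduct

/-! ### Recovering a right pair from its derivation, and the Euler argument on tensors. -/

section Injectivity

variable {K A L Q : Type*} [Field K] [Ring A] [Algebra K A] [AddCommGroup L] [Module K L]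
  [Module A L] [IsScalarTower K A L] [AddCommGroup Q] [Module K Q] [Module A Q]
  [IsScalarTower K A Q]
variable {𝒜 : ℤ → Submodule K A} [GradedAlgebra 𝒜]
  {ℒ : ℤ → Submodule K L} [DirectSum.Decomposition ℒ] [SetLike.GradedSMul 𝒜 ℒ]
  {𝒬 : ℤ → Submodule K Q} {c d e : ℤ}
variable {X : Cochain K L L} {σ : Cochain K L (Module.End K A)} {φ : Cochain K L (Module.End K Q)}

theorem cst_mem_forms {a : A} (ha : a ∈ 𝒜 c) : cst K L a ∈ forms 𝒜 ℒ c := by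
  rw [mem_forms_iff]
  refine ⟨⟨1, fun n hn => ?_⟩, SymmC.cst a, DegC.cst ha, fun i ζ hζ b a' ha' => ?_⟩
  · obtain ⟨m, rfl⟩ := Nat.exists_eq_add_of_le' hn
    rfl
  · rw [ins_cst, ins_cst]
    funext n; ext ξ
    simp [lact_apply]

theorem cst_supp {W : Type*} [AddCommGroup W] [Module K W] (w : W) : SuppC 0 (cst K L w)
  | 0, h => absurd rfl h
  | _ + 1, _ => rfl

/-- Projection of `S_A^• L ⊗_A Q` onto the component `Q` of weight zero. -/
def weightZero (𝒜 : ℤ → Submodule K A) (ℒ : ℤ → Submodule K L) (Q : Type*) [AddCommGroup Q]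
    [Module K Q] [Module A Q] [IsScalarTower K A Q] : SymTensor 𝒜 ℒ Q →ₗ[K] Q :=
  ofTens (cst K L LinearMap.id) (SymmC.cst _) fun n => match n with
    | 0 => fun _ _ _ i => i.elim0
    | _ + 1 => RightLin.zero _

theorem weightZero_tens (n : ℕ) (ξ : Fin n → L) (q : Q) :
    weightZero 𝒜 ℒ Q (tens 𝒜 ℒ Q n ξ q) = cst K L (LinearMap.id : Q →ₗ[K] Q) n ξ q :=
  ofTens_tens _ _ _ n ξ q

theorem postC_weightZero : postC (weightZero 𝒜 ℒ Q) (tens 𝒜 ℒ Q) = cst K L LinearMap.id := by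
  funext n; ext ξ q : 2
  exact ofTens_tens _ _ _ n ξ q

/-- The weight zero projection kills every generator with entries, so the insertion of `X`
disappears and only `φ`, fed with all entries, survives. -/
theorem postC_weightZero_rightOp :
    postC (weightZero 𝒜 ℒ Q) (rightOp ℒ d (LinearMap.llcomp K Q Q (SymTensor 𝒜 ℒ Q)) X φ
      (tens 𝒜 ℒ Q)) = φ := by
  rw [postC_rightOp, postC_weightZero]
  exact rightOp_cst_one

variable {ι : Type*} [Fintype ι] {γ : ι → ℤ} {f : ι → Cochain K L A} {b : ι → L}

theorem circ_sum_left {W J : Type*} [AddCommGroup W] [Module K W] (S : Finset J)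
    (F : J → Cochain K L W) (Y : Cochain K L L) :
    circ ℒ (∑ j ∈ S, F j) Y = ∑ j ∈ S, circ ℒ (F j) Y :=
  LinearMap.map_sum₂ (circHom ℒ) S F Y

theorem circ_sum_right {W J : Type*} [AddCommGroup W] [Module K W] (S : Finset J)
    (F : Cochain K L W) (Y : J → Cochain K L L) :
    circ ℒ F (∑ j ∈ S, Y j) = ∑ j ∈ S, circ ℒ F (Y j) :=
  map_sum (circHom ℒ F) Y S

theorem cstar_sum_right {U V W J : Type*} [AddCommGroup U] [Module K U] [AddCommGroup V]
    [Module K V] [AddCommGroup W] [Module K W] {B : U →ₗ[K] V →ₗ[K] W} (S : Finset J)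
    (F : Cochain K L U) (G : J → Cochain K L V) :
    cstar ℒ c B F (∑ j ∈ S, G j) = ∑ j ∈ S, cstar ℒ c B F (G j) :=
  map_sum (cstarHom ℒ c B F) G S

/-- Expand the identity in `id ∘ X = X`: a multiderivation is determined by the compositions `f_i ∘
X`. -/
theorem IsDualFrame.circ_sum (h : IsDualFrame 𝒜 ℒ γ f b) (hX : DegC ℒ ℒ d X) :
    X = ∑ i, sg K (d * γ i) • cstar ℒ (-γ i) (smulB K A L) (circ ℒ (f i) X) (cst K L (b i)) := by
  have h1 := circ_idC_left hX
  rw [← h.sum_eq, circ_sum_left] at h1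
  refine h1.symm.trans (Finset.sum_congr rfl fun i _ => ?_)
  have hi := mem_forms_iff.1 (h.form_mem i)
  rw [circ_cstar hi.2.1 (SymmC.cst _) hX, circ_cst_left, cstar_zero_right, zero_add,
    mul_neg, sg_ext even_neg]

theorem symbol_eq_zero {σ : Cochain K L (Module.End K A)}
    (h : ∀ c, ∀ a ∈ 𝒜 c, cstar ℒ c (evB K A) σ (cst K L a) = 0) : σ = 0 := by
  refine cochain_ext ℒ fun n e ξ hξ => LinearMap.ext fun a => ?_
  induction a using hom_induction (ℒ := 𝒜) with
  | h0 => rw [map_zero, map_zero]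
  | hadd x y hx hy => rw [map_add, map_add, hx, hy]
  | hom i a ha =>
    have := congrArg (fun F => sg K (i * ∑ j, e j) • F n ξ) (h i a ha)
    simp only [cstar_cst_right_apply _ _ hξ, smul_smul, sg_mul_self, one_smul] at this
    exact this.trans (smul_zero _)

theorem etaPair_injective (h : IsDualFrame 𝒜 ℒ γ f b) :
    Function.Injective (etaPair 𝒜 ℒ 𝒬 d) := by
  rw [injective_iff_map_eq_zero]
  intro x hx
  have hR := mem_rightPairs_iff.1 x.2
  have h1 : ∀ c, ∀ ω ∈ forms 𝒜 ℒ c, eta ℒ d x.1.1 x.1.2.1 c ω = 0 := fun c ω hω => by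
    rw [← etaPair_symbol x ⟨ω, forms_le_allForms 𝒜 ℒ c hω⟩ hω, hx]; rfl
  -- On elements of `A` there is no slot for `X`, so `eta` reduces to the symbol.
  have hσ : x.1.2.1 = 0 := symbol_eq_zero (𝒜 := 𝒜) (ℒ := ℒ) fun c a ha => by
    have := h1 c _ (cst_mem_forms ha)
    rwa [eta, circ_cst_left, smul_zero, sub_zero] at this
  have hX : x.1.1 = 0 := by
    rw [h.circ_sum hR.deg]
    refine Finset.sum_eq_zero fun i _ => ?_
    have := h1 _ _ (h.form_mem i)
    rw [eta, hσ, cstar_zero_left, zero_sub, neg_eq_zero] at this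
    have h2 := congrArg (fun F => sg K (d * γ i) • F) this
    simp only [smul_smul, sg_mul_self, one_smul, smul_zero] at h2
    rw [h2, cstar_zero_left, smul_zero]
  have hφ : -x.1.2.2 = 0 := by
    rw [← postC_weightZero_rightOp (𝒜 := 𝒜) (ℒ := ℒ) (d := d) (X := x.1.1) (φ := -x.1.2.2),
      ← hR.postC_operator]
    have : hR.operator = 0 := congrArg Prod.fst hx
    rw [this]
    funext n; ext ξ q : 2
    rfl
  exact Subtype.ext (Prod.ext hX (Prod.ext hσ (neg_eq_zero.1 hφ)))

/-- Left multiplication by a homogeneous element of `L`. -/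
def leftMul (Q : Type*) [AddCommGroup Q] [Module K Q] [Module A Q] [IsScalarTower K A Q] {x : L}
    (hx : x ∈ ℒ c) : Module.End K (SymTensor 𝒜 ℒ Q) :=
  ofTens (ins x (tens 𝒜 ℒ Q)) (SymmC.ins (tens_grSymm 𝒜 ℒ) hx)
    (((firstRight_of_rightLin (tens_rightLin 𝒜 ℒ)).ins (tens_grSymm 𝒜 ℒ) hx).rightLin
      (SymmC.ins (tens_grSymm 𝒜 ℒ) hx))

theorem postC_leftMul {x : L} (hx : x ∈ ℒ c) :
    postC (leftMul (𝒜 := 𝒜) Q hx) (tens 𝒜 ℒ Q) = ins x (tens 𝒜 ℒ Q) := by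
  funext n; ext ξ q : 2
  exact ofTens_tens _ _ _ n ξ q

theorem lof_weightZero (u : SymTensor 𝒜 ℒ Q) :
    DirectSum.lof K ℕ (SymTensorPow 𝒜 ℒ Q) 0 (u 0) =
      tens 𝒜 ℒ Q 0 (fun i => i.elim0) (weightZero 𝒜 ℒ Q u) := by
  suffices h : DirectSum.lof K ℕ (SymTensorPow 𝒜 ℒ Q) 0 ∘ₗ
      DirectSum.component K ℕ (SymTensorPow 𝒜 ℒ Q) 0 =
      tens 𝒜 ℒ Q 0 (fun i => i.elim0) ∘ₗ weightZero 𝒜 ℒ Q from congrArg (fun l => l u) h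
  refine symTensor_ext fun n ξ q => ?_
  rw [LinearMap.comp_apply, LinearMap.comp_apply, weightZero_tens, tens_apply, DirectSum.component.of]
  rcases n with _ | n
  · rw [dif_pos rfl, Subsingleton.elim ξ fun i => i.elim0]
    rfl
  · rw [dif_neg (by omega), map_zero]
    exact (map_zero _).symm

/-- Contracting with `f_i` and multiplying back by `b_i`, then summing with signs, inserts `id_L`
into all slots. This multiplies weight `m` by `m`, so in characteristic zero only weight zero can
survive. -/
theorem eq_zero_of_contract [CharZero K] [IsGradedComm 𝒜] (h : IsDualFrame 𝒜 ℒ γ f b)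
    {u : SymTensor 𝒜 ℒ Q} (h0 : weightZero 𝒜 ℒ Q u = 0)
    (h1 : ∀ i, contract 𝒜 ℒ Q (γ i) (f i) (h.form_mem i) u = 0) : u = 0 := by
  have key : ∀ m, DirectSum.component K ℕ (SymTensorPow 𝒜 ℒ Q) m ∘ₗ
      (∑ i, sg K (γ i * -γ i) • (leftMul Q (h.vec_mem i) ∘ₗ
        contract 𝒜 ℒ Q (γ i) (f i) (h.form_mem i))) =
      (m : K) • DirectSum.component K ℕ (SymTensorPow 𝒜 ℒ Q) m := by
    intro m
    refine symTensor_ext fun n ξ q => ?_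
    have e1 : ∑ i, sg K (γ i * -γ i) • postC (leftMul Q (h.vec_mem i))
        (postC (contract 𝒜 ℒ Q (γ i) (f i) (h.form_mem i)) (tens 𝒜 ℒ Q)) =
        circ ℒ (tens 𝒜 ℒ Q) (idC K L) := by
      rw [← h.sum_eq, circ_sum_right]
      refine Finset.sum_congr rfl fun i _ => ?_
      have hi := mem_forms_iff.1 (h.form_mem i)
      rw [postC_contract, circ_cstar_smul_of_right (tens_grSymm 𝒜 ℒ)
        (firstRight_of_rightLin (tens_rightLin 𝒜 ℒ)) hi.2.2.1 (DegC.cst (h.vec_mem i)),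
        circ_cst_right (tens_grSymm 𝒜 ℒ) (h.vec_mem i), ← postC_leftMul (h.vec_mem i)]
      exact congrArg _ (postC_cstar _ (fun _ _ => rfl) _ _)
    have e2 : (∑ i, sg K (γ i * -γ i) • (leftMul Q (h.vec_mem i) ∘ₗ
        contract 𝒜 ℒ Q (γ i) (f i) (h.form_mem i))) (tens 𝒜 ℒ Q n ξ q) =
        (n : K) • tens 𝒜 ℒ Q n ξ q := by
      have := congrArg (fun F => F n ξ q) e1
      simp only [circ_idC_right (tens_grSymm 𝒜 ℒ) n] at this
      refine Eq.trans ?_ this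
      simp only [LinearMap.sum_apply, Finset.sum_apply, sum_apply, LinearMap.smul_apply,
        Pi.smul_apply, smul_apply, LinearMap.comp_apply, postC_apply]
    rw [LinearMap.comp_apply, e2, map_smul, LinearMap.smul_apply, tens_apply,
      DirectSum.component.of]
    by_cases hm : n = m
    · subst hm; rfl
    · rw [dif_neg hm, smul_zero, smul_zero]
  have h2 : u = DirectSum.lof K ℕ (SymTensorPow 𝒜 ℒ Q) 0 (u 0) := by
    refine DFinsupp.ext fun m => ?_
    rcases m with _ | m
    · exact (DirectSum.of_eq_same (β := SymTensorPow 𝒜 ℒ Q) 0 (u 0)).symm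
    · have := congrArg (fun l => l u) (key (m + 1))
      simp only [LinearMap.comp_apply, LinearMap.sum_apply, LinearMap.smul_apply, h1, map_zero,
        smul_zero, Finset.sum_const_zero] at this
      have hne : ((m + 1 : ℕ) : K) ≠ 0 := Nat.cast_ne_zero.2 (Nat.succ_ne_zero m)
      refine ((smul_eq_zero.1 this.symm).resolve_left hne).trans
        (DirectSum.of_eq_of_ne (β := SymTensorPow 𝒜 ℒ Q) 0 (m + 1) (u 0) (by omega)).symm
  rw [h2, lof_weightZero, h0, map_zero]

end Injectivity

end RightRep

namespace RightRep

open scoped DirectSum TensorProduct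

/-! ### Derivations of the algebra of forms, and their symbols. -/

section FormDerivations

variable {K A L Q : Type*} [Field K] [Ring A] [Algebra K A] [AddCommGroup L] [Module K L]
  [Module A L] [IsScalarTower K A L] [AddCommGroup Q] [Module K Q] [Module A Q]
  [IsScalarTower K A Q]
variable {𝒜 : ℤ → Submodule K A} [GradedAlgebra 𝒜]
  {ℒ : ℤ → Submodule K L} [DirectSum.Decomposition ℒ] [SetLike.GradedSMul 𝒜 ℒ]
  {𝒬 : ℤ → Submodule K Q} {b c d i w : ℤ}

/-- The restriction of `S` to `Sym_A(L, A)` is a derivation of degree `d`. -/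
structure IsFormDerivation (𝒜 : ℤ → Submodule K A) (ℒ : ℤ → Submodule K L)
    [DirectSum.Decomposition ℒ] (d : ℤ) (S : Cochain K L A →ₗ[K] Cochain K L A) : Prop where
  mem : ∀ c, ∀ ω ∈ forms 𝒜 ℒ c, S ω ∈ forms 𝒜 ℒ (d + c)
  leibniz : ∀ c c', ∀ ω ∈ forms 𝒜 ℒ c, ∀ ω' ∈ forms 𝒜 ℒ c', S (formMul ℒ c' ω ω') =
    formMul ℒ c' (S ω) ω' + sg K (d * c) • formMul ℒ (d + c') ω (S ω')

theorem IsFormDerivation.sub {S S' : Cochain K L A →ₗ[K] Cochain K L A}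
    (h : IsFormDerivation 𝒜 ℒ d S) (h' : IsFormDerivation 𝒜 ℒ d S') :
    IsFormDerivation 𝒜 ℒ d (S - S') where
  mem c ω hω := Submodule.sub_mem _ (h.mem c ω hω) (h'.mem c ω hω)
  leibniz c c' ω hω ω' hω' := by
    rw [LinearMap.sub_apply, LinearMap.sub_apply, LinearMap.sub_apply, h.leibniz c c' ω hω ω' hω',
      h'.leibniz c c' ω hω ω' hω', formMul, formMul, formMul, formMul, formMul, formMul,
      cstar_sub_left, cstar_sub_right, smul_sub]
    abel

/-- The symbol lives on the subspace of forms. Extending it linearly to all families, in any way,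
avoids carrying membership proofs; only its values on forms are used. -/
theorem IsModuleDerivation.exists_isFormDerivation [IsGradedComm 𝒜]
    {D : Module.End K (SymTensor 𝒜 ℒ Q)} {s : Module.End K (allForms 𝒜 ℒ)}
    (h : IsModuleDerivation 𝒜 ℒ 𝒬 d D s) :
    ∃ S : Cochain K L A →ₗ[K] Cochain K L A,
      (∀ ω : allForms 𝒜 ℒ, S ω = s ω) ∧ IsFormDerivation 𝒜 ℒ d S := by
  obtain ⟨S, hS⟩ := LinearMap.exists_extend ((allForms 𝒜 ℒ).subtype ∘ₗ s)
  have hS' : ∀ ω : allForms 𝒜 ℒ, S ω = s ω := fun ω => congrArg (fun l => l ω) hS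
  refine ⟨S, hS', fun c ω hω => ?_, fun c c' ω hω ω' hω' => ?_⟩
  · rw [hS' ⟨ω, forms_le_allForms 𝒜 ℒ c hω⟩]
    exact h.symbol_deg c _ hω
  · have := h.symbol_leibniz c c' ⟨ω, forms_le_allForms 𝒜 ℒ c hω⟩
      ⟨ω', forms_le_allForms 𝒜 ℒ c' hω'⟩ hω hω'
    rw [← hS', ← hS', ← hS'] at this
    exact this

variable {ι : Type*} [Fintype ι] {γ : ι → ℤ} {f : ι → Cochain K L A} {v : ι → L}

theorem ins_mem_forms {ω : Cochain K L A} (hω : ω ∈ forms 𝒜 ℒ c) {x : L} (hx : x ∈ ℒ i) :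
    ins x ω ∈ forms 𝒜 ℒ (c + i) := by
  obtain ⟨⟨N, hN⟩, hs, hd, hl⟩ := mem_forms_iff.1 hω
  refine mem_forms_iff.2 ⟨⟨N, fun n hn => ?_⟩, hs.ins hx, hd.ins hx, hl.ins hs hx⟩
  rw [ins, hN _ (by omega)]
  rfl

/-- The Euler operator written as products of frame forms with forms having one entry less, which
makes it accessible to the Leibniz rule. -/
theorem IsDualFrame.circ_idC (h : IsDualFrame 𝒜 ℒ γ f v) {ω : Cochain K L A}
    (hω : ω ∈ forms 𝒜 ℒ c) : circ ℒ ω (idC K L) =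
      ∑ i, sg K (γ i * c) • formMul ℒ (c + -γ i) (f i) (ins (v i) ω) := by
  obtain ⟨-, hs, -, hl⟩ := mem_forms_iff.1 hω
  rw [← h.sum_eq, circ_sum_right]
  refine Finset.sum_congr rfl fun i _ => ?_
  rw [circ_cstar_smul_of_left hs hl (mem_forms_iff.1 (h.form_mem i)).2.2.1
    (DegC.cst (h.vec_mem i)), circ_cst_right hs (h.vec_mem i)]
  rfl

theorem eq_cst {W : Type*} [AddCommGroup W] [Module K W] {F : Cochain K L W}
    (h : ∀ n ≥ 1, F n = 0) : F = cst K L (F 0 fun i => i.elim0) := by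
  funext n
  rcases n with _ | n
  · ext ξ
    rw [Subsingleton.elim ξ fun i => i.elim0]
    rfl
  · exact h _ (Nat.succ_pos n)

/-- A derivation of `Sym_A(L, A)` is determined by its values on `A` and on a frame of 1-forms. -/
theorem IsFormDerivation.eq_zero [CharZero K] [IsGradedComm 𝒜] (h : IsDualFrame 𝒜 ℒ γ f v)
    {S : Cochain K L A →ₗ[K] Cochain K L A} (hS : IsFormDerivation 𝒜 ℒ d S)
    (h0 : ∀ b, ∀ a ∈ 𝒜 b, S (cst K L a) = 0) (h1 : ∀ i, S (f i) = 0) {ω : Cochain K L A}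
    (hω : ω ∈ forms 𝒜 ℒ c) : S ω = 0 := by
  -- Induction on a bound for the number of entries, so that `ω` may have components in several
  -- arities.
  suffices H : ∀ N : ℕ, ∀ c, ∀ ω ∈ forms 𝒜 ℒ c, (∀ n ≥ N + 1, ω n = 0) → S ω = 0 by
    obtain ⟨⟨N, hN⟩, -⟩ := mem_forms_iff.1 hω
    exact H N c ω hω fun n hn => hN n (by omega)
  intro N
  induction N with
  | zero =>
    intro c ω hω hN
    rw [eq_cst hN]
    have hd := (mem_forms_iff.1 hω).2.2.1.zero_apply fun i => i.elim0
    exact h0 _ _ hd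
  | succ N ih =>
    intro c ω hω hN
    have e1 : S (circ ℒ ω (idC K L)) = 0 := by
      rw [h.circ_idC hω, map_sum]
      refine Finset.sum_eq_zero fun i _ => ?_
      have hi := ins_mem_forms hω (h.vec_mem i)
      rw [map_smul, hS.leibniz _ _ _ (h.form_mem i) _ hi, h1 i, ih _ _ hi fun n hn => ?_, formMul,
        formMul, cstar_zero_left, cstar_zero_right, smul_zero, add_zero, smul_zero]
      rw [ins, hN _ (by omega)]
      rfl
    have hE : circ ℒ ω (idC K L) ∈ forms 𝒜 ℒ c := by
      rw [h.circ_idC hω]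
      refine Submodule.sum_mem _ fun i _ => Submodule.smul_mem _ _ ?_
      have := formMul_mem (h.form_mem i) (ins_mem_forms hω (h.vec_mem i))
      rwa [show γ i + (c + -γ i) = c by ring] at this
    -- Subtracting the Euler operator removes the top arity `N + 1`, so the induction hypothesis
    -- applies. As `S` also vanishes on `ω ∘ id`, this leaves `(N + 1) S ω = 0`.
    have e2 : S (((N + 1 : ℕ) : K) • ω - circ ℒ ω (idC K L)) = 0 := by
      refine ih c _ (Submodule.sub_mem _ (Submodule.smul_mem _ _ hω) hE) fun n hn => ?_
      rw [Pi.sub_apply, Pi.smul_apply, circ_idC_right (mem_forms_iff.1 hω).2.1]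
      rcases hn.eq_or_lt with rfl | hn
      · exact sub_self _
      · rw [hN n hn, smul_zero, smul_zero, sub_zero]
    rw [map_sub, map_smul, e1, sub_zero] at e2
    exact (smul_eq_zero.1 e2).resolve_left (Nat.cast_ne_zero.2 (Nat.succ_ne_zero N))

/-- The linear map `a ↦ cst a`. -/
def cstHom (K L W : Type*) [Field K] [AddCommGroup L] [Module K L] [AddCommGroup W]
    [Module K W] : W →ₗ[K] Cochain K L W where
  toFun := cst K L
  map_add' := cst_add
  map_smul' := cst_smul

/-- The map taking `a` of degree `b` to `(-1)^{b |ξ|} S(a)(ξ)`. -/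
def twistedValue (𝒜 : ℤ → Submodule K A) [GradedAlgebra 𝒜] (ℒ : ℤ → Submodule K L)
    [DirectSum.Decomposition ℒ] (S : Cochain K L A →ₗ[K] Cochain K L A) :
    A →ₗ[K] Cochain K L A :=
  -- Multiplying by the constant `1`, declared to have degree `b`, changes nothing but the sign by
  -- `(-1)^{b |ξ|}`, and keeps the map multilinear without case distinctions on degrees.
  DirectSum.toModule K ℤ _ (fun b => (cstarHom ℒ b (LinearMap.lsmul K A).flip).flip
    (cst K L 1) ∘ₗ S ∘ₗ cstHom K L A ∘ₗ (𝒜 b).subtype) ∘ₗ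
    (DirectSum.decomposeLinearEquiv 𝒜).toLinearMap

theorem twistedValue_of_mem (S : Cochain K L A →ₗ[K] Cochain K L A) {a : A} (ha : a ∈ 𝒜 b) :
    twistedValue 𝒜 ℒ S a =
      cstar ℒ b (LinearMap.lsmul K A).flip (S (cst K L a)) (cst K L 1) := by
  lift a to 𝒜 b using ha
  simp only [twistedValue, LinearMap.comp_apply, LinearEquiv.coe_coe,
    DirectSum.decomposeLinearEquiv_apply_coe, DirectSum.toModule_lof]
  rfl

/-- The `End_K(A)`-valued family representing the restriction of `S` to `A`. -/
def symbolOf (𝒜 : ℤ → Submodule K A) [GradedAlgebra 𝒜] (ℒ : ℤ → Submodule K L)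
    [DirectSum.Decomposition ℒ] (S : Cochain K L A →ₗ[K] Cochain K L A) :
    Cochain K L (Module.End K A) := fun n =>
  { toFun := fun ξ =>
      { toFun := fun a => twistedValue 𝒜 ℒ S a n ξ
        map_add' := fun a a' => by rw [map_add]; rfl
        map_smul' := fun r a => by rw [map_smul]; rfl }
    map_update_add' := fun ξ i x y => LinearMap.ext fun a =>
      (twistedValue 𝒜 ℒ S a n).map_update_add ξ i x y
    map_update_smul' := fun ξ i r x => LinearMap.ext fun a =>
      (twistedValue 𝒜 ℒ S a n).map_update_smul ξ i r x }

theorem symbolOf_apply (S : Cochain K L A →ₗ[K] Cochain K L A) {a : A} (ha : a ∈ 𝒜 b) {n : ℕ}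
    {e : Fin n → ℤ} {ξ : Fin n → L} (hξ : IsHom ℒ e ξ) :
    symbolOf 𝒜 ℒ S n ξ a = sg K (b * ∑ i, e i) • S (cst K L a) n ξ := by
  change twistedValue 𝒜 ℒ S a n ξ = _
  rw [twistedValue_of_mem S ha, cstar_cst_right_apply _ _ hξ]
  congr 1
  exact one_smul K _

/-- The sign in `symbolOf` is undone by the twist of the product: the reconstructed symbol
reproduces `S` on `A`. -/
theorem cstar_symbolOf (S : Cochain K L A →ₗ[K] Cochain K L A) {a : A} (ha : a ∈ 𝒜 b) :
    cstar ℒ b (evB K A) (symbolOf 𝒜 ℒ S) (cst K L a) = S (cst K L a) := by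
  refine cochain_ext ℒ fun n e ξ hξ => ?_
  rw [cstar_cst_right_apply _ _ hξ]
  change _ • symbolOf 𝒜 ℒ S n ξ a = _
  rw [symbolOf_apply S ha hξ, smul_smul, sg_mul_self, one_smul]

variable {S : Cochain K L A →ₗ[K] Cochain K L A}

theorem symbolOf_symm (hS : IsFormDerivation 𝒜 ℒ d S) : SymmC ℒ (symbolOf 𝒜 ℒ S) := by
  intro n e ξ hξ j k hjk
  refine LinearMap.ext fun a => ?_
  have : SymmC ℒ (twistedValue 𝒜 ℒ S a) := by
    induction a using hom_induction (ℒ := 𝒜) with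
    | h0 => rw [map_zero, ← zero_smul K (cst K L (0 : A))]; exact (SymmC.cst _).smul _
    | hadd x y hx hy => rw [map_add]; exact hx.add hy
    | hom i a ha =>
      rw [twistedValue_of_mem S ha]
      exact cstar_symm (mem_forms_iff.1 (hS.mem i _ (cst_mem_forms ha))).2.1 (SymmC.cst _)
  exact this n e ξ hξ j k hjk

theorem symbolOf_firstLeft (hS : IsFormDerivation 𝒜 ℒ d S) :
    FirstLeft 𝒜 ℒ d (symbolOf 𝒜 ℒ S) := by
  intro i ζ hζ b a ha
  refine cochain_ext ℒ fun n e ξ hξ => LinearMap.ext fun a' => ?_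
  induction a' using hom_induction (ℒ := 𝒜) with
  | h0 => rw [map_zero, map_zero]
  | hadd x y hx hy => rw [map_add, map_add, hx, hy]
  | hom j a' ha' =>
    have h1 := congrArg (fun F => F n ξ)
      ((mem_forms_iff.1 (hS.mem j _ (cst_mem_forms (ℒ := ℒ) ha'))).2.2.2 i ζ hζ b a ha)
    have haζ : a • ζ ∈ ℒ (b + i) := SetLike.GradedSMul.smul_mem ha hζ
    simp only [Pi.smul_apply, smul_apply, LinearMap.smul_apply, lact_apply, ins_apply] at h1 ⊢
    rw [symbolOf_apply S ha' (isHom_cons haζ hξ), symbolOf_apply S ha' (isHom_cons hζ hξ), h1]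
    simp only [Fin.sum_univ_succ, Fin.cons_zero, Fin.cons_succ, smul_comm a, smul_smul]
    congr 1
    simp only [← sg_add]
    refine sg_ext ?_
    simp only [Int.even_add, Int.even_mul]
    tauto

/-- The Leibniz rule of `S` on products of elements of `A` is, after evaluation on entries, the
derivation property of each value of the symbol. -/
theorem symbolOf_deg [IsGradedComm 𝒜] (hS : IsFormDerivation 𝒜 ℒ d S) :
    DegC ℒ (derSub 𝒜) d (symbolOf 𝒜 ℒ S) := by
  intro n e ξ hξ
  refine ⟨fun i a ha => ?_, fun i a ha a' => ?_⟩
  · rw [symbolOf_apply S ha hξ, show d + ∑ j, e j + i = d + i + ∑ j, e j by ring]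
    exact Submodule.smul_mem _ _ ((mem_forms_iff.1 (hS.mem i _ (cst_mem_forms ha))).2.2.1 n e ξ hξ)
  · induction a' using hom_induction (ℒ := 𝒜) with
    | h0 => simp
    | hadd x y hx hy =>
      rw [mul_add, map_add, hx, hy, map_add, mul_add, mul_add, smul_add]
      abel
    | hom j a' ha' =>
      have h1 := congrArg (fun F => F n ξ)
        (hS.leibniz i j _ (cst_mem_forms (ℒ := ℒ) ha) _ (cst_mem_forms ha'))
      rw [formMul, cstar_cst_apply, formMul, formMul, cstar_cst_left] at h1
      simp only [Pi.add_apply, Pi.smul_apply, add_apply, smul_apply, mapC_apply,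
        cstar_cst_right_apply _ _ hξ, LinearMap.mul_apply'] at h1
      rw [symbolOf_apply S (SetLike.mul_mem_graded ha ha') hξ, symbolOf_apply S ha hξ,
        symbolOf_apply S ha' hξ, h1]
      simp only [smul_mul_assoc, mul_smul_comm, smul_add, smul_smul]
      congr 2 <;> (simp only [← sg_add]; refine sg_ext ?_; simp only [Int.even_add, Int.even_mul]; tauto)

theorem symbolOf_supp (hw : ∀ b, ∀ a ∈ 𝒜 b, SuppC w (S (cst K L a))) :
    SuppC w (symbolOf 𝒜 ℒ S) := by
  intro n hn
  refine arity_ext (G := 0) ℒ fun e ξ hξ => ?_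
  refine LinearMap.ext fun a => ?_
  induction a using hom_induction (ℒ := 𝒜) with
  | h0 => rw [map_zero, map_zero]
  | hadd x y hx hy => rw [map_add, map_add, hx, hy]
  | hom j a ha =>
    rw [symbolOf_apply S ha hξ, hw j a ha n hn]
    exact smul_zero (sg K (j * ∑ i, e i))

end FormDerivations

end RightRep

namespace RightRep

open scoped DirectSum TensorProduct

/-! ### The multiderivation of a derivation of forms. -/

section Reconstruction

variable {K A L Q : Type*} [Field K] [Ring A] [Algebra K A] [AddCommGroup L] [Module K L]
  [Module A L] [IsScalarTower K A L] [AddCommGroup Q] [Module K Q] [Module A Q]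
  [IsScalarTower K A Q]
variable {𝒜 : ℤ → Submodule K A} [GradedAlgebra 𝒜]
  {ℒ : ℤ → Submodule K L} [DirectSum.Decomposition ℒ] [SetLike.GradedSMul 𝒜 ℒ]
  {𝒬 : ℤ → Submodule K Q} {b c c' d i w : ℤ}
variable {S : Cochain K L A →ₗ[K] Cochain K L A} {ω ω' : Cochain K L A}

/-- The difference `σ ∘ ω - S ω`, where `σ` is the symbol of `S`; it equals `± ω ∘ X` for the
multiderivation `X` to be found. -/
def defect (𝒜 : ℤ → Submodule K A) [GradedAlgebra 𝒜] (ℒ : ℤ → Submodule K L)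
    [DirectSum.Decomposition ℒ] (S : Cochain K L A →ₗ[K] Cochain K L A) (c : ℤ)
    (ω : Cochain K L A) : Cochain K L A :=
  cstar ℒ c (evB K A) (symbolOf 𝒜 ℒ S) ω - S ω

theorem defect_cst {a : A} (ha : a ∈ 𝒜 b) : defect 𝒜 ℒ S b (cst K L a) = 0 := by
  rw [defect, cstar_symbolOf S ha, sub_self]

theorem defect_symm (hS : IsFormDerivation 𝒜 ℒ d S) (hω : ω ∈ forms 𝒜 ℒ c) :
    SymmC ℒ (defect 𝒜 ℒ S c ω) :=
  (cstar_symm (symbolOf_symm hS) (mem_forms_iff.1 hω).2.1).sub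
    (mem_forms_iff.1 (hS.mem c ω hω)).2.1

theorem defect_deg [IsGradedComm 𝒜] (hS : IsFormDerivation 𝒜 ℒ d S) (hω : ω ∈ forms 𝒜 ℒ c) :
    DegC ℒ 𝒜 (d + c) (defect 𝒜 ℒ S c ω) :=
  (DegC.cstar (fun _ j _ hD a ha => (mem_derSub.1 hD).1 j a ha) (symbolOf_deg hS)
    (mem_forms_iff.1 hω).2.2.1 c).sub (mem_forms_iff.1 (hS.mem c ω hω)).2.2.1

/-- Both `ω ↦ σ ∘ ω` and `S` satisfy this Leibniz rule, hence so does their difference. As it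
vanishes on `A`, it is linear over `A` in `ω`. -/
theorem defect_formMul [IsGradedComm 𝒜] (hS : IsFormDerivation 𝒜 ℒ d S) (hω : ω ∈ forms 𝒜 ℒ c)
    (hω' : ω' ∈ forms 𝒜 ℒ c') : defect 𝒜 ℒ S (c + c') (formMul ℒ c' ω ω') =
      formMul ℒ c' (defect 𝒜 ℒ S c ω) ω' +
        sg K (d * c) • formMul ℒ (d + c') ω (defect 𝒜 ℒ S c' ω') := by
  have h := cstar_cstar_smul_of_derLike (c := c') (symbol_derLike (symbolOf_deg hS))
    (mem_forms_iff.1 hω).2.2.1 ω'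
  rw [smulB_self] at h
  rw [defect, hS.leibniz c c' ω hω ω' hω']
  simp only [formMul, defect, h, cstar_sub_left, cstar_sub_right, smul_sub]
  abel

/-- As a function of its entries the defect is not linear: differentiating the value of `ω` at `a •
ζ` leaves the term `S(a) ω(ζ)`. This term becomes the Leibniz rule of the reconstructed
multiderivation. -/
theorem ins_smul_defect [IsGradedComm 𝒜] (hS : IsFormDerivation 𝒜 ℒ d S) (hω : ω ∈ forms 𝒜 ℒ c)
    {ζ : L} (hζ : ζ ∈ ℒ i) {a : A} (ha : a ∈ 𝒜 b) : ins (a • ζ) (defect 𝒜 ℒ S c ω) =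
      sg K (b * (c + d)) • lact a (ins ζ (defect 𝒜 ℒ S c ω)) +
        sg K (b * c) • cstar ℒ (c + i) (LinearMap.mul K A) (S (cst K L a)) (ins ζ ω) := by
  have h := cstar_lact_of_derLike (c := c + i) (symbol_derLike (symbolOf_deg (ℒ := ℒ) hS)) ha
    (ins ζ ω)
  rw [cstar_symbolOf S ha, smulB_self, show b + (c + i) = c + (b + i) by ring] at h
  have haζ : a • ζ ∈ ℒ (b + i) := SetLike.GradedSMul.smul_mem ha hζ
  rw [defect, ins_sub, ins_sub, ins_cstar haζ, ins_cstar hζ,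
    symbolOf_firstLeft hS i ζ hζ b a ha, (mem_forms_iff.1 hω).2.2.2 i ζ hζ b a ha,
    (mem_forms_iff.1 (hS.mem c ω hω)).2.2.2 i ζ hζ b a ha, cstar_smul_right, h, cstar_smul_left,
    cstar_lact_left (fun _ _ _ => rfl)]
  simp only [lact_sub, lact_add, lact_smul, mul_add, sg_add]
  generalize lact a (cstar ℒ c (evB K A) (ins ζ (symbolOf 𝒜 ℒ S)) ω) = x₁
  generalize lact a (cstar ℒ (c + i) (evB K A) (symbolOf 𝒜 ℒ S) (ins ζ ω)) = x₂
  generalize lact a (ins ζ (S ω)) = x₃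
  generalize cstar ℒ (c + i) (LinearMap.mul K A) (S (cst K L a)) (ins ζ ω) = x₄
  rw [mul_comm d b]
  match_scalars <;> grind [sg_mul_self]

variable {ι : Type*} [Fintype ι] {γ : ι → ℤ} {f : ι → Cochain K L A} {v : ι → L}

/-- The multiderivation reconstructed from a derivation of `Sym_A(L, A)`. -/
def multiderivationOf (𝒜 : ℤ → Submodule K A) [GradedAlgebra 𝒜] (ℒ : ℤ → Submodule K L)
    [DirectSum.Decomposition ℒ] (γ : ι → ℤ) (f : ι → Cochain K L A) (v : ι → L)
    (S : Cochain K L A →ₗ[K] Cochain K L A) : Cochain K L L :=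
  ∑ i, cstar ℒ (-γ i) (smulB K A L) (defect 𝒜 ℒ S (γ i) (f i)) (cst K L (v i))

theorem SymmC.sum {W J : Type*} [AddCommGroup W] [Module K W] {T : Finset J}
    {F : J → Cochain K L W} (h : ∀ j ∈ T, SymmC ℒ (F j)) : SymmC ℒ (∑ j ∈ T, F j) :=
  Finset.sum_induction _ (SymmC ℒ) (fun _ _ => SymmC.add) (fun _ => GrSymm.zero _) h

theorem DegC.sum {W J : Type*} [AddCommGroup W] [Module K W] {𝒲 : ℤ → Submodule K W}
    {T : Finset J} {F : J → Cochain K L W} (h : ∀ j ∈ T, DegC ℒ 𝒲 d (F j)) :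
    DegC ℒ 𝒲 d (∑ j ∈ T, F j) :=
  Finset.sum_induction _ (DegC ℒ 𝒲 d) (fun _ _ => DegC.add) (fun _ => HasDeg.zero _ _ _) h

theorem FinC.sum {W J : Type*} [AddCommGroup W] [Module K W] {T : Finset J}
    {F : J → Cochain K L W} (h : ∀ j ∈ T, FinC (F j)) : FinC (∑ j ∈ T, F j) :=
  Finset.sum_induction _ FinC (fun _ _ => FinC.add) ⟨0, fun _ _ => rfl⟩ h

theorem multiderivationOf_symm (h : IsDualFrame 𝒜 ℒ γ f v) (hS : IsFormDerivation 𝒜 ℒ d S) :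
    SymmC ℒ (multiderivationOf 𝒜 ℒ γ f v S) :=
  SymmC.sum fun i _ => cstar_symm (defect_symm hS (h.form_mem i)) (SymmC.cst _)

theorem multiderivationOf_deg [IsGradedComm 𝒜] (h : IsDualFrame 𝒜 ℒ γ f v)
    (hS : IsFormDerivation 𝒜 ℒ d S) : DegC ℒ ℒ d (multiderivationOf 𝒜 ℒ γ f v S) :=
  DegC.sum fun i _ => by
    have := DegC.cstar (𝒲 := ℒ) smulB_deg (defect_deg hS (h.form_mem i))
      (DegC.cst (h.vec_mem i)) (-γ i)
    rwa [add_neg_cancel_right] at this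

theorem multiderivationOf_fin (h : IsDualFrame 𝒜 ℒ γ f v) (hS : IsFormDerivation 𝒜 ℒ d S)
    (hσ : FinC (symbolOf 𝒜 ℒ S)) : FinC (multiderivationOf 𝒜 ℒ γ f v S) :=
  FinC.sum fun i _ => ((hσ.cstar (mem_forms_iff.1 (h.form_mem i)).1).sub
    (mem_forms_iff.1 (hS.mem _ _ (h.form_mem i))).1).cstar (cst_supp _).finC

theorem lact_sum {W J : Type*} [AddCommGroup W] [Module K W] [Module A W] [IsScalarTower K A W]
    (a : A) (T : Finset J) (F : J → Cochain K L W) :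
    lact a (∑ j ∈ T, F j) = ∑ j ∈ T, lact a (F j) :=
  map_sum (AddMonoidHom.mk' (lact a) (lact_add a)) F T

theorem multiderivationOf_leibniz [IsGradedComm 𝒜] (h : IsDualFrame 𝒜 ℒ γ f v)
    (hS : IsFormDerivation 𝒜 ℒ d S) :
    FirstLeibniz 𝒜 ℒ d (multiderivationOf 𝒜 ℒ γ f v S) (symbolOf 𝒜 ℒ S) := by
  intro i ζ hζ b a ha
  have haζ : a • ζ ∈ ℒ (b + i) := SetLike.GradedSMul.smul_mem ha hζ
  -- The factor `ζ` in the symbol term is expanded as `∑ f_j(ζ) b_j`, so that it can be matched,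
  -- index by index, with the nonlinear parts of the defects.
  rw [cstar_symbolOf S ha, ← ins_idC, ← h.sum_eq, multiderivationOf, ins_sum, ins_sum, ins_sum,
    lact_sum, cstar_sum_right, Finset.smul_sum, ← Finset.sum_add_distrib]
  refine Finset.sum_congr rfl fun j _ => ?_
  rw [ins_cstar haζ, ins_cstar hζ, ins_cstar hζ, ins_cst, ins_cst, cstar_zero_right,
    cstar_zero_right, cstar_zero_right, add_zero, add_zero, add_zero,
    ins_smul_defect hS (h.form_mem j) hζ ha, cstar_add_left, cstar_smul_left, cstar_smul_left,
    cstar_lact_left (fun _ _ _ => smul_assoc _ _ _), cstar_smul_right,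
    cstar_assoc (B₃ := smulB K A L) (B₄ := smulB K A L) (fun x y z => mul_smul x y z),
    show γ j + i + -γ j = i by ring, lact_smul]
  generalize lact a (cstar ℒ (-γ j) (smulB K A L) (ins ζ (defect 𝒜 ℒ S (γ j) (f j)))
    (cst K L (v j))) = x₁
  generalize cstar ℒ i (smulB K A L) (S (cst K L a)) _ = x₂
  simp only [mul_add, neg_mul, sg_add, sg_ext (K := K) even_neg]
  match_scalars <;> grind [sg_mul_self]

theorem ins_eq_cst {W : Type*} [AddCommGroup W] [Module K W] {F : Cochain K L W}
    (h : SuppC 1 F) (x : L) : ins x F = cst K L (F 1 fun _ => x) := by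
  have h1 : ∀ n ≥ 1, ins x F n = 0 := fun n hn => by
    rw [ins, h _ (by omega)]
    rfl
  rw [eq_cst h1, ins_apply]
  congr 2
  funext j
  exact Fin.cases rfl (fun j => j.elim0) j

/-- The frame need not be a basis, so consistency must be checked. The relations `f_j = ∑ ± f_i
f_j(b_i)` have coefficients in `A` and are respected by the defect, which is linear over `A`. -/
theorem circ_multiderivationOf [IsGradedComm 𝒜] (h : IsDualFrame 𝒜 ℒ γ f v)
    (hS : IsFormDerivation 𝒜 ℒ d S) (j : ι) : circ ℒ (f j) (multiderivationOf 𝒜 ℒ γ f v S) =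
      sg K (d * γ j) • defect 𝒜 ℒ S (γ j) (f j) := by
  obtain ⟨-, hs, -, hl⟩ := mem_forms_iff.1 (h.form_mem j)
  -- The Euler formula for a form with one entry, where the factor is `1`.
  have e1 : f j = ∑ i, sg K (γ i * γ j) • formMul ℒ (γ j + -γ i) (f i) (ins (v i) (f j)) := by
    rw [← h.circ_idC (h.form_mem j)]
    funext n
    rw [circ_idC_right hs]
    rcases eq_or_ne n 1 with rfl | hn
    · rw [Nat.cast_one]; exact (one_smul K _).symm
    · rw [h.form_supp j n (by exact_mod_cast hn)]; exact (smul_zero _).symm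
  have e2 : ∀ i, defect 𝒜 ℒ S (γ j) (formMul ℒ (γ j + -γ i) (f i) (ins (v i) (f j))) =
      formMul ℒ (γ j + -γ i) (defect 𝒜 ℒ S (γ i) (f i)) (ins (v i) (f j)) := fun i => by
    have hi := ins_mem_forms (h.form_mem j) (h.vec_mem i)
    have hc : defect 𝒜 ℒ S (γ j + -γ i) (ins (v i) (f j)) = 0 := by
      rw [ins_eq_cst (h.form_supp j)] at hi ⊢
      exact defect_cst ((mem_forms_iff.1 hi).2.2.1.zero_apply fun i => i.elim0)
    have := defect_formMul hS (h.form_mem i) hi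
    rw [hc, formMul, formMul, formMul, cstar_zero_right, smul_zero, add_zero,
      show γ i + (γ j + -γ i) = γ j by ring] at this
    exact this
  have e3 : defect 𝒜 ℒ S (γ j) (f j) = ∑ i, sg K (γ i * γ j) •
      formMul ℒ (γ j + -γ i) (defect 𝒜 ℒ S (γ i) (f i)) (ins (v i) (f j)) := by
    simp only [← e2]
    conv_lhs => rw [e1]
    rw [defect, map_sum, cstar_sum_right, ← Finset.sum_sub_distrib]
    refine Finset.sum_congr rfl fun i _ => ?_
    rw [map_smul, cstar_smul_right, ← smul_sub]
    rfl
  rw [e3, multiderivationOf, circ_sum_right, Finset.smul_sum]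
  refine Finset.sum_congr rfl fun i _ => ?_
  rw [circ_cstar_smul_of_left hs hl (defect_deg hS (h.form_mem i)) (DegC.cst (h.vec_mem i)),
    circ_cst_right hs (h.vec_mem i), smul_smul, ← sg_add, ← add_mul]
  rfl

theorem eta_multiderivationOf_form [IsGradedComm 𝒜] (h : IsDualFrame 𝒜 ℒ γ f v)
    (hS : IsFormDerivation 𝒜 ℒ d S) (j : ι) :
    eta ℒ d (multiderivationOf 𝒜 ℒ γ f v S) (symbolOf 𝒜 ℒ S) (γ j) (f j) = S (f j) := by
  rw [eta, circ_multiderivationOf h hS, smul_smul, sg_mul_self, one_smul, defect, sub_sub_cancel]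

end Reconstruction

end RightRep

namespace RightRep

open scoped DirectSum TensorProduct

/-! ### Every module derivation comes from a right pair. -/

section Surjectivity

variable {K A L Q : Type*} [Field K] [Ring A] [Algebra K A] [AddCommGroup L] [Module K L]
  [Module A L] [IsScalarTower K A L] [AddCommGroup Q] [Module K Q] [Module A Q]
  [IsScalarTower K A Q]
variable {𝒜 : ℤ → Submodule K A} [GradedAlgebra 𝒜]
  {ℒ : ℤ → Submodule K L} [DirectSum.Decomposition ℒ] [SetLike.GradedSMul 𝒜 ℒ]
  {𝒬 : ℤ → Submodule K Q} {b c d w : ℤ}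

theorem weightZero_eq_zero {u : SymTensor 𝒜 ℒ Q} (h : u 0 = 0) : weightZero 𝒜 ℒ Q u = 0 := by
  have h1 := congrArg (weightZero 𝒜 ℒ Q) (lof_weightZero u)
  rw [h, map_zero, map_zero, weightZero_tens] at h1
  exact h1.symm

theorem weightZero_mem {m : ℤ} {u : SymTensor 𝒜 ℒ Q} (hu : u ∈ tensorDeg 𝒜 ℒ 𝒬 m) :
    weightZero 𝒜 ℒ Q u ∈ 𝒬 m := by
  suffices h : tensorDeg 𝒜 ℒ 𝒬 m ≤ (𝒬 m).comap (weightZero 𝒜 ℒ Q) from h hu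
  refine Submodule.span_le.2 ?_
  rintro _ ⟨n, e, ξ, f, q, hξ, hq, hm, rfl⟩
  change weightZero 𝒜 ℒ Q (tens 𝒜 ℒ Q n ξ q) ∈ 𝒬 m
  rw [weightZero_tens]
  rcases n with _ | n
  · rw [Fin.sum_univ_zero, zero_add] at hm
    exact hm ▸ hq
  · exact Submodule.zero_mem _

theorem firstRight_postC {W W' : Type*} [AddCommGroup W] [Module K W] [AddCommGroup W']
    [Module K W'] {F : Cochain K L (Q →ₗ[K] W)} (hF : FirstRight 𝒜 ℒ F) (D : W →ₗ[K] W') :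
    FirstRight 𝒜 ℒ (postC D F) := by
  intro i ζ hζ b a ha
  have h := congrArg (postC D) (hF i ζ hζ b a ha)
  refine h.trans ((mapC_smul _ _ _).trans (congrArg _ ?_))
  exact postC_cstar D (B' := compSMul K A Q W') (fun _ _ => rfl) _ _

section Contractions

variable [IsGradedComm 𝒜]

/-- Only the term in which the form consumes all entries reaches weight zero. -/
theorem weightZero_contract_tens {ω : Cochain K L A} (hω : ω ∈ forms 𝒜 ℒ c) (n : ℕ)
    (ξ : Fin n → L) (q : Q) :
    weightZero 𝒜 ℒ Q (contract 𝒜 ℒ Q c ω hω (tens 𝒜 ℒ Q n ξ q)) = ω n ξ • q := by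
  have h : postC (weightZero 𝒜 ℒ Q) (postC (contract 𝒜 ℒ Q c ω hω) (tens 𝒜 ℒ Q)) =
      mapC (compSMul K A Q Q LinearMap.id) ω := by
    rw [postC_contract, postC_cstar _ (B' := compSMul K A Q Q) fun _ _ => rfl, postC_weightZero,
      cstar_cst_left]
  exact congrArg (fun F => F n ξ q) h

theorem weightZero_contract_cst {a : A} (ha : a ∈ 𝒜 b) (u : SymTensor 𝒜 ℒ Q) :
    weightZero 𝒜 ℒ Q (contract 𝒜 ℒ Q b (cst K L a) (cst_mem_forms ha) u) =
      a • weightZero 𝒜 ℒ Q u := by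
  suffices h : weightZero 𝒜 ℒ Q ∘ₗ contract 𝒜 ℒ Q b (cst K L a) (cst_mem_forms ha) =
      smulB K A Q a ∘ₗ weightZero 𝒜 ℒ Q from congrArg (fun l => l u) h
  refine symTensor_ext fun n ξ q => ?_
  rw [LinearMap.comp_apply, LinearMap.comp_apply, weightZero_contract_tens, weightZero_tens,
    smulB_apply]
  rcases n with _ | n
  · rfl
  · exact (zero_smul A q).trans (smul_zero a).symm

/-- The `End_K(Q)`-valued form reconstructed from an operator. -/
def formOf (D : Module.End K (SymTensor 𝒜 ℒ Q)) : Cochain K L (Module.End K Q) :=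
  postC (weightZero 𝒜 ℒ Q) (postC D (tens 𝒜 ℒ Q))

theorem formOf_apply (D : Module.End K (SymTensor 𝒜 ℒ Q)) (n : ℕ) (ξ : Fin n → L) (q : Q) :
    formOf D n ξ q = weightZero 𝒜 ℒ Q (D (tens 𝒜 ℒ Q n ξ q)) := rfl

variable {D : Module.End K (SymTensor 𝒜 ℒ Q)} {s : Module.End K (allForms 𝒜 ℒ)}
  {S : Cochain K L A →ₗ[K] Cochain K L A}

theorem formOf_supp (h : HasWeight w D s) : SuppC w (formOf D) := by
  intro n hn
  ext ξ q
  exact weightZero_eq_zero (h.1 n _ 0 (by push_cast; omega))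

theorem formOf_deg (h : D ∈ endDeg (tensorDeg 𝒜 ℒ 𝒬) d) : DegC ℒ (endDeg 𝒬) d (formOf D) := by
  intro n e ξ hξ i q hq
  rw [add_assoc]
  exact weightZero_mem (h _ _ (Submodule.subset_span ⟨n, e, ξ, i, q, hξ, hq, rfl, rfl⟩))

/-- Apply the Leibniz rule of `D` to the contraction with an element of `A`, which is just
multiplication, and project to weight zero. -/
theorem formOf_derLike (h : IsModuleDerivation 𝒜 ℒ 𝒬 d D s)
    (hS : ∀ ω : allForms 𝒜 ℒ, S ω = s ω) :
    DerLike 𝒜 ℒ (LinearMap.id : Module.End K Q →ₗ[K] Q →ₗ[K] Q) d (formOf D)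
      (symbolOf 𝒜 ℒ S) := by
  intro n e ξ hξ b a ha q
  have hc := cst_mem_forms (ℒ := ℒ) ha
  have h1 := congrArg (weightZero 𝒜 ℒ Q)
    (h.leibniz b ⟨cst K L a, forms_le_allForms 𝒜 ℒ b hc⟩ hc (tens 𝒜 ℒ Q n ξ q))
  rw [map_add, map_smul, weightZero_contract_tens, weightZero_contract_cst ha, ← hS, contract_tens,
    cstar_cst_right_apply _ _ hξ, LinearMap.smul_apply, compSMul_apply, map_smul, map_smul,
    ← formOf_apply, ← formOf_apply] at h1
  have h2 := congrArg (fun x => sg K (b * ∑ i, e i) • x) h1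
  simp only [smul_smul, sg_mul_self, one_smul, smul_add] at h2
  change formOf D n ξ (a • q) = _ + _ • a • formOf D n ξ q
  rw [h2, symbolOf_apply S ha hξ, smul_assoc, ← sg_add]
  congr 2
  exact congrArg (sg K) (by ring)

variable {ι : Type*} [Fintype ι] {γ : ι → ℤ} {f : ι → Cochain K L A} {v : ι → L}

theorem isRightPair_of_derivation (h : IsDualFrame 𝒜 ℒ γ f v)
    (hD : IsModuleDerivation 𝒜 ℒ 𝒬 d D s) (hw : HasWeight w D s)
    (hS : ∀ ω : allForms 𝒜 ℒ, S ω = s ω) (hS' : IsFormDerivation 𝒜 ℒ d S) :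
    IsRightPair 𝒜 ℒ 𝒬 d (multiderivationOf 𝒜 ℒ γ f v S) (symbolOf 𝒜 ℒ S) (formOf D) :=
  -- Homogeneity in weight enters here: the symbol sends `A` to forms with `w` entries, so the
  -- reconstructed symbol lives in a single arity.
  have hσ : FinC (symbolOf 𝒜 ℒ S) := SuppC.finC (k := w) <| symbolOf_supp fun b a ha n hn => by
    rw [hS ⟨cst K L a, forms_le_allForms 𝒜 ℒ b (cst_mem_forms ha)⟩]
    exact hw.2 0 _ (fun j hj => cst_supp a j (by exact_mod_cast hj)) n (by simpa using hn)
  { fin := multiderivationOf_fin h hS' hσ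
    symbol_fin := hσ
    form_fin := (formOf_supp hw).finC
    symm := multiderivationOf_symm h hS'
    symbol_symm := symbolOf_symm hS'
    form_symm := SymmC.mapC _ (SymmC.mapC _ (tens_grSymm 𝒜 ℒ))
    deg := multiderivationOf_deg h hS'
    symbol_deg := symbolOf_deg hS'
    form_deg := formOf_deg hD.deg
    leibniz := multiderivationOf_leibniz h hS'
    symbol_lin := symbolOf_firstLeft hS'
    form_lin := firstRight_postC (firstRight_postC (firstRight_of_rightLin (tens_rightLin 𝒜 ℒ)) D) _
    form_leibniz := formOf_derLike hD hS }

/-- An operator which commutes with the contractions of a frame and does not reach weight zero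
vanishes. -/
theorem operator_eq_zero [CharZero K] (h : IsDualFrame 𝒜 ℒ γ f v)
    {E : Module.End K (SymTensor 𝒜 ℒ Q)} (h0 : formOf E = 0)
    (h1 : ∀ i u, E (contract 𝒜 ℒ Q (γ i) (f i) (h.form_mem i) u) =
      sg K (d * γ i) • contract 𝒜 ℒ Q (γ i) (f i) (h.form_mem i) (E u)) : E = 0 := by
  suffices H : ∀ n, postC E (tens 𝒜 ℒ Q) n = 0 from
    symTensor_ext fun n ξ q => congrArg (fun F => F ξ q) (H n)
  intro n
  -- Contraction with a one-entry form turns a generator with `n` entries into ones with `n - 1`, on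
  -- which `E` vanishes by induction. So the value of `E` is killed by all contractions of the
  -- frame.
  induction n using Nat.strong_induction_on with
  | _ n ih =>
    ext ξ q : 2
    refine eq_zero_of_contract h (congrArg (fun F => F n ξ q) h0) fun i => ?_
    have e1 := h1 i (tens 𝒜 ℒ Q n ξ q)
    have e2 : cstar ℒ (γ i) (compSMul K A Q (SymTensor 𝒜 ℒ Q)) (postC E (tens 𝒜 ℒ Q)) (f i) n =
        0 := by
      refine Finset.sum_eq_zero fun pq hpq => ?_
      rw [Finset.HasAntidiagonal.mem_antidiagonal] at hpq
      by_cases hq : pq.2 = 1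
      · rw [ih pq.1 (by omega), star_zero_left]
      · rw [h.form_supp i pq.2 (by exact_mod_cast hq), star_zero_right]
    have e3 : E (contract 𝒜 ℒ Q (γ i) (f i) (h.form_mem i) (tens 𝒜 ℒ Q n ξ q)) = 0 := by
      have := congrArg (fun F => postC E F n ξ q) (postC_contract (Q := Q) (h.form_mem i))
      rw [postC_cstar _ (B' := compSMul K A Q (SymTensor 𝒜 ℒ Q)) fun _ _ => rfl] at this
      simp only [e2] at this
      exact this
    rw [e3] at e1
    have e4 := congrArg (fun x => sg K (d * γ i) • x) e1
    simp only [smul_smul, sg_mul_self, one_smul, smul_zero] at e4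
    exact e4.symm

/-- The symbols agree because two derivations of forms with equal values on `A` and on the frame
coincide. The operators agree because their difference then commutes with contractions up to sign
and has no weight zero part. -/
theorem mem_range_etaPair [CharZero K] (h : IsDualFrame 𝒜 ℒ γ f v)
    (hD : IsModuleDerivation 𝒜 ℒ 𝒬 d D s) (hw : HasWeight w D s) :
    (D, s) ∈ LinearMap.range (etaPair 𝒜 ℒ 𝒬 d) := by
  obtain ⟨S, hS, hS'⟩ := hD.exists_isFormDerivation
  have hR := isRightPair_of_derivation h hD hw hS hS'
  have hM := hR.isModuleDerivation
  obtain ⟨S₁, hS₁, hS₁'⟩ := hM.exists_isFormDerivation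
  have hsub : ∀ c, ∀ ω ∈ forms 𝒜 ℒ c, (S₁ - S) ω = 0 := fun c ω hω => by
    have hval : ∀ c, ∀ ω ∈ forms 𝒜 ℒ c, S₁ ω =
        eta ℒ d (multiderivationOf 𝒜 ℒ γ f v S) (symbolOf 𝒜 ℒ S) c ω := fun c ω hω => by
      rw [hS₁ ⟨ω, forms_le_allForms 𝒜 ℒ c hω⟩]
      exact hR.symbol_apply (ω := ⟨ω, forms_le_allForms 𝒜 ℒ c hω⟩) hω
    refine (hS₁'.sub hS').eq_zero h (fun b a ha => ?_) (fun i => ?_) hω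
    · rw [LinearMap.sub_apply, hval b _ (cst_mem_forms ha), eta, cstar_symbolOf S ha, circ_cst_left,
        smul_zero, sub_zero, sub_self]
    · rw [LinearMap.sub_apply, hval _ _ (h.form_mem i), eta_multiderivationOf_form h hS', sub_self]
  have hs : hR.symbol = s := allForms_ext fun c ω hω => Subtype.ext <| by
    rw [← hS₁, ← hS, ← sub_eq_zero]
    exact hsub c ω hω
  have hE : hR.operator - D = 0 := by
    refine operator_eq_zero (d := d) h ?_ fun i u => ?_
    · funext n; ext ξ q : 2
      have h2 := congrArg (fun F => postC (weightZero 𝒜 ℒ Q) F n ξ q) hR.postC_operator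
      rw [postC_weightZero_rightOp] at h2
      rw [formOf_apply, LinearMap.sub_apply, map_sub]
      exact sub_eq_zero.2 h2
    · have e1 := hM.leibniz _ ⟨f i, forms_le_allForms 𝒜 ℒ _ (h.form_mem i)⟩ (h.form_mem i) u
      have e2 := hD.leibniz _ ⟨f i, forms_le_allForms 𝒜 ℒ _ (h.form_mem i)⟩ (h.form_mem i) u
      have e3 := contract_congr (Q := Q)
        (hM.symbol_deg _ ⟨f i, forms_le_allForms 𝒜 ℒ _ (h.form_mem i)⟩ (h.form_mem i))
        (hD.symbol_deg _ ⟨f i, forms_le_allForms 𝒜 ℒ _ (h.form_mem i)⟩ (h.form_mem i)) rfl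
        (by rw [hs])
      -- The symbol terms of the two Leibniz rules are equal and cancel in the difference.
      rw [LinearMap.sub_apply, e1, e2, e3, add_sub_add_left_eq_sub, LinearMap.sub_apply, map_sub,
        smul_sub]
  have hx : ((multiderivationOf 𝒜 ℒ γ f v S, symbolOf 𝒜 ℒ S, -formOf D) :
      Cochain K L L × Cochain K L (Module.End K A) × Cochain K L (Module.End K Q)) ∈
      rightPairs 𝒜 ℒ 𝒬 d := by
    rw [mem_rightPairs_iff, neg_neg]
    exact hR
  refine ⟨⟨_, hx⟩, Prod.ext ?_ ?_⟩
  · refine Eq.trans ?_ (sub_eq_zero.1 hE)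
    refine symTensor_ext fun n ξ q => ?_
    rw [hR.operator_tens]
    refine ((mem_rightPairs_iff.1 hx).operator_tens n ξ q).trans ?_
    rw [neg_neg]
  · refine Eq.trans ?_ hs
    exact allForms_ext fun c ω hω => Subtype.ext <|
      ((mem_rightPairs_iff.1 hx).symbol_apply hω).trans (hR.symbol_apply hω).symm

theorem moduleDerivations_le_range [CharZero K] (h : IsDualFrame 𝒜 ℒ γ f v) :
    moduleDerivations 𝒜 ℒ 𝒬 d ≤ LinearMap.range (etaPair 𝒜 ℒ 𝒬 d) :=
  Submodule.span_le.2 fun _ ⟨hD, _, hw⟩ => mem_range_etaPair h hD hw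

theorem etaPair_bijective [CharZero K] (hP : Module.Projective A L) (hF : Module.Finite A L) :
    Function.Bijective ((etaPair 𝒜 ℒ 𝒬 d).codRestrict _ etaPair_mem) := by
  obtain ⟨T, γ, f, v, h⟩ := exists_isDualFrame (𝒜 := 𝒜) (ℒ := ℒ) hP hF
  refine ⟨fun x y hxy => etaPair_injective h (congrArg Subtype.val hxy), fun p => ?_⟩
  obtain ⟨x, hx⟩ := moduleDerivations_le_range h p.2
  exact ⟨x, Subtype.ext hx⟩

end Contractions

end Surjectivity

end RightRep

theorem mainTheorem7 {K A L Q : Type*} [Field K] [CharZero K]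
    [Ring A] [Algebra K A] (𝒜 : ℤ → Submodule K A) [GradedAlgebra 𝒜] [RightRep.IsGradedComm 𝒜]
    [AddCommGroup L] [Module K L] [Module A L] [IsScalarTower K A L]
    (ℒ : ℤ → Submodule K L) [DirectSum.Decomposition ℒ] [SetLike.GradedSMul 𝒜 ℒ]
    [AddCommGroup Q] [Module K Q] [Module A Q] [IsScalarTower K A Q]
    (𝒬 : ℤ → Submodule K Q) [DirectSum.Decomposition 𝒬] [SetLike.GradedSMul 𝒜 𝒬] :
    RightRep.IsGradedLieAlgebra (RightRep.rightPairs 𝒜 ℒ 𝒬) (RightRep.rightBracket ℒ) ∧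
    RightRep.IsGradedLieAlgebra (RightRep.moduleDerivations 𝒜 ℒ 𝒬) RightRep.pairCommutator ∧
    ∃ etaR : (d : ℤ) →
        (RightRep.rightPairs 𝒜 ℒ 𝒬 d →ₗ[K] RightRep.moduleDerivations 𝒜 ℒ 𝒬 d),
      -- the operator is given by the canonical formula
      (∀ (d : ℤ) (x : RightRep.rightPairs 𝒜 ℒ 𝒬 d) (n : ℕ) (ξ : Fin n → L) (q : Q),
        (etaR d x).1.1 (RightRep.tens 𝒜 ℒ Q n ξ q) =
          RightRep.etaRight 𝒜 ℒ d x.1.1 x.1.2.2 n ξ q) ∧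
      -- the symbol is `η(𝕏)`
      (∀ (d : ℤ) (x : RightRep.rightPairs 𝒜 ℒ 𝒬 d) (c : ℤ) (ω : RightRep.allForms 𝒜 ℒ),
        (ω : RightRep.Cochain K L A) ∈ RightRep.forms 𝒜 ℒ c →
        ((etaR d x).1.2 ω : RightRep.Cochain K L A) =
          RightRep.eta ℒ d x.1.1 x.1.2.1 c (ω : RightRep.Cochain K L A)) ∧
      -- elements with `k` entries lower the weight of tensors by `k - 1`
      (∀ (d : ℤ) (k : ℕ) (x : RightRep.rightPairs 𝒜 ℒ 𝒬 d), RightRep.HasEntries k x.1 →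
        RightRep.HasWeight ((k : ℤ) - 1) (etaR d x).1.1 (etaR d x).1.2) ∧
      -- brackets are preserved
      (∀ (d e : ℤ) (x : RightRep.rightPairs 𝒜 ℒ 𝒬 d) (y : RightRep.rightPairs 𝒜 ℒ 𝒬 e)
        (z : RightRep.rightPairs 𝒜 ℒ 𝒬 (d + e)), z.1 = RightRep.rightBracket ℒ d e x.1 y.1 →
        (etaR (d + e) z).1 = RightRep.pairCommutator d e (etaR d x).1 (etaR e y).1) ∧
      -- isomorphism for projective and finitely generated `L`
      (Module.Projective A L → Module.Finite A L → ∀ d : ℤ, Function.Bijective (etaR d)) := by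
  exact ⟨RightRep.rightPairs_isGradedLieAlgebra, RightRep.moduleDerivations_isGradedLieAlgebra,
    fun d => (RightRep.etaPair 𝒜 ℒ 𝒬 d).codRestrict _ RightRep.etaPair_mem,
    fun _ x n ξ q => RightRep.etaPair_tens x n ξ q,
    fun _ x _ ω hω => RightRep.etaPair_symbol x ω hω,
    fun _ k x hx => RightRep.etaPair_hasWeight k x hx,
    fun _ _ x y z hz => RightRep.etaPair_bracket x y z hz,
    fun hP hF _ => RightRep.etaPair_bijective hP hF⟩
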